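/- \textbf{Setting.} Let $\widetilde M$ be a (Hausdorff, second countable) complex manifold of complex dimension $n+1$, $n\ge 0$, and let $\Omega\subset\widetilde M$ be a relatively compact domain with smooth boundary $M=\partial\Omega$. A \emph{defining function} of $\Omega$ is a $C^\infty$ function $\rho:\widetilde M\to\mathbb R$ with $\Omega=\{\rho<0\}$ and $d\rho\ne0$ on $M$. The boundary is assumed \emph{pseudoconvex}: for some (equivalently, every) defining function, $\partial\bar\partial\rho(L,\overline L)\ge0$ for all $L\in T^{1,0}_p\widetilde M$ with $\partial\rho(L)=0$, $p\in M$ (here $\partial\bar\partial u(L,\overline L)=\sum u_{j\bar k}L_j\overline{L_k}$). A $C^\infty$ function $u$ is plurisubharmonic (strictly plurisubharmonic) where this form is $\ge0$ ($>0$ for $L\neq 0$). \textbf{CR notions.} $M$ carries the CR structure $T^{1,0}_M=(\mathbb C\otimes TM)\cap T^{1,0}\widetilde M$, with $T^{0,1}_M=\overline{T^{1,0}_M}$. A \emph{trivialization} is a smooth, purely imaginary, nowhere vanishing $1$-form $\eta$ on $M$ annihilating $T^{1,0}_M\oplus T^{0,1}_M$. Its Levi form is $\lambda_\eta(L,L')=-d\eta(L,\overline{L'})$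 on $T^{1,0}_M$; $\eta$ is \emph{positive} if $\lambda_\eta(L,L)\ge0$ for all $L$. Let $\mathcal N\subset T^{1,0}_M$ be the kernel of the Levi form (independent of $\eta$). Choose a smooth, purely imaginary vector field $T$ on $M$ with $\eta(T)=1$, put $\alpha_\eta(X)=-d\eta(T,X)$, and let $\omega_\eta$ be the $1$-form that agrees with $\alpha_\eta$ on $T^{1,0}_M$ and annihilates $T^{0,1}_M\oplus\mathbb C T$. On $\mathcal N$ consider the quadratic forms $$\bar\partial_b\omega_\eta(L,\overline L)=d\omega_\eta(L,\overline L),\qquad \omega_\eta\wedge\overline{\omega}_\eta(L,\overline L)=|\omega_\eta(L)|^2,$$ which are real and do not depend on $T$; here $d\omega(X,Y)=X\omega(Y)-Y\omega(X)-\omega([X,Y])$. ``$>0$ on $\mathcal N$'' means positive at every nonzero $L\in\mathcal N$. \textbf{Indices.} With $\rho$ ranging over the defining functions of $\Omega$, $\eta$ over the positive trivializations of $M$, and $W$ over the open neighbourhoods of $M$ in $\widetilde M$ (allowed to depend on $\gamma$ and $\rho$), let \begin{align*} DF_s(\Omega)&=\sup\{0<\gamma<1:\ \exists\,\rho,W:\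 -(-\rho)^\gamma\text{ is strictly plurisubharmonic on }\Omega\cap W\},\\ S_s(\Omega)&=\inf\{\gamma>1:\ \exists\,\rho,W:\ \rho^\gamma\text{ is strictly plurisubharmonic on }\overline\Omega^{\,\complement}\cap W\},\\ DF_s(M)&=\sup\{0<\gamma<1:\ \exists\,\eta:\ \bar\partial_b\omega_\eta-\tfrac{\gamma}{1-\gamma}\,\omega_\eta\wedge\overline\omega_\eta>0\text{ on }\mathcal N\},\\ S_s(M)&=\inf\{\gamma>1:\ \exists\,\eta:\ -\bar\partial_b\omega_\eta-\tfrac{\gamma}{\gamma-1}\,\omega_\eta\wedge\overline\omega_\eta>0\text{ on }\mathcal N\}, \end{align*} and let $DF_w(\Omega),S_w(\Omega),DF_w(M),S_w(M)$ be defined in the same way with ``plurisubharmonic'' in place of ``strictly plurisubharmonic'' and ``$\ge0$'' in place of ``$>0$''. Conventions: $\sup\emptyset=0$ and $\inf\emptyset=\infty$. \textbf{Statement.} Suppose that at least one of the following holds: \begin{enumerate} \item $\widetilde M$ is a Stein manifold (for example $\widetilde M=\mathbb C^{n+1}$); \item $\Omega$ is Takeuchi $1$-convex, i.e. there are a defining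 function $\rho$ of $\Omega$, a smooth hermitian metric $g$ on $\widetilde M$ and an open neighbourhood $W$ of $M$ such that $i\partial\bar\partial(-\log(-\rho))\ge g$ on $\Omega\cap W$; \item $DF_s(M)>0$. \end{enumerate} Then $$0<DF_s(M)=DF_s(\Omega)=DF_w(\Omega)=DF_w(M),\qquad S_w(M)=S_w(\Omega)=S_s(\Omega)=S_s(M).$$ -/

import Mathlib

open scoped Manifold ContDiff Topology

noncomputable section

namespace CRIndex

/-! ### Real differential geometry: complexified tangent vectors and complex-valued 1-forms

`M` is a smooth manifold of real dimension `m`. -/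

section Real

variable {m : ℕ} {M : Type*} [TopologicalSpace M] [ChartedSpace (EuclideanSpace ℝ (Fin m)) M]

/-- The real tangent space `T_p M`. -/
abbrev RTangent (m : ℕ) {M : Type*} [TopologicalSpace M]
    [ChartedSpace (EuclideanSpace ℝ (Fin m)) M] (p : M) : Type := TangentSpace (𝓡 m) p

/-- The complexified tangent space `ℂ ⊗ T_p M`; the pair `(a, b)` stands for `a + i b`. -/
abbrev CTangent (m : ℕ) {M : Type*} [TopologicalSpace M]
    [ChartedSpace (EuclideanSpace ℝ (Fin m)) M] (p : M) : Type := RTangent m p × RTangent m p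

/-- Complex conjugation `a + i b ↦ a - i b` on `ℂ ⊗ T_p M`. -/
def conjC {p : M} (Z : CTangent m p) : CTangent m p := (Z.1, -Z.2)

/-- The complex linear extension to `ℂ ⊗ T_p M` of a complex-valued real linear form. -/
def extC {p : M} (φ : RTangent m p → ℂ) (Z : CTangent m p) : ℂ := φ Z.1 + Complex.I * φ Z.2

/-- The complex bilinear extension to `ℂ ⊗ T_p M` of a complex-valued real bilinear form. -/
def extC₂ {p : M} (B : RTangent m p → RTangent m p → ℂ) (Z W : CTangent m p) : ℂ :=
  (B Z.1 W.1 - B Z.2 W.2) + Complex.I * (B Z.1 W.2 + B Z.2 W.1)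

/-- Complex-valued 1-forms on `M` (not necessarily smooth). -/
abbrev OneForm (m : ℕ) (M : Type*) [TopologicalSpace M]
    [ChartedSpace (EuclideanSpace ℝ (Fin m)) M] : Type _ := ∀ p : M, RTangent m p →L[ℝ] ℂ

/-- Smoothness of a 1-form, as a section of the bundle `Hom(TM, ℂ)`. -/
def OneForm.IsSmooth [IsManifold (𝓡 m) ∞ M] (η : OneForm m M) : Prop :=
  ContMDiff (𝓡 m) ((𝓡 m).prod 𝓘(ℝ, EuclideanSpace ℝ (Fin m) →L[ℝ] ℂ)) ∞
    (fun p : M => Bundle.TotalSpace.mk' (EuclideanSpace ℝ (Fin m) →L[ℝ] ℂ)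
      (E := fun p : M => TangentSpace (𝓡 m) p →L[ℝ] Bundle.Trivial M ℂ p) p (η p))

/-- The pull-back of the 1-form `η` to the model space by the inverse of the chart at `p`. -/
def OneForm.inChart (η : OneForm m M) (p : M) (x : EuclideanSpace ℝ (Fin m)) :
    EuclideanSpace ℝ (Fin m) →L[ℝ] ℂ :=
  (η ((extChartAt (𝓡 m) p).symm x)).comp
    (mfderiv 𝓘(ℝ, EuclideanSpace ℝ (Fin m)) (𝓡 m) (extChartAt (𝓡 m) p).symm x)

/-- The exterior derivative `dη` at `p`, computed in the chart at `p`, with the convention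
`dη(X, Y) = X η(Y) - Y η(X) - η([X, Y])`. The chart at `p` also identifies `T_p M` with the model
space. -/
def OneForm.d (η : OneForm m M) (p : M) (v w : RTangent m p) : ℂ :=
  let D := fderiv ℝ (η.inChart p) (extChartAt (𝓡 m) p p)
  let v' : EuclideanSpace ℝ (Fin m) :=
    mfderiv (𝓡 m) 𝓘(ℝ, EuclideanSpace ℝ (Fin m)) (extChartAt (𝓡 m) p) p v
  let w' : EuclideanSpace ℝ (Fin m) :=
    mfderiv (𝓡 m) 𝓘(ℝ, EuclideanSpace ℝ (Fin m)) (extChartAt (𝓡 m) p) p w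
  D v' w' - D w' v'

/-- A field of sets of complexified tangent vectors; it is used for the bundle `T^{1,0}_M` of a CR
manifold of hypersurface type, a complex subbundle of `ℂ ⊗ TM` with
`T^{1,0}_M ∩ T^{0,1}_M = 0`, where `T^{0,1}_M` is the conjugate of `T^{1,0}_M`. -/
abbrev CRField (m : ℕ) (M : Type*) [TopologicalSpace M]
    [ChartedSpace (EuclideanSpace ℝ (Fin m)) M] : Type _ := ∀ p : M, Set (CTangent m p)

variable (T10 : CRField m M)

/-- A trivialization of `ℂ ⊗ TM / (T^{1,0} ⊕ T^{0,1})`: a smooth, purely imaginary, nowhere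
vanishing 1-form that annihilates `T^{1,0} ⊕ T^{0,1}`. -/
structure IsTrivialization [IsManifold (𝓡 m) ∞ M] (η : OneForm m M) : Prop where
  smooth : η.IsSmooth
  imaginary : ∀ (p : M) (v : RTangent m p), (η p v).re = 0
  ne_zero : ∀ p : M, η p ≠ 0
  annihilates : ∀ (p : M), ∀ L ∈ T10 p, extC (η p) L = 0 ∧ extC (η p) (conjC L) = 0

/-- The Levi form `λ_η(L, L') = - dη(L, conj L')`. -/
def leviForm (η : OneForm m M) (p : M) (L L' : CTangent m p) : ℂ :=
  -extC₂ (η.d p) L (conjC L')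

/-- The kernel `Null_p` of the Levi form. -/
def nullSpace (η : OneForm m M) (p : M) : Set (CTangent m p) :=
  {L | L ∈ T10 p ∧ ∀ L' ∈ T10 p, leviForm η p L L' = 0}

/-- A positive trivialization: its Levi form is positive semi-definite on `T^{1,0}`. -/
structure IsPositiveTrivialization [IsManifold (𝓡 m) ∞ M] (η : OneForm m M) : Prop
    extends IsTrivialization T10 η where
  levi_nonneg : ∀ (p : M), ∀ L ∈ T10 p, 0 ≤ (leviForm η p L L).re

/-- A transversal vector field normalized with respect to `η`: a smooth, purely imaginary
complexified vector field `T` with `η(T) = 1`. -/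
structure IsTransversal [IsManifold (𝓡 m) ∞ M] (η : OneForm m M) (T : ∀ p : M, CTangent m p) :
    Prop where
  smooth : ContMDiff (𝓡 m) (𝓡 m).tangent ∞
    (fun p : M => (⟨p, (T p).2⟩ : TangentBundle (𝓡 m) M))
  imaginary : ∀ p : M, (T p).1 = 0
  normalized : ∀ p : M, extC (η p) (T p) = 1

/-- The D'Angelo 1-form `α_η(X) = - dη(T, X)`, extended complex linearly to `ℂ ⊗ TM`. -/
def dAngelo (η : OneForm m M) (T : ∀ p : M, CTangent m p) (p : M) (X : CTangent m p) : ℂ :=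
  -extC₂ (η.d p) (T p) X

/-- `ω` is the D'Angelo `(1,0)`-form of `η` with respect to `T`: the (unique, smooth) 1-form that
agrees with the D'Angelo 1-form on `T^{1,0}` and annihilates `T^{0,1} ⊕ ℂ T`. -/
structure IsDAngelo10 [IsManifold (𝓡 m) ∞ M] (η : OneForm m M) (T : ∀ p : M, CTangent m p)
    (om : OneForm m M) : Prop where
  smooth : om.IsSmooth
  on_T10 : ∀ (p : M), ∀ L ∈ T10 p, extC (om p) L = dAngelo η T p L
  on_T01 : ∀ (p : M), ∀ L ∈ T10 p, extC (om p) (conjC L) = 0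
  on_T : ∀ p : M, extC (om p) (T p) = 0

/-- The quadratic form of the `(1,1)`-form `∂̄_b ω`. For a `(1,0)`-form `ω`, the form `∂̄_b ω` is the
restriction of `dω` to `T^{1,0} × T^{0,1}`; it is hermitian on the null space when `ω` is the
D'Angelo `(1,0)`-form of a pseudoconvex CR manifold, and its diagonal is real there. -/
def dbarQuad (om : OneForm m M) (p : M) (L : CTangent m p) : ℝ :=
  (extC₂ (om.d p) L (conjC L)).re

/-- The quadratic form `|ω(L)|²` of `ω ∧ conj ω`. -/
def wedgeQuad (om : OneForm m M) (p : M) (L : CTangent m p) : ℝ :=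
  ‖extC (om p) L‖ ^ 2

/-- `a ∂̄_b ω_η - c ω_η ∧ conj ω_η > 0` on `Null`. (On `Null` the forms do not depend on the
transversal vector field.) -/
def PosOnNull [IsManifold (𝓡 m) ∞ M] (η : OneForm m M) (a c : ℝ) : Prop :=
  ∃ (T : ∀ p : M, CTangent m p) (om : OneForm m M), IsTransversal η T ∧ IsDAngelo10 T10 η T om ∧
    ∀ (p : M), ∀ L ∈ nullSpace T10 η p, L ≠ 0 → 0 < a * dbarQuad om p L - c * wedgeQuad om p L

/-- `a ∂̄_b ω_η - c ω_η ∧ conj ω_η ≥ 0` on `Null`. -/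
def NonnegOnNull [IsManifold (𝓡 m) ∞ M] (η : OneForm m M) (a c : ℝ) : Prop :=
  ∃ (T : ∀ p : M, CTangent m p) (om : OneForm m M), IsTransversal η T ∧ IsDAngelo10 T10 η T om ∧
    ∀ (p : M), ∀ L ∈ nullSpace T10 η p, 0 ≤ a * dbarQuad om p L - c * wedgeQuad om p L

variable [IsManifold (𝓡 m) ∞ M]

/-- `DF_s(M)`; the supremum of the empty set of reals is `0`. -/
def dfStrongCR : ℝ :=
  sSup {γ : ℝ | 0 < γ ∧ γ < 1 ∧
    ∃ η, IsPositiveTrivialization T10 η ∧ PosOnNull T10 η 1 (γ / (1 - γ))}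

/-- `DF_w(M)`. -/
def dfWeakCR : ℝ :=
  sSup {γ : ℝ | 0 < γ ∧ γ < 1 ∧
    ∃ η, IsPositiveTrivialization T10 η ∧ NonnegOnNull T10 η 1 (γ / (1 - γ))}

/-- `S_s(M)`; the infimum of the empty set of extended reals is `∞`. -/
def steinnessStrongCR : EReal :=
  sInf ((fun γ : ℝ => (γ : EReal)) '' {γ : ℝ | 1 < γ ∧
    ∃ η, IsPositiveTrivialization T10 η ∧ PosOnNull T10 η (-1) (γ / (γ - 1))})

/-- `S_w(M)`. -/
def steinnessWeakCR : EReal :=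
  sInf ((fun γ : ℝ => (γ : EReal)) '' {γ : ℝ | 1 < γ ∧
    ∃ η, IsPositiveTrivialization T10 η ∧ NonnegOnNull T10 η (-1) (γ / (γ - 1))})

end Real

/-! ### Domains in complex manifolds

`X` is a complex manifold of complex dimension `d`. -/

section Complex

variable {d : ℕ} {X : Type*} [TopologicalSpace X] [ChartedSpace (EuclideanSpace ℂ (Fin d)) X]

/-- The model with corners of `ℂ^d` as a real vector space. -/
abbrev realModel (d : ℕ) :
    ModelWithCorners ℝ (EuclideanSpace ℂ (Fin d)) (EuclideanSpace ℂ (Fin d)) :=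
  𝓘(ℝ, EuclideanSpace ℂ (Fin d))

/-- The model with corners of `ℂ^d` as a complex vector space. -/
abbrev complexModel (d : ℕ) :
    ModelWithCorners ℂ (EuclideanSpace ℂ (Fin d)) (EuclideanSpace ℂ (Fin d)) :=
  𝓘(ℂ, EuclideanSpace ℂ (Fin d))

/-- A complex manifold is in particular a real analytic manifold. -/
instance realManifold [h : IsManifold (complexModel d) ω X] : IsManifold (realModel d) ω X := by
  refine isManifold_of_contDiffOn _ _ _ fun e e' he he' => ?_
  have h1 := ((contDiffGroupoid ω (complexModel d)).compatible he he')
  rw [contDiffGroupoid, mem_groupoid_of_pregroupoid] at h1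
  exact ContDiffOn.restrict_scalars ℝ h1.1

/-- The complex structure `J` on the real tangent space. -/
def tangentJ {p : X} (v : TangentSpace (realModel d) p) : TangentSpace (realModel d) p :=
  (Complex.I • (show EuclideanSpace ℂ (Fin d) from v) : EuclideanSpace ℂ (Fin d))

/-- The real differential of a real function. -/
def diff (d : ℕ) {X : Type*} [TopologicalSpace X]
    [ChartedSpace (EuclideanSpace ℂ (Fin d)) X] (u : X → ℝ) (p : X) (v : TangentSpace (realModel d) p) : ℝ :=
  mfderiv (realModel d) 𝓘(ℝ, ℝ) u p v

/-- The complex Hessian `∂∂̄u(L, conj L) = ∑ u_{j k̄} v_j conj(v_k)` at `p`, where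
`L = ∑ v_j ∂/∂z_j = (v - i J v) / 2`, computed in the holomorphic chart at `p`; it equals a quarter
of `D²u(v, v) + D²u(iv, iv)`. -/
def complexHessian (d : ℕ) {X : Type*} [TopologicalSpace X]
    [ChartedSpace (EuclideanSpace ℂ (Fin d)) X] (u : X → ℝ) (p : X) (v : TangentSpace (realModel d) p) : ℝ :=
  let z : EuclideanSpace ℂ (Fin d) := extChartAt (realModel d) p p
  let D := fderiv ℝ (fderiv ℝ (u ∘ (extChartAt (realModel d) p).symm)) z
  let v' : EuclideanSpace ℂ (Fin d) := v
  let w' : EuclideanSpace ℂ (Fin d) := tangentJ v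
  (D v' v' + D w' w') / 4

/-- `u` (smooth near `U`) is plurisubharmonic on `U`. -/
def IsPSHOn (d : ℕ) {X : Type*} [TopologicalSpace X]
    [ChartedSpace (EuclideanSpace ℂ (Fin d)) X] (u : X → ℝ) (U : Set X) : Prop :=
  ∀ p ∈ U, ∀ v : TangentSpace (realModel d) p, 0 ≤ complexHessian d u p v

/-- `u` (smooth near `U`) is strictly plurisubharmonic on `U`. -/
def IsStrictlyPSHOn (d : ℕ) {X : Type*} [TopologicalSpace X]
    [ChartedSpace (EuclideanSpace ℂ (Fin d)) X] (u : X → ℝ) (U : Set X) : Prop :=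
  ∀ p ∈ U, ∀ v : TangentSpace (realModel d) p, v ≠ 0 → 0 < complexHessian d u p v

/-- `ρ` is a smooth defining function of `Ω`. -/
structure IsDefiningFunction (d : ℕ) {X : Type*} [TopologicalSpace X]
    [ChartedSpace (EuclideanSpace ℂ (Fin d)) X] (Ω : Set X) (ρ : X → ℝ) : Prop where
  smooth : ContMDiff (realModel d) 𝓘(ℝ, ℝ) ∞ ρ
  eq_neg : Ω = {x | ρ x < 0}
  diff_ne_zero : ∀ p ∈ frontier Ω, ∃ v : TangentSpace (realModel d) p, diff d ρ p v ≠ 0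

/-- `Ω` is a relatively compact domain with smooth (Levi) pseudoconvex boundary: it has a smooth
defining function `ρ` with `i∂∂̄ρ ≥ 0` on the kernel of `∂ρ` at each boundary point. -/
structure IsPseudoconvexDomain (d : ℕ) {X : Type*} [TopologicalSpace X]
    [ChartedSpace (EuclideanSpace ℂ (Fin d)) X] (Ω : Set X) : Prop where
  isOpen : IsOpen Ω
  isConnected : IsConnected Ω
  relCompact : IsCompact (closure Ω)
  pseudoconvex : ∃ ρ : X → ℝ, IsDefiningFunction d Ω ρ ∧
    ∀ p ∈ frontier Ω, ∀ v : TangentSpace (realModel d) p,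
      diff d ρ p v = 0 → diff d ρ p (tangentJ v) = 0 → 0 ≤ complexHessian d ρ p v

/-- `DF_s(Ω)`. -/
def dfStrong (d : ℕ) {X : Type*} [TopologicalSpace X]
    [ChartedSpace (EuclideanSpace ℂ (Fin d)) X] (Ω : Set X) : ℝ :=
  sSup {γ : ℝ | 0 < γ ∧ γ < 1 ∧ ∃ ρ : X → ℝ, IsDefiningFunction d Ω ρ ∧
    ∃ W : Set X, IsOpen W ∧ frontier Ω ⊆ W ∧ IsStrictlyPSHOn d (fun x => -(-ρ x) ^ γ) (Ω ∩ W)}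

/-- `DF_w(Ω)`. -/
def dfWeak (d : ℕ) {X : Type*} [TopologicalSpace X]
    [ChartedSpace (EuclideanSpace ℂ (Fin d)) X] (Ω : Set X) : ℝ :=
  sSup {γ : ℝ | 0 < γ ∧ γ < 1 ∧ ∃ ρ : X → ℝ, IsDefiningFunction d Ω ρ ∧
    ∃ W : Set X, IsOpen W ∧ frontier Ω ⊆ W ∧ IsPSHOn d (fun x => -(-ρ x) ^ γ) (Ω ∩ W)}

/-- `S_s(Ω)`. -/
def steinnessStrong (d : ℕ) {X : Type*} [TopologicalSpace X]
    [ChartedSpace (EuclideanSpace ℂ (Fin d)) X] (Ω : Set X) : EReal :=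
  sInf ((fun γ : ℝ => (γ : EReal)) '' {γ : ℝ | 1 < γ ∧ ∃ ρ : X → ℝ, IsDefiningFunction d Ω ρ ∧
    ∃ W : Set X, IsOpen W ∧ frontier Ω ⊆ W ∧
      IsStrictlyPSHOn d (fun x => ρ x ^ γ) ((closure Ω)ᶜ ∩ W)})

/-- `S_w(Ω)`. -/
def steinnessWeak (d : ℕ) {X : Type*} [TopologicalSpace X]
    [ChartedSpace (EuclideanSpace ℂ (Fin d)) X] (Ω : Set X) : EReal :=
  sInf ((fun γ : ℝ => (γ : EReal)) '' {γ : ℝ | 1 < γ ∧ ∃ ρ : X → ℝ, IsDefiningFunction d Ω ρ ∧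
    ∃ W : Set X, IsOpen W ∧ frontier Ω ⊆ W ∧ IsPSHOn d (fun x => ρ x ^ γ) ((closure Ω)ᶜ ∩ W)})

/-- The smooth hermitian metrics of `X`, given as the `J`-invariant Riemannian metrics. -/
structure HermitianMetric (d : ℕ) (X : Type*) [TopologicalSpace X]
    [ChartedSpace (EuclideanSpace ℂ (Fin d)) X] [IsManifold (complexModel d) ω X] extends
    Bundle.ContMDiffRiemannianMetric (realModel d) ∞ (EuclideanSpace ℂ (Fin d))
      (fun p : X => TangentSpace (realModel d) p) where
  invariant : ∀ (p : X) (v w : TangentSpace (realModel d) p),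
    inner p (tangentJ v) (tangentJ w) = inner p v w

/-- Takeuchi 1-convexity: some smooth defining function satisfies the strong Oka condition
`i∂∂̄(-log(-ρ)) ≥ g` on `Ω ∩ W`, with a hermitian metric `g` and a neighbourhood `W` of the
boundary. -/
def IsTakeuchiOneConvex (d : ℕ) {X : Type*} [TopologicalSpace X]
    [ChartedSpace (EuclideanSpace ℂ (Fin d)) X] [IsManifold (complexModel d) ω X] (Ω : Set X) : Prop :=
  ∃ ρ : X → ℝ, IsDefiningFunction d Ω ρ ∧ ∃ g : HermitianMetric d X,
    ∃ W : Set X, IsOpen W ∧ frontier Ω ⊆ W ∧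
      ∀ p ∈ Ω ∩ W, ∀ v : TangentSpace (realModel d) p,
        g.inner p v v ≤ complexHessian d (fun x => -Real.log (-ρ x)) p v

/-- Stein manifolds: holomorphically convex complex manifolds whose global holomorphic functions
separate points and give local coordinates at every point. -/
structure IsStein (d : ℕ) (X : Type*) [TopologicalSpace X]
    [ChartedSpace (EuclideanSpace ℂ (Fin d)) X] : Prop where
  holomorphicallyConvex : ∀ K : Set X, IsCompact K →
    IsCompact {x : X | ∀ f : X → ℂ, MDifferentiable (complexModel d) 𝓘(ℂ, ℂ) f →
      ∀ C : ℝ, (∀ y ∈ K, ‖f y‖ ≤ C) → ‖f x‖ ≤ C}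
  separates : ∀ x y : X, x ≠ y →
    ∃ f : X → ℂ, MDifferentiable (complexModel d) 𝓘(ℂ, ℂ) f ∧ f x ≠ f y
  coordinates : ∀ x : X, ∃ F : X → EuclideanSpace ℂ (Fin d),
    MDifferentiable (complexModel d) (complexModel d) F ∧
      Function.Bijective (mfderiv (complexModel d) (complexModel d) F x)

/-- The case `X = ℂ^d`. -/
theorem isStein_euclideanSpace (d : ℕ) : IsStein d (EuclideanSpace ℂ (Fin d)) where
  holomorphicallyConvex K hK := by
    have hcoord : ∀ i : Fin d, MDifferentiable (complexModel d) 𝓘(ℂ, ℂ)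
        (fun x : EuclideanSpace ℂ (Fin d) => x i) := fun i => by
      rw [mdifferentiable_iff_differentiable]
      exact (EuclideanSpace.proj (𝕜 := ℂ) i).differentiable
    refine Metric.isCompact_of_isClosed_isBounded ?_ ?_
    · simp only [Set.ofPred_forall]
      refine isClosed_iInter fun f => isClosed_iInter fun hf => isClosed_iInter fun C =>
        isClosed_iInter fun _ => isClosed_le ?_ continuous_const
      rw [mdifferentiable_iff_differentiable] at hf
      exact hf.continuous.norm
    · obtain ⟨R, hR⟩ := hK.isBounded.exists_norm_le
      refine isBounded_iff_forall_norm_le.2 ⟨√(∑ _i : Fin d, R ^ 2), fun x hx => ?_⟩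
      rw [EuclideanSpace.norm_eq]
      refine Real.sqrt_le_sqrt (Finset.sum_le_sum fun i _ => ?_)
      have := hx _ (hcoord i) R fun y hy => (PiLp.norm_apply_le y i).trans (hR y hy)
      exact pow_le_pow_left₀ (norm_nonneg _) this 2
  separates x y hxy := by
    by_contra! hcon
    refine hxy (PiLp.ext fun i => hcon (fun z => z i) ?_)
    rw [mdifferentiable_iff_differentiable]
    exact (EuclideanSpace.proj (𝕜 := ℂ) i).differentiable
  coordinates x := ⟨id, mdifferentiable_id, by
    rw [mfderiv_id]
    exact Function.bijective_id⟩

/-- The CR structure induced on `M` by a map `ι : M → X`: the vector `a + i b` is of type `(1,0)` if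
its image `dι(a) + i dι(b)` is of type `(1,0)` in `X`, that is, `dι(a) = J dι(b)`. -/
def inducedCR (m d : ℕ) {X : Type*} [TopologicalSpace X]
    [ChartedSpace (EuclideanSpace ℂ (Fin d)) X] {M : Type*} [TopologicalSpace M]
    [ChartedSpace (EuclideanSpace ℝ (Fin m)) M] (ι : M → X) : CRField m M :=
  fun p => {Z | mfderiv (𝓡 m) (realModel d) ι p Z.1 =
    tangentJ (mfderiv (𝓡 m) (realModel d) ι p Z.2)}

end Complex

end CRIndex

end

open scoped Manifold ContDiff Topology

set_option linter.unusedSectionVars false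

noncomputable section

namespace CRIndex

/-! ### Hermitian parts of real multilinear forms on a complex vector space -/

section Algebra

variable {E : Type*} [NormedAddCommGroup E] [NormedSpace ℂ E] [NormedSpace ℝ E]
  [IsScalarTower ℝ ℂ E]

/-! Put σ = 1 inside Ω and σ = -1 outside, t = -σρ, and κ = 1-γ or γ-1 respectively. Up to a
positive factor, the complex Hessian of -(-ρ)^γ or of ρ^γ at a point with t > 0 is H(v) +
(κ/t)|∂ρ(v)|², where H is the complex Hessian of ρ. All indices of Ω are therefore about the sign of
this one expression as t tends to 0.

Blow up at a boundary point p. Take N with ∂ρ(N) = 1 and a null vector v, that is ∂ρ(v) = 0 and H(v)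
= 0. At p - (σs/2)N, where t is asymptotic to s, evaluate on v + syN. The result divided by s tends
to -(σ/2)(D_N H)(v) + 2Re(ȳw) + κ|y - (σ/2)β|², with w = H(v,N) and β = ∂(D_N ρ)(v). Its minimum
over y is `boundaryForm`: σ(Re(β̄w) - ½(D_N H)(v)) - |w|²/κ. Weak plurisubharmonicity on one side
thus makes this form nonnegative on null vectors (`boundaryForm_ge_of_weak`). Conversely, its
positivity there, together with nonnegativity of the Levi form at all nearby boundary points, gives
strict plurisubharmonicity near p (`strict_of_boundaryForm_pos`, by contradiction and compactness of
the unit sphere).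

On the CR side, the contact form -(i/2)dρ∘J has D'Angelo form ω with ω(L) = w, and its ∂̄_b ω on
null vectors is `leviQuad`, namely Re(β̄w) - ½(D_N H)(v) - |w|². Hence `boundaryForm` equals σ∂̄_b ω
- (1/κ - σ)|ω|² (`IsDAngelo10.quad_eq`), and 1/κ - σ is exactly γ/(1-γ) or γ/(γ-1). Every
trivialization is, locally up to sign, the contact form of some exp(F)ρ (`exists_isContactForm`). So
at one and the same exponent: strong on M implies strong on Ω, which implies weak on Ω, which
implies weak on M.

The chain is closed by passing from weak on M at γ to strong on M at every strictly worse exponent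
(smaller for Diederich-Fornæss, larger for Steinness). Replacing ρ by exp(F)ρ adds ∂F to ω and
subtracts the complex Hessian of F from ∂̄_b ω. Both depend affinely on F, so a single strong
Diederich-Fornæss trivialization can be mixed into a weak one with a small weight t = σδ². The
weight is negative in the Steinness case, which is why one hypothesis serves both families
(`exists_interpolation`).

It remains to find one strong trivialization. On a Stein manifold the factor exp(-Kφ), with φ
strictly plurisubharmonic along M, makes ∂̄_b ω positive on null vectors. On a Takeuchi 1-convex
domain the blow-up with κ = 1 gives the same. Compactness of M then leaves room for a small multiple
of |ω|², hence for some γ > 0 (`BoundaryPos.exists_improvement`). -/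

/-- The complex linear part of a real linear form. -/
def holPart (l : E →L[ℝ] ℝ) (v : E) : ℂ := ((l v : ℂ) - Complex.I * l (Complex.I • v)) / 2

/-- The sesquilinear part of a real bilinear form. -/
def hermForm (B : E →L[ℝ] E →L[ℝ] ℝ) (v w : E) : ℂ :=
  ((B v w + B (Complex.I • v) (Complex.I • w) : ℝ) +
    Complex.I * (B v (Complex.I • w) - B (Complex.I • v) w : ℝ)) / 4

/-- The hermitian quadratic form of a real bilinear form. -/
def hermQuad (B : E →L[ℝ] E →L[ℝ] ℝ) (v : E) : ℝ :=
  (B v v + B (Complex.I • v) (Complex.I • v)) / 4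

theorem complex_smul_eq (c : ℂ) (v : E) :
    c • v = c.re • v + c.im • Complex.I • v := by
  conv_lhs => rw [← Complex.re_add_im c]
  rw [add_smul, mul_smul, ← Complex.coe_algebraMap, algebraMap_smul, algebraMap_smul]

theorem I_smul_I_smul (v : E) : Complex.I • Complex.I • v = -v := by
  rw [smul_smul, Complex.I_mul_I, neg_one_smul]

theorem I_smul_real_smul (a : ℝ) (v : E) : Complex.I • a • v = a • Complex.I • v :=
  smul_comm _ _ _

theorem holPart_add (l : E →L[ℝ] ℝ) (v w : E) : holPart l (v + w) = holPart l v + holPart l w := by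
  simp only [holPart, smul_add, map_add, Complex.ofReal_add]; ring

theorem holPart_smul (l : E →L[ℝ] ℝ) (c : ℂ) (v : E) : holPart l (c • v) = c * holPart l v := by
  simp only [holPart]
  rw [complex_smul_eq c v]
  simp only [smul_add, I_smul_real_smul, I_smul_I_smul, map_add, map_smul, map_neg, smul_eq_mul]
  apply Complex.ext <;> simp <;> ring

theorem holPart_re (l : E →L[ℝ] ℝ) (v : E) : (holPart l v).re = l v / 2 := by
  simp [holPart]

theorem holPart_im (l : E →L[ℝ] ℝ) (v : E) : (holPart l v).im = -l (Complex.I • v) / 2 := by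
  simp [holPart]

theorem holPart_eq_zero_iff (l : E →L[ℝ] ℝ) (v : E) :
    holPart l v = 0 ↔ l v = 0 ∧ l (Complex.I • v) = 0 := by
  rw [Complex.ext_iff, holPart_re, holPart_im]
  simp

theorem normSq_holPart (l : E →L[ℝ] ℝ) (v : E) :
    ‖holPart l v‖ ^ 2 = (l v ^ 2 + l (Complex.I • v) ^ 2) / 4 := by
  rw [← Complex.normSq_eq_norm_sq, Complex.normSq_apply, holPart_re, holPart_im]; ring

theorem hermForm_add_right (B : E →L[ℝ] E →L[ℝ] ℝ) (v w w' : E) :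
    hermForm B v (w + w') = hermForm B v w + hermForm B v w' := by
  simp only [hermForm, smul_add, map_add]; push_cast; ring

theorem hermForm_smul_left (B : E →L[ℝ] E →L[ℝ] ℝ) (c : ℂ) (v w : E) :
    hermForm B (c • v) w = c * hermForm B v w := by
  simp only [hermForm]
  rw [complex_smul_eq c v]
  simp only [smul_add, I_smul_real_smul, I_smul_I_smul, map_add, map_smul, map_neg, smul_eq_mul,
    add_apply, smul_apply, neg_apply]
  apply Complex.ext <;> simp <;> ring

theorem hermForm_smul_right (B : E →L[ℝ] E →L[ℝ] ℝ) (c : ℂ) (v w : E) :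
    hermForm B v (c • w) = (starRingEnd ℂ) c * hermForm B v w := by
  simp only [hermForm]
  rw [complex_smul_eq c w]
  simp only [smul_add, I_smul_real_smul, I_smul_I_smul, map_add, map_smul, map_neg, smul_eq_mul]
  apply Complex.ext <;> simp <;> ring

theorem hermForm_self {B : E →L[ℝ] E →L[ℝ] ℝ} (hB : ∀ v w, B v w = B w v) (v : E) :
    hermForm B v v = hermQuad B v := by
  simp only [hermForm, hermQuad]
  rw [hB v (Complex.I • v)]
  apply Complex.ext <;> simp

theorem hermQuad_add {B : E →L[ℝ] E →L[ℝ] ℝ} (hB : ∀ v w, B v w = B w v) (v w : E) :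
    hermQuad B (v + w) = hermQuad B v + 2 * (hermForm B v w).re + hermQuad B w := by
  simp only [hermForm, hermQuad, smul_add, map_add, add_apply]
  rw [hB w v, hB (Complex.I • w) (Complex.I • v)]
  simp
  ring

theorem hermQuad_smul (B : E →L[ℝ] E →L[ℝ] ℝ) (c : ℂ) (v : E) :
    hermQuad B (c • v) = ‖c‖ ^ 2 * hermQuad B v := by
  rw [← Complex.normSq_eq_norm_sq, Complex.normSq_apply]
  simp only [hermQuad]
  rw [complex_smul_eq c v]
  simp only [smul_add, I_smul_real_smul, I_smul_I_smul, map_add, map_smul, map_neg, smul_eq_mul,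
    add_apply, smul_apply, neg_apply]
  ring

theorem hermQuad_add_smul {B : E →L[ℝ] E →L[ℝ] ℝ} (hB : ∀ v w, B v w = B w v) (c : ℂ) (v w : E) :
    hermQuad B (v + c • w) =
      hermQuad B v + 2 * ((starRingEnd ℂ) c * hermForm B v w).re + ‖c‖ ^ 2 * hermQuad B w := by
  rw [hermQuad_add hB, hermForm_smul_right, hermQuad_smul]

theorem hermQuad_real_smul (B : E →L[ℝ] E →L[ℝ] ℝ) (c : ℝ) (v : E) :
    hermQuad B (c • v) = c ^ 2 * hermQuad B v := by
  simp only [hermQuad, I_smul_real_smul, map_smul, smul_apply, smul_eq_mul]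
  ring

/-- The equality case of positivity: a null vector of a positive semi-definite hermitian form on
`ker λ` is orthogonal to `ker λ`. -/
theorem hermForm_eq_zero_of_null {B : E →L[ℝ] E →L[ℝ] ℝ} (hB : ∀ v w, B v w = B w v)
    {l : E →L[ℝ] ℝ} (hpos : ∀ v, holPart l v = 0 → 0 ≤ hermQuad B v) {v w : E}
    (hv : holPart l v = 0) (hw : holPart l w = 0) (h0 : hermQuad B v = 0) :
    hermForm B v w = 0 := by
  by_contra hne
  have hq := hpos w hw
  set a := hermForm B v w with ha
  have hn : 0 < ‖a‖ ^ 2 := by positivity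
  have key : ∀ t : ℝ, 0 ≤ 2 * t * ‖a‖ ^ 2 + t ^ 2 * ‖a‖ ^ 2 * hermQuad B w := by
    intro t
    have h1 := hpos (v + ((t : ℂ) * a) • w) (by rw [holPart_add, holPart_smul, hv, hw]; simp)
    rw [hermQuad_add_smul hB, h0, ← ha] at h1
    have h2 : ((starRingEnd ℂ) ((t : ℂ) * a) * a).re = t * ‖a‖ ^ 2 := by
      rw [← Complex.normSq_eq_norm_sq, Complex.normSq_apply]; simp; ring
    have h3 : ‖(t : ℂ) * a‖ ^ 2 = t ^ 2 * ‖a‖ ^ 2 := by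
      rw [norm_mul, mul_pow, Complex.norm_real, Real.norm_eq_abs, sq_abs]
    rw [h2, h3] at h1
    linarith
  -- Any small negative parameter contradicts `key`; this one turns 2t + t²H(w) into -(2 + H(w))/(1
  -- + H(w))², with a denominator that is positive without a case distinction on H(w) = 0.
  have h4 := key (-(1 / (1 + hermQuad B w)))
  have h5 : 0 < 1 + hermQuad B w := by linarith
  have h6 : 2 * -(1 / (1 + hermQuad B w)) * ‖a‖ ^ 2 +
      (-(1 / (1 + hermQuad B w))) ^ 2 * ‖a‖ ^ 2 * hermQuad B w
      = -(‖a‖ ^ 2 * (2 + hermQuad B w) / (1 + hermQuad B w) ^ 2) := by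
    field_simp; ring
  rw [h6] at h4
  have : 0 < ‖a‖ ^ 2 * (2 + hermQuad B w) / (1 + hermQuad B w) ^ 2 := by positivity
  linarith

/-- If `l ≠ 0` then there is a vector `N` with `∂`-part equal to `1`. -/
theorem exists_holPart_eq_one {l : E →L[ℝ] ℝ} (hl : l ≠ 0) : ∃ N, holPart l N = 1 := by
  obtain ⟨w, hw⟩ : ∃ w, l w ≠ 0 := by
    by_contra! h
    exact hl (ContinuousLinearMap.ext h)
  have : holPart l w ≠ 0 := fun h => hw ((holPart_eq_zero_iff l w).1 h).1
  exact ⟨(holPart l w)⁻¹ • w, by rw [holPart_smul, inv_mul_cancel₀ this]⟩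

/-- The real bilinear form of the 1-form `i∂` contracted; the second variation term of a boundary
point: `Re(conj(B(N,·)^{1,0}(v)) H(v,N)) - ½ D(N)(v,v)` for the 2-jet `B` and the 3-jet `D`. -/
def normalTerm (B : E →L[ℝ] E →L[ℝ] ℝ) (D : E →L[ℝ] E →L[ℝ] E →L[ℝ] ℝ) (N v : E) : ℝ :=
  ((starRingEnd ℂ) (holPart (B N) v) * hermForm B v N).re - hermQuad (D N) v / 2

/-- The boundary form with side `σ = ±1` and exponent parameter `κ`. -/
def boundaryForm (B : E →L[ℝ] E →L[ℝ] ℝ) (D : E →L[ℝ] E →L[ℝ] E →L[ℝ] ℝ) (σ κ : ℝ) (N v : E) : ℝ :=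
  σ * normalTerm B D N v - ‖hermForm B v N‖ ^ 2 / κ

end Algebra

/-! ### Local analysis at a boundary point -/

section Flat

open Filter

variable {E : Type*} [NormedAddCommGroup E] [NormedSpace ℂ E] [NormedSpace ℝ E]
  [IsScalarTower ℝ ℂ E]

/-- Both ends of the difference quotient move, since foot points vary with the sequence. Ordinary
differentiability at `p` would not suffice; strict differentiability does, because the increment has
a fixed direction `w`. -/
theorem tendsto_slope_of_hasStrictFDerivAt {F : Type*} [NormedAddCommGroup F] [NormedSpace ℝ F]
    {G : E → F} {G' : E →L[ℝ] F} {p : E} (hG : HasStrictFDerivAt G G' p) {q m : ℕ → E}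
    (hq : Tendsto q atTop (𝓝 p)) (hm : Tendsto m atTop (𝓝 p)) {s : ℕ → ℝ} (hs : ∀ n, s n ≠ 0)
    {w : E} (h : ∀ n, q n - m n = s n • w) :
    Tendsto (fun n => (s n)⁻¹ • (G (q n) - G (m n))) atTop (𝓝 (G' w)) := by
  have h1 := hG.isLittleO.comp_tendsto (hq.prodMk_nhds hm)
  have h2 : (fun n => G (q n) - G (m n) - s n • G' w) =o[atTop] s := by
    refine Asymptotics.IsLittleO.trans_isBigO (g := fun n => s n • w) ?_ ?_
    · refine (h1.congr (fun n => ?_) (fun n => ?_))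
      · simp only [Function.comp_apply]
        rw [h, map_smul]
      · exact h n
    · exact Asymptotics.IsBigO.of_bound ‖w‖ (Eventually.of_forall fun n => by
        rw [norm_smul, mul_comm])
  have h3 := (Asymptotics.isLittleO_iff_tendsto' (Eventually.of_forall fun n hn =>
    absurd hn (hs n))).1 h2.norm_left
  have h4 : Tendsto (fun n => (s n)⁻¹ • (G (q n) - G (m n) - s n • G' w)) atTop (𝓝 0) := by
    rw [tendsto_zero_iff_norm_tendsto_zero]
    have := h3.norm
    rw [norm_zero] at this
    refine this.congr fun n => ?_
    rw [norm_smul, norm_div, norm_norm, norm_inv, div_eq_inv_mul]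
  have h5 := h4.add_const (G' w)
  rw [zero_add] at h5
  refine h5.congr fun n => ?_
  rw [smul_sub, smul_smul, inv_mul_cancel₀ (hs n), one_smul, sub_add_cancel]

/-- Since df(N) = 2, moving by (σs/2)N raises σf at rate close to 1, so the intermediate value
theorem reaches the zero set before s = 2t, where t = -σf(q). The bound s ≤ 2t keeps the foot points
converging to `p`. -/
theorem exists_foot_point {f : E → ℝ} {p : E} {σ : ℝ} (hσ : σ ^ 2 = 1) (hf : ContDiffAt ℝ 3 f p)
    (hp : f p = 0) {N : E} (hN : fderiv ℝ f p N = 2) :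
    ∀ᶠ q in 𝓝 p, 0 < -(σ * f q) →
      ∃ s, 0 < s ∧ s ≤ 2 * -(σ * f q) ∧ f (q + (σ * s / 2) • N) = 0 := by
  have hN0 : 0 < ‖N‖ := by
    rw [norm_pos_iff]; rintro rfl; simp at hN
  have habs : |σ| = 1 := by
    rwa [← abs_one, ← sq_eq_sq_iff_abs_eq_abs, one_pow]
  have hst : HasStrictFDerivAt f (fderiv ℝ f p) p := hf.hasStrictFDerivAt (by norm_num)
  have h1 := hst.isLittleO.def (show (0 : ℝ) < 1 / ‖N‖ by positivity)
  have hcont : ∀ᶠ q in 𝓝 p, ContinuousAt f q :=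
    (hf.eventually (by simp)).mono fun q hq => hq.continuousAt
  obtain ⟨δ, hδ, hball⟩ : ∃ δ > 0, (∀ x ∈ Metric.ball p δ, ∀ y ∈ Metric.ball p δ,
      ‖f x - f y - fderiv ℝ f p (x - y)‖ ≤ 1 / ‖N‖ * ‖x - y‖) ∧
      ∀ x ∈ Metric.ball p δ, ContinuousAt f x := by
    obtain ⟨δ₁, hδ₁, h1'⟩ := Metric.eventually_nhds_iff.1 h1
    obtain ⟨δ₂, hδ₂, h2'⟩ := Metric.eventually_nhds_iff.1 hcont
    refine ⟨min δ₁ δ₂, lt_min hδ₁ hδ₂, fun x hx y hy => ?_, fun x hx => ?_⟩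
    · refine h1' (y := (x, y)) ?_
      rw [Prod.dist_eq]
      exact max_lt ((Metric.mem_ball.1 hx).trans_le (min_le_left _ _))
        ((Metric.mem_ball.1 hy).trans_le (min_le_left _ _))
    · exact h2' ((Metric.mem_ball.1 hx).trans_le (min_le_right _ _))
  have ht : Tendsto (fun q => -(σ * f q) * ‖N‖) (𝓝 p) (𝓝 0) := by
    have : Tendsto f (𝓝 p) (𝓝 0) := by simpa [hp] using hf.continuousAt.tendsto
    simpa using ((this.const_mul σ).neg).mul_const ‖N‖
  filter_upwards [Metric.ball_mem_nhds p (half_pos hδ), ht.eventually_lt_const (half_pos hδ)]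
    with q hq hsmall hpos
  set t := -(σ * f q) with htdef
  have hmem : ∀ s ∈ Set.Icc 0 (2 * t), q + (σ * s / 2) • N ∈ Metric.ball p δ := by
    intro s hs
    rw [Metric.mem_ball, dist_eq_norm]
    have : q + (σ * s / 2) • N - p = (q - p) + (σ * s / 2) • N := by abel
    rw [this]
    refine (norm_add_le _ _).trans_lt ?_
    have h3 : ‖(σ * s / 2) • N‖ ≤ t * ‖N‖ := by
      rw [norm_smul, Real.norm_eq_abs, abs_div, abs_mul, habs, abs_of_nonneg hs.1, one_mul, abs_two]
      exact mul_le_mul_of_nonneg_right (by linarith [hs.2]) hN0.le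
    have h4 : ‖q - p‖ < δ / 2 := by rwa [← dist_eq_norm]
    linarith
  have hc : ContinuousOn (fun s => σ * f (q + (σ * s / 2) • N)) (Set.Icc 0 (2 * t)) := by
    intro s hs
    refine (ContinuousAt.mul continuousAt_const ?_).continuousWithinAt
    exact ContinuousAt.comp (f := fun s : ℝ => q + (σ * s / 2) • N) (hball.2 _ (hmem s hs))
      (by fun_prop)
  -- At s = 2t the linear part contributes 2t, starting from -t, and the error is at most ‖tN‖/‖N‖ =
  -- t; this is why the constant 1/‖N‖ was used above.
  have hend : 0 ≤ σ * f (q + (σ * (2 * t) / 2) • N) := by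
    have h5 := hball.1 _ (hmem (2 * t) ⟨by linarith, le_rfl⟩) q
      (Metric.ball_subset_ball (by linarith) hq)
    rw [add_sub_cancel_left, map_smul, hN, norm_smul, smul_eq_mul, Real.norm_eq_abs,
      Real.norm_eq_abs] at h5
    have h6 : |σ * (2 * t) / 2| = t := by
      rw [show σ * (2 * t) / 2 = σ * t by ring, abs_mul, habs, one_mul, abs_of_pos hpos]
    rw [h6, show 1 / ‖N‖ * (t * ‖N‖) = t by field_simp] at h5
    have h7 : |σ * (f (q + (σ * (2 * t) / 2) • N) - f q - σ * (2 * t) / 2 * 2)| ≤ t := by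
      rw [abs_mul, habs, one_mul]; exact h5
    have h8 := (abs_le.1 h7).1
    nlinarith
  obtain ⟨s, hs, hs0⟩ := intermediate_value_Icc (by linarith : (0 : ℝ) ≤ 2 * t) hc
    (show (0 : ℝ) ∈ Set.Icc _ _ from ⟨by
      simp only [mul_zero, zero_div, zero_smul, add_zero]; linarith, hend⟩)
  have hσ0 : σ ≠ 0 := by rintro rfl; norm_num at hσ
  have hfs : f (q + (σ * s / 2) • N) = 0 := (mul_eq_zero.1 hs0).resolve_left hσ0
  refine ⟨s, lt_of_le_of_ne hs.1 ?_, hs.2, hfs⟩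
  rintro rfl
  simp only [mul_zero, zero_div, zero_smul, add_zero] at hfs
  rw [htdef, hfs] at hpos
  simp at hpos

theorem neg_normSq_div_le (A : ℝ) (hA : 0 < A) (y B : ℂ) :
    -(‖B‖ ^ 2 / A) ≤ A * ‖y‖ ^ 2 + 2 * ((starRingEnd ℂ) y * B).re := by
  have h : 0 ≤ ‖(A : ℂ) * y + B‖ ^ 2 := by positivity
  have h2 : ‖(A : ℂ) * y + B‖ ^ 2 =
      A * (A * ‖y‖ ^ 2 + 2 * ((starRingEnd ℂ) y * B).re) + ‖B‖ ^ 2 := by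
    simp only [← Complex.normSq_eq_norm_sq, Complex.normSq_apply]
    simp
    ring
  rw [h2] at h
  rw [neg_le_iff_add_nonneg]
  have : A * ‖y‖ ^ 2 + 2 * ((starRingEnd ℂ) y * B).re + ‖B‖ ^ 2 / A =
    (A * (A * ‖y‖ ^ 2 + 2 * ((starRingEnd ℂ) y * B).re) + ‖B‖ ^ 2) / A := by
    field_simp
  rw [this]
  positivity

/-- Levi nonnegativity at the foot point (`h1`) and failure of strictness (`h4`) combine so that
`Hm` drops out, leaving s times a quadratic polynomial in y that is nonpositive. No bound on y is
known along the sequence, so one cannot pass to the limit in y; completing the square replaces the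
polynomial by its minimum, in which y no longer occurs. -/
theorem limit_inequality {s h d Hm κ : ℝ} {y c e w : ℂ} (hs : 0 < s)
    (hA : 0 < κ * ‖c‖ ^ 2 - s * h)
    (h1 : 0 ≤ Hm - 2 * s * ((starRingEnd ℂ) y * w).re + s ^ 2 * ‖y‖ ^ 2 * h)
    (h4 : s * d + Hm + s * (κ * ‖c * y - e‖ ^ 2) ≤ 0) :
    0 ≤ -(κ * ‖e‖ ^ 2 + d - ‖w - κ * ((starRingEnd ℂ) c * e)‖ ^ 2 / (κ * ‖c‖ ^ 2 - s * h)) := by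
  have h9 : ‖c * y - e‖ ^ 2 = ‖c‖ ^ 2 * ‖y‖ ^ 2 -
      2 * ((starRingEnd ℂ) y * ((starRingEnd ℂ) c * e)).re + ‖e‖ ^ 2 := by
    simp only [← Complex.normSq_eq_norm_sq, Complex.normSq_apply]
    simp
    ring
  have h10 := neg_normSq_div_le _ hA y (w - κ * ((starRingEnd ℂ) c * e))
  have h11 : ((starRingEnd ℂ) y * (w - κ * ((starRingEnd ℂ) c * e))).re =
      ((starRingEnd ℂ) y * w).re - κ * ((starRingEnd ℂ) y * ((starRingEnd ℂ) c * e)).re := by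
    rw [mul_sub, Complex.sub_re, mul_left_comm, Complex.re_ofReal_mul]
  rw [h11] at h10
  rw [h9] at h4
  generalize ‖w - κ * ((starRingEnd ℂ) c * e)‖ ^ 2 / (κ * ‖c‖ ^ 2 - s * h) = R at h10 ⊢
  generalize ((starRingEnd ℂ) y * ((starRingEnd ℂ) c * e)).re = X at h10 h4
  generalize ((starRingEnd ℂ) y * w).re = Y at h10 h1
  generalize ‖y‖ ^ 2 = Z at *
  generalize ‖c‖ ^ 2 = C at *
  generalize ‖e‖ ^ 2 = G at *
  have h13 : s * (d + 2 * Y - s * Z * h + κ * (C * Z - 2 * X + G)) ≤ 0 := by linarith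
  have h14 := nonpos_of_mul_nonpos_right h13 hs
  linarith

theorem tendsto_clm_apply {ι F : Type*} [NormedAddCommGroup F] [NormedSpace ℝ F] {l : Filter ι}
    {φ : ι → E →L[ℝ] F} {v : ι → E} {φ₀ : E →L[ℝ] F} {v₀ : E} (hφ : Tendsto φ l (𝓝 φ₀))
    (hv : Tendsto v l (𝓝 v₀)) : Tendsto (fun i => φ i (v i)) l (𝓝 (φ₀ v₀)) :=
  (isBoundedBilinearMap_apply.continuous.tendsto (φ₀, v₀)).comp (hφ.prodMk_nhds hv)

theorem tendsto_holPart {ι : Type*} {l : Filter ι} {φ : ι → E →L[ℝ] ℝ} {v : ι → E}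
    {φ₀ : E →L[ℝ] ℝ} {v₀ : E} (hφ : Tendsto φ l (𝓝 φ₀)) (hv : Tendsto v l (𝓝 v₀)) :
    Tendsto (fun i => holPart (φ i) (v i)) l (𝓝 (holPart φ₀ v₀)) := by
  have h1 := tendsto_clm_apply hφ hv
  have h2 := tendsto_clm_apply hφ (hv.const_smul Complex.I)
  exact (((Complex.continuous_ofReal.tendsto _).comp h1).sub
    (((Complex.continuous_ofReal.tendsto _).comp h2).const_mul Complex.I)).div_const 2

theorem tendsto_hermForm {ι : Type*} {l : Filter ι} {φ : ι → E →L[ℝ] E →L[ℝ] ℝ}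
    {v w : ι → E} {φ₀ : E →L[ℝ] E →L[ℝ] ℝ} {v₀ w₀ : E} (hφ : Tendsto φ l (𝓝 φ₀))
    (hv : Tendsto v l (𝓝 v₀)) (hw : Tendsto w l (𝓝 w₀)) :
    Tendsto (fun i => hermForm (φ i) (v i) (w i)) l (𝓝 (hermForm φ₀ v₀ w₀)) := by
  have hv' := tendsto_clm_apply hφ (hv.const_smul Complex.I)
  have hv := tendsto_clm_apply hφ hv
  have hw' := hw.const_smul Complex.I
  exact ((((Complex.continuous_ofReal.tendsto _).comp
    ((tendsto_clm_apply hv hw).add (tendsto_clm_apply hv' hw')))).add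
    ((((Complex.continuous_ofReal.tendsto _).comp
    ((tendsto_clm_apply hv hw').sub (tendsto_clm_apply hv' hw)))).const_mul Complex.I)).div_const 4

theorem tendsto_hermQuad {ι : Type*} {l : Filter ι} {φ : ι → E →L[ℝ] E →L[ℝ] ℝ} {v : ι → E}
    {φ₀ : E →L[ℝ] E →L[ℝ] ℝ} {v₀ : E} (hφ : Tendsto φ l (𝓝 φ₀)) (hv : Tendsto v l (𝓝 v₀)) :
    Tendsto (fun i => hermQuad (φ i) (v i)) l (𝓝 (hermQuad φ₀ v₀)) :=
  ((tendsto_clm_apply (tendsto_clm_apply hφ hv) hv).add (tendsto_clm_apply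
    (tendsto_clm_apply hφ (hv.const_smul Complex.I)) (hv.const_smul Complex.I))).div_const 4

theorem ContDiffAt.fderiv_fderiv_symm {f : E → ℝ} {p : E} (hf : ContDiffAt ℝ 3 f p) (v w : E) :
    fderiv ℝ (fderiv ℝ f) p v w = fderiv ℝ (fderiv ℝ f) p w v :=
  (hf.isSymmSndFDerivAt (by simp; norm_num)).eq v w

theorem ContDiffAt.jets {f : E → ℝ} {p : E} (hf : ContDiffAt ℝ 3 f p) :
    HasStrictFDerivAt f (fderiv ℝ f p) p ∧
    HasStrictFDerivAt (fderiv ℝ f) (fderiv ℝ (fderiv ℝ f) p) p ∧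
    HasStrictFDerivAt (fderiv ℝ (fderiv ℝ f)) (fderiv ℝ (fderiv ℝ (fderiv ℝ f)) p) p := by
  have h1 : ContDiffAt ℝ 2 (fderiv ℝ f) p := hf.fderiv_right (by norm_num)
  have h2 : ContDiffAt ℝ 1 (fderiv ℝ (fderiv ℝ f)) p := h1.fderiv_right (by norm_num)
  exact ⟨hf.hasStrictFDerivAt (by norm_num), h1.hasStrictFDerivAt (by norm_num),
    h2.hasStrictFDerivAt (by norm_num)⟩

theorem fderiv_of_holPart_eq_one {l : E →L[ℝ] ℝ} {N : E} (hN : holPart l N = 1) : l N = 2 := by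
  have := holPart_re l N
  rw [hN] at this
  simp at this
  linarith

/-- The shape in which the boundary form arises as a limit in the strict argument: e tends to (σ/2)β
and d to -(σ/2)(D_N H)(v). -/
theorem boundaryForm_eq {B : E →L[ℝ] E →L[ℝ] ℝ} {D : E →L[ℝ] E →L[ℝ] E →L[ℝ] ℝ} {σ κ : ℝ}
    (hσ : σ ^ 2 = 1) (hκ : 0 < κ) (N v : E) :
    boundaryForm B D σ κ N v =
      κ * ‖(σ / 2 : ℂ) * holPart (B N) v‖ ^ 2 + -(σ / 2) * hermQuad (D N) v
        - ‖hermForm B v N - κ * ((σ / 2 : ℂ) * holPart (B N) v)‖ ^ 2 / κ := by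
  rw [boundaryForm, normalTerm]
  simp only [← Complex.normSq_eq_norm_sq, Complex.normSq_apply]
  simp
  field_simp
  linear_combination 0 * hσ

/-- If strictness fails along points `q n` with unit vectors `v n`, a limit vector is null, and each
`q n` is compared with its foot point on the zero set along `N`. Dividing by the distance parameter
and using the Levi condition at the foot points, not only at `p`, forces the boundary form of the
limit vector to be nonpositive. -/
theorem strict_of_boundaryForm_pos [FiniteDimensional ℝ E] {f : E → ℝ} {p : E} {σ κ : ℝ}
    (hσ : σ ^ 2 = 1) (hκ : 0 < κ) (hf : ContDiffAt ℝ 3 f p) (hp : f p = 0) {N : E}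
    (hN : holPart (fderiv ℝ f p) N = 1)
    (hlevi : ∀ᶠ q in 𝓝 p, f q = 0 → ∀ v, holPart (fderiv ℝ f q) v = 0 →
      0 ≤ hermQuad (fderiv ℝ (fderiv ℝ f) q) v)
    (hpos : ∀ v ≠ 0, holPart (fderiv ℝ f p) v = 0 → hermQuad (fderiv ℝ (fderiv ℝ f) p) v = 0 →
      0 < boundaryForm (fderiv ℝ (fderiv ℝ f) p) (fderiv ℝ (fderiv ℝ (fderiv ℝ f)) p) σ κ N v) :
    ∀ᶠ q in 𝓝 p, 0 < -(σ * f q) → ∀ v ≠ 0,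
      0 < hermQuad (fderiv ℝ (fderiv ℝ f) q) v
        + κ / (-(σ * f q)) * ‖holPart (fderiv ℝ f q) v‖ ^ 2 := by
  by_contra hcon
  rw [not_eventually] at hcon
  have hDN := fderiv_of_holPart_eq_one hN
  have hsymm : ∀ᶠ q in 𝓝 p, ContDiffAt ℝ 3 f q := hf.eventually (by simp)
  have hfreq : ∃ᶠ q in 𝓝 p, ∃ (v : E) (s : ℝ), ‖v‖ = 1 ∧ 0 < -(σ * f q) ∧
      hermQuad (fderiv ℝ (fderiv ℝ f) q) v
        + κ / (-(σ * f q)) * ‖holPart (fderiv ℝ f q) v‖ ^ 2 ≤ 0 ∧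
      0 < s ∧ s ≤ 2 * -(σ * f q) ∧ f (q + (σ * s / 2) • N) = 0 := by
    refine (hcon.and_eventually (exists_foot_point hσ hf hp hDN)).mono fun q hq => ?_
    obtain ⟨hq1, hq2⟩ := hq
    push Not at hq1
    obtain ⟨ht, v, hv, hle⟩ := hq1
    obtain ⟨s, hs⟩ := hq2 ht
    have hv' : ‖v‖ ≠ 0 := norm_ne_zero_iff.2 hv
    refine ⟨((‖v‖⁻¹ : ℝ) : ℂ) • v, s, ?_, ht, ?_, hs⟩
    · rw [norm_smul, Complex.norm_real, norm_inv, norm_norm, inv_mul_cancel₀ hv']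
    · rw [hermQuad_smul, holPart_smul, norm_mul, mul_pow, mul_left_comm, ← mul_add]
      exact mul_nonpos_of_nonneg_of_nonpos (by positivity) hle
  obtain ⟨q, hq, hq'⟩ := exists_seq_forall_of_frequently hfreq
  choose v s hv ht hle hs hst hfoot using hq'
  obtain ⟨v₀, hv₀, φ, hφ, hvφ⟩ := (isCompact_sphere (0 : E) 1).tendsto_subseq
    (fun n => show v n ∈ Metric.sphere 0 1 by rw [mem_sphere_zero_iff_norm, hv])
  obtain ⟨jf, jD, jH⟩ := ContDiffAt.jets hf
  set B := fderiv ℝ (fderiv ℝ f) p with hB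
  set D := fderiv ℝ (fderiv ℝ (fderiv ℝ f)) p with hD
  have hBs : ∀ v w, B v w = B w v := fun v w => ContDiffAt.fderiv_fderiv_symm hf v w
  -- pass to the subsequence
  have hqφ : Tendsto (fun n => q (φ n)) atTop (𝓝 p) := hq.comp hφ.tendsto_atTop
  have htend : Tendsto (fun n => -(σ * f (q (φ n)))) atTop (𝓝 0) := by
    have := ((jf.continuousAt.tendsto.comp hqφ).const_mul σ).neg
    simpa [hp] using this
  have hsφ : Tendsto (fun n => s (φ n)) atTop (𝓝 0) := by
    refine squeeze_zero (fun n => (hs _).le) (fun n => hst _) ?_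
    simpa using htend.const_mul 2
  have hmφ : Tendsto (fun n => q (φ n) + (σ * s (φ n) / 2) • N) atTop (𝓝 p) := by
    have h1 : Tendsto (fun n => σ * s (φ n) / 2) atTop (𝓝 0) := by
      simpa using (hsφ.const_mul σ).div_const 2
    simpa using hqφ.add (h1.smul_const N)
  have hs0 : ∀ n, s (φ n) ≠ 0 := fun n => (hs _).ne'
  have hdiff : ∀ n, q (φ n) - (q (φ n) + (σ * s (φ n) / 2) • N) = s (φ n) • (-(σ / 2) • N) := by
    intro n
    rw [smul_smul, sub_add_cancel_left, ← neg_smul]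
    congr 1
    ring
  have lf := tendsto_slope_of_hasStrictFDerivAt jf hqφ hmφ hs0 hdiff
  have lD := tendsto_slope_of_hasStrictFDerivAt jD hqφ hmφ hs0 hdiff
  have lH := tendsto_slope_of_hasStrictFDerivAt (F := E →L[ℝ] E →L[ℝ] ℝ) jH hqφ hmφ hs0 hdiff
  have lDq := jD.continuousAt.tendsto.comp hqφ
  have lDm := jD.continuousAt.tendsto.comp hmφ
  have lHq := jH.continuousAt.tendsto.comp hqφ
  have lHm := jH.continuousAt.tendsto.comp hmφ
  -- the limit vector is null
  have hHlim := tendsto_hermQuad lHq hvφ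
  have halim := tendsto_holPart lDq hvφ
  have hlevi₀ := hlevi.self_of_nhds hp
  have hv₀hol : holPart (fderiv ℝ f p) v₀ = 0 := by
    -- Multiplying the failed inequality by t removes the singular factor: κ|∂f(v)|² is at most
    -- -tH(v), which tends to 0.
    have h1 : Tendsto (fun n => -(σ * f (q (φ n))) *
        -CRIndex.hermQuad (fderiv ℝ (fderiv ℝ f) (q (φ n))) (v (φ n))) atTop (𝓝 0) := by
      simpa using htend.mul hHlim.neg
    have h2 := (halim.norm.pow 2).const_mul κ
    have h3 : κ * ‖CRIndex.holPart (fderiv ℝ f p) v₀‖ ^ 2 ≤ 0 := by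
      refine le_of_tendsto_of_tendsto' h2 h1 fun n => ?_
      have h4 := hle (φ n)
      have h5 := ht (φ n)
      simp only [Function.comp_apply]
      have h6 := mul_le_mul_of_nonneg_left h4 h5.le
      rw [mul_add, mul_zero, ← mul_assoc, mul_div_cancel₀ _ h5.ne'] at h6
      linarith
    have h4 : ‖CRIndex.holPart (fderiv ℝ f p) v₀‖ ^ 2 ≤ 0 := by
      by_contra hc
      push Not at hc
      linarith [mul_pos hκ hc]
    have h5 := pow_eq_zero_iff (two_ne_zero) |>.1 (le_antisymm h4 (by positivity))
    exact norm_eq_zero.1 h5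
  have hv₀quad : hermQuad B v₀ = 0 := by
    refine le_antisymm (le_of_tendsto' hHlim fun n => ?_) (hlevi₀ v₀ hv₀hol)
    have h4 := hle (φ n)
    have h5 : 0 ≤ κ / (-(σ * f (q (φ n)))) *
        ‖CRIndex.holPart (fderiv ℝ f (q (φ n))) (v (φ n))‖ ^ 2 := by
      have := ht (φ n)
      positivity
    simp only [Function.comp_apply]
    linarith
  have hv₀ne : v₀ ≠ 0 := by
    rintro rfl
    simp at hv₀
  have hfinal := hpos v₀ hv₀ne hv₀hol hv₀quad
  -- the rescaled quantities
  set m : ℕ → E := fun n => q (φ n) + (σ * s (φ n) / 2) • N with hm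
  set c : ℕ → ℂ := fun n => holPart (fderiv ℝ f (m n)) N with hc
  set b : ℕ → ℂ := fun n => holPart (fderiv ℝ f (m n)) (v (φ n)) with hb
  set a : ℕ → ℂ := fun n => holPart (fderiv ℝ f (q (φ n))) (v (φ n)) with ha
  set w : ℕ → ℂ := fun n => hermForm (fderiv ℝ (fderiv ℝ f) (m n)) (v (φ n)) N with hw
  set h : ℕ → ℝ := fun n => hermQuad (fderiv ℝ (fderiv ℝ f) (m n)) N with hh
  set e : ℕ → ℂ := fun n => -holPart ((s (φ n))⁻¹ • (fderiv ℝ f (q (φ n)) - fderiv ℝ f (m n)))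
    (v (φ n)) with he
  set d : ℕ → ℝ := fun n => hermQuad ((s (φ n))⁻¹ • (fderiv ℝ (fderiv ℝ f) (q (φ n)) -
    fderiv ℝ (fderiv ℝ f) (m n))) (v (φ n)) with hd
  set κn : ℕ → ℝ := fun n => κ / (-(σ * ((s (φ n))⁻¹ • (f (q (φ n)) - f (m n))))) with hκn
  have cl : Tendsto c atTop (𝓝 1) := by
    rw [← hN]; exact tendsto_holPart lDm tendsto_const_nhds
  have wl : Tendsto w atTop (𝓝 (hermForm B v₀ N)) :=
    tendsto_hermForm lHm hvφ tendsto_const_nhds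
  have hl : Tendsto h atTop (𝓝 (hermQuad B N)) := tendsto_hermQuad lHm tendsto_const_nhds
  have el : Tendsto e atTop (𝓝 ((σ / 2 : ℂ) * holPart (B N) v₀)) := by
    have := (tendsto_holPart lD hvφ).neg
    refine this.mono_right (le_of_eq (congrArg 𝓝 ?_))
    rw [map_smul]
    simp only [CRIndex.holPart, smul_apply, smul_eq_mul]
    push_cast
    ring
  have dl : Tendsto d atTop (𝓝 (-(σ / 2) * hermQuad (D N) v₀)) := by
    have := tendsto_hermQuad lH hvφ
    refine this.mono_right (le_of_eq (congrArg 𝓝 ?_))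
    rw [map_smul]
    simp only [CRIndex.hermQuad, smul_apply, smul_eq_mul]
    ring
  have κl : Tendsto κn atTop (𝓝 κ) := by
    have h1 := (tendsto_const_nhds (x := κ)).div ((lf.const_mul σ).neg) (by
      rw [map_smul, hDN, smul_eq_mul]
      intro h0
      nlinarith)
    refine h1.mono_right (le_of_eq (congrArg 𝓝 ?_))
    rw [map_smul, hDN, smul_eq_mul]
    rw [show -(σ * (-(σ / 2) * 2)) = σ ^ 2 by ring, hσ, div_one]
  have Al : Tendsto (fun n => κn n * ‖c n‖ ^ 2 - s (φ n) * h n) atTop (𝓝 κ) := by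
    simpa using (κl.mul (cl.norm.pow 2)).sub (hsφ.mul hl)
  have Rl : Tendsto (fun n => κn n * ‖e n‖ ^ 2 + d n - ‖w n - κn n * ((starRingEnd ℂ) (c n) * e n)‖ ^ 2 /
      (κn n * ‖c n‖ ^ 2 - s (φ n) * h n)) atTop
      (𝓝 (boundaryForm B D σ κ N v₀)) := by
    rw [boundaryForm_eq hσ hκ]
    have h1 : Tendsto (fun n => (starRingEnd ℂ) (c n)) atTop (𝓝 1) := by
      have := (Complex.continuous_conj.tendsto 1).comp cl
      rwa [map_one] at this
    have h2 : Tendsto (fun n => (κn n : ℂ)) atTop (𝓝 κ) :=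
      (Complex.continuous_ofReal.tendsto _).comp κl
    have h3 := (h2.mul (h1.mul el))
    rw [one_mul] at h3
    exact ((κl.mul (el.norm.pow 2)).add dl).sub (((wl.sub h3).norm.pow 2).div Al hκ.ne')
  -- The quantity whose limit is the positive boundary form is eventually nonpositive.
  refine absurd (ge_of_tendsto (b := 0) Rl.neg ?_) (by linarith)
  filter_upwards [Al.eventually_const_lt hκ, cl.eventually_ne one_ne_zero, hmφ.eventually hlevi,
    hmφ.eventually hsymm] with n hA hcn hlev hsm
  have hspos := hs (φ n)
  have htpos := ht (φ n)
  have hmz : f (m n) = 0 := hfoot (φ n)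
  -- With this y the vector v - syN lies in the complex tangent space at the foot point, where the
  -- Levi condition applies.
  set y : ℂ := b n / (c n * s (φ n)) with hy
  have hsC : (s (φ n) : ℂ) ≠ 0 := by exact_mod_cast hspos.ne'
  have h1 := hlev hmz (v (φ n) + (-((s (φ n) : ℂ) * y)) • N) (by
    rw [holPart_add, holPart_smul]
    change b n + -((s (φ n) : ℂ) * y) * c n = 0
    rw [hy]
    field_simp
    ring)
  rw [hermQuad_add_smul (fun v w => ContDiffAt.fderiv_fderiv_symm hsm v w)] at h1
  have h2 : ‖-((s (φ n) : ℂ) * y)‖ ^ 2 = s (φ n) ^ 2 * ‖y‖ ^ 2 := by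
    rw [norm_neg, norm_mul, mul_pow, Complex.norm_real, Real.norm_eq_abs, sq_abs]
  have h3 : ((starRingEnd ℂ) (-((s (φ n) : ℂ) * y)) *
      hermForm (fderiv ℝ (fderiv ℝ f) (m n)) (v (φ n)) N).re =
      -s (φ n) * ((starRingEnd ℂ) y * w n).re := by
    rw [map_neg, map_mul, Complex.conj_ofReal, neg_mul, mul_assoc, Complex.neg_re,
      Complex.re_ofReal_mul]
    ring
  rw [h2, h3] at h1
  have h4 := hle (φ n)
  have h5 : a n = s (φ n) * (c n * y - e n) := by
    have : e n = -((s (φ n) : ℂ)⁻¹ * (a n - b n)) := by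
      rw [he, ha, hb]
      simp only [CRIndex.holPart, smul_apply, sub_apply, smul_eq_mul]
      push_cast
      ring
    rw [this, hy]
    field_simp
    ring
  have h6 : d n = (s (φ n))⁻¹ * (hermQuad (fderiv ℝ (fderiv ℝ f) (q (φ n))) (v (φ n)) -
      hermQuad (fderiv ℝ (fderiv ℝ f) (m n)) (v (φ n))) := by
    rw [hd]
    simp only [CRIndex.hermQuad, smul_apply, sub_apply, smul_eq_mul]
    ring
  have h7 : κn n = κ * s (φ n) / (-(σ * f (q (φ n)))) := by
    rw [hκn]
    simp only [hmz, sub_zero, smul_eq_mul]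
    have : f (q (φ n)) ≠ 0 := by
      intro h0; rw [h0] at htpos; simp at htpos
    have : σ ≠ 0 := by rintro rfl; norm_num at hσ
    field_simp
  have h8 : κ / (-(σ * f (q (φ n)))) * ‖a n‖ ^ 2 = s (φ n) * (κn n * ‖c n * y - e n‖ ^ 2) := by
    rw [h5, norm_mul, mul_pow, Complex.norm_real, Real.norm_eq_abs, sq_abs, h7]
    ring
  have h12 : hermQuad (fderiv ℝ (fderiv ℝ f) (q (φ n))) (v (φ n)) =
      s (φ n) * d n + hermQuad (fderiv ℝ (fderiv ℝ f) (m n)) (v (φ n)) := by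
    rw [h6]; field_simp; ring
  change _ + κ / (-(σ * f (q (φ n)))) * ‖a n‖ ^ 2 ≤ 0 at h4
  rw [h8, h12] at h4
  refine limit_inequality hspos hA (y := y) (Hm := hermQuad (fderiv ℝ (fderiv ℝ f) (m n)) (v (φ n)))
    ?_ h4
  change 0 ≤ _ + _ + s (φ n) ^ 2 * ‖y‖ ^ 2 * h n at h1
  linarith

end Flat

/-! ### The weak direction, and changes of the normal vector. -/

section Flat

open Filter

variable {E : Type*} [NormedAddCommGroup E] [NormedSpace ℂ E] [NormedSpace ℝ E]
  [IsScalarTower ℝ ℂ E]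

/-- The quadratic polynomial of the blow-up, evaluated at its minimizer y = -w/κ + (σ/2)β, is the
boundary form. -/
theorem weak_limit_identity {κ σ : ℝ} (hκ : 0 < κ) (β om : ℂ) (H : ℝ) :
    -(σ / 2) * H + 2 * ((starRingEnd ℂ) (-om / κ + (σ / 2 : ℂ) * β) * om).re + κ * ‖-om / (κ : ℂ)‖ ^ 2 =
      σ * (((starRingEnd ℂ) β * om).re - H / 2) - ‖om‖ ^ 2 / κ := by
  have h1 : ‖-om / (κ : ℂ)‖ ^ 2 = ‖om‖ ^ 2 / κ ^ 2 := by
    rw [norm_div, norm_neg, div_pow, Complex.norm_real, Real.norm_eq_abs, sq_abs]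
  have h2 : ((starRingEnd ℂ) (-om / κ + (σ / 2 : ℂ) * β) * om).re =
      -(‖om‖ ^ 2 / κ) + σ / 2 * ((starRingEnd ℂ) β * om).re := by
    have : (starRingEnd ℂ) (-om / κ + (σ / 2 : ℂ) * β) * om =
        ((-(‖om‖ ^ 2 / κ) : ℝ) : ℂ) + ((σ / 2 : ℝ) : ℂ) * ((starRingEnd ℂ) β * om) := by
      have h3 : ((‖om‖ ^ 2 : ℝ) : ℂ) = (starRingEnd ℂ) om * om := by
        rw [← Complex.normSq_eq_norm_sq, Complex.normSq_eq_conj_mul_self]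
      push_cast at h3 ⊢
      rw [h3]
      simp only [map_add, map_mul, map_div₀, map_neg, Complex.conj_ofReal, Complex.conj_ofNat]
      ring
    rw [this, Complex.add_re, Complex.ofReal_re, Complex.re_ofReal_mul]
  rw [h1, h2]
  field_simp
  ring

/-- The inequality is tested at p - (σs/2)N, first on vectors annihilated by ∂f there (the singular
term disappears and the Levi condition remains), then, for a null vector, on v + syN with the
optimal y after division by s. The term with ε carries the lower bound of a metric through the limit
and is 0 in the weak case. -/
theorem boundaryForm_ge_of_weak {f : E → ℝ} {p : E} {σ κ ε : ℝ}
    (hσ : σ ^ 2 = 1) (hκ : 0 < κ) (hε : 0 ≤ ε) (hf : ContDiffAt ℝ 3 f p) (hp : f p = 0)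
    {N : E} (hN : holPart (fderiv ℝ f p) N = 1)
    (hweak : ∀ᶠ q in 𝓝 p, 0 < -(σ * f q) → ∀ v, -(σ * f q) * (ε * ‖v‖ ^ 2) ≤
      hermQuad (fderiv ℝ (fderiv ℝ f) q) v
        + κ / (-(σ * f q)) * ‖holPart (fderiv ℝ f q) v‖ ^ 2) {v : E}
    (hv : holPart (fderiv ℝ f p) v = 0) :
    0 ≤ hermQuad (fderiv ℝ (fderiv ℝ f) p) v ∧ (hermQuad (fderiv ℝ (fderiv ℝ f) p) v = 0 →
      ε * ‖v‖ ^ 2 ≤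
        boundaryForm (fderiv ℝ (fderiv ℝ f) p) (fderiv ℝ (fderiv ℝ (fderiv ℝ f)) p) σ κ N v) := by
  have hDN := fderiv_of_holPart_eq_one hN
  obtain ⟨jf, jD, jH⟩ := ContDiffAt.jets hf
  set B := fderiv ℝ (fderiv ℝ f) p with hB
  set D := fderiv ℝ (fderiv ℝ (fderiv ℝ f)) p with hD
  set s : ℕ → ℝ := fun n => 1 / ((n : ℝ) + 1) with hs
  have hspos : ∀ n, 0 < s n := fun n => Nat.one_div_pos_of_nat
  have hs0 : ∀ n, s n ≠ 0 := fun n => (hspos n).ne'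
  have hsl : Tendsto s atTop (𝓝 0) := tendsto_one_div_add_atTop_nhds_zero_nat
  set q : ℕ → E := fun n => p + s n • (-(σ / 2) • N) with hqdef
  have hq : Tendsto q atTop (𝓝 p) := by
    have := (hsl.smul_const (-(σ / 2) • N)).const_add p
    rwa [zero_smul, add_zero] at this
  have hdiff : ∀ n, q n - p = s n • (-(σ / 2) • N) := fun n => by rw [hqdef]; simp
  have lf := tendsto_slope_of_hasStrictFDerivAt jf hq tendsto_const_nhds hs0 hdiff
  have lD := tendsto_slope_of_hasStrictFDerivAt jD hq tendsto_const_nhds hs0 hdiff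
  have lH := tendsto_slope_of_hasStrictFDerivAt (F := E →L[ℝ] E →L[ℝ] ℝ) jH hq
    tendsto_const_nhds hs0 hdiff
  have lDq := jD.continuousAt.tendsto.comp hq
  have lHq := jH.continuousAt.tendsto.comp hq
  have hτ : Tendsto (fun n => -(σ * f (q n)) / s n) atTop (𝓝 1) := by
    have := (lf.const_mul σ).neg
    refine Tendsto.congr (fun n => ?_) (this.mono_right (le_of_eq (congrArg 𝓝 ?_)))
    · rw [hp, sub_zero, smul_eq_mul]; ring
    · rw [map_smul, hDN, smul_eq_mul, ← hσ]; ring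
  have htpos : ∀ᶠ n in atTop, 0 < -(σ * f (q n)) := by
    filter_upwards [hτ.eventually_const_lt one_pos] with n hn
    exact (div_pos_iff_of_pos_right (hspos n)).1 hn
  have hweak' := hq.eventually hweak
  set c : ℕ → ℂ := fun n => holPart (fderiv ℝ f (q n)) N with hc
  have cl : Tendsto c atTop (𝓝 1) := by
    rw [← hN]; exact tendsto_holPart lDq tendsto_const_nhds
  have hsymm : ∀ᶠ n in atTop, ContDiffAt ℝ 3 f (q n) := hq.eventually (hf.eventually (by simp))
  refine ⟨?_, fun hv0 => ?_⟩
  -- The correction along `N` puts the test vector in the kernel of ∂f at q, which removes the term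
  -- with 1/t before the limit is taken.
  · have hx : Tendsto (fun n => v + (-(holPart (fderiv ℝ f (q n)) v / c n)) • N) atTop (𝓝 v) := by
      have h1 := (((tendsto_holPart lDq (tendsto_const_nhds (x := v))).div cl one_ne_zero).neg.smul_const
        N).const_add v
      refine h1.mono_right (le_of_eq (congrArg 𝓝 ?_))
      rw [hv]; simp
    refine ge_of_tendsto (tendsto_hermQuad lHq hx) ?_
    filter_upwards [hweak', htpos, cl.eventually_ne one_ne_zero] with n hn ht hcn
    have h2 := hn ht (v + (-(holPart (fderiv ℝ f (q n)) v / c n)) • N)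
    have h3 : holPart (fderiv ℝ f (q n)) (v + (-(holPart (fderiv ℝ f (q n)) v / c n)) • N) = 0 := by
      rw [holPart_add, holPart_smul]
      change _ + _ * c n = 0
      field_simp
      ring
    rw [h3, norm_zero] at h2
    have : 0 ≤ -(σ * f (q n)) *
      (ε * ‖v + (-(holPart (fderiv ℝ f (q n)) v / c n)) • N‖ ^ 2) := by positivity
    simp only [Function.comp_apply]
    linarith
  set om := hermForm B v N with hom_def
  set β := holPart (B N) v with hβ
  -- The minimizer over y of 2Re(ȳw) + κ|y - (σ/2)β|².
  set y : ℂ := -om / κ + (σ / 2 : ℂ) * β with hy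
  have hvn : Tendsto (fun n => v + ((s n : ℂ) * y) • N) atTop (𝓝 v) := by
    have h1 := ((((Complex.continuous_ofReal.tendsto _).comp hsl).mul_const y).smul_const N).const_add v
    simpa using h1
  have l1 : Tendsto (fun n => (s n)⁻¹ * hermQuad (fderiv ℝ (fderiv ℝ f) (q n)) v) atTop
      (𝓝 (-(σ / 2) * hermQuad (D N) v)) := by
    have := tendsto_hermQuad lH (tendsto_const_nhds (x := v))
    refine Tendsto.congr (fun n => ?_) (this.mono_right (le_of_eq (congrArg 𝓝 ?_)))
    · have h2 : hermQuad B v = 0 := hv0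
      simp only [hermQuad, smul_apply, sub_apply, smul_eq_mul] at h2 ⊢
      linear_combination (-(s n)⁻¹) * h2
    · rw [map_smul]
      simp only [hermQuad, smul_apply, smul_eq_mul]
      ring
  have l2 : Tendsto (fun n => (s n : ℂ)⁻¹ * holPart (fderiv ℝ f (q n)) v) atTop
      (𝓝 (-(σ / 2 : ℂ) * β)) := by
    have := tendsto_holPart lD (tendsto_const_nhds (x := v))
    refine Tendsto.congr (fun n => ?_) (this.mono_right (le_of_eq (congrArg 𝓝 ?_)))
    · have h2 : holPart (fderiv ℝ f p) v = 0 := hv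
      simp only [holPart, smul_apply, sub_apply, smul_eq_mul] at h2 ⊢
      push_cast
      linear_combination (-(s n : ℂ)⁻¹) * h2
    · rw [map_smul, hβ]
      simp only [holPart, smul_apply, smul_eq_mul]
      push_cast
      ring
  have l3 : Tendsto (fun n => (s n : ℂ)⁻¹ * holPart (fderiv ℝ f (q n)) v + y * c n) atTop
      (𝓝 (-om / κ)) := by
    refine (l2.add (cl.const_mul y)).mono_right (le_of_eq (congrArg 𝓝 ?_))
    rw [hy]; ring
  have lw : Tendsto (fun n => hermForm (fderiv ℝ (fderiv ℝ f) (q n)) v N) atTop (𝓝 om) :=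
    tendsto_hermForm lHq tendsto_const_nhds tendsto_const_nhds
  have lh : Tendsto (fun n => hermQuad (fderiv ℝ (fderiv ℝ f) (q n)) N) atTop (𝓝 (hermQuad B N)) :=
    tendsto_hermQuad lHq tendsto_const_nhds
  have lR := ((l1.add (((Complex.continuous_re.tendsto _).comp
      (lw.const_mul ((starRingEnd ℂ) y))).const_mul 2)).add
      ((hsl.mul_const (‖y‖ ^ 2)).mul lh)).add
      ((((hτ.inv₀ one_ne_zero).const_mul κ).mul (l3.norm.pow 2)))
  have lL := hτ.mul ((hvn.norm.pow 2).const_mul ε)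
  have hfin := le_of_tendsto_of_tendsto lL lR ?_
  · rw [one_mul, inv_one, mul_one, zero_mul, zero_mul, add_zero,
      weak_limit_identity hκ] at hfin
    exact hfin
  · filter_upwards [hweak', htpos, hsymm] with n hn ht hsm
    have h2 := hn ht (v + ((s n : ℂ) * y) • N)
    rw [hermQuad_add_smul (fun v w => ContDiffAt.fderiv_fderiv_symm hsm v w), holPart_add,
      holPart_smul] at h2
    have hsn := hspos n
    have h3 : holPart (fderiv ℝ f (q n)) v + (s n : ℂ) * y * holPart (fderiv ℝ f (q n)) N =
        s n * ((s n : ℂ)⁻¹ * holPart (fderiv ℝ f (q n)) v + y * c n) := by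
      have : (s n : ℂ) ≠ 0 := by exact_mod_cast hsn.ne'
      rw [hc]
      field_simp
    have h4 : ((starRingEnd ℂ) ((s n : ℂ) * y) * hermForm (fderiv ℝ (fderiv ℝ f) (q n)) v N).re =
        s n * ((starRingEnd ℂ) y * hermForm (fderiv ℝ (fderiv ℝ f) (q n)) v N).re := by
      rw [map_mul, Complex.conj_ofReal, mul_assoc, Complex.re_ofReal_mul]
    rw [h3, h4, norm_mul, norm_mul, mul_pow, mul_pow, Complex.norm_real, Real.norm_eq_abs,
      sq_abs] at h2
    simp only [Function.comp_apply]
    have h5 := mul_le_mul_of_nonneg_left h2 (inv_pos.2 hsn).le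
    convert h5 using 1
    · ring
    · field_simp

theorem hasDerivAt_comp_of_eq {F : Type*} [NormedAddCommGroup F] [NormedSpace ℝ F] {G : E → F}
    {G' : E →L[ℝ] F} {p τ : E} {j : ℝ → E} {t : ℝ} (hG : HasFDerivAt G G' p)
    (hj : HasDerivAt j τ t) (hp : j t = p) : HasDerivAt (fun t => G (j t)) (G' τ) t :=
  hG.comp_hasDerivAt_of_eq t hj hp.symm

theorem HasDerivAt.holPart {φ : ℝ → E →L[ℝ] ℝ} {φ' : E →L[ℝ] ℝ} {t : ℝ} (h : HasDerivAt φ φ' t)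
    (v : E) : HasDerivAt (fun t => holPart (φ t) v) (holPart φ' v) t := by
  have h1 := (h.clm_apply (hasDerivAt_const t v)).ofReal_comp
  have h2 := (h.clm_apply (hasDerivAt_const t (Complex.I • v))).ofReal_comp
  simp only [map_zero, add_zero] at h1 h2
  exact (h1.sub (h2.const_mul Complex.I)).div_const 2

theorem HasDerivAt.bilin {φ : ℝ → E →L[ℝ] E →L[ℝ] ℝ} {φ' : E →L[ℝ] E →L[ℝ] ℝ} {t : ℝ}
    (h : HasDerivAt φ φ' t) (v w : E) : HasDerivAt (fun t => φ t v w) (φ' v w) t := by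
  have h1 := (h.clm_apply (hasDerivAt_const t v)).clm_apply (hasDerivAt_const t w)
  simpa using h1

theorem HasDerivAt.hermQuad {φ : ℝ → E →L[ℝ] E →L[ℝ] ℝ} {φ' : E →L[ℝ] E →L[ℝ] ℝ} {t : ℝ}
    (h : HasDerivAt φ φ' t) (v : E) :
    HasDerivAt (fun t => hermQuad (φ t) v) (hermQuad φ' v) t :=
  ((HasDerivAt.bilin h v v).add (HasDerivAt.bilin h _ _)).div_const 4

theorem HasDerivAt.hermForm {φ : ℝ → E →L[ℝ] E →L[ℝ] ℝ} {φ' : E →L[ℝ] E →L[ℝ] ℝ} {t : ℝ}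
    (h : HasDerivAt φ φ' t) (v w : E) :
    HasDerivAt (fun t => hermForm (φ t) v w) (hermForm φ' v w) t :=
  ((((HasDerivAt.bilin h v w).add (HasDerivAt.bilin h _ _)).ofReal_comp).add
    ((((HasDerivAt.bilin h v _).sub (HasDerivAt.bilin h _ w)).ofReal_comp).const_mul
      Complex.I)).div_const 4

/-- The tangential derivative of the Levi form at a null vector vanishes. -/
theorem tangential_term_eq_zero {f : E → ℝ} {p : E} (hf : ContDiffAt ℝ 3 f p) {N : E}
    (hN : holPart (fderiv ℝ f p) N = 1)
    (hlevi : ∀ᶠ q in 𝓝 p, f q = 0 → ∀ v, holPart (fderiv ℝ f q) v = 0 →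
      0 ≤ hermQuad (fderiv ℝ (fderiv ℝ f) q) v)
    {j : ℝ → E} {τ : E} (hj : HasDerivAt j τ 0) (hj0 : j 0 = p) (hjf : ∀ᶠ t in 𝓝 0, f (j t) = 0)
    {v : E} (hv : holPart (fderiv ℝ f p) v = 0) (hv0 : hermQuad (fderiv ℝ (fderiv ℝ f) p) v = 0) :
    normalTerm (fderiv ℝ (fderiv ℝ f) p) (fderiv ℝ (fderiv ℝ (fderiv ℝ f)) p) (N + τ) v =
      normalTerm (fderiv ℝ (fderiv ℝ f) p) (fderiv ℝ (fderiv ℝ (fderiv ℝ f)) p) N v +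
      ((starRingEnd ℂ) (holPart (fderiv ℝ (fderiv ℝ f) p (N + τ)) v) *
        hermForm (fderiv ℝ (fderiv ℝ f) p) v τ).re := by
  obtain ⟨jf, jD, jH⟩ := ContDiffAt.jets hf
  set B := fderiv ℝ (fderiv ℝ f) p with hB
  set D := fderiv ℝ (fderiv ℝ (fderiv ℝ f)) p with hD
  have dD : HasDerivAt (fun t => fderiv ℝ f (j t)) (B τ) 0 :=
    hasDerivAt_comp_of_eq jD.hasFDerivAt hj hj0
  have dH : HasDerivAt (fun t => fderiv ℝ (fderiv ℝ f) (j t)) (D τ) 0 :=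
    hasDerivAt_comp_of_eq (F := E →L[ℝ] E →L[ℝ] ℝ) (G := fderiv ℝ (fderiv ℝ f)) (G' := D)
      (HasStrictFDerivAt.hasFDerivAt (F := E →L[ℝ] E →L[ℝ] ℝ) jH) hj hj0
  have da := HasDerivAt.holPart dD v
  have dc := HasDerivAt.holPart dD N
  have hc0 : holPart (fderiv ℝ f (j 0)) N = 1 := by rw [hj0, hN]
  have ha0 : holPart (fderiv ℝ f (j 0)) v = 0 := by rw [hj0, hv]
  have du := (da.div dc (by rw [hc0]; exact one_ne_zero)).neg
  have dw := HasDerivAt.hermForm dH v N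
  have dg := ((HasDerivAt.hermQuad dH v).add
    (((Complex.reCLM.hasFDerivAt.comp_hasDerivAt 0 (du.star.mul dw)).const_mul 2))).add
    (((du.norm_sq)).mul (HasDerivAt.hermQuad dH N))
  -- Along a curve in the zero set, v is corrected by a multiple of `N` to stay complex tangent. The
  -- Levi form of the corrected vector is nonnegative and vanishes at time 0, so its derivative
  -- there is zero.
  have hmin : IsLocalMin (fun t => hermQuad (fderiv ℝ (fderiv ℝ f) (j t))
      (v + (-(holPart (fderiv ℝ f (j t)) v / holPart (fderiv ℝ f (j t)) N)) • N)) 0 := by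
    have hjt : Tendsto j (𝓝 0) (𝓝 p) := by rw [← hj0]; exact hj.continuousAt.tendsto
    have hcne : ∀ᶠ t in 𝓝 (0 : ℝ), holPart (fderiv ℝ f (j t)) N ≠ 0 :=
      dc.continuousAt.eventually_ne (by rw [hc0]; exact one_ne_zero)
    filter_upwards [hjf, hjt.eventually hlevi, hcne] with t h1 h2 h3
    rw [ha0, hj0, hN]
    simp only [zero_div, neg_zero, zero_smul, add_zero]
    rw [hv0]
    refine h2 h1 _ ?_
    rw [holPart_add, holPart_smul]
    field_simp
    ring
  have hexp : (fun t => hermQuad (fderiv ℝ (fderiv ℝ f) (j t))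
      (v + (-(holPart (fderiv ℝ f (j t)) v / holPart (fderiv ℝ f (j t)) N)) • N)) =ᶠ[𝓝 0]
      fun t => hermQuad (fderiv ℝ (fderiv ℝ f) (j t)) v +
        2 * ((starRingEnd ℂ) (-(holPart (fderiv ℝ f (j t)) v / holPart (fderiv ℝ f (j t)) N)) *
          hermForm (fderiv ℝ (fderiv ℝ f) (j t)) v N).re +
        ‖-(holPart (fderiv ℝ f (j t)) v / holPart (fderiv ℝ f (j t)) N)‖ ^ 2 *
          hermQuad (fderiv ℝ (fderiv ℝ f) (j t)) N := by
    have hjt : Tendsto j (𝓝 0) (𝓝 p) := by rw [← hj0]; exact hj.continuousAt.tendsto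
    filter_upwards [hjt.eventually (hf.eventually (by simp))] with t ht
    exact hermQuad_add_smul (fun v w => ContDiffAt.fderiv_fderiv_symm ht v w) _ v N
  -- The resulting relation is (D_τ H)(v) = 2Re(conj(∂(D_τ f)(v))·H(v,N)): the third-order
  -- tangential term is determined by the 2-jet.
  have hzero := (hmin.congr hexp).hasDerivAt_eq_zero dg
  simp [hj0, hv, hN] at hzero
  simp only [normalTerm, hermForm_add_right, map_add]
  have e1 : holPart (B N + B τ) v = holPart (B N) v + holPart (B τ) v := by
    simp only [holPart, add_apply]; push_cast; ring
  have e2 : hermQuad (D N + D τ) v = hermQuad (D N) v + hermQuad (D τ) v := by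
    simp only [hermQuad, add_apply]; ring
  rw [e1, e2]
  simp only [map_add, add_mul, mul_add, Complex.add_re, Complex.mul_re, Complex.conj_re,
    Complex.conj_im] at hzero ⊢
  linarith

/-- For complex tangent τ the vanishing of H(v,τ), which follows from v being null, removes both the
change of w and the remaining term of `tangential_term_eq_zero`. -/
theorem boundaryForm_congr_normal {f : E → ℝ} {p : E} (hf : ContDiffAt ℝ 3 f p) (hp : f p = 0)
    {N : E} (hN : holPart (fderiv ℝ f p) N = 1)
    (hlevi : ∀ᶠ q in 𝓝 p, f q = 0 → ∀ v, holPart (fderiv ℝ f q) v = 0 →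
      0 ≤ hermQuad (fderiv ℝ (fderiv ℝ f) q) v)
    {j : ℝ → E} {τ : E} (hj : HasDerivAt j τ 0) (hj0 : j 0 = p) (hjf : ∀ᶠ t in 𝓝 0, f (j t) = 0)
    {v : E} (hv : holPart (fderiv ℝ f p) v = 0) (hv0 : hermQuad (fderiv ℝ (fderiv ℝ f) p) v = 0)
    (hτ : holPart (fderiv ℝ f p) τ = 0) (σ κ : ℝ) :
    boundaryForm (fderiv ℝ (fderiv ℝ f) p) (fderiv ℝ (fderiv ℝ (fderiv ℝ f)) p) σ κ (N + τ) v =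
      boundaryForm (fderiv ℝ (fderiv ℝ f) p) (fderiv ℝ (fderiv ℝ (fderiv ℝ f)) p) σ κ N v := by
  have h0 := hermForm_eq_zero_of_null (fun v w => ContDiffAt.fderiv_fderiv_symm hf v w)
    (hlevi.self_of_nhds hp) hv hτ hv0
  rw [boundaryForm, boundaryForm, tangential_term_eq_zero hf hN hlevi hj hj0 hjf hv hv0,
    hermForm_add_right, h0]
  simp

end Flat

/-! ### Jets of exp(F)f, and Hessians of powers and logarithms of f. -/

section Flat

open Filter

variable {E : Type*} [NormedAddCommGroup E] [NormedSpace ℂ E] [NormedSpace ℝ E]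
  [IsScalarTower ℝ ℂ E]

theorem ContDiffAt.eventually_jets {f : E → ℝ} {p : E} (hf : ContDiffAt ℝ 3 f p) :
    ∀ᶠ q in 𝓝 p, HasFDerivAt f (fderiv ℝ f q) q ∧
      HasFDerivAt (fderiv ℝ f) (fderiv ℝ (fderiv ℝ f) q) q ∧
      HasFDerivAt (fderiv ℝ (fderiv ℝ f)) (fderiv ℝ (fderiv ℝ (fderiv ℝ f)) q) q := by
  filter_upwards [hf.eventually (by simp)] with q hq
  obtain ⟨h1, h2, h3⟩ := ContDiffAt.jets hq
  exact ⟨h1.hasFDerivAt, h2.hasFDerivAt, h3.hasFDerivAt⟩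

theorem hasFDerivAt_apply_const {F : Type*} [NormedAddCommGroup F] [NormedSpace ℝ F]
    {G : E → E →L[ℝ] F} {G' : E →L[ℝ] E →L[ℝ] F} {q : E} (hG : HasFDerivAt G G' q) (w : E) :
    HasFDerivAt (fun x => G x w) ((ContinuousLinearMap.apply ℝ F w).comp G') q :=
  (ContinuousLinearMap.apply ℝ F w).hasFDerivAt.comp q hG

theorem hasFDerivAt_apply_const₂
    {G : E → E →L[ℝ] E →L[ℝ] ℝ} {G' : E →L[ℝ] E →L[ℝ] E →L[ℝ] ℝ} {q : E}
    (hG : HasFDerivAt G G' q) (v w : E) :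
    HasFDerivAt (fun x => G x v w) ((ContinuousLinearMap.apply ℝ ℝ w).comp
      ((ContinuousLinearMap.apply ℝ (E →L[ℝ] ℝ) v).comp G')) q :=
  hasFDerivAt_apply_const (hasFDerivAt_apply_const hG v) w

/-- The jets of `exp F * f`. -/
theorem exp_mul_jets {f F : E → ℝ} {p : E} (hf : ContDiffAt ℝ 3 f p) (hF : ContDiffAt ℝ 3 F p)
    (hp : f p = 0) :
    fderiv ℝ (fun x => Real.exp (F x) * f x) p = Real.exp (F p) • fderiv ℝ f p ∧
    (∀ v w, fderiv ℝ (fderiv ℝ (fun x => Real.exp (F x) * f x)) p v w = Real.exp (F p) *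
      (fderiv ℝ (fderiv ℝ f) p v w + fderiv ℝ F p v * fderiv ℝ f p w +
        fderiv ℝ f p v * fderiv ℝ F p w)) ∧
    (∀ u v w, fderiv ℝ (fderiv ℝ (fderiv ℝ (fun x => Real.exp (F x) * f x))) p u v w =
      Real.exp (F p) * (fderiv ℝ F p u * (fderiv ℝ (fderiv ℝ f) p v w +
          fderiv ℝ F p v * fderiv ℝ f p w + fderiv ℝ f p v * fderiv ℝ F p w) +
        (fderiv ℝ (fderiv ℝ (fderiv ℝ f)) p u v w +
        fderiv ℝ (fderiv ℝ F) p u v * fderiv ℝ f p w +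
        fderiv ℝ F p v * fderiv ℝ (fderiv ℝ f) p u w +
        fderiv ℝ (fderiv ℝ f) p u v * fderiv ℝ F p w +
        fderiv ℝ f p v * fderiv ℝ (fderiv ℝ F) p u w +
        fderiv ℝ f p u * (fderiv ℝ (fderiv ℝ F) p v w + fderiv ℝ F p v * fderiv ℝ F p w)))) := by
  have hg : ContDiffAt ℝ 3 (fun x => Real.exp (F x) * f x) p := hF.exp.mul hf
  have e1 : ∀ᶠ q in 𝓝 p, ∀ v, fderiv ℝ (fun x => Real.exp (F x) * f x) q v =
      Real.exp (F q) * (fderiv ℝ f q v + f q * fderiv ℝ F q v) := by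
    filter_upwards [ContDiffAt.eventually_jets hf, ContDiffAt.eventually_jets hF] with q h1 h2 v
    have h3 : HasFDerivAt (fun x => Real.exp (F x) * f x) _ q := h2.1.exp.mul h1.1
    rw [h3.fderiv]
    simp
    ring
  have e2 : ∀ᶠ q in 𝓝 p, ∀ v w, fderiv ℝ (fderiv ℝ (fun x => Real.exp (F x) * f x)) q v w =
      Real.exp (F q) * (fderiv ℝ (fderiv ℝ f) q v w + fderiv ℝ F q v * fderiv ℝ f q w +
        fderiv ℝ f q v * fderiv ℝ F q w +
        f q * (fderiv ℝ (fderiv ℝ F) q v w + fderiv ℝ F q v * fderiv ℝ F q w)) := by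
    filter_upwards [ContDiffAt.eventually_jets hf, ContDiffAt.eventually_jets hF,
      ContDiffAt.eventually_jets hg, e1.eventually_nhds] with q h1 h2 h3 h4 v w
    have h5 := (hasFDerivAt_apply_const h3.2.1 w).congr_of_eventuallyEq
      (h4.mono fun x hx => (hx w).symm)
    have h6 := h2.1.exp.mul ((hasFDerivAt_apply_const h1.2.1 w).add
      (h1.1.mul (hasFDerivAt_apply_const h2.2.1 w)))
    have h7 := congrArg (fun L : E →L[ℝ] ℝ => L v) (h5.unique h6)
    simp at h7
    rw [h7]
    ring
  refine ⟨?_, fun v w => ?_, fun u v w => ?_⟩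
  · ext v
    rw [e1.self_of_nhds v, hp]
    simp
  · rw [e2.self_of_nhds v w, hp]
    ring
  · have h1 := (ContDiffAt.eventually_jets hf).self_of_nhds
    have h2 := (ContDiffAt.eventually_jets hF).self_of_nhds
    have h3 := (ContDiffAt.eventually_jets hg).self_of_nhds
    have h5 := (hasFDerivAt_apply_const₂ h3.2.2 v w).congr_of_eventuallyEq
      (e2.mono fun x hx => (hx v w).symm)
    have h6 := h2.1.exp.mul ((((hasFDerivAt_apply_const₂ h1.2.2 v w).add
      ((hasFDerivAt_apply_const h2.2.1 v).mul (hasFDerivAt_apply_const h1.2.1 w))).add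
      ((hasFDerivAt_apply_const h1.2.1 v).mul (hasFDerivAt_apply_const h2.2.1 w))).add
      (h1.1.mul ((hasFDerivAt_apply_const₂ h2.2.2 v w).add
      ((hasFDerivAt_apply_const h2.2.1 v).mul (hasFDerivAt_apply_const h2.2.1 w)))))
    have h7 := congrArg (fun L : E →L[ℝ] ℝ => L u) (h5.unique h6)
    simp [hp] at h7
    rw [h7]
    ring

/-- The normal vector must be rescaled by exp(-F(p)) to keep ∂g(N') = 1. After this rescaling the
factor exp(F(p)) disappears from w and from the normal term, leaving additive changes that depend on
F only through ∂F(v) and its complex Hessian on v. -/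
theorem exp_mul_boundary_terms {f F : E → ℝ} {p : E} (hf : ContDiffAt ℝ 3 f p)
    (hF : ContDiffAt ℝ 3 F p) (hp : f p = 0) {N v : E} (hN : holPart (fderiv ℝ f p) N = 1)
    (hv : holPart (fderiv ℝ f p) v = 0) :
    let g := fun x => Real.exp (F x) * f x
    let N' := ((Real.exp (F p))⁻¹ : ℝ) • N
    holPart (fderiv ℝ g p) N' = 1 ∧ holPart (fderiv ℝ g p) v = 0 ∧
    hermQuad (fderiv ℝ (fderiv ℝ g) p) v = Real.exp (F p) * hermQuad (fderiv ℝ (fderiv ℝ f) p) v ∧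
    hermForm (fderiv ℝ (fderiv ℝ g) p) v N' =
      hermForm (fderiv ℝ (fderiv ℝ f) p) v N + holPart (fderiv ℝ F p) v ∧
    (hermQuad (fderiv ℝ (fderiv ℝ f) p) v = 0 →
      normalTerm (fderiv ℝ (fderiv ℝ g) p) (fderiv ℝ (fderiv ℝ (fderiv ℝ g)) p) N' v =
      normalTerm (fderiv ℝ (fderiv ℝ f) p) (fderiv ℝ (fderiv ℝ (fderiv ℝ f)) p) N v +
      2 * ((starRingEnd ℂ) (holPart (fderiv ℝ F p) v) *
        hermForm (fderiv ℝ (fderiv ℝ f) p) v N).re + ‖holPart (fderiv ℝ F p) v‖ ^ 2 -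
      hermQuad (fderiv ℝ (fderiv ℝ F) p) v) := by
  intro g N'
  obtain ⟨h1, h2, h3⟩ := exp_mul_jets hf hF hp
  have hu : Real.exp (F p) ≠ 0 := (Real.exp_pos _).ne'
  have hl := (holPart_eq_zero_iff _ _).1 hv
  have hN1 := fderiv_of_holPart_eq_one hN
  have hN2 : fderiv ℝ f p (Complex.I • N) = 0 := by
    have := holPart_im (fderiv ℝ f p) N
    rw [hN] at this
    simp at this
    linarith
  have hl1 := hl.1
  have hl2 := hl.2
  refine ⟨?_, ?_, ?_, ?_, fun h0 => ?_⟩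
  · rw [holPart, h1]
    simp [N', I_smul_real_smul, hN1, hN2, hu]
  · rw [holPart, h1]
    simp [hl1, hl2]
  · simp only [hermQuad, g, h2, hl1, hl2]
    ring
  · simp only [hermForm, N', g, h2, hl1, hl2, I_smul_real_smul, map_smul, smul_eq_mul, hN1, hN2,
      holPart]
    push_cast
    have : Complex.exp (F p : ℂ) ≠ 0 := Complex.exp_ne_zero _
    field_simp
    ring
  · have h0' : fderiv ℝ (fderiv ℝ f) p v v +
        fderiv ℝ (fderiv ℝ f) p (Complex.I • v) (Complex.I • v) = 0 := by
      simp only [hermQuad] at h0; linarith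
    have hc : holPart (fderiv ℝ (fderiv ℝ g) p N') v =
        holPart (fderiv ℝ (fderiv ℝ f) p N) v + 2 * holPart (fderiv ℝ F p) v := by
      simp only [holPart, N', g, map_smul, smul_apply, smul_eq_mul, h2, hl1, hl2, hN1]
      push_cast
      have : Complex.exp (F p : ℂ) ≠ 0 := Complex.exp_ne_zero _
      field_simp
      ring
    have hw : hermForm (fderiv ℝ (fderiv ℝ g) p) v N' =
        hermForm (fderiv ℝ (fderiv ℝ f) p) v N + holPart (fderiv ℝ F p) v := by
      simp only [hermForm, N', g, h2, hl1, hl2, I_smul_real_smul, map_smul, smul_eq_mul, hN1, hN2,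
        holPart]
      push_cast
      have : Complex.exp (F p : ℂ) ≠ 0 := Complex.exp_ne_zero _
      field_simp
      ring
    have hd : hermQuad (fderiv ℝ (fderiv ℝ (fderiv ℝ g)) p N') v =
        hermQuad (fderiv ℝ (fderiv ℝ (fderiv ℝ f)) p N) v +
        2 * ((starRingEnd ℂ) (holPart (fderiv ℝ F p) v) *
          holPart (fderiv ℝ (fderiv ℝ f) p N) v).re +
        2 * (hermQuad (fderiv ℝ (fderiv ℝ F) p) v + ‖holPart (fderiv ℝ F p) v‖ ^ 2) := by
      rw [normSq_holPart]
      simp only [hermQuad, N', g, map_smul, smul_apply, smul_eq_mul, h3, hl1, hl2, hN1,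
        Complex.mul_re, Complex.conj_re, Complex.conj_im, holPart_re, holPart_im]
      field_simp
      -- The derivative of F along `N` enters only as a multiple of H(v), which is zero.
      linear_combination 2 * (fderiv ℝ F p) N * h0'
    rw [normalTerm, normalTerm, hc, hw, hd]
    simp only [← Complex.normSq_eq_norm_sq, Complex.normSq_apply, map_add, map_mul, add_mul,
      mul_add, Complex.add_re, Complex.mul_re, Complex.conj_re, Complex.conj_im, Complex.mul_im,
      Complex.conj_ofNat, Complex.re_ofNat, Complex.im_ofNat]
    ring

/-- The hermitian form of the Hessian of `χ ∘ f`. -/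
theorem hermQuad_comp {f : E → ℝ} {q : E} (hf : ContDiffAt ℝ 3 f q) {χ χ' : ℝ → ℝ} {c : ℝ}
    (h1 : ∀ᶠ y in 𝓝 (f q), HasDerivAt χ (χ' y) y) (h2 : HasDerivAt χ' c (f q)) (v : E) :
    hermQuad (fderiv ℝ (fderiv ℝ (fun x => χ (f x))) q) v =
      χ' (f q) * hermQuad (fderiv ℝ (fderiv ℝ f) q) v + c * ‖holPart (fderiv ℝ f q) v‖ ^ 2 := by
  have e1 : fderiv ℝ (fun x => χ (f x)) =ᶠ[𝓝 q] fun x => χ' (f x) • fderiv ℝ f x := by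
    filter_upwards [ContDiffAt.eventually_jets hf, hf.continuousAt.eventually h1] with x hx hy
    exact (hy.comp_hasFDerivAt x hx.1).fderiv
  have hj := (ContDiffAt.eventually_jets hf).self_of_nhds
  have e2 : HasFDerivAt (fun x => χ' (f x) • fderiv ℝ f x) _ q :=
    (h2.comp_hasFDerivAt q hj.1).smul hj.2.1
  rw [normSq_holPart, e1.fderiv_eq, e2.fderiv]
  simp only [hermQuad, add_apply, smul_apply, ContinuousLinearMap.smulRight_apply, smul_eq_mul,
    Function.comp_apply]
  ring

/-- The factor -(1 * f q) is t = -σf with σ = 1, so that this formula, `hermQuad_rpow` with σ = -1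
and `hermQuad_neg_log` with κ = 1 all feed the same local analysis. -/
theorem hermQuad_neg_rpow {f : E → ℝ} {q : E} (hf : ContDiffAt ℝ 3 f q) (hq : f q < 0) (γ : ℝ)
    (v : E) :
    hermQuad (fderiv ℝ (fderiv ℝ (fun x => -(-f x) ^ γ)) q) v = γ * (-f q) ^ (γ - 1) *
      (hermQuad (fderiv ℝ (fderiv ℝ f) q) v +
        (1 - γ) / (-(1 * f q)) * ‖holPart (fderiv ℝ f q) v‖ ^ 2) := by
  have hd : ∀ γ : ℝ, ∀ y < 0, HasDerivAt (fun y : ℝ => (-y) ^ γ) (-(γ * (-y) ^ (γ - 1))) y := by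
    intro γ y hy
    have := (hasDerivAt_neg y).rpow_const (p := γ) (Or.inl (by linarith : -y ≠ 0))
    convert this using 1
    ring
  have h2 := ((hd (γ - 1) (f q) hq).const_mul γ)
  rw [hermQuad_comp hf (χ := fun y => -(-y) ^ γ) (χ' := fun y => γ * (-y) ^ (γ - 1))
    ?_ h2]
  · have : (-f q) ^ (γ - 1) = (-f q) ^ (γ - 1 - 1) * (-f q) := by
      rw [← Real.rpow_add_one (by linarith)]; ring_nf
    rw [this, one_mul]
    have : f q ≠ 0 := hq.ne
    field_simp
    ring
  · filter_upwards [gt_mem_nhds hq] with y hy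
    have h3 : HasDerivAt (fun y : ℝ => -(-y) ^ γ) _ y := (hd γ y hy).neg
    rwa [neg_neg] at h3

theorem hermQuad_rpow {f : E → ℝ} {q : E} (hf : ContDiffAt ℝ 3 f q) (hq : 0 < f q) (γ : ℝ)
    (v : E) :
    hermQuad (fderiv ℝ (fderiv ℝ (fun x => f x ^ γ)) q) v = γ * f q ^ (γ - 1) *
      (hermQuad (fderiv ℝ (fderiv ℝ f) q) v +
        (γ - 1) / (-(-1 * f q)) * ‖holPart (fderiv ℝ f q) v‖ ^ 2) := by
  have hd : ∀ γ : ℝ, ∀ y : ℝ, 0 < y → HasDerivAt (fun y : ℝ => y ^ γ) (γ * y ^ (γ - 1)) y :=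
    fun γ y hy => Real.hasDerivAt_rpow_const (Or.inl hy.ne')
  have h2 := ((hd (γ - 1) (f q) hq).const_mul γ)
  rw [hermQuad_comp hf (χ := fun y => y ^ γ) (χ' := fun y => γ * y ^ (γ - 1)) ?_ h2]
  · have : f q ^ (γ - 1) = f q ^ (γ - 1 - 1) * f q := by
      rw [← Real.rpow_add_one hq.ne']; ring_nf
    rw [this, neg_one_mul, neg_neg]
    field_simp
  · filter_upwards [lt_mem_nhds hq] with y hy
    exact hd γ y hy

theorem hermQuad_neg_log {f : E → ℝ} {q : E} (hf : ContDiffAt ℝ 3 f q) (hq : f q < 0) (v : E) :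
    hermQuad (fderiv ℝ (fderiv ℝ (fun x => -Real.log (-f x))) q) v = (-(1 * f q))⁻¹ *
      (hermQuad (fderiv ℝ (fderiv ℝ f) q) v +
        1 / (-(1 * f q)) * ‖holPart (fderiv ℝ f q) v‖ ^ 2) := by
  rw [hermQuad_comp hf (χ := fun y => -Real.log (-y)) (χ' := fun y => -y⁻¹) (c := (f q ^ 2)⁻¹)]
  · have : f q ≠ 0 := hq.ne
    field_simp
    ring
  · filter_upwards [gt_mem_nhds hq] with y hy
    have := ((hasDerivAt_neg y).log (by linarith : -y ≠ 0)).neg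
    refine this.congr_deriv ?_
    rw [inv_eq_one_div]
    ring_nf
  · exact (hasDerivAt_inv hq.ne).neg.congr_deriv (by ring)

end Flat

/-! ### Complex differentiable functions of several variables are smooth -/

section Holomorphic

open Filter Metric MeasureTheory

variable {E : Type*} [NormedAddCommGroup E] [NormedSpace ℂ E] [FiniteDimensional ℂ E]
  {F : Type*} [NormedAddCommGroup F] [NormedSpace ℂ F] [CompleteSpace F]

/-- Cauchy's formula for the derivative on the complex line through y in direction v. The
restriction r‖v‖ < R/2 makes one circle work for all y in the half ball, so regularity in y can be
read off under the integral sign. -/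
theorem fderiv_apply_eq_integral {f : E → F} {x₀ : E} {R : ℝ}
    (hf : DifferentiableOn ℂ f (ball x₀ R)) {v : E} {r : ℝ} (hr : 0 < r) (hrv : r * ‖v‖ < R / 2)
    {y : E} (hy : y ∈ ball x₀ (R / 2)) :
    fderiv ℂ f y v = (2 * Real.pi * Complex.I : ℂ)⁻¹ • ∫ θ in (0 : ℝ)..2 * Real.pi,
      (deriv (circleMap 0 r) θ * ((circleMap 0 r θ) ^ 2)⁻¹) • f (y + circleMap 0 r θ • v) := by
  have hcont : Continuous fun ζ : ℂ => y + ζ • v := by fun_prop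
  have hopen : IsOpen ((fun ζ : ℂ => y + ζ • v) ⁻¹' ball x₀ R) := isOpen_ball.preimage hcont
  have hsub : closedBall (0 : ℂ) r ⊆ (fun ζ : ℂ => y + ζ • v) ⁻¹' ball x₀ R := by
    intro ζ hζ
    rw [mem_closedBall_zero_iff] at hζ
    rw [Set.mem_preimage, mem_ball, dist_eq_norm]
    have h1 : y + ζ • v - x₀ = (y - x₀) + ζ • v := by abel
    rw [mem_ball, dist_eq_norm] at hy
    have h2 : ‖ζ • v‖ ≤ r * ‖v‖ := by
      rw [norm_smul]; exact mul_le_mul_of_nonneg_right hζ (norm_nonneg _)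
    rw [h1]
    linarith [norm_add_le (y - x₀) (ζ • v)]
  have hd : DifferentiableOn ℂ (fun ζ : ℂ => f (y + ζ • v))
      ((fun ζ : ℂ => y + ζ • v) ⁻¹' ball x₀ R) :=
    hf.comp (by fun_prop) (fun ζ hζ => hζ)
  have key := Complex.two_pi_I_inv_smul_circleIntegral_sub_sq_inv_smul_of_differentiable hopen hsub
    hd (mem_ball_self hr)
  have hyR : y ∈ ball x₀ R := by
    rw [mem_ball] at hy ⊢
    have : 0 ≤ r * ‖v‖ := by positivity
    linarith
  have hderiv : deriv (fun ζ : ℂ => f (y + ζ • v)) 0 = fderiv ℂ f y v := by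
    have h1 : HasFDerivAt f (fderiv ℂ f y) (y + (0 : ℂ) • v) := by
      rw [zero_smul, add_zero]
      exact (hf.differentiableAt (isOpen_ball.mem_nhds hyR)).hasFDerivAt
    have h2 : HasDerivAt (fun ζ : ℂ => y + ζ • v) ((1 : ℂ) • v) 0 :=
      ((hasDerivAt_id (0 : ℂ)).smul_const v).const_add y
    have := (h1.comp_hasDerivAt (0 : ℂ) h2).deriv
    rw [one_smul] at this
    exact this
  rw [← hderiv, ← key]
  simp only [circleIntegral, sub_zero, smul_smul]

theorem continuous_cauchyKernel {r : ℝ} (hr : 0 < r) :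
    Continuous fun θ : ℝ => deriv (circleMap 0 r) θ * ((circleMap 0 r θ) ^ 2)⁻¹ := by
  simp only [deriv_circleMap]
  refine ((continuous_circleMap 0 r).mul continuous_const).mul
    (((continuous_circleMap 0 r).pow 2).inv₀ fun θ => ?_)
  simp [hr.ne']

theorem add_circleMap_smul_mem {x₀ y v : E} {R r θ : ℝ} (hr : 0 < r) (hrv : r * ‖v‖ < R / 2)
    (hy : y ∈ ball x₀ (R / 2)) : y + circleMap 0 r θ • v ∈ ball x₀ R := by
  rw [mem_ball, dist_eq_norm] at hy ⊢
  have h1 : y + circleMap 0 r θ • v - x₀ = (y - x₀) + circleMap 0 r θ • v := by abel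
  have h2 : ‖circleMap 0 r θ • v‖ = r * ‖v‖ := by
    rw [norm_smul, norm_circleMap_zero, abs_of_pos hr]
  rw [h1]
  linarith [norm_add_le (y - x₀) (circleMap 0 r θ • v)]

theorem exists_radius (v : E) {R : ℝ} (hR : 0 < R) : ∃ r : ℝ, 0 < r ∧ r * ‖v‖ < R / 2 := by
  refine ⟨R / 2 / (‖v‖ + 1), by positivity, ?_⟩
  rw [div_mul_eq_mul_div, div_lt_iff₀ (by positivity)]
  nlinarith [norm_nonneg v]

/-- Dominated convergence in the Cauchy integral. Continuity of the derivative is obtained before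
its differentiability, because it supplies the dominating bound there. -/
theorem continuousOn_fderiv_of_differentiableOn {f : E → F} {U : Set E} (hU : IsOpen U)
    (hf : DifferentiableOn ℂ f U) : ContinuousOn (fderiv ℂ f) U := by
  intro x₀ hx₀
  refine ContinuousAt.continuousWithinAt ?_
  rw [continuousAt_clm_apply]
  intro v
  have hcf : ContinuousAt f x₀ := hf.continuousOn.continuousAt (hU.mem_nhds hx₀)
  obtain ⟨R₁, hR₁, hsub⟩ := Metric.isOpen_iff.1 hU x₀ hx₀
  obtain ⟨R₂, hR₂, hbd⟩ := Metric.eventually_nhds_iff.1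
    (hcf.norm.eventually (gt_mem_nhds (lt_add_one ‖f x₀‖)))
  set R := min R₁ R₂ with hRdef
  have hR : 0 < R := lt_min hR₁ hR₂
  have hfR : DifferentiableOn ℂ f (ball x₀ R) :=
    hf.mono ((ball_subset_ball (min_le_left _ _)).trans hsub)
  obtain ⟨r, hr, hrv⟩ := exists_radius v hR
  have hev := Filter.eventuallyEq_of_mem (ball_mem_nhds x₀ (half_pos hR))
    fun y hy => fderiv_apply_eq_integral hfR hr hrv hy
  refine ContinuousAt.congr ?_ hev.symm
  refine ContinuousAt.const_smul ?_ _
  refine intervalIntegral.continuousAt_of_dominated_interval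
    (bound := fun θ => ‖deriv (circleMap 0 r) θ * ((circleMap 0 r θ) ^ 2)⁻¹‖ * (‖f x₀‖ + 1))
    ?_ ?_ ?_ ?_
  · filter_upwards [ball_mem_nhds x₀ (half_pos hR)] with y hy
    refine Continuous.aestronglyMeasurable ((continuous_cauchyKernel hr).smul ?_)
    exact hfR.continuousOn.comp_continuous (by fun_prop)
      fun θ => add_circleMap_smul_mem hr hrv hy
  · filter_upwards [ball_mem_nhds x₀ (half_pos hR)] with y hy
    refine Eventually.of_forall fun θ _ => ?_
    rw [norm_smul]
    refine mul_le_mul_of_nonneg_left (le_of_lt ?_) (norm_nonneg _)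
    exact hbd ((mem_ball.1 (add_circleMap_smul_mem hr hrv hy)).trans_le (min_le_right _ _))
  · exact ((continuous_cauchyKernel hr).norm.mul continuous_const).intervalIntegrable _ _
  · refine Eventually.of_forall fun θ _ => ContinuousAt.const_smul ?_ _
    have h1 := hfR.continuousOn.continuousAt (isOpen_ball.mem_nhds
      (add_circleMap_smul_mem (θ := θ) hr hrv (mem_ball_self (half_pos hR))))
    exact ContinuousAt.comp (f := fun y => y + circleMap 0 r θ • v) h1 (by fun_prop)

/-- Differentiation under the Cauchy integral in each direction v; finite dimensionality then
reassembles the derivative from its values on a basis. -/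
theorem differentiableOn_fderiv_of_differentiableOn {f : E → F} {U : Set E} (hU : IsOpen U)
    (hf : DifferentiableOn ℂ f U) : DifferentiableOn ℂ (fderiv ℂ f) U := by
  have hcD := continuousOn_fderiv_of_differentiableOn hU hf
  have hv : ∀ v, DifferentiableOn ℂ (fun y => fderiv ℂ f y v) U := by
    intro v x₀ hx₀
    refine DifferentiableAt.differentiableWithinAt ?_
    have hcf : ContinuousAt (fderiv ℂ f) x₀ := hcD.continuousAt (hU.mem_nhds hx₀)
    obtain ⟨R₁, hR₁, hsub⟩ := Metric.isOpen_iff.1 hU x₀ hx₀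
    obtain ⟨R₂, hR₂, hbd⟩ := Metric.eventually_nhds_iff.1
      (hcf.norm.eventually (gt_mem_nhds (lt_add_one ‖fderiv ℂ f x₀‖)))
    set R := min R₁ R₂ with hRdef
    have hR : 0 < R := lt_min hR₁ hR₂
    have hsubR : ball x₀ R ⊆ U := (ball_subset_ball (min_le_left _ _)).trans hsub
    have hfR : DifferentiableOn ℂ f (ball x₀ R) := hf.mono hsubR
    obtain ⟨r, hr, hrv⟩ := exists_radius v hR
    have hev := Filter.eventuallyEq_of_mem (ball_mem_nhds x₀ (half_pos hR))
      fun y hy => fderiv_apply_eq_integral hfR hr hrv hy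
    refine DifferentiableAt.congr_of_eventuallyEq ?_ hev
    refine DifferentiableAt.const_smul ?_ _
    refine HasFDerivAt.differentiableAt
      (intervalIntegral.hasFDerivAt_integral_of_dominated_of_fderiv_le
      (F' := fun y θ => (deriv (circleMap 0 r) θ * ((circleMap 0 r θ) ^ 2)⁻¹) •
        fderiv ℂ f (y + circleMap 0 r θ • v))
      (bound := fun θ => ‖deriv (circleMap 0 r) θ * ((circleMap 0 r θ) ^ 2)⁻¹‖ *
        (‖fderiv ℂ f x₀‖ + 1)) (ball_mem_nhds x₀ (half_pos hR)) ?_ ?_ ?_ ?_ ?_ ?_)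
    · filter_upwards [ball_mem_nhds x₀ (half_pos hR)] with y hy
      refine Continuous.aestronglyMeasurable ((continuous_cauchyKernel hr).smul ?_)
      exact hfR.continuousOn.comp_continuous (by fun_prop)
        fun θ => add_circleMap_smul_mem hr hrv hy
    · refine Continuous.intervalIntegrable ((continuous_cauchyKernel hr).smul ?_) _ _
      exact hfR.continuousOn.comp_continuous (by fun_prop)
        fun θ => add_circleMap_smul_mem hr hrv (mem_ball_self (half_pos hR))
    · refine Continuous.aestronglyMeasurable ((continuous_cauchyKernel hr).smul ?_)
      exact (hcD.mono hsubR).comp_continuous (by fun_prop)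
        fun θ => add_circleMap_smul_mem hr hrv (mem_ball_self (half_pos hR))
    · refine Eventually.of_forall fun θ _ y hy => ?_
      rw [norm_smul]
      refine mul_le_mul_of_nonneg_left (le_of_lt ?_) (norm_nonneg _)
      exact hbd ((mem_ball.1 (add_circleMap_smul_mem hr hrv hy)).trans_le (min_le_right _ _))
    · exact ((continuous_cauchyKernel hr).norm.mul continuous_const).intervalIntegrable _ _
    · refine Eventually.of_forall fun θ _ y hy => HasFDerivAt.const_smul ?_ _
      have h1 := (hfR.differentiableAt (isOpen_ball.mem_nhds
        (add_circleMap_smul_mem (θ := θ) hr hrv hy))).hasFDerivAt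
      have h2 : HasFDerivAt (fun y => y + circleMap 0 r θ • v) (ContinuousLinearMap.id ℂ E) y :=
        (hasFDerivAt_id y).add_const _
      exact h1.comp y h2
  let b := Module.finBasis ℂ E
  have hrep : ∀ L : E →L[ℂ] F, L = ∑ i, ContinuousLinearMap.smulRightL ℂ E F
      (LinearMap.toContinuousLinearMap (b.coord i)) (L (b i)) := by
    intro L
    ext x
    rw [ContinuousLinearMap.sum_apply]
    conv_lhs => rw [← b.sum_repr x, map_sum]
    refine Finset.sum_congr rfl fun i _ => ?_
    rw [map_smul]
    rfl
  have heq : fderiv ℂ f = fun y => ∑ i, ContinuousLinearMap.smulRightL ℂ E F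
      (LinearMap.toContinuousLinearMap (b.coord i)) (fderiv ℂ f y (b i)) :=
    funext fun y => hrep _
  rw [heq]
  exact DifferentiableOn.fun_sum fun i _ =>
    (ContinuousLinearMap.differentiable _).comp_differentiableOn (hv (b i))

/-- Each step of the induction replaces the target `G` by `E →L[ℂ] G`, so the target is quantified
inside the induction and shares the universe of `E`. -/
theorem contDiffOn_of_differentiableOn.{u} {E : Type u} [NormedAddCommGroup E] [NormedSpace ℂ E]
    [FiniteDimensional ℂ E] {U : Set E} (hU : IsOpen U) (n : ℕ) :
    ∀ {G : Type u} [NormedAddCommGroup G] [NormedSpace ℂ G] [CompleteSpace G] {f : E → G},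
      DifferentiableOn ℂ f U → ContDiffOn ℂ n f U := by
  induction n with
  | zero =>
    intro G _ _ _ f hf
    exact contDiffOn_zero.2 hf.continuousOn
  | succ n ih =>
    intro G _ _ _ f hf
    push_cast
    rw [contDiffOn_succ_iff_fderiv_of_isOpen hU]
    exact ⟨hf, by simp, ih (differentiableOn_fderiv_of_differentiableOn hU hf)⟩

theorem contDiffOn_infty_of_differentiableOn {U : Set E} (hU : IsOpen U) {f : E → E}
    (hf : DifferentiableOn ℂ f U) : ContDiffOn ℂ ∞ f U := by
  rw [contDiffOn_infty]
  exact fun n => haveI : CompleteSpace E := FiniteDimensional.complete ℂ E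
    contDiffOn_of_differentiableOn hU n hf

end Holomorphic

/-! ### Holomorphic changes of coordinates -/

section CoordinateChange

open Filter

variable {E : Type*} [NormedAddCommGroup E] [NormedSpace ℂ E] [NormedSpace ℝ E]
  [IsScalarTower ℝ ℂ E]

theorem contDiffAt_three_jets {F : Type*} [NormedAddCommGroup F] [NormedSpace ℝ F] {f : E → F}
    {p : E} (hf : ContDiffAt ℝ 3 f p) :
    ∀ᶠ q in 𝓝 p, HasFDerivAt f (fderiv ℝ f q) q ∧
      HasFDerivAt (fderiv ℝ f) (fderiv ℝ (fderiv ℝ f) q) q ∧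
      HasFDerivAt (fderiv ℝ (fderiv ℝ f)) (fderiv ℝ (fderiv ℝ (fderiv ℝ f)) q) q := by
  filter_upwards [hf.eventually (by simp)] with q hf
  have h1 : ContDiffAt ℝ 2 (fderiv ℝ f) q := hf.fderiv_right (by norm_num)
  have h2 : ContDiffAt ℝ 1 (fderiv ℝ (fderiv ℝ f)) q := h1.fderiv_right (by norm_num)
  exact ⟨(hf.differentiableAt (by norm_num)).hasFDerivAt,
    (h1.differentiableAt (by norm_num)).hasFDerivAt,
    (h2.differentiableAt (by norm_num)).hasFDerivAt⟩

theorem comp_jets {f : E → ℝ} {τ : E → E} {z : E} (hf : ContDiffAt ℝ 3 f (τ z))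
    (hτ : ContDiffAt ℝ 3 τ z) :
    (∀ v, fderiv ℝ (f ∘ τ) z v = fderiv ℝ f (τ z) (fderiv ℝ τ z v)) ∧
    (∀ v w, fderiv ℝ (fderiv ℝ (f ∘ τ)) z v w =
      fderiv ℝ (fderiv ℝ f) (τ z) (fderiv ℝ τ z v) (fderiv ℝ τ z w) +
        fderiv ℝ f (τ z) (fderiv ℝ (fderiv ℝ τ) z v w)) ∧
    (∀ u v w, fderiv ℝ (fderiv ℝ (fderiv ℝ (f ∘ τ))) z u v w =
      fderiv ℝ (fderiv ℝ (fderiv ℝ f)) (τ z) (fderiv ℝ τ z u) (fderiv ℝ τ z v) (fderiv ℝ τ z w) +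
      fderiv ℝ (fderiv ℝ f) (τ z) (fderiv ℝ (fderiv ℝ τ) z u v) (fderiv ℝ τ z w) +
      fderiv ℝ (fderiv ℝ f) (τ z) (fderiv ℝ τ z v) (fderiv ℝ (fderiv ℝ τ) z u w) +
      fderiv ℝ (fderiv ℝ f) (τ z) (fderiv ℝ τ z u) (fderiv ℝ (fderiv ℝ τ) z v w) +
      fderiv ℝ f (τ z) (fderiv ℝ (fderiv ℝ (fderiv ℝ τ)) z u v w)) := by
  have hg : ContDiffAt ℝ 3 (f ∘ τ) z := hf.comp z hτ
  have jf := hτ.continuousAt.eventually (contDiffAt_three_jets hf)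
  have jτ := contDiffAt_three_jets hτ
  have jg := contDiffAt_three_jets hg
  have e1 : ∀ᶠ x in 𝓝 z, ∀ v, fderiv ℝ (f ∘ τ) x v = fderiv ℝ f (τ x) (fderiv ℝ τ x v) := by
    filter_upwards [jf, jτ] with x h1 h2 v
    rw [(h1.1.comp x h2.1).fderiv]
    rfl
  have e2 : ∀ᶠ x in 𝓝 z, ∀ v w, fderiv ℝ (fderiv ℝ (f ∘ τ)) x v w =
      fderiv ℝ (fderiv ℝ f) (τ x) (fderiv ℝ τ x v) (fderiv ℝ τ x w) +
        fderiv ℝ f (τ x) (fderiv ℝ (fderiv ℝ τ) x v w) := by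
    filter_upwards [jf, jτ, jg, e1.eventually_nhds] with x h1 h2 h3 h4 v w
    have h5 := (hasFDerivAt_apply_const h3.2.1 w).congr_of_eventuallyEq
      (h4.mono fun x hx => (hx w).symm)
    have h6 := (h1.2.1.comp x h2.1).clm_apply (hasFDerivAt_apply_const h2.2.1 w)
    have h7 := congrArg (fun L : E →L[ℝ] ℝ => L v) (h5.unique h6)
    simp at h7
    rw [h7]
    ring
  refine ⟨e1.self_of_nhds, e2.self_of_nhds, fun u v w => ?_⟩
  have h1 := jf.self_of_nhds
  have h2 := jτ.self_of_nhds
  have h3 := jg.self_of_nhds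
  have h5 := (hasFDerivAt_apply_const₂ h3.2.2 v w).congr_of_eventuallyEq
    (e2.mono fun x hx => (hx v w).symm)
  have h2vw : HasFDerivAt (fun x => fderiv ℝ (fderiv ℝ τ) x v w) _ z :=
    hasFDerivAt_apply_const (hasFDerivAt_apply_const h2.2.2 v) w
  have h6 := (((h1.2.2.comp z h2.1).clm_apply (hasFDerivAt_apply_const h2.2.1 v)).clm_apply
    (hasFDerivAt_apply_const h2.2.1 w)).add ((h1.2.1.comp z h2.1).clm_apply h2vw)
  have h7 := congrArg (fun L : E →L[ℝ] ℝ => L u) (h5.unique h6)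
  simp at h7
  rw [h7]
  ring

/-- Complex linearity of the first derivative near z may be differentiated, and symmetry of the
second derivative transfers it to the other slot. The second derivative is therefore complex
bilinear, and the pure second-order terms cancel in hermitian parts. -/
theorem holomorphic_jets {τ : E → E} {z : E} (hτ : ContDiffAt ℝ 3 τ z)
    (hJ : ∀ᶠ x in 𝓝 z, ∀ v, fderiv ℝ τ x (Complex.I • v) = Complex.I • fderiv ℝ τ x v) :
    (∀ v w, fderiv ℝ (fderiv ℝ τ) z v (Complex.I • w) = Complex.I • fderiv ℝ (fderiv ℝ τ) z v w) ∧
    (∀ v w, fderiv ℝ (fderiv ℝ τ) z (Complex.I • v) w =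
      Complex.I • fderiv ℝ (fderiv ℝ τ) z v w) ∧
    (∀ u v, fderiv ℝ (fderiv ℝ (fderiv ℝ τ)) z u (Complex.I • v) (Complex.I • v) =
      -fderiv ℝ (fderiv ℝ (fderiv ℝ τ)) z u v v) := by
  have jτ := contDiffAt_three_jets hτ
  let L : E →L[ℝ] E := Complex.I • ContinuousLinearMap.id ℝ E
  have hL : ∀ v, L v = Complex.I • v := fun v => rfl
  have e1 : ∀ᶠ x in 𝓝 z, ∀ v w, fderiv ℝ (fderiv ℝ τ) x v (Complex.I • w) =
      Complex.I • fderiv ℝ (fderiv ℝ τ) x v w := by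
    filter_upwards [jτ, hJ.eventually_nhds] with x h1 h2 v w
    have h3 := (hasFDerivAt_apply_const h1.2.1 (Complex.I • w)).congr_of_eventuallyEq
      (h2.mono fun y hy => (hy w).symm)
    have h4 := L.hasFDerivAt.comp x (hasFDerivAt_apply_const h1.2.1 w)
    exact congrArg (fun T : E →L[ℝ] E => T v) (h3.unique h4)
  have e2 : ∀ᶠ x in 𝓝 z, ∀ v w, fderiv ℝ (fderiv ℝ τ) x (Complex.I • v) w =
      Complex.I • fderiv ℝ (fderiv ℝ τ) x v w := by
    filter_upwards [e1, hτ.eventually (by simp)] with x h1 h2 v w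
    have hs : ∀ v w, fderiv ℝ (fderiv ℝ τ) x v w = fderiv ℝ (fderiv ℝ τ) x w v :=
      fun v w => (h2.isSymmSndFDerivAt (by simp; norm_num)).eq v w
    rw [hs, h1, hs]
  refine ⟨e1.self_of_nhds, e2.self_of_nhds, fun u v => ?_⟩
  have e3 : ∀ᶠ x in 𝓝 z, -fderiv ℝ (fderiv ℝ τ) x v v =
      fderiv ℝ (fderiv ℝ τ) x (Complex.I • v) (Complex.I • v) := by
    filter_upwards [e1, e2] with x h1 h2
    rw [h1, h2, I_smul_I_smul]
  have h1 := jτ.self_of_nhds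
  have h3 := (hasFDerivAt_apply_const (hasFDerivAt_apply_const h1.2.2 (Complex.I • v))
    (Complex.I • v)).congr_of_eventuallyEq e3
  have h4 := (hasFDerivAt_apply_const (hasFDerivAt_apply_const h1.2.2 v) v).neg
  exact congrArg (fun T : E →L[ℝ] E => T u) (h3.unique h4)

/-- A null vector is orthogonal to the whole kernel of ∂ρ, so H(v,·) is determined by its value at
`N`. -/
theorem hermForm_null_eq {B : E →L[ℝ] E →L[ℝ] ℝ} (hB : ∀ v w, B v w = B w v)
    {l : E →L[ℝ] ℝ} (hpos : ∀ v, holPart l v = 0 → 0 ≤ hermQuad B v) {v w N : E}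
    (hN : holPart l N = 1) (hv : holPart l v = 0) (h0 : hermQuad B v = 0) :
    hermForm B v w = (starRingEnd ℂ) (holPart l w) * hermForm B v N := by
  have h1 : holPart l (w + (-holPart l w) • N) = 0 := by
    rw [holPart_add, holPart_smul, hN]; ring
  have h2 := hermForm_eq_zero_of_null hB hpos hv h1 h0
  rw [hermForm_add_right, hermForm_smul_right, map_neg] at h2
  linear_combination h2

/-- Invariance of the boundary terms under holomorphic coordinate changes. -/
theorem comp_holomorphic_terms {f : E → ℝ} {τ : E → E} {z : E} (hf : ContDiffAt ℝ 3 f (τ z))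
    (hτ : ContDiffAt ℝ 3 τ z)
    (hJ : ∀ᶠ x in 𝓝 z, ∀ v, fderiv ℝ τ x (Complex.I • v) = Complex.I • fderiv ℝ τ x v) :
    (∀ v, holPart (fderiv ℝ (f ∘ τ) z) v = holPart (fderiv ℝ f (τ z)) (fderiv ℝ τ z v)) ∧
    (∀ v w, hermForm (fderiv ℝ (fderiv ℝ (f ∘ τ)) z) v w =
      hermForm (fderiv ℝ (fderiv ℝ f) (τ z)) (fderiv ℝ τ z v) (fderiv ℝ τ z w)) ∧
    (∀ v, hermQuad (fderiv ℝ (fderiv ℝ (f ∘ τ)) z) v =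
      hermQuad (fderiv ℝ (fderiv ℝ f) (τ z)) (fderiv ℝ τ z v)) ∧
    ((∀ v, holPart (fderiv ℝ f (τ z)) v = 0 → 0 ≤ hermQuad (fderiv ℝ (fderiv ℝ f) (τ z)) v) →
      ∀ N v, holPart (fderiv ℝ f (τ z)) (fderiv ℝ τ z N) = 1 →
      holPart (fderiv ℝ f (τ z)) (fderiv ℝ τ z v) = 0 →
      hermQuad (fderiv ℝ (fderiv ℝ f) (τ z)) (fderiv ℝ τ z v) = 0 →
      normalTerm (fderiv ℝ (fderiv ℝ (f ∘ τ)) z) (fderiv ℝ (fderiv ℝ (fderiv ℝ (f ∘ τ))) z) N v =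
      normalTerm (fderiv ℝ (fderiv ℝ f) (τ z)) (fderiv ℝ (fderiv ℝ (fderiv ℝ f)) (τ z))
        (fderiv ℝ τ z N) (fderiv ℝ τ z v)) := by
  obtain ⟨c1, c2, c3⟩ := comp_jets hf hτ
  obtain ⟨k1, k2, k3⟩ := holomorphic_jets hτ hJ
  have k0 := hJ.self_of_nhds
  have hh : ∀ v w, hermForm (fderiv ℝ (fderiv ℝ (f ∘ τ)) z) v w =
      hermForm (fderiv ℝ (fderiv ℝ f) (τ z)) (fderiv ℝ τ z v) (fderiv ℝ τ z w) := by
    intro v w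
    simp only [hermForm, c2, k0, k1, k2, I_smul_I_smul, map_neg]
    push_cast
    ring
  refine ⟨fun v => ?_, hh, fun v => ?_, fun hpos N v hN hv h0 => ?_⟩
  · simp only [holPart, c1, k0]
  · simp only [hermQuad, c2, k0, k1, k2, I_smul_I_smul, map_neg]
    ring
  · have hs := fun v w => ContDiffAt.fderiv_fderiv_symm hf v w
    set B := fderiv ℝ (fderiv ℝ f) (τ z) with hB
    set x := fderiv ℝ (fderiv ℝ τ) z N v with hx
    have hx' : fderiv ℝ (fderiv ℝ τ) z N (Complex.I • v) = Complex.I • x := k1 N v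
    have e1 : holPart (fderiv ℝ (fderiv ℝ (f ∘ τ)) z N) v =
        holPart (B (fderiv ℝ τ z N)) (fderiv ℝ τ z v) + holPart (fderiv ℝ f (τ z)) x := by
      simp only [holPart, c2, k0, hx', ← hx]
      push_cast
      ring
    have e2 : hermQuad (fderiv ℝ (fderiv ℝ (fderiv ℝ (f ∘ τ))) z N) v =
        hermQuad (fderiv ℝ (fderiv ℝ (fderiv ℝ f)) (τ z) (fderiv ℝ τ z N)) (fderiv ℝ τ z v) +
        2 * (hermForm B (fderiv ℝ τ z v) x).re := by
      have h4 : fderiv ℝ (fderiv ℝ τ) z (Complex.I • v) (Complex.I • v) =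
        -fderiv ℝ (fderiv ℝ τ) z v v := by rw [k1, k2, I_smul_I_smul]
      have h5 : (hermForm B (fderiv ℝ τ z v) x).re = (B (fderiv ℝ τ z v) x +
          B (Complex.I • fderiv ℝ τ z v) (Complex.I • x)) / 4 := by
        simp [hermForm]
      rw [h5]
      simp only [hermQuad, c3, k0, hx', ← hx, k3, h4, map_neg]
      rw [hs x, hs (Complex.I • x)]
      ring
    -- The second derivative of τ adds ∂f(x) to β and 2Re H(v,x) to the third-order term. For null v
    -- one has H(v,x) = conj(∂f(x))·H(v,N), and the two contributions cancel. For other vectors the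
    -- term would not be invariant.
    rw [normalTerm, normalTerm, e1, e2, hh, hermForm_null_eq hs hpos hN hv h0 (w := x), map_add,
      add_mul, Complex.add_re]
    ring

end CoordinateChange

/-! ### Functions on a complex manifold in holomorphic charts -/

section Charts

open Filter

variable {d : ℕ} {X : Type*} [TopologicalSpace X] [ChartedSpace (EuclideanSpace ℂ (Fin d)) X]

/-- The expression of `u` in the chart at `p`. -/
def chartRep (u : X → ℝ) (p : X) : EuclideanSpace ℂ (Fin d) → ℝ :=
  u ∘ (extChartAt (realModel d) p).symm

/-- The coordinates of `q` in the chart at `p`. -/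
def coord (d : ℕ) {X : Type*} [TopologicalSpace X] [ChartedSpace (EuclideanSpace ℂ (Fin d)) X]
    (p q : X) : EuclideanSpace ℂ (Fin d) := extChartAt (realModel d) p q

/-- The transition map from the chart at `q` to the chart at `p`. -/
def transition (d : ℕ) {X : Type*} [TopologicalSpace X]
    [ChartedSpace (EuclideanSpace ℂ (Fin d)) X] (q p : X) :
    EuclideanSpace ℂ (Fin d) → EuclideanSpace ℂ (Fin d) :=
  extChartAt (realModel d) p ∘ (extChartAt (realModel d) q).symm

/-- The differential of the chart at `p` at the point `q`, in the chart at `q`. -/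
def chartDeriv (d : ℕ) {X : Type*} [TopologicalSpace X]
    [ChartedSpace (EuclideanSpace ℂ (Fin d)) X] (q p : X) :
    EuclideanSpace ℂ (Fin d) →L[ℝ] EuclideanSpace ℂ (Fin d) :=
  fderiv ℝ (transition d q p) (coord d q q)

theorem coord_mem_target (p : X) {q : X} (hq : q ∈ (extChartAt (realModel d) p).source) :
    coord d p q ∈ (extChartAt (realModel d) p).target :=
  (extChartAt (realModel d) p).map_source hq

theorem chartRep_coord (u : X → ℝ) {p q : X} (hq : q ∈ (extChartAt (realModel d) p).source) :
    chartRep u p (coord d p q) = u q := by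
  simp only [chartRep, coord, Function.comp_apply, (extChartAt (realModel d) p).left_inv hq]

theorem target_mem_nhds_coord {p q : X} (hq : q ∈ (extChartAt (realModel d) p).source) :
    (extChartAt (realModel d) p).target ∈ 𝓝 (coord d p q) :=
  (isOpen_extChartAt_target p).mem_nhds (coord_mem_target p hq)

theorem tendsto_coord {p q : X} (hq : q ∈ (extChartAt (realModel d) p).source) :
    Tendsto (coord d p) (𝓝 q) (𝓝 (coord d p q)) :=
  continuousAt_extChartAt' hq

theorem tendsto_coord_symm {p q : X} (hq : q ∈ (extChartAt (realModel d) p).source) :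
    Tendsto (extChartAt (realModel d) p).symm (𝓝 (coord d p q)) (𝓝 q) := by
  have := (continuousAt_extChartAt_symm'' (I := realModel d) (coord_mem_target p hq)).tendsto
  rwa [coord, (extChartAt (realModel d) p).left_inv hq] at this

/-- A property holds near `q` iff it holds near the coordinates of `q`. -/
theorem eventually_coord_iff {p q : X} (hq : q ∈ (extChartAt (realModel d) p).source)
    {P : X → Prop} : (∀ᶠ y in 𝓝 q, P y) ↔
      ∀ᶠ z in 𝓝 (coord d p q), P ((extChartAt (realModel d) p).symm z) := by
  refine ⟨fun h => (tendsto_coord_symm hq).eventually h, fun h => ?_⟩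
  filter_upwards [(tendsto_coord hq).eventually h,
    (isOpen_extChartAt_source p).mem_nhds hq] with y hy hys
  rwa [coord, (extChartAt (realModel d) p).left_inv hys] at hy

variable [IsManifold (complexModel d) ω X]

theorem contDiffAt_transition {p q : X} (hq : q ∈ (extChartAt (realModel d) p).source) :
    ContDiffAt ℂ ω (transition d q p) (coord d q q) := by
  have h1 := (contDiffGroupoid ω (complexModel d)).compatible
    (chart_mem_atlas (EuclideanSpace ℂ (Fin d)) q) (chart_mem_atlas (EuclideanSpace ℂ (Fin d)) p)
  rw [contDiffGroupoid, mem_groupoid_of_pregroupoid] at h1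
  refine ContDiffOn.contDiffAt h1.1 ?_
  simp only [modelWithCornersSelf_coe, Set.range_id, Set.inter_univ]
  refine IsOpen.mem_nhds ?_ ?_
  · exact ((chartAt (EuclideanSpace ℂ (Fin d)) q).symm.trans
      (chartAt (EuclideanSpace ℂ (Fin d)) p)).open_source.preimage continuous_id
  · rw [extChartAt_source] at hq
    simp [coord, hq]

theorem contDiffAt_transition_real {p q : X} (hq : q ∈ (extChartAt (realModel d) p).source) :
    ContDiffAt ℝ 3 (transition d q p) (coord d q q) :=
  ((contDiffAt_transition hq).restrict_scalars ℝ).of_le le_top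

theorem transition_holomorphic {p q : X} (hq : q ∈ (extChartAt (realModel d) p).source) :
    ∀ᶠ x in 𝓝 (coord d q q), ∀ v, fderiv ℝ (transition d q p) x (Complex.I • v) =
      Complex.I • fderiv ℝ (transition d q p) x v := by
  have h := (contDiffAt_transition hq).of_le (show (1 : WithTop ℕ∞) ≤ ω from le_top)
  filter_upwards [h.eventually (by simp)] with x hx v
  have h2 := (hx.differentiableAt one_ne_zero).fderiv_restrictScalars ℝ
  rw [h2]
  simp

theorem transition_coord {p q : X} : transition d q p (coord d q q) = coord d p q := by
  simp only [transition, coord, Function.comp_apply,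
    (extChartAt (realModel d) q).left_inv (mem_extChartAt_source (I := realModel d) q)]

theorem chartRep_eventuallyEq (u : X → ℝ) {p q : X}
    (hq : q ∈ (extChartAt (realModel d) p).source) :
    chartRep u q =ᶠ[𝓝 (coord d q q)] chartRep u p ∘ transition d q p := by
  have h : ∀ᶠ y in 𝓝 q, y ∈ (extChartAt (realModel d) p).source :=
    (isOpen_extChartAt_source p).mem_nhds hq
  rw [eventually_coord_iff (p := q) (mem_extChartAt_source (I := realModel d) q)] at h
  filter_upwards [h] with x hx
  simp only [chartRep, transition, Function.comp_apply]
  rw [(extChartAt (realModel d) p).left_inv hx]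

theorem chartDeriv_I (q p : X) (hq : q ∈ (extChartAt (realModel d) p).source)
    (v : EuclideanSpace ℂ (Fin d)) :
    chartDeriv d q p (Complex.I • v) = Complex.I • chartDeriv d q p v :=
  (transition_holomorphic hq).self_of_nhds v

theorem chartDeriv_eq_tangentCoordChange (q p : X) :
    chartDeriv d q p = tangentCoordChange (realModel d) q p q := by
  rw [tangentCoordChange_def, modelWithCornersSelf_coe, Set.range_id, fderivWithin_univ]
  rfl

theorem mfderiv_extChartAt_eq (q p : X) (hq : q ∈ (extChartAt (realModel d) p).source) :
    mfderiv (realModel d) 𝓘(ℝ, EuclideanSpace ℂ (Fin d)) (extChartAt (realModel d) p) q =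
      chartDeriv d q p := by
  rw [extChartAt_source] at hq
  have : IsManifold (realModel d) 1 X := .of_le (n := ω) le_top
  have h := mfderiv_chartAt_eq_tangentCoordChange (I := realModel d) hq
  rw [chartDeriv_eq_tangentCoordChange]
  exact h

theorem chartDeriv_chartDeriv (q p : X) (hq : q ∈ (extChartAt (realModel d) p).source)
    (v : EuclideanSpace ℂ (Fin d)) :
    tangentCoordChange (realModel d) p q q (chartDeriv d q p v) = v := by
  have : IsManifold (realModel d) 1 X := .of_le (n := ω) le_top
  rw [chartDeriv_eq_tangentCoordChange, tangentCoordChange_comp, tangentCoordChange_self]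
  · exact mem_extChartAt_source q
  · exact ⟨⟨mem_extChartAt_source q, hq⟩, mem_extChartAt_source q⟩

theorem chartDeriv_surjective (q p : X) (hq : q ∈ (extChartAt (realModel d) p).source) :
    Function.Surjective (chartDeriv d q p) := by
  have : IsManifold (realModel d) 1 X := .of_le (n := ω) le_top
  intro w
  refine ⟨tangentCoordChange (realModel d) p q q w, ?_⟩
  rw [chartDeriv_eq_tangentCoordChange, tangentCoordChange_comp, tangentCoordChange_self hq]
  exact ⟨⟨hq, mem_extChartAt_source q⟩, hq⟩

theorem chartDeriv_ne_zero (q p : X) (hq : q ∈ (extChartAt (realModel d) p).source)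
    {v : EuclideanSpace ℂ (Fin d)} (hv : v ≠ 0) : chartDeriv d q p v ≠ 0 := by
  intro h
  have := chartDeriv_chartDeriv q p hq v
  rw [h, map_zero] at this
  exact hv this.symm

theorem contDiffAt_chartRep {u : X → ℝ} {p q : X}
    (hu : ContMDiffAt (realModel d) 𝓘(ℝ, ℝ) ∞ u q)
    (hq : q ∈ (extChartAt (realModel d) p).source) :
    ContDiffAt ℝ ∞ (chartRep u p) (coord d p q) := by
  rw [← contMDiffAt_iff_contDiffAt]
  have h1 : ContMDiffAt 𝓘(ℝ, EuclideanSpace ℂ (Fin d)) (realModel d) ∞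
      (extChartAt (realModel d) p).symm (coord d p q) :=
    (contMDiffOn_extChartAt_symm (n := ∞) (I := realModel d) p).contMDiffAt
      (target_mem_nhds_coord hq)
  refine ContMDiffAt.comp (coord d p q) ?_ h1
  rwa [coord, (extChartAt (realModel d) p).left_inv hq]

theorem contMDiffAt_of_chartRep {u : X → ℝ} {p q : X} {n : WithTop ℕ∞}
    (hu : ContDiffAt ℝ n (chartRep u p) (coord d p q))
    (hq : q ∈ (extChartAt (realModel d) p).source) :
    ContMDiffAt (realModel d) 𝓘(ℝ, ℝ) n u q := by
  have : IsManifold (realModel d) n X := .of_le (n := ω) le_top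
  rw [contMDiffAt_iff_source_of_mem_source (x' := q) (x := p) (by rwa [extChartAt_source] at hq)]
  simp only [modelWithCornersSelf_coe, Set.range_id]
  exact (contMDiffAt_iff_contDiffAt.2 hu).contMDiffWithinAt

theorem diff_eq {u : X → ℝ} {p : X} (hu : MDifferentiableAt (realModel d) 𝓘(ℝ, ℝ) u p)
    (v : TangentSpace (realModel d) p) :
    diff d u p v = fderiv ℝ (chartRep u p) (coord d p p) v := by
  have h : mfderiv (realModel d) 𝓘(ℝ, ℝ) u p = fderivWithin ℝ
      (writtenInExtChartAt (realModel d) 𝓘(ℝ, ℝ) p u) (Set.range (realModel d))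
      (extChartAt (realModel d) p p) := hu.mfderiv
  rw [diff, h]
  simp only [modelWithCornersSelf_coe, Set.range_id, fderivWithin_univ]
  rfl

theorem complexHessian_eq (u : X → ℝ) (p : X) (v : TangentSpace (realModel d) p) :
    complexHessian d u p v = hermQuad (fderiv ℝ (fderiv ℝ (chartRep u p)) (coord d p p)) v := rfl

theorem holPart_chart {u : X → ℝ} {p q : X} (hq : q ∈ (extChartAt (realModel d) p).source)
    (hu : ContDiffAt ℝ 3 (chartRep u p) (coord d p q)) (v : EuclideanSpace ℂ (Fin d)) :
    holPart (fderiv ℝ (chartRep u q) (coord d q q)) v =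
      holPart (fderiv ℝ (chartRep u p) (coord d p q)) (chartDeriv d q p v) := by
  rw [(chartRep_eventuallyEq u hq).fderiv_eq]
  have h := (comp_holomorphic_terms (f := chartRep u p) (by rwa [transition_coord])
    (contDiffAt_transition_real hq) (transition_holomorphic hq)).1 v
  rwa [transition_coord] at h

theorem hermForm_chart {u : X → ℝ} {p q : X} (hq : q ∈ (extChartAt (realModel d) p).source)
    (hu : ContDiffAt ℝ 3 (chartRep u p) (coord d p q)) (v w : EuclideanSpace ℂ (Fin d)) :
    hermForm (fderiv ℝ (fderiv ℝ (chartRep u q)) (coord d q q)) v w =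
      hermForm (fderiv ℝ (fderiv ℝ (chartRep u p)) (coord d p q)) (chartDeriv d q p v)
        (chartDeriv d q p w) := by
  rw [(chartRep_eventuallyEq u hq).fderiv.fderiv_eq]
  have h := (comp_holomorphic_terms (f := chartRep u p) (by rwa [transition_coord])
    (contDiffAt_transition_real hq) (transition_holomorphic hq)).2.1 v w
  rwa [transition_coord] at h

theorem hermQuad_chart {u : X → ℝ} {p q : X} (hq : q ∈ (extChartAt (realModel d) p).source)
    (hu : ContDiffAt ℝ 3 (chartRep u p) (coord d p q)) (v : EuclideanSpace ℂ (Fin d)) :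
    hermQuad (fderiv ℝ (fderiv ℝ (chartRep u q)) (coord d q q)) v =
      hermQuad (fderiv ℝ (fderiv ℝ (chartRep u p)) (coord d p q)) (chartDeriv d q p v) := by
  rw [(chartRep_eventuallyEq u hq).fderiv.fderiv_eq]
  have h := (comp_holomorphic_terms (f := chartRep u p) (by rwa [transition_coord])
    (contDiffAt_transition_real hq) (transition_holomorphic hq)).2.2.1 v
  rwa [transition_coord] at h

theorem normalTerm_chart {u : X → ℝ} {p q : X} (hq : q ∈ (extChartAt (realModel d) p).source)
    (hu : ContDiffAt ℝ 3 (chartRep u p) (coord d p q))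
    (hpos : ∀ v, holPart (fderiv ℝ (chartRep u p) (coord d p q)) v = 0 →
      0 ≤ hermQuad (fderiv ℝ (fderiv ℝ (chartRep u p)) (coord d p q)) v)
    {N v : EuclideanSpace ℂ (Fin d)}
    (hN : holPart (fderiv ℝ (chartRep u p) (coord d p q)) (chartDeriv d q p N) = 1)
    (hv : holPart (fderiv ℝ (chartRep u p) (coord d p q)) (chartDeriv d q p v) = 0)
    (h0 : hermQuad (fderiv ℝ (fderiv ℝ (chartRep u p)) (coord d p q)) (chartDeriv d q p v) = 0) :
    normalTerm (fderiv ℝ (fderiv ℝ (chartRep u q)) (coord d q q))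
      (fderiv ℝ (fderiv ℝ (fderiv ℝ (chartRep u q))) (coord d q q)) N v =
    normalTerm (fderiv ℝ (fderiv ℝ (chartRep u p)) (coord d p q))
      (fderiv ℝ (fderiv ℝ (fderiv ℝ (chartRep u p))) (coord d p q))
      (chartDeriv d q p N) (chartDeriv d q p v) := by
  rw [(chartRep_eventuallyEq u hq).fderiv.fderiv_eq,
    (chartRep_eventuallyEq u hq).fderiv.fderiv.fderiv_eq]
  have h := (comp_holomorphic_terms (f := chartRep u p) (by rwa [transition_coord])
    (contDiffAt_transition_real hq) (transition_holomorphic hq)).2.2.2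
  rw [transition_coord] at h
  exact h hpos N v hN hv h0

end Charts

/-! ### Defining functions and the boundary form -/

section Boundary

open Filter

variable {d : ℕ} {X : Type*} [TopologicalSpace X] [ChartedSpace (EuclideanSpace ℂ (Fin d)) X]

/-- The differential of `u` at `p`, in the chart at `p`. -/
abbrev jet₁ (d : ℕ) {X : Type*} [TopologicalSpace X] [ChartedSpace (EuclideanSpace ℂ (Fin d)) X]
    (u : X → ℝ) (p : X) : EuclideanSpace ℂ (Fin d) →L[ℝ] ℝ :=
  fderiv ℝ (chartRep u p) (coord d p p)

/-- The second derivative of `u` at `p`, in the chart at `p`. -/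
abbrev jet₂ (d : ℕ) {X : Type*} [TopologicalSpace X] [ChartedSpace (EuclideanSpace ℂ (Fin d)) X]
    (u : X → ℝ) (p : X) : EuclideanSpace ℂ (Fin d) →L[ℝ] EuclideanSpace ℂ (Fin d) →L[ℝ] ℝ :=
  fderiv ℝ (fderiv ℝ (chartRep u p)) (coord d p p)

/-- The third derivative of `u` at `p`, in the chart at `p`. -/
abbrev jet₃ (d : ℕ) {X : Type*} [TopologicalSpace X] [ChartedSpace (EuclideanSpace ℂ (Fin d)) X]
    (u : X → ℝ) (p : X) : EuclideanSpace ℂ (Fin d) →L[ℝ] EuclideanSpace ℂ (Fin d) →L[ℝ]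
      EuclideanSpace ℂ (Fin d) →L[ℝ] ℝ :=
  fderiv ℝ (fderiv ℝ (fderiv ℝ (chartRep u p))) (coord d p p)

/-- The Levi form of `ρ` is positive semi-definite on the boundary. -/
def LeviNonneg (d : ℕ) {X : Type*} [TopologicalSpace X]
    [ChartedSpace (EuclideanSpace ℂ (Fin d)) X] (Ω : Set X) (ρ : X → ℝ) : Prop :=
  ∀ p ∈ frontier Ω, ∀ v, holPart (jet₁ d ρ p) v = 0 → 0 ≤ hermQuad (jet₂ d ρ p) v

/-- The boundary form of `ρ` is positive on the null vectors, for some normal vector. -/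
def BoundaryPos (d : ℕ) {X : Type*} [TopologicalSpace X]
    [ChartedSpace (EuclideanSpace ℂ (Fin d)) X] (Ω : Set X) (ρ : X → ℝ) (σ κ : ℝ) : Prop :=
  ∀ p ∈ frontier Ω, ∃ N, holPart (jet₁ d ρ p) N = 1 ∧ ∀ v ≠ 0, holPart (jet₁ d ρ p) v = 0 →
    hermQuad (jet₂ d ρ p) v = 0 → 0 < boundaryForm (jet₂ d ρ p) (jet₃ d ρ p) σ κ N v

/-- The boundary form of `ρ` is non-negative on the null vectors, for some normal vector. -/
def BoundaryNonneg (d : ℕ) {X : Type*} [TopologicalSpace X]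
    [ChartedSpace (EuclideanSpace ℂ (Fin d)) X] (Ω : Set X) (ρ : X → ℝ) (σ κ : ℝ) : Prop :=
  ∀ p ∈ frontier Ω, ∃ N, holPart (jet₁ d ρ p) N = 1 ∧ ∀ v, holPart (jet₁ d ρ p) v = 0 →
    hermQuad (jet₂ d ρ p) v = 0 → 0 ≤ boundaryForm (jet₂ d ρ p) (jet₃ d ρ p) σ κ N v

variable {Ω : Set X} {ρ : X → ℝ}

theorem IsDefiningFunction.isOpen (h : IsDefiningFunction d Ω ρ) : IsOpen Ω := by
  rw [h.eq_neg]
  exact isOpen_lt h.smooth.continuous continuous_const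

theorem IsDefiningFunction.eq_zero (h : IsDefiningFunction d Ω ρ) {p : X} (hp : p ∈ frontier Ω) :
    ρ p = 0 := by
  rw [h.eq_neg] at hp
  exact frontier_lt_subset_eq h.smooth.continuous continuous_const hp

theorem IsDefiningFunction.nonpos_of_mem_closure (h : IsDefiningFunction d Ω ρ) {p : X}
    (hp : p ∈ closure Ω) : ρ p ≤ 0 := by
  rw [h.eq_neg] at hp
  exact closure_lt_subset_le h.smooth.continuous continuous_const hp

variable [IsManifold (complexModel d) ω X]

theorem three_le_infty : (3 : WithTop ℕ∞) ≤ ∞ :=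
  WithTop.coe_le_coe.2 (le_top : (3 : ℕ∞) ≤ ⊤)

theorem IsDefiningFunction.contDiffAt (h : IsDefiningFunction d Ω ρ) {p q : X}
    (hq : q ∈ (extChartAt (realModel d) p).source) :
    ContDiffAt ℝ 3 (chartRep ρ p) (coord d p q) :=
  (contDiffAt_chartRep (h.smooth q) hq).of_le three_le_infty

theorem IsDefiningFunction.contDiffAt_self (h : IsDefiningFunction d Ω ρ) (p : X) :
    ContDiffAt ℝ 3 (chartRep ρ p) (coord d p p) :=
  h.contDiffAt (mem_extChartAt_source (I := realModel d) p)

theorem chartRep_coord_self (u : X → ℝ) (p : X) : chartRep u p (coord d p p) = u p :=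
  chartRep_coord u (mem_extChartAt_source (I := realModel d) p)

theorem IsDefiningFunction.mdifferentiableAt (h : IsDefiningFunction d Ω ρ) (p : X) :
    MDifferentiableAt (realModel d) 𝓘(ℝ, ℝ) ρ p :=
  (h.smooth p).mdifferentiableAt (by simp)

theorem IsDefiningFunction.jet_ne_zero (h : IsDefiningFunction d Ω ρ) {p : X}
    (hp : p ∈ frontier Ω) : jet₁ d ρ p ≠ 0 := by
  obtain ⟨v, hv⟩ := h.diff_ne_zero p hp
  rw [diff_eq (h.mdifferentiableAt p)] at hv
  exact fun h0 => hv (DFunLike.congr_fun h0 v)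

/-- A defining function may vanish away from the boundary. Near the boundary it cannot: at a zero
outside the closure of Ω it would have a local minimum, while its differential does not vanish
there. -/
theorem IsDefiningFunction.eventually_mem_frontier (h : IsDefiningFunction d Ω ρ) {p : X}
    (hp : p ∈ frontier Ω) : ∀ᶠ q in 𝓝 p, ρ q = 0 → q ∈ frontier Ω := by
  have hps := mem_extChartAt_source (I := realModel d) p
  have hf := h.contDiffAt_self p
  have hne : ∀ᶠ z in 𝓝 (coord d p p), fderiv ℝ (chartRep ρ p) z ≠ 0 :=
    (ContDiffAt.jets hf).2.1.continuousAt.eventually_ne (h.jet_ne_zero hp)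
  filter_upwards [(tendsto_coord hps).eventually hne,
    (isOpen_extChartAt_source (I := realModel d) p).mem_nhds hps] with q hq hqs h0
  rw [frontier, h.isOpen.interior_eq]
  refine ⟨?_, fun hqΩ => ?_⟩
  · by_contra hcl
    refine hq (IsLocalMin.fderiv_eq_zero ?_)
    have h1 : ∀ᶠ y in 𝓝 q, 0 ≤ ρ y := by
      filter_upwards [isClosed_closure.isOpen_compl.mem_nhds hcl] with y hy
      by_contra hlt
      refine hy (subset_closure ?_)
      rw [h.eq_neg]
      exact not_le.1 hlt
    rw [eventually_coord_iff hqs] at h1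
    filter_upwards [h1] with z hz
    rw [chartRep_coord ρ hqs, h0]
    exact hz
  · rw [h.eq_neg] at hqΩ
    exact absurd h0 (ne_of_lt hqΩ)

/-- Needed for the Steinness index: outside the closure ρ is only known to be nonnegative, and
positivity holds near the boundary by the previous lemma. -/
theorem IsDefiningFunction.eventually_sides (h : IsDefiningFunction d Ω ρ) {p : X}
    (hp : p ∈ frontier Ω) : ∀ᶠ q in 𝓝 p, q ∉ closure Ω → 0 < ρ q := by
  filter_upwards [h.eventually_mem_frontier hp] with q hq hcl
  have h1 : 0 ≤ ρ q := by
    by_contra hlt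
    refine hcl (subset_closure ?_)
    rw [h.eq_neg]
    exact not_le.1 hlt
  exact lt_of_le_of_ne h1 fun h0 => hcl (frontier_subset_closure (hq h0.symm))

/-- The Levi condition in the chart at `p`. -/
theorem LeviNonneg.eventually_chart (hL : LeviNonneg d Ω ρ) (h : IsDefiningFunction d Ω ρ) {p : X}
    (hp : p ∈ frontier Ω) : ∀ᶠ z in 𝓝 (coord d p p), chartRep ρ p z = 0 →
      ∀ v, holPart (fderiv ℝ (chartRep ρ p) z) v = 0 →
        0 ≤ hermQuad (fderiv ℝ (fderiv ℝ (chartRep ρ p)) z) v := by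
  have hps := mem_extChartAt_source (I := realModel d) p
  have h1 := (eventually_coord_iff hps).1 (h.eventually_mem_frontier hp)
  have h2 := (eventually_coord_iff hps).1
    ((isOpen_extChartAt_source (I := realModel d) p).mem_nhds hps)
  filter_upwards [h1, h2, target_mem_nhds_coord hps] with z hz hzs hzt hz0 v hv
  set q := (extChartAt (realModel d) p).symm z with hq
  have hzq : coord d p q = z := (extChartAt (realModel d) p).right_inv hzt
  obtain ⟨w, rfl⟩ := chartDeriv_surjective q p hzs v
  have hf := h.contDiffAt hzs
  have := hL q (hz hz0) w
  rw [holPart_chart hzs hf, hermQuad_chart hzs hf, hzq] at this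
  exact this hv

/-- The local theorem gives strictness in the chart at `p`; hermitian parts are invariant under
holomorphic coordinate changes, which moves it to the chart at each nearby point, where
`complexHessian` is computed. -/
theorem IsDefiningFunction.eventually_strict (h : IsDefiningFunction d Ω ρ)
    (hL : LeviNonneg d Ω ρ) {σ κ : ℝ} (hσ : σ ^ 2 = 1) (hκ : 0 < κ) (hpos : BoundaryPos d Ω ρ σ κ)
    {p : X} (hp : p ∈ frontier Ω) : ∀ᶠ q in 𝓝 p, 0 < -(σ * ρ q) → ∀ v ≠ 0,
      0 < hermQuad (jet₂ d ρ q) v + κ / (-(σ * ρ q)) * ‖holPart (jet₁ d ρ q) v‖ ^ 2 := by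
  have hps := mem_extChartAt_source (I := realModel d) p
  obtain ⟨N, hN, hN'⟩ := hpos p hp
  have key := strict_of_boundaryForm_pos hσ hκ (h.contDiffAt_self p)
    ((chartRep_coord_self ρ p).trans (h.eq_zero hp)) hN (hL.eventually_chart h hp) hN'
  filter_upwards [(tendsto_coord hps).eventually key,
    (isOpen_extChartAt_source (I := realModel d) p).mem_nhds hps] with q hq hqs h0 v hv
  have hf := h.contDiffAt hqs
  rw [chartRep_coord ρ hqs] at hq
  rw [jet₁, jet₂, holPart_chart hqs hf, hermQuad_chart hqs hf]
  exact hq h0 _ (chartDeriv_ne_zero q p hqs hv)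

theorem exists_nhds_of_eventually {S : Set X} {P : X → Prop} (h : ∀ p ∈ S, ∀ᶠ q in 𝓝 p, P q) :
    ∃ W : Set X, IsOpen W ∧ S ⊆ W ∧ ∀ q ∈ W, P q :=
  ⟨interior {q | P q}, isOpen_interior, fun p hp => mem_interior_iff_mem_nhds.2 (h p hp),
    fun _ hq => interior_subset hq⟩

theorem IsDefiningFunction.exists_strictlyPSH_inside (h : IsDefiningFunction d Ω ρ)
    (hL : LeviNonneg d Ω ρ) {γ : ℝ} (hγ : 0 < γ) (hγ1 : γ < 1)
    (hpos : BoundaryPos d Ω ρ 1 (1 - γ)) :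
    ∃ W : Set X, IsOpen W ∧ frontier Ω ⊆ W ∧
      IsStrictlyPSHOn d (fun x => -(-ρ x) ^ γ) (Ω ∩ W) := by
  obtain ⟨W, hW, hsub, hP⟩ := exists_nhds_of_eventually fun p hp =>
    h.eventually_strict hL (one_pow 2) (sub_pos.2 hγ1) hpos hp
  refine ⟨W, hW, hsub, fun q hq v hv => ?_⟩
  have hneg : ρ q < 0 := by have := hq.1; rwa [h.eq_neg] at this
  have h0 : chartRep ρ q (coord d q q) < 0 := by rwa [chartRep_coord_self]
  rw [complexHessian_eq]
  have e := hermQuad_neg_rpow (h.contDiffAt_self q) h0 γ v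
  rw [chartRep_coord_self] at e
  refine lt_of_lt_of_eq ?_ e.symm
  exact mul_pos (mul_pos hγ (Real.rpow_pos_of_pos (by linarith) _))
    (hP q hq.2 (by linarith) v hv)

theorem IsDefiningFunction.exists_strictlyPSH_outside (h : IsDefiningFunction d Ω ρ)
    (hL : LeviNonneg d Ω ρ) {γ : ℝ} (hγ1 : 1 < γ) (hpos : BoundaryPos d Ω ρ (-1) (γ - 1)) :
    ∃ W : Set X, IsOpen W ∧ frontier Ω ⊆ W ∧
      IsStrictlyPSHOn d (fun x => ρ x ^ γ) ((closure Ω)ᶜ ∩ W) := by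
  obtain ⟨W, hW, hsub, hP⟩ := exists_nhds_of_eventually fun p hp =>
    (h.eventually_strict hL (by norm_num) (sub_pos.2 hγ1) hpos hp).and (h.eventually_sides hp)
  refine ⟨W, hW, hsub, fun q hq v hv => ?_⟩
  have hqpos : 0 < ρ q := (hP q hq.2).2 hq.1
  have h0 : 0 < chartRep ρ q (coord d q q) := by rwa [chartRep_coord_self]
  rw [complexHessian_eq]
  have e := hermQuad_rpow (h.contDiffAt_self q) h0 γ v
  rw [chartRep_coord_self] at e
  refine lt_of_lt_of_eq ?_ e.symm
  exact mul_pos (mul_pos (by linarith) (Real.rpow_pos_of_pos hqpos _))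
    ((hP q hq.2).1 (by linarith) v hv)

/-- A weak lower bound on one side of the boundary, with a local error term `ε`. -/
theorem IsDefiningFunction.boundaryForm_ge (h : IsDefiningFunction d Ω ρ) {σ κ ε : ℝ}
    (hσ : σ ^ 2 = 1) (hκ : 0 < κ) (hε : 0 ≤ ε) {p : X} (hp : p ∈ frontier Ω)
    (hweak : ∀ᶠ q in 𝓝 p, 0 < -(σ * ρ q) → ∀ v,
      -(σ * ρ q) * (ε * ‖chartDeriv d q p v‖ ^ 2) ≤
      hermQuad (jet₂ d ρ q) v + κ / (-(σ * ρ q)) * ‖holPart (jet₁ d ρ q) v‖ ^ 2)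
    {N : EuclideanSpace ℂ (Fin d)} (hN : holPart (jet₁ d ρ p) N = 1)
    {v : EuclideanSpace ℂ (Fin d)} (hv : holPart (jet₁ d ρ p) v = 0) :
    0 ≤ hermQuad (jet₂ d ρ p) v ∧ (hermQuad (jet₂ d ρ p) v = 0 →
      ε * ‖v‖ ^ 2 ≤ boundaryForm (jet₂ d ρ p) (jet₃ d ρ p) σ κ N v) := by
  have hps := mem_extChartAt_source (I := realModel d) p
  refine boundaryForm_ge_of_weak hσ hκ hε (h.contDiffAt_self p)
    ((chartRep_coord_self ρ p).trans (h.eq_zero hp)) hN ?_ hv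
  have h2 := (eventually_coord_iff hps).1
    ((isOpen_extChartAt_source (I := realModel d) p).mem_nhds hps)
  filter_upwards [(eventually_coord_iff hps).1 hweak, h2, target_mem_nhds_coord hps]
    with z hz hzs hzt hz0 v
  set q := (extChartAt (realModel d) p).symm z with hq
  have hzq : coord d p q = z := (extChartAt (realModel d) p).right_inv hzt
  have hzρ : chartRep ρ p z = ρ q := rfl
  obtain ⟨w, rfl⟩ := chartDeriv_surjective q p hzs v
  have hf := h.contDiffAt hzs
  rw [hzρ] at hz0 ⊢
  have := hz hz0 w
  rwa [jet₁, jet₂, holPart_chart hzs hf, hermQuad_chart hzs hf, hzq] at this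

theorem exists_normal {ρ : X → ℝ} (h : IsDefiningFunction d Ω ρ) {p : X} (hp : p ∈ frontier Ω) :
    ∃ N, holPart (jet₁ d ρ p) N = 1 :=
  exists_holPart_eq_one (h.jet_ne_zero hp)

/-- The Levi condition is recovered from plurisubharmonicity of this particular ρ, so no comparison
with the defining function in the pseudoconvexity hypothesis is required. -/
theorem IsDefiningFunction.levi_and_nonneg_of_weak (h : IsDefiningFunction d Ω ρ) {σ κ : ℝ}
    (hσ : σ ^ 2 = 1) (hκ : 0 < κ)
    (hweak : ∀ p ∈ frontier Ω, ∀ᶠ q in 𝓝 p, 0 < -(σ * ρ q) → ∀ v,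
      0 ≤ hermQuad (jet₂ d ρ q) v + κ / (-(σ * ρ q)) * ‖holPart (jet₁ d ρ q) v‖ ^ 2) :
    LeviNonneg d Ω ρ ∧ BoundaryNonneg d Ω ρ σ κ := by
  have key : ∀ p ∈ frontier Ω, ∀ N, holPart (jet₁ d ρ p) N = 1 → ∀ v, holPart (jet₁ d ρ p) v = 0 →
      0 ≤ hermQuad (jet₂ d ρ p) v ∧ (hermQuad (jet₂ d ρ p) v = 0 →
        0 ≤ boundaryForm (jet₂ d ρ p) (jet₃ d ρ p) σ κ N v) := by
    intro p hp N hN v hv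
    have := h.boundaryForm_ge hσ hκ le_rfl hp (by simpa using hweak p hp) hN hv
    simpa using this
  refine ⟨fun p hp v hv => ?_, fun p hp => ?_⟩
  · obtain ⟨N, hN⟩ := exists_normal h hp
    exact (key p hp N hN v hv).1
  · obtain ⟨N, hN⟩ := exists_normal h hp
    exact ⟨N, hN, fun v hv => (key p hp N hN v hv).2⟩

theorem IsDefiningFunction.weak_inside (h : IsDefiningFunction d Ω ρ) {γ : ℝ} (hγ : 0 < γ)
    (hγ1 : γ < 1) {W : Set X} (hW : IsOpen W) (hsub : frontier Ω ⊆ W)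
    (hpsh : IsPSHOn d (fun x => -(-ρ x) ^ γ) (Ω ∩ W)) :
    LeviNonneg d Ω ρ ∧ BoundaryNonneg d Ω ρ 1 (1 - γ) := by
  refine h.levi_and_nonneg_of_weak (one_pow 2) (sub_pos.2 hγ1) fun p hp => ?_
  filter_upwards [hW.mem_nhds (hsub hp)] with q hq h0 v
  have hneg : ρ q < 0 := by linarith
  have h0 : chartRep ρ q (coord d q q) < 0 := by rwa [chartRep_coord_self]
  have hqΩ : q ∈ Ω := by rw [h.eq_neg]; exact hneg
  have e := hermQuad_neg_rpow (h.contDiffAt_self q) h0 γ v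
  rw [chartRep_coord_self] at e
  have h1 := (hpsh q ⟨hqΩ, hq⟩ v).trans_eq e
  exact nonneg_of_mul_nonneg_right h1 (mul_pos hγ (Real.rpow_pos_of_pos (by linarith) _))

theorem IsDefiningFunction.weak_outside (h : IsDefiningFunction d Ω ρ) {γ : ℝ}
    (hγ1 : 1 < γ) {W : Set X} (hW : IsOpen W) (hsub : frontier Ω ⊆ W)
    (hpsh : IsPSHOn d (fun x => ρ x ^ γ) ((closure Ω)ᶜ ∩ W)) :
    LeviNonneg d Ω ρ ∧ BoundaryNonneg d Ω ρ (-1) (γ - 1) := by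
  refine h.levi_and_nonneg_of_weak (by norm_num) (sub_pos.2 hγ1) fun p hp => ?_
  filter_upwards [hW.mem_nhds (hsub hp)] with q hq h0 v
  have hpos : 0 < ρ q := by linarith
  have h0 : 0 < chartRep ρ q (coord d q q) := by rwa [chartRep_coord_self]
  have hqΩ : q ∈ (closure Ω)ᶜ := fun hcl => by
    have := h.nonpos_of_mem_closure hcl
    linarith
  have e := hermQuad_rpow (h.contDiffAt_self q) h0 γ v
  rw [chartRep_coord_self] at e
  have h1 := (hpsh q ⟨hqΩ, hq⟩ v).trans_eq e
  exact nonneg_of_mul_nonneg_right h1 (mul_pos (by linarith) (Real.rpow_pos_of_pos hpos _))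

end Boundary

/-! ### Interpolation of the boundary form -/

section Flat

open Filter

variable {E : Type*} [NormedAddCommGroup E] [NormedSpace ℂ E] [NormedSpace ℝ E]
  [IsScalarTower ℝ ℂ E]

/-- The boundary form without its correction term: the quadratic form of `∂̄_b ω`. -/
def leviQuad (B : E →L[ℝ] E →L[ℝ] ℝ) (D : E →L[ℝ] E →L[ℝ] E →L[ℝ] ℝ) (N v : E) : ℝ :=
  normalTerm B D N v - ‖hermForm B v N‖ ^ 2

/-- The dictionary with the CR indices: the coefficient 1/κ - σ is γ/(1-γ) for σ = 1, κ = 1-γ and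
γ/(γ-1) for σ = -1, κ = γ-1. -/
theorem boundaryForm_eq_leviQuad (B : E →L[ℝ] E →L[ℝ] ℝ) (D : E →L[ℝ] E →L[ℝ] E →L[ℝ] ℝ)
    (σ κ : ℝ) (N v : E) : boundaryForm B D σ κ N v =
      σ * leviQuad B D N v - (1 / κ - σ) * ‖hermForm B v N‖ ^ 2 := by
  rw [boundaryForm, leviQuad]
  ring

theorem ofReal_smul_eq (c : ℝ) (v : E) : (c : ℂ) • v = c • v := by
  rw [← Complex.coe_algebraMap, algebraMap_smul]

theorem leviQuad_real_smul (B : E →L[ℝ] E →L[ℝ] ℝ) (D : E →L[ℝ] E →L[ℝ] E →L[ℝ] ℝ)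
    (N v : E) (c : ℝ) : leviQuad B D N (c • v) = c ^ 2 * leviQuad B D N v := by
  have h1 : hermForm B (c • v) N = c * hermForm B v N := by
    rw [← hermForm_smul_left, ofReal_smul_eq]
  have h2 : holPart (B N) (c • v) = c * holPart (B N) v := by
    rw [← holPart_smul, ofReal_smul_eq]
  simp only [leviQuad, normalTerm]
  rw [h1, h2, hermQuad_real_smul, norm_mul, mul_pow, Complex.norm_real, Real.norm_eq_abs, sq_abs]
  simp only [map_mul, Complex.conj_ofReal, Complex.mul_re, Complex.mul_im, Complex.ofReal_re,
    Complex.ofReal_im]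
  ring

/-- A curve in a regular level set with a given tangent vector. -/
theorem exists_curve_of_hasStrictFDerivAt [CompleteSpace E] {f : E → ℝ} {f' : E →L[ℝ] ℝ} {p τ : E}
    (hf : HasStrictFDerivAt f f' p) (hf' : f' ≠ 0) (hp : f p = 0) (hτ : f' τ = 0) :
    ∃ j : ℝ → E, HasDerivAt j τ 0 ∧ j 0 = p ∧ ∀ᶠ t in 𝓝 0, f (j t) = 0 := by
  have hr : f'.range = ⊤ := by
    have : (f' : E →ₗ[ℝ] ℝ) ≠ 0 := fun h => hf' (ContinuousLinearMap.coe_injective h)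
    exact LinearMap.range_eq_top.2 (LinearMap.surjective this)
  set τ' : f'.ker := ⟨τ, hτ⟩
  have hτ0 : (0 : ℝ) • τ' = 0 := zero_smul _ _
  refine ⟨fun t => hf.implicitFunction f f' hr (f p) (t • τ'), ?_, ?_, ?_⟩
  · have h1 : HasDerivAt (fun t : ℝ => t • τ') τ' 0 := by
      simpa using (hasDerivAt_id (0 : ℝ)).smul_const τ'
    have h2 := (hf.to_implicitFunction hr).hasFDerivAt
    rw [← hτ0] at h2
    exact h2.comp_hasDerivAt (0 : ℝ) h1
  · simp only [hτ0, hf.implicitFunction_apply_image]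
  · have h1 : Tendsto (fun t : ℝ => (f p, t • τ')) (𝓝 0) (𝓝 (f p, 0)) := by
      refine tendsto_const_nhds.prodMk_nhds ?_
      rw [← hτ0]
      exact (continuous_id.smul continuous_const).tendsto 0
    filter_upwards [h1.eventually (hf.map_implicitFunction_eq hr)] with t ht
    rw [ht, hp]

/-- On the null vectors the boundary form does not depend on the normal vector. -/
theorem boundaryForm_normal_indep [CompleteSpace E] {f : E → ℝ} {p : E} (hf : ContDiffAt ℝ 3 f p)
    (hp : f p = 0) {N N' : E} (hN : holPart (fderiv ℝ f p) N = 1)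
    (hN' : holPart (fderiv ℝ f p) N' = 1)
    (hlevi : ∀ᶠ q in 𝓝 p, f q = 0 → ∀ v, holPart (fderiv ℝ f q) v = 0 →
      0 ≤ hermQuad (fderiv ℝ (fderiv ℝ f) q) v)
    {v : E} (hv : holPart (fderiv ℝ f p) v = 0) (hv0 : hermQuad (fderiv ℝ (fderiv ℝ f) p) v = 0)
    (σ κ : ℝ) :
    boundaryForm (fderiv ℝ (fderiv ℝ f) p) (fderiv ℝ (fderiv ℝ (fderiv ℝ f)) p) σ κ N' v =
      boundaryForm (fderiv ℝ (fderiv ℝ f) p) (fderiv ℝ (fderiv ℝ (fderiv ℝ f)) p) σ κ N v := by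
  have hτ : holPart (fderiv ℝ f p) (N' - N) = 0 := by
    have := holPart_add (fderiv ℝ f p) (N' - N) N
    rw [sub_add_cancel, hN, hN'] at this
    simpa using this.symm
  have hne : fderiv ℝ f p ≠ 0 := by
    intro h
    rw [h] at hN
    simp [holPart] at hN
  obtain ⟨j, hj, hj0, hjf⟩ := exists_curve_of_hasStrictFDerivAt (ContDiffAt.jets hf).1 hne hp
    ((holPart_eq_zero_iff _ _).1 hτ).1
  have := boundaryForm_congr_normal hf hp hN hlevi hj hj0 hjf hv hv0 hτ σ κ
  rwa [add_sub_cancel] at this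

/-- The terms of the boundary form of `exp F * f` on null vectors. -/
theorem exp_mul_leviQuad {f F : E → ℝ} {p : E} (hf : ContDiffAt ℝ 3 f p)
    (hF : ContDiffAt ℝ 3 F p) (hp : f p = 0) {N v : E} (hN : holPart (fderiv ℝ f p) N = 1)
    (hv : holPart (fderiv ℝ f p) v = 0) (h0 : hermQuad (fderiv ℝ (fderiv ℝ f) p) v = 0) :
    let g := fun x => Real.exp (F x) * f x
    let N' := ((Real.exp (F p))⁻¹ : ℝ) • N
    leviQuad (fderiv ℝ (fderiv ℝ g) p) (fderiv ℝ (fderiv ℝ (fderiv ℝ g)) p) N' v =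
      leviQuad (fderiv ℝ (fderiv ℝ f) p) (fderiv ℝ (fderiv ℝ (fderiv ℝ f)) p) N v -
      hermQuad (fderiv ℝ (fderiv ℝ F) p) v := by
  intro g N'
  obtain ⟨-, -, -, h4, h5⟩ := exp_mul_boundary_terms hf hF hp hN hv
  rw [leviQuad, leviQuad, h5 h0, h4]
  rw [← Complex.normSq_eq_norm_sq, ← Complex.normSq_eq_norm_sq, ← Complex.normSq_eq_norm_sq,
    Complex.normSq_add]
  have : ((starRingEnd ℂ) (holPart (fderiv ℝ F p) v) * hermForm (fderiv ℝ (fderiv ℝ f) p) v N).re =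
      (hermForm (fderiv ℝ (fderiv ℝ f) p) v N * (starRingEnd ℂ) (holPart (fderiv ℝ F p) v)).re := by
    rw [mul_comm]
  rw [this]
  ring

/-- The weight of the strong pair is taken of order δ², with sign σ so that σt = δ² is positive on
either side. The cross term in |w|² is split by the Cauchy inequality with parameter δ: this costs a
factor 1 + δ on w₁, absorbed by c < c₁, and a coefficient δ²(δ² + δ) on w₀, absorbed by δ²c₀ for
small δ. The parameter t is chosen before Q and w, hence uniformly over the boundary. -/
theorem exists_interpolation {σ c₁ c₀ c : ℝ} (hσ : σ ^ 2 = 1) (hc : 0 < c) (hc₁ : c < c₁)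
    (hc₀ : 0 < c₀) : ∃ t : ℝ, ∀ (Q₁ Q₀ : ℝ) (w₁ w₀ : ℂ), 0 ≤ σ * Q₁ - c₁ * ‖w₁‖ ^ 2 →
      0 < Q₀ - c₀ * ‖w₀‖ ^ 2 →
      0 < σ * ((1 - t) * Q₁ + t * Q₀) - c * ‖((1 - t : ℝ) : ℂ) * w₁ + (t : ℂ) * w₀‖ ^ 2 := by
  obtain ⟨δ, hδ0, hδ1, h1, h2⟩ : ∃ δ : ℝ, 0 < δ ∧ δ < 1 ∧ c * ((1 + δ ^ 2) * (1 + δ)) < c₁ ∧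
      c * (δ ^ 2 + δ) < c₀ := by
    have hA : ∀ᶠ δ : ℝ in 𝓝[>] 0, c * ((1 + δ ^ 2) * (1 + δ)) < c₁ := by
      refine (Tendsto.eventually_lt_const (u := c₁) (v := c * ((1 + 0 ^ 2) * (1 + 0))) (by linarith)
        ?_)
      exact (Continuous.tendsto (by fun_prop) 0).mono_left nhdsWithin_le_nhds
    have hB : ∀ᶠ δ : ℝ in 𝓝[>] 0, c * (δ ^ 2 + δ) < c₀ := by
      refine (Tendsto.eventually_lt_const (u := c₀) (v := c * (0 ^ 2 + 0)) (by linarith) ?_)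
      exact (Continuous.tendsto (by fun_prop) 0).mono_left nhdsWithin_le_nhds
    have hC : ∀ᶠ δ : ℝ in 𝓝[>] 0, δ ∈ Set.Ioo (0 : ℝ) 1 := Ioo_mem_nhdsGT one_pos
    obtain ⟨δ, hδ, ha, hb⟩ := (hC.and (hA.and hB)).exists
    exact ⟨δ, hδ.1, hδ.2, ha, hb⟩
  have hσ' : |σ| = 1 := by
    have : |σ| ^ 2 = 1 := by rw [sq_abs, hσ]
    nlinarith [abs_nonneg σ]
  have hσ1 := abs_le.1 hσ'.le
  -- For σ = -1 this is an extrapolation beyond the weak pair, away from the strong one.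
  refine ⟨σ * δ ^ 2, fun Q₁ Q₀ w₁ w₀ hQ₁ hQ₀ => ?_⟩
  set a := 1 - σ * δ ^ 2 with ha
  have hδ2 : δ ^ 2 < 1 := by nlinarith
  have ha0 : 0 ≤ a := by nlinarith
  have ha1 : a ≤ 1 + δ ^ 2 := by nlinarith
  set x := ‖w₁‖
  set y := ‖w₀‖
  have hx : 0 ≤ x := norm_nonneg _
  have hy : 0 ≤ y := norm_nonneg _
  have hn : ‖(a : ℂ) * w₁ + ((σ * δ ^ 2 : ℝ) : ℂ) * w₀‖ ≤ a * x + δ ^ 2 * y := by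
    refine (norm_add_le _ _).trans_eq ?_
    rw [norm_mul, norm_mul, Complex.norm_real, Complex.norm_real, Real.norm_eq_abs, Real.norm_eq_abs,
      abs_mul, hσ', one_mul, abs_of_nonneg ha0, abs_of_nonneg (sq_nonneg δ)]
  have hn2 : ‖(a : ℂ) * w₁ + ((σ * δ ^ 2 : ℝ) : ℂ) * w₀‖ ^ 2 ≤ (a * x + δ ^ 2 * y) ^ 2 :=
    pow_le_pow_left₀ (norm_nonneg _) hn 2
  -- The inequality 2aδ²xy ≤ δ(a²x² + δ²y²).
  have hn3 : (a * x + δ ^ 2 * y) ^ 2 ≤ a ^ 2 * (1 + δ) * x ^ 2 + δ ^ 2 * (δ ^ 2 + δ) * y ^ 2 := by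
    have : 0 ≤ δ * (a * x - δ * y) ^ 2 := by positivity
    nlinarith
  have e1 : c * (a ^ 2 * (1 + δ) * x ^ 2) ≤ a * (σ * Q₁) := by
    have : c * (a * (1 + δ)) ≤ c₁ := by
      refine le_trans ?_ h1.le
      gcongr
    have h3 : c * (a * (1 + δ)) * x ^ 2 ≤ σ * Q₁ := by
      have := mul_le_mul_of_nonneg_right this (sq_nonneg x)
      linarith
    have := mul_le_mul_of_nonneg_left h3 ha0
    linarith
  have e2 : c * (δ ^ 2 * (δ ^ 2 + δ) * y ^ 2) < δ ^ 2 * Q₀ := by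
    have h3 : c * (δ ^ 2 + δ) * y ^ 2 < Q₀ := by
      have := mul_le_mul_of_nonneg_right h2.le (sq_nonneg y)
      linarith
    have := mul_lt_mul_of_pos_left h3 (by positivity : 0 < δ ^ 2)
    linarith
  have e3 : σ * (a * Q₁ + σ * δ ^ 2 * Q₀) = a * (σ * Q₁) + δ ^ 2 * Q₀ := by
    linear_combination δ ^ 2 * Q₀ * hσ
  rw [e3]
  have := mul_le_mul_of_nonneg_left (hn2.trans hn3) hc.le
  linarith

/-- A positive function dominates another one, locally uniformly over the unit sphere. -/
theorem exists_pos_combination {Z G F : Type*} [TopologicalSpace Z] [NormedAddCommGroup G]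
    [ProperSpace G] [TopologicalSpace F] [T1Space F] [Zero F]
    {z₀ : Z} {a b : Z × G → ℝ} {ν : Z × G → F} (ha : ∀ v, ContinuousAt a (z₀, v))
    (hb : ∀ v, ContinuousAt b (z₀, v)) (hν : ∀ v, ContinuousAt ν (z₀, v))
    (hpos : ∀ v, ‖v‖ = 1 → ν (z₀, v) = 0 → 0 < b (z₀, v)) :
    ∃ K : ℝ, ∀ᶠ z in 𝓝 z₀, ∀ v, ‖v‖ = 1 → ν (z, v) = 0 → 0 < b (z, v) ∧ 0 < a (z, v) + K * b (z, v)
    := by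
  have hc : IsCompact (Metric.sphere (0 : G) 1) := isCompact_sphere _ _
  have key : ∃ K : ℝ, ∀ᶠ z in 𝓝 z₀, ∀ v ∈ Metric.sphere (0 : G) 1, ν (z, v) = 0 →
      0 < b (z, v) ∧ 0 < a (z, v) + K * b (z, v) := by
    refine hc.induction_on (p := fun s => ∃ K : ℝ, ∀ᶠ z in 𝓝 z₀, ∀ v ∈ s, ν (z, v) = 0 →
      0 < b (z, v) ∧ 0 < a (z, v) + K * b (z, v)) ⟨0, by simp⟩ ?_ ?_ ?_
    · rintro s t hst ⟨K, hK⟩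
      exact ⟨K, hK.mono fun z hz v hv => hz v (hst hv)⟩
    · rintro s t ⟨K, hK⟩ ⟨K', hK'⟩
      refine ⟨max K K', ?_⟩
      filter_upwards [hK, hK'] with z h1 h2 v hv hν
      rcases hv with hv | hv
      · obtain ⟨h3, h4⟩ := h1 v hv hν
        have := mul_le_mul_of_nonneg_right (le_max_left K K') h3.le
        exact ⟨h3, by linarith⟩
      · obtain ⟨h3, h4⟩ := h2 v hv hν
        have := mul_le_mul_of_nonneg_right (le_max_right K K') h3.le
        exact ⟨h3, by linarith⟩
    · intro v hv
      rw [mem_sphere_zero_iff_norm] at hv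
      by_cases h0 : ν (z₀, v) = 0
      · have hbv := hpos v hv h0
        -- This value gives a + Kb = 1 at the centre, so positivity persists on a product
        -- neighbourhood.
        set K := (1 - a (z₀, v)) / b (z₀, v) with hK
        have h1 : ∀ᶠ x in 𝓝 (z₀, v), 0 < b x := (hb v).eventually_const_lt hbv
        have h2 : ∀ᶠ x in 𝓝 (z₀, v), 0 < a x + K * b x := by
          refine ((ha v).add (continuousAt_const.mul (hb v))).eventually_const_lt ?_
          have : K * b (z₀, v) = 1 - a (z₀, v) := div_mul_cancel₀ _ hbv.ne'
          show 0 < a (z₀, v) + K * b (z₀, v)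
          linarith
        obtain ⟨U, hU, V, hV, hUV⟩ := mem_nhds_prod_iff.1 (h1.and h2)
        refine ⟨V, mem_nhdsWithin_of_mem_nhds hV, K, ?_⟩
        filter_upwards [hU] with z hz w hw _
        exact hUV (Set.mk_mem_prod hz hw)
      -- Away from the zeros of ν the condition is vacuous nearby, and any K serves.
      · have h1 : ∀ᶠ x in 𝓝 (z₀, v), ν x ≠ 0 := (hν v).eventually_ne h0
        obtain ⟨U, hU, V, hV, hUV⟩ := mem_nhds_prod_iff.1 h1
        refine ⟨V, mem_nhdsWithin_of_mem_nhds hV, 0, ?_⟩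
        filter_upwards [hU] with z hz w hw h2
        exact absurd h2 (hUV (Set.mk_mem_prod hz hw))
  obtain ⟨K, hK⟩ := key
  exact ⟨K, hK.mono fun z hz v hv => hz v (mem_sphere_zero_iff_norm.2 hv)⟩

theorem exists_uniform_of_local {Z : Type*} [TopologicalSpace Z] {S : Set Z} (hS : IsCompact S)
    {R : Z → ℝ → Prop} (hmono : ∀ q ∈ S, ∀ K K', K ≤ K' → R q K → R q K')
    (hloc : ∀ p ∈ S, ∃ K, ∀ᶠ q in 𝓝 p, q ∈ S → R q K) : ∃ K > 0, ∀ q ∈ S, R q K := by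
  have : ∃ K, ∀ q ∈ S, q ∈ S → R q K := by
    refine hS.induction_on (p := fun s => ∃ K, ∀ q ∈ s, q ∈ S → R q K) ⟨0, by simp⟩ ?_ ?_ ?_
    · rintro s t hst ⟨K, hK⟩
      exact ⟨K, fun q hq => hK q (hst hq)⟩
    · rintro s t ⟨K, hK⟩ ⟨K', hK'⟩
      refine ⟨max K K', fun q hq hqS => ?_⟩
      rcases hq with hq | hq
      · exact hmono q hqS _ _ (le_max_left _ _) (hK q hq hqS)
      · exact hmono q hqS _ _ (le_max_right _ _) (hK' q hq hqS)
    · intro p hp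
      obtain ⟨K, hK⟩ := hloc p hp
      exact ⟨_, mem_nhdsWithin_of_mem_nhds hK, K, fun q hq => hq⟩
  obtain ⟨K, hK⟩ := this
  exact ⟨max K 1, lt_max_of_lt_right one_pos,
    fun q hq => hmono q hq _ _ (le_max_left _ _) (hK q hq hq)⟩

end Flat

/-! ### Changing the defining function -/

section Change

open Filter

variable {d : ℕ} {X : Type*} [TopologicalSpace X] [ChartedSpace (EuclideanSpace ℂ (Fin d)) X]
  [IsManifold (complexModel d) ω X] {Ω : Set X} {ρ F : X → ℝ}

theorem contDiffAt_chartRep_self (hF : ContMDiff (realModel d) 𝓘(ℝ, ℝ) ∞ F) (p : X) :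
    ContDiffAt ℝ 3 (chartRep F p) (coord d p p) :=
  (contDiffAt_chartRep (hF p) (mem_extChartAt_source (I := realModel d) p)).of_le three_le_infty

theorem IsDefiningFunction.exp_mul (h : IsDefiningFunction d Ω ρ)
    (hF : ContMDiff (realModel d) 𝓘(ℝ, ℝ) ∞ F) :
    IsDefiningFunction d Ω (fun x => Real.exp (F x) * ρ x) := by
  have hs : ContMDiff (realModel d) 𝓘(ℝ, ℝ) ∞ (fun x => Real.exp (F x) * ρ x) :=
    ((Real.contDiff_exp.contMDiff).comp hF).mul h.smooth
  refine ⟨hs, ?_, fun p hp => ?_⟩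
  · conv_lhs => rw [h.eq_neg]
    ext x
    simp only [Set.mem_setOf_eq]
    exact ⟨mul_neg_of_pos_of_neg (Real.exp_pos _), fun h1 => lt_of_not_ge fun h2 =>
      not_le.2 h1 (mul_nonneg (Real.exp_pos _).le h2)⟩
  · obtain ⟨v, hv⟩ := h.diff_ne_zero p hp
    refine ⟨v, ?_⟩
    rw [diff_eq (h.mdifferentiableAt p)] at hv
    rw [diff_eq ((hs p).mdifferentiableAt (by simp))]
    have h1 := (exp_mul_jets (h.contDiffAt_self p) (contDiffAt_chartRep_self hF p)
      ((chartRep_coord_self ρ p).trans (h.eq_zero hp))).1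
    have h2 := DFunLike.congr_fun h1 v
    refine ne_of_eq_of_ne h2 ?_
    exact mul_ne_zero (Real.exp_pos _).ne' hv

/-- The terms of the boundary form of `exp F * ρ`. -/
theorem IsDefiningFunction.exp_mul_terms (h : IsDefiningFunction d Ω ρ)
    (hF : ContMDiff (realModel d) 𝓘(ℝ, ℝ) ∞ F) {p : X} (hp : p ∈ frontier Ω)
    {N v : EuclideanSpace ℂ (Fin d)} (hN : holPart (jet₁ d ρ p) N = 1)
    (hv : holPart (jet₁ d ρ p) v = 0) :
    holPart (jet₁ d (fun x => Real.exp (F x) * ρ x) p) ((Real.exp (F p))⁻¹ • N) = 1 ∧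
    holPart (jet₁ d (fun x => Real.exp (F x) * ρ x) p) v = 0 ∧
    hermQuad (jet₂ d (fun x => Real.exp (F x) * ρ x) p) v =
      Real.exp (F p) * hermQuad (jet₂ d ρ p) v ∧
    hermForm (jet₂ d (fun x => Real.exp (F x) * ρ x) p) v ((Real.exp (F p))⁻¹ • N) =
      hermForm (jet₂ d ρ p) v N + holPart (jet₁ d F p) v ∧
    (hermQuad (jet₂ d ρ p) v = 0 →
      leviQuad (jet₂ d (fun x => Real.exp (F x) * ρ x) p)
        (jet₃ d (fun x => Real.exp (F x) * ρ x) p) ((Real.exp (F p))⁻¹ • N) v =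
      leviQuad (jet₂ d ρ p) (jet₃ d ρ p) N v - hermQuad (jet₂ d F p) v) := by
  have hf := h.contDiffAt_self p
  have hF' := contDiffAt_chartRep_self hF p
  have h0 := (chartRep_coord_self (d := d) ρ p).trans (h.eq_zero hp)
  obtain ⟨h1, h2, h3, h4, -⟩ := exp_mul_boundary_terms hf hF' h0 hN hv
  have h5 := fun hq => exp_mul_leviQuad hf hF' h0 hN hv hq
  rw [chartRep_coord_self] at h1 h3 h4
  simp only [chartRep_coord_self] at h5
  exact ⟨h1, h2, h3, h4, h5⟩

theorem IsDefiningFunction.holPart_exp_mul_iff (h : IsDefiningFunction d Ω ρ)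
    (hF : ContMDiff (realModel d) 𝓘(ℝ, ℝ) ∞ F) {p : X} (hp : p ∈ frontier Ω)
    (v : EuclideanSpace ℂ (Fin d)) :
    holPart (jet₁ d (fun x => Real.exp (F x) * ρ x) p) v = 0 ↔ holPart (jet₁ d ρ p) v = 0 := by
  have h1 := (exp_mul_jets (h.contDiffAt_self p) (contDiffAt_chartRep_self hF p)
      ((chartRep_coord_self ρ p).trans (h.eq_zero hp))).1
  have h2 : jet₁ d (fun x => Real.exp (F x) * ρ x) p =
    Real.exp (chartRep F p (coord d p p)) • jet₁ d ρ p := h1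
  rw [h2, holPart_eq_zero_iff, holPart_eq_zero_iff]
  have := (Real.exp_pos (chartRep F p (coord d p p))).ne'
  simp only [smul_apply, smul_eq_mul, mul_eq_zero, this, false_or]

theorem LeviNonneg.exp_mul (hL : LeviNonneg d Ω ρ) (h : IsDefiningFunction d Ω ρ)
    (hF : ContMDiff (realModel d) 𝓘(ℝ, ℝ) ∞ F) :
    LeviNonneg d Ω (fun x => Real.exp (F x) * ρ x) := by
  intro p hp v hv
  obtain ⟨N, hN⟩ := exists_normal h hp
  have hv' := (h.holPart_exp_mul_iff hF hp v).1 hv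
  rw [(h.exp_mul_terms hF hp hN hv').2.2.1]
  exact mul_nonneg (Real.exp_pos _).le (hL p hp v hv')

theorem LeviNonneg.boundaryForm_indep (hL : LeviNonneg d Ω ρ) (h : IsDefiningFunction d Ω ρ)
    {p : X} (hp : p ∈ frontier Ω) {N N' v : EuclideanSpace ℂ (Fin d)}
    (hN : holPart (jet₁ d ρ p) N = 1) (hN' : holPart (jet₁ d ρ p) N' = 1)
    (hv : holPart (jet₁ d ρ p) v = 0) (hv0 : hermQuad (jet₂ d ρ p) v = 0) (σ κ : ℝ) :
    boundaryForm (jet₂ d ρ p) (jet₃ d ρ p) σ κ N' v =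
      boundaryForm (jet₂ d ρ p) (jet₃ d ρ p) σ κ N v :=
  boundaryForm_normal_indep (h.contDiffAt_self p) ((chartRep_coord_self ρ p).trans (h.eq_zero hp))
    hN hN' (hL.eventually_chart h hp) hv hv0 σ κ

theorem BoundaryPos.forall_normal {σ κ : ℝ} (hb : BoundaryPos d Ω ρ σ κ) (hL : LeviNonneg d Ω ρ)
    (h : IsDefiningFunction d Ω ρ) {p : X} (hp : p ∈ frontier Ω) {N v : EuclideanSpace ℂ (Fin d)}
    (hN : holPart (jet₁ d ρ p) N = 1) (hv : v ≠ 0) (hv1 : holPart (jet₁ d ρ p) v = 0)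
    (hv0 : hermQuad (jet₂ d ρ p) v = 0) :
    0 < boundaryForm (jet₂ d ρ p) (jet₃ d ρ p) σ κ N v := by
  obtain ⟨N', hN', h1⟩ := hb p hp
  rw [hL.boundaryForm_indep h hp hN' hN hv1 hv0]
  exact h1 v hv hv1 hv0

theorem BoundaryNonneg.forall_normal {σ κ : ℝ} (hb : BoundaryNonneg d Ω ρ σ κ)
    (hL : LeviNonneg d Ω ρ) (h : IsDefiningFunction d Ω ρ) {p : X} (hp : p ∈ frontier Ω)
    {N v : EuclideanSpace ℂ (Fin d)} (hN : holPart (jet₁ d ρ p) N = 1)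
    (hv1 : holPart (jet₁ d ρ p) v = 0) (hv0 : hermQuad (jet₂ d ρ p) v = 0) :
    0 ≤ boundaryForm (jet₂ d ρ p) (jet₃ d ρ p) σ κ N v := by
  obtain ⟨N', hN', h1⟩ := hb p hp
  rw [hL.boundaryForm_indep h hp hN' hN hv1 hv0]
  exact h1 v hv1 hv0

/-- Interpolation between a weak and a strong defining function. -/
theorem exists_boundaryPos_of_nonneg_of_pos (h : IsDefiningFunction d Ω ρ)
    (hL : LeviNonneg d Ω ρ) (hF : ContMDiff (realModel d) 𝓘(ℝ, ℝ) ∞ F) {σ κ₁ κ₀ κ : ℝ}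
    (hσ : σ ^ 2 = 1) (hκ₀ : 0 < κ₀) (hκ₀1 : κ₀ < 1) (hκ : 0 < 1 / κ - σ) (hκ₁ : 1 / κ < 1 / κ₁)
    (hweak : BoundaryNonneg d Ω ρ σ κ₁)
    (hstrong : BoundaryPos d Ω (fun x => Real.exp (F x) * ρ x) 1 κ₀) :
    ∃ t : ℝ, BoundaryPos d Ω (fun x => Real.exp (t * F x) * ρ x) σ κ := by
  -- The assumption κ₀ < 1 makes the coefficient of |w₀|² positive, that is, the strong function has
  -- a genuine margin.
  have hc₀ : 0 < 1 / κ₀ - 1 := by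
    rw [sub_pos, lt_div_iff₀ hκ₀]; linarith
  obtain ⟨t, ht⟩ := exists_interpolation hσ hκ (sub_lt_sub_right hκ₁ σ) hc₀
  refine ⟨t, fun p hp => ?_⟩
  have htF : ContMDiff (realModel d) 𝓘(ℝ, ℝ) ∞ (fun x => t * F x) := contMDiff_const.mul hF
  obtain ⟨N, hN, hN'⟩ := hweak p hp
  have hv0 : holPart (jet₁ d ρ p) 0 = 0 := by simp [holPart]
  refine ⟨(Real.exp (t * F p))⁻¹ • N, (h.exp_mul_terms htF hp hN hv0).1, fun v hv hv1 hv2 => ?_⟩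
  rw [h.holPart_exp_mul_iff htF hp] at hv1
  obtain ⟨-, -, a3, a4, a5⟩ := h.exp_mul_terms htF hp hN hv1
  rw [a3, mul_eq_zero, or_iff_right (Real.exp_pos _).ne'] at hv2
  obtain ⟨b1, b2, b3, b4, b5⟩ := h.exp_mul_terms hF hp hN hv1
  have hq1 := hN' v hv1 hv2
  have hq0 := hstrong.forall_normal (hL.exp_mul h hF) (h.exp_mul hF) hp b1 hv b2
    (by rw [b3, hv2, mul_zero])
  rw [boundaryForm_eq_leviQuad] at hq1 hq0 ⊢
  rw [one_mul, b5 hv2, b4] at hq0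
  rw [a5 hv2, a4]
  have key := ht _ _ _ _ hq1 hq0
  have ef : jet₁ d (fun x => t * F x) p = t • jet₁ d F p := by
    have : chartRep (fun x => t * F x) p = t • chartRep (d := d) F p := rfl
    rw [jet₁, this, fderiv_const_smul (contDiffAt_chartRep_self hF p |>.differentiableAt (by simp))]
  have e2 : jet₂ d (fun x => t * F x) p = t • jet₂ d F p := by
    have : chartRep (fun x => t * F x) p = t • chartRep (d := d) F p := rfl
    have hF3 := contDiffAt_chartRep_self hF p
    have h4 : fderiv ℝ (chartRep (d := d) (fun x => t * F x) p) =ᶠ[𝓝 (coord d p p)]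
        t • fderiv ℝ (chartRep F p) := by
      filter_upwards [ContDiffAt.eventually_jets hF3] with z hz
      rw [this]
      exact (hz.1.const_smul t).fderiv
    rw [jet₂, h4.fderiv_eq, fderiv_const_smul (ContDiffAt.jets hF3).2.1.hasFDerivAt.differentiableAt]
  have e3 : holPart (jet₁ d (fun x => t * F x) p) v = t * holPart (jet₁ d F p) v := by
    rw [ef]; simp only [holPart, smul_apply, smul_eq_mul]; push_cast; ring
  have e4 : hermQuad (jet₂ d (fun x => t * F x) p) v = t * hermQuad (jet₂ d F p) v := by
    rw [e2]; simp only [hermQuad, smul_apply, smul_eq_mul]; ring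
  rw [e3, e4]
  convert key using 4
  · ring
  · congr 1
    push_cast
    ring

end Change

/-! ### Uniform estimates on a compact boundary -/

section Uniform

open Filter

variable {d : ℕ} {X : Type*} [TopologicalSpace X] [ChartedSpace (EuclideanSpace ℂ (Fin d)) X]
  [IsManifold (complexModel d) ω X] {Ω : Set X} {ρ φ : X → ℝ}

/-- Local uniformity of a combination of quadratic forms on the null vectors. -/
theorem IsDefiningFunction.exists_local_combination (h : IsDefiningFunction d Ω ρ) {p : X}
    {a b : EuclideanSpace ℂ (Fin d) × EuclideanSpace ℂ (Fin d) → ℝ}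
    (ha : ∀ v, ContinuousAt a (coord d p p, v)) (hb : ∀ v, ContinuousAt b (coord d p p, v))
    (ha2 : ∀ z v (c : ℝ), a (z, c • v) = c ^ 2 * a (z, v))
    (hb2 : ∀ z v (c : ℝ), b (z, c • v) = c ^ 2 * b (z, v))
    (hpos : ∀ v ≠ 0, holPart (jet₁ d ρ p) v = 0 → hermQuad (jet₂ d ρ p) v = 0 →
      0 < b (coord d p p, v)) :
    ∃ K : ℝ, ∀ᶠ q in 𝓝 p, q ∈ (extChartAt (realModel d) p).source ∧
      ∀ v ≠ 0, holPart (jet₁ d ρ q) v = 0 → hermQuad (jet₂ d ρ q) v = 0 →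
        0 < b (coord d p q, chartDeriv d q p v) ∧
        0 < a (coord d p q, chartDeriv d q p v) + K * b (coord d p q, chartDeriv d q p v) := by
  have hps := mem_extChartAt_source (I := realModel d) p
  obtain ⟨j0, j1, j2⟩ := ContDiffAt.jets (h.contDiffAt_self p)
  have hν : ∀ v, ContinuousAt (fun x : EuclideanSpace ℂ (Fin d) × EuclideanSpace ℂ (Fin d) =>
      (holPart (fderiv ℝ (chartRep ρ p) x.1) x.2,
        hermQuad (fderiv ℝ (fderiv ℝ (chartRep ρ p)) x.1) x.2)) (coord d p p, v) := by
    intro v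
    have t1 : Tendsto (fun x : EuclideanSpace ℂ (Fin d) × EuclideanSpace ℂ (Fin d) => x.1)
        (𝓝 (coord d p p, v)) (𝓝 (coord d p p)) := continuousAt_fst
    have t2 : Tendsto (fun x : EuclideanSpace ℂ (Fin d) × EuclideanSpace ℂ (Fin d) => x.2)
        (𝓝 (coord d p p, v)) (𝓝 v) := continuousAt_snd
    exact (tendsto_holPart (j1.continuousAt.tendsto.comp t1) t2).prodMk_nhds
      (tendsto_hermQuad (j2.continuousAt.tendsto.comp t1) t2)
  obtain ⟨K, hK⟩ := exists_pos_combination ha hb hν fun v hv h0 => hpos v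
    (fun h1 => by rw [h1, norm_zero] at hv; exact zero_ne_one hv)
    (congrArg Prod.fst h0) (congrArg Prod.snd h0)
  refine ⟨K, ?_⟩
  filter_upwards [(tendsto_coord hps).eventually hK,
    (isOpen_extChartAt_source (I := realModel d) p).mem_nhds hps] with q hq hqs
  refine ⟨hqs, fun v hv hv1 hv2 => ?_⟩
  have hf := h.contDiffAt hqs
  rw [jet₁, holPart_chart hqs hf] at hv1
  rw [jet₂, hermQuad_chart hqs hf] at hv2
  set w := chartDeriv d q p v with hw
  have hw0 : w ≠ 0 := chartDeriv_ne_zero q p hqs hv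
  have hn : 0 < ‖w‖ := norm_pos_iff.2 hw0
  -- Both forms are homogeneous of degree 2, which reduces the claim to the unit sphere.
  set u := ‖w‖⁻¹ • w with hu
  have hwu : w = ‖w‖ • u := by rw [hu, smul_smul, mul_inv_cancel₀ hn.ne', one_smul]
  have hu1 : ‖u‖ = 1 := by
    rw [hu, norm_smul, norm_inv, norm_norm, inv_mul_cancel₀ hn.ne']
  have hu2 : holPart (fderiv ℝ (chartRep ρ p) (coord d p q)) u = 0 := by
    rw [hu, ← ofReal_smul_eq, holPart_smul, hv1, mul_zero]
  have hu3 : hermQuad (fderiv ℝ (fderiv ℝ (chartRep ρ p)) (coord d p q)) u = 0 := by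
    rw [hu, hermQuad_real_smul, hv2, mul_zero]
  obtain ⟨k1, k2⟩ := hq u hu1 (Prod.ext hu2 hu3)
  rw [hwu, hb2, ha2]
  refine ⟨by positivity, ?_⟩
  have := mul_pos (pow_pos hn 2) k2
  linarith

/-- A continuous field of normal vectors, in a fixed chart. -/
theorem IsDefiningFunction.exists_normal_field (h : IsDefiningFunction d Ω ρ)
    (hL : LeviNonneg d Ω ρ) {p : X} (hp : p ∈ frontier Ω) {N₀ : EuclideanSpace ℂ (Fin d)}
    (hN₀ : holPart (jet₁ d ρ p) N₀ = 1) :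
    ∃ N : EuclideanSpace ℂ (Fin d) → EuclideanSpace ℂ (Fin d), N (coord d p p) = N₀ ∧
      ContinuousAt N (coord d p p) ∧ ∀ᶠ q in 𝓝 p, q ∈ frontier Ω →
        ∃ N', holPart (jet₁ d ρ q) N' = 1 ∧ ∀ v, holPart (jet₁ d ρ q) v = 0 →
          hermQuad (jet₂ d ρ q) v = 0 →
          hermForm (jet₂ d ρ q) v N' = hermForm (fderiv ℝ (fderiv ℝ (chartRep ρ p)) (coord d p q))
            (chartDeriv d q p v) (N (coord d p q)) ∧
          leviQuad (jet₂ d ρ q) (jet₃ d ρ q) N' v =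
            leviQuad (fderiv ℝ (fderiv ℝ (chartRep ρ p)) (coord d p q))
              (fderiv ℝ (fderiv ℝ (fderiv ℝ (chartRep ρ p))) (coord d p q)) (N (coord d p q))
              (chartDeriv d q p v) := by
  have hps := mem_extChartAt_source (I := realModel d) p
  obtain ⟨j0, j1, j2⟩ := ContDiffAt.jets (h.contDiffAt_self p)
  set c := fun z => holPart (fderiv ℝ (chartRep ρ p) z) N₀ with hc
  have hcont : ContinuousAt c (coord d p p) :=
    tendsto_holPart j1.continuousAt.tendsto tendsto_const_nhds
  have hc1 : c (coord d p p) = 1 := hN₀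
  have hne : ∀ᶠ z in 𝓝 (coord d p p), c z ≠ 0 :=
    hcont.eventually_ne (by rw [hc1]; exact one_ne_zero)
  -- A constant vector, renormalized so that ∂ρ of it is 1 at every nearby point.
  refine ⟨fun z => (c z)⁻¹ • N₀, ?_, ?_, ?_⟩
  · simp only [hc1, inv_one, one_smul]
  · exact (hcont.inv₀ (by rw [hc1]; exact one_ne_zero)).smul continuousAt_const
  · filter_upwards [(tendsto_coord hps).eventually hne,
      (isOpen_extChartAt_source (I := realModel d) p).mem_nhds hps,
      (tendsto_coord hps).eventually (hL.eventually_chart h hp)] with q hq hqs hlev hqf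
    obtain ⟨N', hN'⟩ := chartDeriv_surjective q p hqs ((c (coord d p q))⁻¹ • N₀)
    have hf := h.contDiffAt hqs
    have hlev := hlev ((chartRep_coord ρ hqs).trans (h.eq_zero hqf))
    have h1 : holPart (fderiv ℝ (chartRep ρ p) (coord d p q)) (chartDeriv d q p N') = 1 := by
      rw [hN', holPart_smul]
      exact inv_mul_cancel₀ hq
    refine ⟨N', by rw [jet₁, holPart_chart hqs hf, h1], fun v hv1 hv2 => ?_⟩
    rw [jet₁, holPart_chart hqs hf] at hv1
    rw [jet₂, hermQuad_chart hqs hf] at hv2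
    have h2 : hermForm (jet₂ d ρ q) v N' =
        hermForm (fderiv ℝ (fderiv ℝ (chartRep ρ p)) (coord d p q))
            (chartDeriv d q p v) ((c (coord d p q))⁻¹ • N₀) := by
      rw [jet₂, hermForm_chart hqs hf, hN']
    refine ⟨h2, ?_⟩
    rw [leviQuad, leviQuad, h2, normalTerm_chart hqs hf hlev h1 hv1 hv2, hN']

theorem continuousAt_leviQuad {f : EuclideanSpace ℂ (Fin d) → ℝ} {z : EuclideanSpace ℂ (Fin d)}
    (hf : ContDiffAt ℝ 3 f z) {N : EuclideanSpace ℂ (Fin d) → EuclideanSpace ℂ (Fin d)}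
    (hN : ContinuousAt N z) (v : EuclideanSpace ℂ (Fin d)) :
    ContinuousAt (fun x : EuclideanSpace ℂ (Fin d) × EuclideanSpace ℂ (Fin d) =>
      hermForm (fderiv ℝ (fderiv ℝ f) x.1) x.2 (N x.1)) (z, v) ∧
    ContinuousAt (fun x : EuclideanSpace ℂ (Fin d) × EuclideanSpace ℂ (Fin d) =>
      leviQuad (fderiv ℝ (fderiv ℝ f) x.1) (fderiv ℝ (fderiv ℝ (fderiv ℝ f)) x.1) (N x.1) x.2)
      (z, v) := by
  obtain ⟨j0, j1, j2⟩ := ContDiffAt.jets hf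
  have j3 : ContinuousAt (fderiv ℝ (fderiv ℝ (fderiv ℝ f))) z := by
    have h1 : ContDiffAt ℝ 2 (fderiv ℝ f) z := hf.fderiv_right (by norm_num)
    have h2 : ContDiffAt ℝ 1 (fderiv ℝ (fderiv ℝ f)) z := h1.fderiv_right (by norm_num)
    exact (h2.fderiv_right (m := 0) (by norm_num)).continuousAt
  have t1 : Tendsto (fun x : EuclideanSpace ℂ (Fin d) × EuclideanSpace ℂ (Fin d) => x.1)
      (𝓝 (z, v)) (𝓝 z) := continuousAt_fst
  have t2 : Tendsto (fun x : EuclideanSpace ℂ (Fin d) × EuclideanSpace ℂ (Fin d) => x.2)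
      (𝓝 (z, v)) (𝓝 v) := continuousAt_snd
  have tN := hN.tendsto.comp t1
  have tB := j2.continuousAt.tendsto.comp t1
  have tD := j3.tendsto.comp t1
  have hw := tendsto_hermForm tB t2 tN
  refine ⟨hw, ?_⟩
  have tBN : Tendsto (fun x : EuclideanSpace ℂ (Fin d) × EuclideanSpace ℂ (Fin d) =>
      fderiv ℝ (fderiv ℝ f) x.1 (N x.1)) (𝓝 (z, v)) (𝓝 (fderiv ℝ (fderiv ℝ f) z (N z))) :=
    tendsto_clm_apply tB tN
  have tDN : Tendsto (fun x : EuclideanSpace ℂ (Fin d) × EuclideanSpace ℂ (Fin d) =>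
      fderiv ℝ (fderiv ℝ (fderiv ℝ f)) x.1 (N x.1)) (𝓝 (z, v))
      (𝓝 (fderiv ℝ (fderiv ℝ (fderiv ℝ f)) z (N z))) :=
    (isBoundedBilinearMap_apply.continuous.tendsto
      (fderiv ℝ (fderiv ℝ (fderiv ℝ f)) z, N z)).comp (tD.prodMk_nhds tN)
  have hBN := tendsto_holPart tBN t2
  have hDN := tendsto_hermQuad tDN t2
  exact (((Complex.continuous_re.tendsto _).comp
    (((Complex.continuous_conj.tendsto _).comp hBN).mul hw)).sub (hDN.div_const 2)).sub
    (hw.norm.pow 2)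

/-- If the form `∂̄_b ω` is positive on the null vectors, then so is a definite improvement. -/
theorem BoundaryPos.exists_improvement (hb : BoundaryPos d Ω ρ 1 1) (h : IsDefiningFunction d Ω ρ)
    (hL : LeviNonneg d Ω ρ) (hc : IsCompact (frontier Ω)) :
    ∃ γ : ℝ, 0 < γ ∧ γ < 1 ∧ BoundaryPos d Ω ρ 1 (1 - γ) := by
  -- Since the boundary form does not depend on the normal vector on null vectors, the normal may be
  -- chosen anew near each point; what is made uniform over the compact boundary is only the
  -- constant K.
  have hex : ∃ K > 0, ∀ q ∈ frontier Ω, ∃ N, holPart (jet₁ d ρ q) N = 1 ∧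
      ∀ v ≠ 0, holPart (jet₁ d ρ q) v = 0 → hermQuad (jet₂ d ρ q) v = 0 →
        0 < leviQuad (jet₂ d ρ q) (jet₃ d ρ q) N v ∧
        0 < -‖hermForm (jet₂ d ρ q) v N‖ ^ 2 + K * leviQuad (jet₂ d ρ q) (jet₃ d ρ q) N v := by
    refine exists_uniform_of_local hc ?_ ?_
    · rintro q - K K' hKK ⟨N, hN, hN'⟩
      refine ⟨N, hN, fun v hv hv1 hv2 => ?_⟩
      obtain ⟨h3, h4⟩ := hN' v hv hv1 hv2
      have := mul_le_mul_of_nonneg_right hKK h3.le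
      exact ⟨h3, by linarith⟩
    · intro p hp
      obtain ⟨N₀, hN₀, hpos⟩ := hb p hp
      obtain ⟨N, hN, hNc, hev⟩ := h.exists_normal_field hL hp hN₀
      have hcont := continuousAt_leviQuad (h.contDiffAt_self p) hNc
      obtain ⟨K, hK⟩ := h.exists_local_combination (p := p)
        (a := fun x => -‖hermForm (fderiv ℝ (fderiv ℝ (chartRep ρ p)) x.1) x.2 (N x.1)‖ ^ 2)
        (b := fun x => leviQuad (fderiv ℝ (fderiv ℝ (chartRep ρ p)) x.1)
          (fderiv ℝ (fderiv ℝ (fderiv ℝ (chartRep ρ p))) x.1) (N x.1) x.2)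
        (fun v => ((hcont v).1.norm.pow 2).neg) (fun v => (hcont v).2)
        (fun z v c => by
          simp only
          rw [← ofReal_smul_eq, hermForm_smul_left, norm_mul, mul_pow, Complex.norm_real,
            Real.norm_eq_abs, sq_abs, mul_neg])
        (fun z v c => leviQuad_real_smul _ _ _ _ _)
        (fun v hv hv1 hv2 => by
          have := hpos v hv hv1 hv2
          rw [boundaryForm_eq_leviQuad] at this
          simpa [hN] using this)
      refine ⟨K, ?_⟩
      filter_upwards [hK, hev] with q hq hq' hqf
      obtain ⟨N', hN', hterm⟩ := hq' hqf
      refine ⟨N', hN', fun v hv hv1 hv2 => ?_⟩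
      obtain ⟨e1, e2⟩ := hterm v hv1 hv2
      rw [e1, e2]
      exact hq.2 v hv hv1 hv2
  obtain ⟨K, hK, hR⟩ := hex
  -- The exponent γ = 1/(K+1) is the one for which γ/(1-γ) = 1/K.
  have h1 : 1 / (1 - 1 / (K + 1)) - 1 = 1 / K := by
    have : K + 1 ≠ 0 := by positivity
    have : K ≠ 0 := hK.ne'
    rw [one_sub_div (by positivity), add_sub_cancel_right, one_div_div, add_div, div_self this]
    ring
  refine ⟨1 / (K + 1), by positivity, ?_, fun p hp => ?_⟩
  · rw [div_lt_one (by positivity)]; linarith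
  · obtain ⟨N, hN, hN'⟩ := hR p hp
    refine ⟨N, hN, fun v hv hv1 hv2 => ?_⟩
    rw [boundaryForm_eq_leviQuad, h1]
    obtain ⟨-, h3⟩ := hN' v hv hv1 hv2
    have := mul_pos (one_div_pos.2 hK) h3
    have h4 : 1 / K * (K * leviQuad (jet₂ d ρ p) (jet₃ d ρ p) N v) =
      leviQuad (jet₂ d ρ p) (jet₃ d ρ p) N v := by field_simp
    rw [mul_add, h4] at this
    linarith

/-- A strictly plurisubharmonic weight makes `∂̄_b ω` positive on the null vectors. -/
theorem exists_weight_boundaryPos (h : IsDefiningFunction d Ω ρ) (hL : LeviNonneg d Ω ρ)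
    (hc : IsCompact (frontier Ω)) (hφ : ContMDiff (realModel d) 𝓘(ℝ, ℝ) ∞ φ)
    (hφpos : ∀ p ∈ frontier Ω, ∀ v ≠ 0, 0 < hermQuad (jet₂ d φ p) v) :
    ∃ K : ℝ, BoundaryPos d Ω (fun x => Real.exp (-K * φ x) * ρ x) 1 1 := by
  have hex : ∃ K > 0, ∀ q ∈ frontier Ω, ∃ N, holPart (jet₁ d ρ q) N = 1 ∧
      ∀ v ≠ 0, holPart (jet₁ d ρ q) v = 0 → hermQuad (jet₂ d ρ q) v = 0 →
        0 < leviQuad (jet₂ d ρ q) (jet₃ d ρ q) N v + K * hermQuad (jet₂ d φ q) v := by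
    refine exists_uniform_of_local hc ?_ ?_
    · rintro q hq K K' hKK ⟨N, hN, hN'⟩
      refine ⟨N, hN, fun v hv hv1 hv2 => ?_⟩
      have h4 := hN' v hv hv1 hv2
      have := mul_le_mul_of_nonneg_right hKK (hφpos q hq v hv).le
      linarith
    · intro p hp
      obtain ⟨N₀, hN₀⟩ := exists_normal h hp
      obtain ⟨N, hN, hNc, hev⟩ := h.exists_normal_field hL hp hN₀
      have hcont := continuousAt_leviQuad (h.contDiffAt_self p) hNc
      have hφ3 := contDiffAt_chartRep_self hφ p
      obtain ⟨K, hK⟩ := h.exists_local_combination (p := p)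
        (a := fun x => leviQuad (fderiv ℝ (fderiv ℝ (chartRep ρ p)) x.1)
          (fderiv ℝ (fderiv ℝ (fderiv ℝ (chartRep ρ p))) x.1) (N x.1) x.2)
        (b := fun x => hermQuad (fderiv ℝ (fderiv ℝ (chartRep φ p)) x.1) x.2)
        (fun v => (hcont v).2)
        (fun v => tendsto_hermQuad ((ContDiffAt.jets hφ3).2.2.continuousAt.tendsto.comp
          continuousAt_fst) continuousAt_snd)
        (fun z v c => leviQuad_real_smul _ _ _ _ _)
        (fun z v c => hermQuad_real_smul _ _ _)
        (fun v hv _ _ => hφpos p hp v hv)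
      refine ⟨K, ?_⟩
      filter_upwards [hK, hev] with q hq hq' hqf
      obtain ⟨N', hN', hterm⟩ := hq' hqf
      refine ⟨N', hN', fun v hv hv1 hv2 => ?_⟩
      obtain ⟨e1, e2⟩ := hterm v hv1 hv2
      have hφq : ContDiffAt ℝ 3 (chartRep φ p) (coord d p q) :=
        (contDiffAt_chartRep (hφ q) hq.1).of_le three_le_infty
      rw [e2, jet₂, hermQuad_chart hq.1 hφq]
      exact (hq.2 v hv hv1 hv2).2
  obtain ⟨K, hK, hR⟩ := hex
  refine ⟨K, fun p hp => ?_⟩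
  have hKφ : ContMDiff (realModel d) 𝓘(ℝ, ℝ) ∞ (fun x => -K * φ x) := contMDiff_const.mul hφ
  obtain ⟨N, hN, hN'⟩ := hR p hp
  have hv0 : holPart (jet₁ d ρ p) 0 = 0 := by simp [holPart]
  refine ⟨(Real.exp (-K * φ p))⁻¹ • N, (h.exp_mul_terms hKφ hp hN hv0).1,
    fun v hv hv1 hv2 => ?_⟩
  rw [h.holPart_exp_mul_iff hKφ hp] at hv1
  obtain ⟨-, -, a3, a4, a5⟩ := h.exp_mul_terms hKφ hp hN hv1
  rw [a3, mul_eq_zero, or_iff_right (Real.exp_pos _).ne'] at hv2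
  rw [boundaryForm_eq_leviQuad, a5 hv2]
  have e : hermQuad (jet₂ d (fun x => -K * φ x) p) v = -K * hermQuad (jet₂ d φ p) v := by
    have hφ3 := contDiffAt_chartRep_self hφ p
    have h4 : fderiv ℝ (chartRep (d := d) (fun x => -K * φ x) p) =ᶠ[𝓝 (coord d p p)]
        (-K) • fderiv ℝ (chartRep φ p) := by
      filter_upwards [ContDiffAt.eventually_jets hφ3] with z hz
      exact (hz.1.const_smul (-K)).fderiv
    rw [jet₂, h4.fderiv_eq,
      fderiv_const_smul (ContDiffAt.jets hφ3).2.1.hasFDerivAt.differentiableAt]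
    simp only [hermQuad, smul_apply, smul_eq_mul]; ring
  rw [e]
  have := hN' v hv hv1 hv2
  -- For σ = κ = 1 the coefficient of |w|² is zero, so only ∂̄_b ω remains and the unknown size of
  -- the change of ω by ∂φ is harmless.
  simp only [one_mul, div_one, sub_self, zero_mul, sub_zero]
  linarith

end Uniform

/-! ### Stein manifolds and Takeuchi 1-convex domains -/

section Existence

open Filter

variable {d : ℕ} {X : Type*} [TopologicalSpace X] [ChartedSpace (EuclideanSpace ℂ (Fin d)) X]
  [IsManifold (complexModel d) ω X] {Ω : Set X} {ρ φ : X → ℝ}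

/-- The hermitian quadratic form of the second derivative of `‖x‖²`. -/
theorem hermQuad_norm_sq (z v : EuclideanSpace ℂ (Fin d)) :
    hermQuad (fderiv ℝ (fderiv ℝ (fun x : EuclideanSpace ℂ (Fin d) => ‖x‖ ^ 2)) z) v = ‖v‖ ^ 2 := by
  set B : EuclideanSpace ℂ (Fin d) →L[ℝ] EuclideanSpace ℂ (Fin d) →L[ℝ] ℝ :=
    (ContinuousLinearMap.compL ℝ (EuclideanSpace ℂ (Fin d)) ℂ ℝ Complex.reCLM).comp
      (isBoundedBilinearMap_inner (𝕜 := ℂ)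
        (E := EuclideanSpace ℂ (Fin d))).toContinuousLinearMap with hB
  have hBs : ∀ x y, B x y = (inner ℂ x y : ℂ).re := fun x y => rfl
  have hBx : ∀ x, B x x = ‖x‖ ^ 2 := fun x => by
    rw [hBs]
    exact inner_self_eq_norm_sq (𝕜 := ℂ) x
  have h1 : (fun x : EuclideanSpace ℂ (Fin d) => ‖x‖ ^ 2) = fun x => B x x :=
    funext fun x => (hBx x).symm
  have h2 : ∀ x, HasFDerivAt (fun x => B x x) ((B + B.flip) x) x := by
    intro x
    have h3 := B.isBoundedBilinearMap.hasFDerivAt (x, x)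
    have h4 : HasFDerivAt (fun y : EuclideanSpace ℂ (Fin d) => (y, y))
        ((ContinuousLinearMap.id ℝ (EuclideanSpace ℂ (Fin d))).prod (.id ℝ _)) x :=
      (hasFDerivAt_id x).prodMk (hasFDerivAt_id x)
    refine (HasFDerivAt.comp (g := fun p : EuclideanSpace ℂ (Fin d) × EuclideanSpace ℂ (Fin d) =>
      B p.1 p.2) (f := fun y => (y, y)) x h3 h4).congr_fderiv ?_
    ext y
    simp
  have h5 : fderiv ℝ (fun x : EuclideanSpace ℂ (Fin d) => ‖x‖ ^ 2) = fun x => (B + B.flip) x := by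
    rw [h1]
    exact funext fun x => (h2 x).fderiv
  rw [h5, ContinuousLinearMap.fderiv]
  simp only [hermQuad, add_apply, ContinuousLinearMap.flip_apply, hBx, norm_smul, Complex.norm_I,
    one_mul]
  ring

theorem differentiableOn_of_mdifferentiable {F : X → EuclideanSpace ℂ (Fin d)}
    (hF : MDifferentiable (complexModel d) (complexModel d) F) (p : X) :
    DifferentiableOn ℂ (F ∘ (extChartAt (realModel d) p).symm)
      (extChartAt (realModel d) p).target := by
  have : IsManifold (complexModel d) 1 X := .of_le (n := ω) le_top
  have h := hF.comp_mdifferentiableOn (mdifferentiableOn_extChartAt_symm (I := complexModel d)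
    (x := p))
  exact mdifferentiableOn_iff_differentiableOn.1 h

theorem mfderiv_eq_fderiv_chart {F : X → EuclideanSpace ℂ (Fin d)}
    (hF : MDifferentiable (complexModel d) (complexModel d) F) (p : X)
    (v : EuclideanSpace ℂ (Fin d)) : mfderiv (complexModel d) (complexModel d) F p v =
      fderiv ℂ (F ∘ (extChartAt (realModel d) p).symm) (coord d p p) v := by
  have h : mfderiv (complexModel d) (complexModel d) F p = fderivWithin ℂ
      (writtenInExtChartAt (complexModel d) (complexModel d) p F) (Set.range (complexModel d))
      (extChartAt (complexModel d) p p) := (hF p).mfderiv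
  rw [h]
  simp only [modelWithCornersSelf_coe, Set.range_id, fderivWithin_univ]
  rfl

/-- The squared norm of a holomorphic map is plurisubharmonic, strictly where the map is
immersive. -/
theorem norm_sq_psh {F : X → EuclideanSpace ℂ (Fin d)}
    (hF : MDifferentiable (complexModel d) (complexModel d) F) :
    ContMDiff (realModel d) 𝓘(ℝ, ℝ) ∞ (fun x => ‖F x‖ ^ 2) ∧
    ∀ (p : X) (v : EuclideanSpace ℂ (Fin d)), hermQuad (jet₂ d (fun x => ‖F x‖ ^ 2) p) v =
      ‖fderiv ℂ (F ∘ (extChartAt (realModel d) p).symm) (coord d p p) v‖ ^ 2 := by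
  have hG : ∀ p : X, ContDiffAt ℝ ∞ (F ∘ (extChartAt (realModel d) p).symm) (coord d p p) := by
    intro p
    exact ((contDiffOn_infty_of_differentiableOn (isOpen_extChartAt_target p)
      (differentiableOn_of_mdifferentiable hF p)).contDiffAt
        (target_mem_nhds_coord (mem_extChartAt_source p))).restrict_scalars ℝ
  refine ⟨fun p => contMDiffAt_of_chartRep (p := p) ?_ (mem_extChartAt_source p), fun p v => ?_⟩
  · exact (contDiff_norm_sq ℂ).contDiffAt.comp _ (hG p)
  · have hd := differentiableOn_of_mdifferentiable hF p
    have hev : ∀ᶠ x in 𝓝 (coord d p p),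
        DifferentiableAt ℂ (F ∘ (extChartAt (realModel d) p).symm) x := by
      filter_upwards [(isOpen_extChartAt_target p).mem_nhds
        (coord_mem_target p (mem_extChartAt_source p))] with x hx
      exact hd.differentiableAt ((isOpen_extChartAt_target p).mem_nhds hx)
    -- Invariance of the hermitian form uses only complex linearity of the derivative, so it applies
    -- to `F`, which need not be a local coordinate system away from the chosen point.
    have h := (comp_holomorphic_terms (f := fun x : EuclideanSpace ℂ (Fin d) => ‖x‖ ^ 2)
      (τ := F ∘ (extChartAt (realModel d) p).symm) (z := coord d p p)
      (contDiff_norm_sq ℂ).contDiffAt ((hG p).of_le three_le_infty) (by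
        filter_upwards [hev] with x hx v
        rw [hx.fderiv_restrictScalars ℝ]
        simp)).2.2.1 v
    rw [hermQuad_norm_sq, hev.self_of_nhds.fderiv_restrictScalars ℝ] at h
    exact h

/-- The case a = 0 and ν = 0 of `exists_pos_combination`: positivity on the unit sphere is an open
condition by compactness. -/
theorem eventually_hermQuad_pos (hφ : ContMDiff (realModel d) 𝓘(ℝ, ℝ) ∞ φ) {p : X}
    (hp : ∀ v ≠ 0, 0 < hermQuad (jet₂ d φ p) v) :
    ∀ᶠ q in 𝓝 p, ∀ v ≠ 0, 0 < hermQuad (jet₂ d φ q) v := by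
  have hps := mem_extChartAt_source (I := realModel d) p
  have hφ3 := contDiffAt_chartRep_self hφ p
  obtain ⟨K, hK⟩ := exists_pos_combination (z₀ := coord d p p) (a := fun _ => 0)
    (b := fun x => hermQuad (fderiv ℝ (fderiv ℝ (chartRep φ p)) x.1) x.2) (ν := fun _ => (0 : ℝ))
    (fun v => continuousAt_const) (fun v => tendsto_hermQuad
      ((ContDiffAt.jets hφ3).2.2.continuousAt.tendsto.comp continuousAt_fst) continuousAt_snd)
    (fun v => continuousAt_const)
    (fun v hv _ => hp v (fun h1 => by rw [h1, norm_zero] at hv; exact zero_ne_one hv))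
  filter_upwards [(tendsto_coord hps).eventually hK,
    (isOpen_extChartAt_source (I := realModel d) p).mem_nhds hps] with q hq hqs v hv
  have hφq : ContDiffAt ℝ 3 (chartRep φ p) (coord d p q) :=
    (contDiffAt_chartRep (hφ q) hqs).of_le three_le_infty
  rw [jet₂, hermQuad_chart hqs hφq]
  set w := chartDeriv d q p v with hw
  have hn : 0 < ‖w‖ := norm_pos_iff.2 (chartDeriv_ne_zero q p hqs hv)
  have hwu : w = ‖w‖ • (‖w‖⁻¹ • w) := by rw [smul_smul, mul_inv_cancel₀ hn.ne', one_smul]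
  have h1 := (hq (‖w‖⁻¹ • w) (by rw [norm_smul, norm_inv, norm_norm, inv_mul_cancel₀ hn.ne'])
    rfl).1
  rw [hwu, hermQuad_real_smul]
  exact mul_pos (pow_pos hn 2) h1

theorem jet₂_add {u w : X → ℝ} (hu : ContMDiff (realModel d) 𝓘(ℝ, ℝ) ∞ u)
    (hw : ContMDiff (realModel d) 𝓘(ℝ, ℝ) ∞ w) (p : X) :
    jet₂ d (fun x => u x + w x) p = jet₂ d u p + jet₂ d w p := by
  have hu3 := contDiffAt_chartRep_self hu p
  have hw3 := contDiffAt_chartRep_self hw p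
  have h4 : fderiv ℝ (chartRep (d := d) (fun x => u x + w x) p) =ᶠ[𝓝 (coord d p p)]
      fderiv ℝ (chartRep u p) + fderiv ℝ (chartRep w p) := by
    filter_upwards [ContDiffAt.eventually_jets hu3, ContDiffAt.eventually_jets hw3] with z hz hz'
    exact (hz.1.add hz'.1).fderiv
  rw [jet₂, h4.fderiv_eq]
  exact fderiv_add (ContDiffAt.jets hu3).2.1.hasFDerivAt.differentiableAt
    (ContDiffAt.jets hw3).2.1.hasFDerivAt.differentiableAt

/-- On a Stein manifold there is a plurisubharmonic function which is strictly plurisubharmonic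
along a given compact set. -/
theorem IsStein.exists_weight (hX : IsStein d X) {S : Set X} (hS : IsCompact S) :
    ∃ φ : X → ℝ, ContMDiff (realModel d) 𝓘(ℝ, ℝ) ∞ φ ∧
      ∀ p ∈ S, ∀ v ≠ 0, 0 < hermQuad (jet₂ d φ p) v := by
  -- Plurisubharmonicity on all of `X` is carried along, so that the sum of two weights is strict on
  -- the union of the sets where either one is.
  have key : ∃ φ : X → ℝ, ContMDiff (realModel d) 𝓘(ℝ, ℝ) ∞ φ ∧
      (∀ p v, 0 ≤ hermQuad (jet₂ d φ p) v) ∧ ∀ p ∈ S, ∀ v ≠ 0, 0 < hermQuad (jet₂ d φ p) v := by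
    refine hS.induction_on (p := fun s => ∃ φ : X → ℝ, ContMDiff (realModel d) 𝓘(ℝ, ℝ) ∞ φ ∧
      (∀ p v, 0 ≤ hermQuad (jet₂ d φ p) v) ∧ ∀ p ∈ s, ∀ v ≠ 0, 0 < hermQuad (jet₂ d φ p) v)
      ?_ ?_ ?_ ?_
    · refine ⟨fun _ => 0, contMDiff_const, fun p v => ?_, by simp⟩
      have h : chartRep (d := d) (fun _ : X => (0 : ℝ)) p = fun _ => 0 := rfl
      simp [jet₂, h, hermQuad]
    · rintro s t hst ⟨φ, h1, h2, h3⟩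
      exact ⟨φ, h1, h2, fun p hp => h3 p (hst hp)⟩
    · rintro s t ⟨φ, h1, h2, h3⟩ ⟨φ', h1', h2', h3'⟩
      have e : ∀ p v, hermQuad (jet₂ d (fun x => φ x + φ' x) p) v =
          hermQuad (jet₂ d φ p) v + hermQuad (jet₂ d φ' p) v := by
        intro p v
        rw [jet₂_add h1 h1']
        simp only [hermQuad, add_apply]
        ring
      refine ⟨fun x => φ x + φ' x, h1.add h1', fun p v => ?_, fun p hp v hv => ?_⟩
      · rw [e]
        exact add_nonneg (h2 p v) (h2' p v)
      · rw [e]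
        rcases hp with hp | hp
        · exact add_pos_of_pos_of_nonneg (h3 p hp v hv) (h2' p v)
        · exact add_pos_of_nonneg_of_pos (h2 p v) (h3' p hp v hv)
    · intro p hp
      -- Near p the weight is ‖F‖² for a global holomorphic map giving coordinates at p.
      obtain ⟨F, hF, hbij⟩ := hX.coordinates p
      obtain ⟨h1, h2⟩ := norm_sq_psh hF
      have hpos : ∀ v ≠ 0, 0 < hermQuad (jet₂ d (fun x => ‖F x‖ ^ 2) p) v := by
        intro v hv
        rw [h2]
        refine pow_pos (norm_pos_iff.2 fun h0 => hv ?_) 2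
        rw [← mfderiv_eq_fderiv_chart hF] at h0
        exact hbij.1 (h0.trans (map_zero _).symm)
      refine ⟨_, mem_nhdsWithin_of_mem_nhds (eventually_hermQuad_pos h1 hpos), _, h1, ?_, ?_⟩
      · intro q v
        rw [h2]
        positivity
      · exact fun q hq => hq
  obtain ⟨φ, h1, -, h3⟩ := key
  exact ⟨φ, h1, h3⟩

open Bundle in
/-- A hermitian metric is locally bounded below by the euclidean metric of a chart. -/
theorem HermitianMetric.exists_lower_bound (g : HermitianMetric d X) (p : X) :
    ∃ ε > 0, ∀ᶠ q in 𝓝 p, ∀ v : TangentSpace (realModel d) q,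
      ε * ‖chartDeriv d q p v‖ ^ 2 ≤ g.inner q v v := by
  have : IsManifold (realModel d) 1 X := .of_le (n := ω) le_top
  -- With `g` as the norm on tangent spaces, the bound is local boundedness of the operator norm of
  -- the tangent bundle trivialization, which is the chart derivative.
  letI : Bundle.RiemannianBundle (fun q : X => TangentSpace (realModel d) q) :=
    ⟨g.toContMDiffRiemannianMetric.toContinuousRiemannianMetric.toRiemannianMetric⟩
  obtain ⟨C, hC, hev⟩ := eventually_norm_trivializationAt_lt (EuclideanSpace ℂ (Fin d))
    (fun q : X => TangentSpace (realModel d) q) p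
  refine ⟨(C ^ 2)⁻¹, by positivity, ?_⟩
  filter_upwards [hev, (isOpen_extChartAt_source (I := realModel d) p).mem_nhds
    (mem_extChartAt_source p)] with q hq hqs v
  have hqs' := hqs
  rw [extChartAt_source] at hqs'
  have h1 : (trivializationAt (EuclideanSpace ℂ (Fin d))
      (fun q : X => TangentSpace (realModel d) q) p).continuousLinearMapAt ℝ q v =
      chartDeriv d q p v := by
    rw [TangentBundle.continuousLinearMapAt_trivializationAt hqs', mfderiv_extChartAt_eq q p hqs]
    rfl
  have h2 := ((trivializationAt (EuclideanSpace ℂ (Fin d))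
      (fun q : X => TangentSpace (realModel d) q) p).continuousLinearMapAt ℝ q).le_opNorm v
  rw [h1] at h2
  have h3 : ‖chartDeriv d q p v‖ ≤ C * ‖v‖ :=
    h2.trans (mul_le_mul_of_nonneg_right hq.le (norm_nonneg _))
  have h4 : g.inner q v v = ‖v‖ ^ 2 := by
    rw [← real_inner_self_eq_norm_sq]
    rfl
  rw [h4, inv_mul_le_iff₀ (by positivity), ← mul_pow]
  exact pow_le_pow_left₀ (norm_nonneg _) h3 2

/-- On a Takeuchi 1-convex domain the form `∂̄_b ω` is positive on the null vectors. -/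
theorem IsTakeuchiOneConvex.exists_boundaryPos (h : IsTakeuchiOneConvex d Ω) :
    ∃ ρ : X → ℝ, IsDefiningFunction d Ω ρ ∧ LeviNonneg d Ω ρ ∧ BoundaryPos d Ω ρ 1 1 := by
  obtain ⟨ρ, hρ, g, W, hW, hsub, hg⟩ := h
  have key : ∀ p ∈ frontier Ω, ∃ ε > 0, ∀ N, holPart (jet₁ d ρ p) N = 1 → ∀ v,
      holPart (jet₁ d ρ p) v = 0 → 0 ≤ hermQuad (jet₂ d ρ p) v ∧ (hermQuad (jet₂ d ρ p) v = 0 →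
      ε * ‖v‖ ^ 2 ≤ boundaryForm (jet₂ d ρ p) (jet₃ d ρ p) 1 1 N v) := by
    intro p hp
    obtain ⟨ε, hε, hev⟩ := g.exists_lower_bound p
    refine ⟨ε, hε, fun N hN v hv => hρ.boundaryForm_ge (one_pow 2) one_pos hε.le hp ?_ hN hv⟩
    filter_upwards [hev, hW.mem_nhds (hsub hp)] with q hq hqW h0 v
    have hneg : ρ q < 0 := by linarith
    have hqΩ : q ∈ Ω := by rw [hρ.eq_neg]; exact hneg
    have h1 := (hq v).trans (hg q ⟨hqΩ, hqW⟩ v)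
    have h0' : chartRep ρ q (coord d q q) < 0 := by rwa [chartRep_coord_self]
    have e := hermQuad_neg_log (hρ.contDiffAt_self q) h0' v
    rw [chartRep_coord_self] at e
    have h2 := h1.trans_eq e
    -- Multiplying by -ρ turns the Oka condition into the weak inequality with κ = 1 and an error
    -- term proportional to -ρ, which is exactly the term with ε in `boundaryForm_ge`.
    rw [inv_mul_eq_div, le_div_iff₀ h0] at h2
    rw [mul_comm (-(1 * ρ q))]
    exact h2
  refine ⟨ρ, hρ, fun p hp v hv => ?_, fun p hp => ?_⟩
  · obtain ⟨N, hN⟩ := exists_normal hρ hp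
    obtain ⟨ε, hε, hk⟩ := key p hp
    exact (hk N hN v hv).1
  · obtain ⟨N, hN⟩ := exists_normal hρ hp
    obtain ⟨ε, hε, hk⟩ := key p hp
    refine ⟨N, hN, fun v hv hv1 hv2 => lt_of_lt_of_le ?_ ((hk N hN v hv1).2 hv2)⟩
    have := norm_pos_iff.2 hv
    positivity

end Existence

/-! ### Exterior derivatives of forms on a parametrized hypersurface -/

section FlatCR

open Filter

variable {E : Type*} [NormedAddCommGroup E] [NormedSpace ℂ E] [NormedSpace ℝ E]
  [IsScalarTower ℝ ℂ E]

/-- Multiplication by `i` as a real linear map. -/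
def mulI (E : Type*) [NormedAddCommGroup E] [NormedSpace ℂ E] [NormedSpace ℝ E]
    [IsScalarTower ℝ ℂ E] : E →L[ℝ] E :=
  (Complex.I • ContinuousLinearMap.id ℂ E).restrictScalars ℝ

@[simp] theorem mulI_apply (v : E) : mulI E v = Complex.I • v := rfl

/-- `holPart` as a continuous linear map. -/
def holPartCLM (E : Type*) [NormedAddCommGroup E] [NormedSpace ℂ E] [NormedSpace ℝ E]
    [IsScalarTower ℝ ℂ E] : (E →L[ℝ] ℝ) →L[ℝ] (E →L[ℝ] ℂ) :=
  (1 / 2 : ℂ) • (ContinuousLinearMap.compL ℝ E ℝ ℂ Complex.ofRealCLM -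
    Complex.I • (ContinuousLinearMap.compL ℝ E ℝ ℂ Complex.ofRealCLM).comp
      ((ContinuousLinearMap.compL ℝ E E ℝ).flip (mulI E)))

theorem holPartCLM_apply (l : E →L[ℝ] ℝ) (v : E) : holPartCLM E l v = holPart l v := by
  simp only [holPartCLM, holPart, smul_apply, sub_apply, ContinuousLinearMap.comp_apply,
    ContinuousLinearMap.flip_apply, ContinuousLinearMap.compL_apply, Complex.ofRealCLM_apply,
    mulI_apply, smul_eq_mul]
  ring

/-- `hermForm B · w` as a continuous linear map. -/
def hermFormCLM (B : E →L[ℝ] E →L[ℝ] ℝ) (w : E) : E →L[ℝ] ℂ :=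
  (1 / 2 : ℂ) • (holPartCLM E (B.flip w) + Complex.I • holPartCLM E (B.flip (mulI E w)))

theorem hermFormCLM_apply (B : E →L[ℝ] E →L[ℝ] ℝ) (v w : E) :
    hermFormCLM B w v = hermForm B v w := by
  simp only [hermFormCLM, hermForm, smul_apply, add_apply, holPartCLM_apply, holPart,
    ContinuousLinearMap.flip_apply, mulI_apply, smul_eq_mul]
  push_cast
  linear_combination (-(1 / 4) * (B (Complex.I • v) (Complex.I • w) : ℂ)) * Complex.I_sq

/-- The real bilinear 1-form `-(i ε / 2) l(i ·)`. -/
def contactCLM (ε : ℝ) (l : E →L[ℝ] ℝ) : E →L[ℝ] ℂ :=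
  (-(Complex.I * ε / 2)) • Complex.ofRealCLM.comp (l.comp (mulI E))

theorem contactCLM_apply (ε : ℝ) (l : E →L[ℝ] ℝ) (v : E) :
    contactCLM ε l v = -(Complex.I * ε / 2) * l (Complex.I • v) := rfl

/-- The D'Angelo form of a hypersurface with 1-jet `l`, 2-jet `B` and normal vector `N`. -/
def dAngeloCLM (l : E →L[ℝ] ℝ) (B : E →L[ℝ] E →L[ℝ] ℝ) (N : E) : E →L[ℝ] ℂ :=
  hermFormCLM B N - (hermQuad B N : ℂ) • holPartCLM E l

/-- The second term is there to kill `N`: when ∂ρ(N) = 1 the form vanishes at `N`, hence on the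
transversal direction, while on the complex tangent space it reduces to H(·,N). -/
theorem dAngeloCLM_apply (l : E →L[ℝ] ℝ) (B : E →L[ℝ] E →L[ℝ] ℝ) (N v : E) :
    dAngeloCLM l B N v = hermForm B v N - hermQuad B N * holPart l v := by
  simp only [dAngeloCLM, sub_apply, smul_apply, hermFormCLM_apply, holPartCLM_apply, smul_eq_mul]

theorem hasDerivAt_holPart {φ : ℝ → E →L[ℝ] ℝ} {φ' : E →L[ℝ] ℝ} {N : ℝ → E} {N' : E} {t : ℝ}
    (h : HasDerivAt φ φ' t) (hN : HasDerivAt N N' t) :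
    HasDerivAt (fun t => holPart (φ t) (N t)) (holPart φ' (N t) + holPart (φ t) N') t := by
  have h1 := (h.clm_apply hN).ofReal_comp
  have h2 := (h.clm_apply (hN.const_smul Complex.I)).ofReal_comp
  refine ((h1.sub (h2.const_mul Complex.I)).div_const 2).congr_deriv ?_
  simp only [holPart, Pi.smul_apply]
  push_cast
  ring

theorem hasDerivAt_hermForm {φ : ℝ → E →L[ℝ] E →L[ℝ] ℝ} {φ' : E →L[ℝ] E →L[ℝ] ℝ} {N : ℝ → E}
    {N' : E} {t : ℝ} (h : HasDerivAt φ φ' t) (hN : HasDerivAt N N' t) (v : E) :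
    HasDerivAt (fun t => hermForm (φ t) v (N t)) (hermForm φ' v (N t) + hermForm (φ t) v N') t := by
  have hv := h.clm_apply (hasDerivAt_const t v)
  have hIv := h.clm_apply (hasDerivAt_const t (Complex.I • v))
  simp only [map_zero, add_zero] at hv hIv
  have hIN := hN.const_smul Complex.I
  refine (((((hv.clm_apply hN).add (hIv.clm_apply hIN)).ofReal_comp).add
    ((((hv.clm_apply hIN).sub (hIv.clm_apply hN)).ofReal_comp).const_mul
      Complex.I)).div_const 4).congr_deriv ?_
  simp only [hermForm, Pi.smul_apply]
  push_cast
  ring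

theorem hermForm_re (B : E →L[ℝ] E →L[ℝ] ℝ) (v w : E) : (hermForm B v w).re =
    (B v w + B (Complex.I • v) (Complex.I • w)) / 4 := by
  simp [hermForm]

theorem hermForm_im (B : E →L[ℝ] E →L[ℝ] ℝ) (v w : E) : (hermForm B v w).im =
    (B v (Complex.I • w) - B (Complex.I • v) w) / 4 := by
  simp [hermForm]

theorem fderiv_fderiv_fderiv_symm {f : E → ℝ} {p : E} (hf : ContDiffAt ℝ 3 f p) (u v w : E) :
    fderiv ℝ (fderiv ℝ (fderiv ℝ f)) p u v w = fderiv ℝ (fderiv ℝ (fderiv ℝ f)) p v u w ∧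
    fderiv ℝ (fderiv ℝ (fderiv ℝ f)) p u v w = fderiv ℝ (fderiv ℝ (fderiv ℝ f)) p u w v := by
  have h1 : ContDiffAt ℝ 2 (fderiv ℝ f) p := hf.fderiv_right (by norm_num)
  constructor
  · have := (h1.isSymmSndFDerivAt (by simp)).eq u v
    exact DFunLike.congr_fun this w
  · have h2 := (ContDiffAt.jets hf).2.2.hasFDerivAt
    have h3 := (hasFDerivAt_apply_const h2 v)
    have a := hasFDerivAt_apply_const h3 w
    have b := hasFDerivAt_apply_const (hasFDerivAt_apply_const h2 w) v
    have hs : (fun q => fderiv ℝ (fderiv ℝ f) q v w) =ᶠ[𝓝 p]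
        fun q => fderiv ℝ (fderiv ℝ f) q w v := by
      filter_upwards [hf.eventually (by simp)] with q hq
      exact ContDiffAt.fderiv_fderiv_symm hq v w
    have := (a.congr_of_eventuallyEq hs.symm).unique b
    simpa using DFunLike.congr_fun this u

variable {G : Type*} [NormedAddCommGroup G] [NormedSpace ℝ G]

theorem hasDerivAt_line {F : Type*} [NormedAddCommGroup F] [NormedSpace ℝ F] {g : G → F}
    {g' : G →L[ℝ] F} {y : G} (hg : HasFDerivAt g g' y) (c : G) :
    HasDerivAt (fun t : ℝ => g (y + t • c)) (g' c) 0 := by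
  have h : HasDerivAt (fun t : ℝ => y + t • c) c 0 := by
    simpa using ((hasDerivAt_id (0 : ℝ)).smul_const c).const_add y
  exact hg.comp_hasDerivAt_of_eq (0 : ℝ) h (by simp)

theorem contDiffAt_flip {n : WithTop ℕ∞} {L : G → E →L[ℝ] E →L[ℝ] ℝ} {y : G}
    (hL : ContDiffAt ℝ n L y) : ContDiffAt ℝ n (fun z => (L z).flip) y :=
  ContDiffAt.comp (g := ContinuousLinearMap.flipₗᵢ ℝ E E ℝ) y
    (LinearIsometryEquiv.contDiff _).contDiffAt hL

theorem contDiffAt_hermQuad {n : WithTop ℕ∞} {L : G → E →L[ℝ] E →L[ℝ] ℝ} {N : G → E} {y : G}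
    (hL : ContDiffAt ℝ n L y) (hN : ContDiffAt ℝ n N y) :
    ContDiffAt ℝ n (fun z => hermQuad (L z) (N z)) y := by
  have h1 : ContDiffAt ℝ n (fun z => mulI E (N z)) y := (mulI E).contDiff.contDiffAt.comp y hN
  exact (((hL.clm_apply hN).clm_apply hN).add ((hL.clm_apply h1).clm_apply h1)).div_const (4 : ℝ)

theorem contDiffAt_dAngeloCLM {n : WithTop ℕ∞} {l : G → E →L[ℝ] ℝ} {L : G → E →L[ℝ] E →L[ℝ] ℝ}
    {N : G → E} {y : G} (hl : ContDiffAt ℝ n l y) (hL : ContDiffAt ℝ n L y)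
    (hN : ContDiffAt ℝ n N y) : ContDiffAt ℝ n (fun z => dAngeloCLM (l z) (L z) (N z)) y := by
  have e3 := contDiffAt_flip hL
  have e4 : ContDiffAt ℝ n (fun z => mulI E (N z)) y := (mulI E).contDiff.contDiffAt.comp y hN
  have e6 : ContDiffAt ℝ n (fun z => ((hermQuad (L z) (N z) : ℝ) : ℂ)) y :=
    Complex.ofRealCLM.contDiff.contDiffAt.comp y (contDiffAt_hermQuad hL hN)
  have e7 := (holPartCLM E).contDiff.contDiffAt.comp y (e3.clm_apply hN)
  have e8 := (holPartCLM E).contDiff.contDiffAt.comp y (e3.clm_apply e4)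
  have e9 := (holPartCLM E).contDiff.contDiffAt.comp y hl
  exact ((e7.add (e8.const_smul Complex.I)).const_smul (1 / 2 : ℂ)).sub (e6.smul e9)

/-- On vectors annihilated by ∂ρ the derivative of the coefficient H(N) does not contribute, because
it multiplies ∂ρ(u) = 0. -/
theorem fderiv_dAngeloCLM {l : G → E →L[ℝ] ℝ} {L : G → E →L[ℝ] E →L[ℝ] ℝ} {N : G → E} {y : G}
    (hl : ContDiffAt ℝ 1 l y) (hL : ContDiffAt ℝ 1 L y) (hN : ContDiffAt ℝ 1 N y) {u : E}
    (hu : holPart (l y) u = 0) (c : G) :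
    fderiv ℝ (fun z => dAngeloCLM (l z) (L z) (N z)) y c u =
      hermForm (fderiv ℝ L y c) u (N y) + hermForm (L y) u (fderiv ℝ N y c) -
        hermQuad (L y) (N y) * holPart (fderiv ℝ l y c) u := by
  have h0 : y + (0 : ℝ) • c = y := by simp
  have h1 := hasDerivAt_line (hl.differentiableAt one_ne_zero).hasFDerivAt c
  have h2 := hasDerivAt_line (hL.differentiableAt one_ne_zero).hasFDerivAt c
  have h3 := hasDerivAt_line (hN.differentiableAt one_ne_zero).hasFDerivAt c
  have h4 := hasDerivAt_line
    ((contDiffAt_dAngeloCLM hl hL hN).differentiableAt one_ne_zero).hasFDerivAt c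
  have h5 := h4.clm_apply (hasDerivAt_const (0 : ℝ) u)
  simp only [map_zero, add_zero] at h5
  have h6 := hasDerivAt_line
    ((contDiffAt_hermQuad hL hN).differentiableAt one_ne_zero).hasFDerivAt c
  have h7 := (hasDerivAt_hermForm h2 h3 u).sub (h6.ofReal_comp.mul (HasDerivAt.holPart h1 u))
  simp only [h0] at h7
  rw [hu, mul_zero, zero_add] at h7
  have h8 : (fun t : ℝ => dAngeloCLM (l (y + t • c)) (L (y + t • c)) (N (y + t • c)) u) =
      (fun t : ℝ => hermForm (L (y + t • c)) u (N (y + t • c))) -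
      (fun t : ℝ => ((hermQuad (L (y + t • c)) (N (y + t • c)) : ℝ) : ℂ)) *
        fun t => holPart (l (y + t • c)) u :=
    funext fun t => dAngeloCLM_apply _ _ _ _
  exact h5.unique (h7.congr_of_eventuallyEq h8.eventuallyEq)

/-- The algebraic identity behind `exteriorDeriv_dAngelo`. -/
theorem dAngelo_identity {B : E →L[ℝ] E →L[ℝ] ℝ} {D : E →L[ℝ] E →L[ℝ] E →L[ℝ] ℝ} {α n : E}
    (hBs : ∀ v w, B v w = B w v) (s1 : ∀ u v w, D u v w = D v u w) (s2 : ∀ u v w, D u v w = D u w v)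
    (hv0 : hermQuad B α = 0) :
    2 * (hermForm (D α) (-(Complex.I • α)) n +
        Complex.I * (starRingEnd ℂ) (holPart (B α) n) * hermForm B α n -
        hermQuad B n * holPart (B α) (-(Complex.I • α)) -
      (hermForm (D (-(Complex.I • α))) α n +
        -((starRingEnd ℂ) (holPart (B (-(Complex.I • α))) n) * hermForm B α n) -
        hermQuad B n * holPart (B (-(Complex.I • α))) α)).im = leviQuad B D n ((2 : ℝ) • α) := by
  have t1 : D n α α = D α α n := by rw [s1 n α α, s2 α n α]
  have t2 : D n (Complex.I • α) (Complex.I • α) = D (Complex.I • α) (Complex.I • α) n := by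
    rw [s1 n _ _, s2 _ n _]
  have t3 : D (Complex.I • α) α (Complex.I • n) = D α (Complex.I • α) (Complex.I • n) := s1 _ _ _
  have r1 := hBs n α
  have r2 := hBs n (Complex.I • α)
  have r3 := hBs (Complex.I • α) α
  have q1 : B (Complex.I • α) (Complex.I • α) = -B α α := by
    rw [hermQuad] at hv0
    linarith
  rw [leviQuad_real_smul, leviQuad, normalTerm, ← Complex.normSq_eq_norm_sq, Complex.normSq_apply]
  simp only [Complex.mul_re, Complex.mul_im, Complex.sub_im, Complex.add_im, Complex.conj_re,
    Complex.conj_im, Complex.I_re, Complex.I_im, Complex.ofReal_re, Complex.ofReal_im, Complex.neg_im,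
    hermForm_re, hermForm_im, holPart_re, holPart_im]
  simp only [hermQuad, smul_neg, I_smul_I_smul, map_neg, neg_apply, neg_neg,
    t1, t2, t3, r1, r2, r3, q1]
  ring

/-- The exterior derivative of a pulled-back 1-form. -/
theorem exteriorDeriv_pullback {Λ : G → E →L[ℝ] ℂ} {j : G → E} {θ : G → G →L[ℝ] ℂ} {y : G}
    (hΛ : DifferentiableAt ℝ Λ y) (hj : ContDiffAt ℝ 2 j y)
    (hθ : ∀ᶠ z in 𝓝 y, ∀ a, θ z a = Λ z (fderiv ℝ j z a)) (a b : G) :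
    fderiv ℝ θ y a b - fderiv ℝ θ y b a =
      fderiv ℝ Λ y a (fderiv ℝ j y b) - fderiv ℝ Λ y b (fderiv ℝ j y a) := by
  have hev : θ =ᶠ[𝓝 y] fun z => (Λ z).comp (fderiv ℝ j z) := by
    filter_upwards [hθ] with z hz
    exact ContinuousLinearMap.ext hz
  have hdj : DifferentiableAt ℝ (fderiv ℝ j) y :=
    (hj.fderiv_right (m := 1) (by norm_num)).differentiableAt one_ne_zero
  have h1 := (hΛ.hasFDerivAt.clm_comp hdj.hasFDerivAt)
  rw [hev.fderiv_eq, h1.fderiv]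
  -- Symmetry of the second derivative of the parametrization removes all its second-order terms
  -- from the exterior derivative.
  have hsymm := (hj.isSymmSndFDerivAt (by simp)).eq a b
  simp only [add_apply, ContinuousLinearMap.comp_apply, ContinuousLinearMap.compL_apply,
    ContinuousLinearMap.flip_apply, hsymm]
  ring

/-- The exterior derivative of the contact form of a hypersurface. -/
theorem exteriorDeriv_contact {f : E → ℝ} {j : G → E} {θ : G → G →L[ℝ] ℂ} {y : G} {ε : ℝ}
    (hf : ContDiffAt ℝ 3 f (j y)) (hj : ContDiffAt ℝ 2 j y)
    (hθ : ∀ᶠ z in 𝓝 y, ∀ a, θ z a = contactCLM ε (fderiv ℝ f (j z)) (fderiv ℝ j z a)) (a b : G) :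
    fderiv ℝ θ y a b - fderiv ℝ θ y b a = -(Complex.I * ε / 2) *
      (fderiv ℝ (fderiv ℝ f) (j y) (fderiv ℝ j y a) (Complex.I • fderiv ℝ j y b) -
        fderiv ℝ (fderiv ℝ f) (j y) (fderiv ℝ j y b) (Complex.I • fderiv ℝ j y a)) := by
  have hj1 := (hj.differentiableAt (by norm_num)).hasFDerivAt
  have h2 := (ContDiffAt.jets hf).2.1.hasFDerivAt.comp y hj1
  set C : (E →L[ℝ] ℝ) →L[ℝ] (E →L[ℝ] ℂ) := (-(Complex.I * ε / 2)) •
    (ContinuousLinearMap.compL ℝ E ℝ ℂ Complex.ofRealCLM).comp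
      ((ContinuousLinearMap.compL ℝ E E ℝ).flip (mulI E)) with hC
  have hCa : ∀ l, C l = contactCLM ε l := fun l => rfl
  have h3 : HasFDerivAt (fun z => contactCLM ε (fderiv ℝ f (j z))) _ y :=
    C.hasFDerivAt.comp y h2
  rw [exteriorDeriv_pullback h3.differentiableAt hj hθ, h3.fderiv]
  simp only [ContinuousLinearMap.comp_apply, hCa, contactCLM_apply]
  ring

/-- The quadratic form `∂̄_b ω` of the D'Angelo form of a hypersurface, at a null vector. -/
theorem exteriorDeriv_dAngelo {f : E → ℝ} {j N : G → E} {θ : G → G →L[ℝ] ℂ} {y : G}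
    (hf : ContDiffAt ℝ 3 f (j y)) (hj : ContDiffAt ℝ 2 j y) (hN : ContDiffAt ℝ 1 N y)
    (hN1 : ∀ᶠ z in 𝓝 y, holPart (fderiv ℝ f (j z)) (N z) = 1)
    (hθ : ∀ᶠ z in 𝓝 y, ∀ a, θ z a = dAngeloCLM (fderiv ℝ f (j z)) (fderiv ℝ (fderiv ℝ f) (j z))
      (N z) (fderiv ℝ j z a))
    (hpos : ∀ v, holPart (fderiv ℝ f (j y)) v = 0 → 0 ≤ hermQuad (fderiv ℝ (fderiv ℝ f) (j y)) v)
    {a b : G} (hab : fderiv ℝ j y b = -(Complex.I • fderiv ℝ j y a))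
    (hv : holPart (fderiv ℝ f (j y)) (fderiv ℝ j y a) = 0)
    (hv0 : hermQuad (fderiv ℝ (fderiv ℝ f) (j y)) (fderiv ℝ j y a) = 0) :
    2 * (fderiv ℝ θ y a b - fderiv ℝ θ y b a).im = leviQuad (fderiv ℝ (fderiv ℝ f) (j y))
      (fderiv ℝ (fderiv ℝ (fderiv ℝ f)) (j y)) (N y) ((2 : ℝ) • fderiv ℝ j y a) := by
  obtain ⟨j0, j1, j2⟩ := ContDiffAt.jets hf
  have hj1 := (hj.differentiableAt (by norm_num)).hasFDerivAt
  have hBs : ∀ v w, fderiv ℝ (fderiv ℝ f) (j y) v w = fderiv ℝ (fderiv ℝ f) (j y) w v :=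
    fun v w => ContDiffAt.fderiv_fderiv_symm hf v w
  have hj' : ContDiffAt ℝ 1 j y := hj.of_le (by norm_num)
  have cl0 : ContDiffAt ℝ 2 (fderiv ℝ f) (j y) := hf.fderiv_right (by norm_num)
  have cL0 : ContDiffAt ℝ 1 (fderiv ℝ (fderiv ℝ f)) (j y) := cl0.fderiv_right (by norm_num)
  have cl : ContDiffAt ℝ 1 (fun z => fderiv ℝ f (j z)) y :=
    ContDiffAt.comp (g := fderiv ℝ f) y (cl0.of_le (by norm_num)) hj'
  have cL : ContDiffAt ℝ 1 (fun z => fderiv ℝ (fderiv ℝ f) (j z)) y :=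
    ContDiffAt.comp (g := fderiv ℝ (fderiv ℝ f)) y cL0 hj'
  have dl : ∀ c, fderiv ℝ (fun z => fderiv ℝ f (j z)) y c =
      fderiv ℝ (fderiv ℝ f) (j y) (fderiv ℝ j y c) := fun c => by
    have h : HasFDerivAt (fun z => fderiv ℝ f (j z)) _ y :=
      HasFDerivAt.comp (g := fderiv ℝ f) y j1.hasFDerivAt hj1
    rw [h.fderiv]
    rfl
  have dL : ∀ c, fderiv ℝ (fun z => fderiv ℝ (fderiv ℝ f) (j z)) y c =
      fderiv ℝ (fderiv ℝ (fderiv ℝ f)) (j y) (fderiv ℝ j y c) := fun c => by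
    have h : HasFDerivAt (fun z => fderiv ℝ (fderiv ℝ f) (j z)) _ y :=
      HasFDerivAt.comp (g := fderiv ℝ (fderiv ℝ f)) y j2.hasFDerivAt hj1
    rw [h.fderiv]
    rfl
  have hN0 : holPart (fderiv ℝ f (j y)) (N y) = 1 := hN1.self_of_nhds
  -- Differentiating the normalization ∂f(N) = 1. It expresses the only component of the derivative
  -- of `N` that matters through the 2-jet of f.
  have hnorm : ∀ c, holPart (fderiv ℝ f (j y)) (fderiv ℝ N y c) =
      -holPart (fderiv ℝ (fderiv ℝ f) (j y) (fderiv ℝ j y c)) (N y) := by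
    intro c
    have h1 := hasDerivAt_line (cl.differentiableAt one_ne_zero).hasFDerivAt c
    have h2 := hasDerivAt_line (hN.differentiableAt one_ne_zero).hasFDerivAt c
    have h3 := hasDerivAt_holPart h1 h2
    have h0 : y + (0 : ℝ) • c = y := by simp
    simp only [h0, dl] at h3
    have h4 : (fun t : ℝ => holPart (fderiv ℝ f (j (y + t • c))) (N (y + t • c))) =ᶠ[𝓝 0]
        fun _ => 1 := by
      have hline : ContinuousAt (fun t : ℝ => y + t • c) 0 := by fun_prop
      have h0' : Tendsto (fun t : ℝ => y + t • c) (𝓝 0) (𝓝 y) := by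
        simpa using hline.tendsto
      exact h0'.eventually hN1
    have h5 := (h3.congr_of_eventuallyEq h4.symm).unique (hasDerivAt_const (0 : ℝ) (1 : ℂ))
    exact eq_neg_of_add_eq_zero_right h5
  rw [exteriorDeriv_pullback ((contDiffAt_dAngeloCLM cl cL hN).differentiableAt one_ne_zero) hj hθ]
  have hβ : holPart (fderiv ℝ f (j y)) (-(Complex.I • fderiv ℝ j y a)) = 0 := by
    rw [← neg_smul, holPart_smul, hv, mul_zero]
  -- For a null vector H(v,w) sees w only through ∂f(w), so the unknown derivative of `N` can be
  -- eliminated with `hnorm`.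
  have hnull : ∀ w, hermForm (fderiv ℝ (fderiv ℝ f) (j y)) (fderiv ℝ j y a) w =
      (starRingEnd ℂ) (holPart (fderiv ℝ f (j y)) w) *
        hermForm (fderiv ℝ (fderiv ℝ f) (j y)) (fderiv ℝ j y a) (N y) := by
    intro w
    have h1 : holPart (fderiv ℝ f (j y)) (w + (-holPart (fderiv ℝ f (j y)) w) • N y) = 0 := by
      rw [holPart_add, holPart_smul, hN0]; ring
    have h2 := hermForm_eq_zero_of_null hBs hpos hv h1 hv0
    rw [hermForm_add_right, hermForm_smul_right, map_neg] at h2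
    linear_combination h2
  rw [hab, fderiv_dAngeloCLM cl cL hN hβ, fderiv_dAngeloCLM cl cL hN hv, dL, dL, dl, dl, hab]
  have e1 : hermForm (fderiv ℝ (fderiv ℝ f) (j y)) (-(Complex.I • fderiv ℝ j y a))
      (fderiv ℝ N y a) =
      Complex.I * (starRingEnd ℂ) (holPart (fderiv ℝ (fderiv ℝ f) (j y) (fderiv ℝ j y a)) (N y)) *
        hermForm (fderiv ℝ (fderiv ℝ f) (j y)) (fderiv ℝ j y a) (N y) := by
    rw [← neg_smul, hermForm_smul_left, hnull, hnorm a, map_neg]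
    ring
  have e2 : hermForm (fderiv ℝ (fderiv ℝ f) (j y)) (fderiv ℝ j y a) (fderiv ℝ N y b) =
      -((starRingEnd ℂ) (holPart (fderiv ℝ (fderiv ℝ f) (j y) (-(Complex.I • fderiv ℝ j y a)))
        (N y)) * hermForm (fderiv ℝ (fderiv ℝ f) (j y)) (fderiv ℝ j y a) (N y)) := by
    rw [hnull, hnorm b, hab, map_neg]
    ring
  rw [e1, e2]
  exact dAngelo_identity hBs (fun u v w => (fderiv_fderiv_fderiv_symm hf u v w).1)
    (fun u v w => (fderiv_fderiv_fderiv_symm hf u v w).2) hv0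

end FlatCR

/-! ### Embedded submanifolds -/

section Embedding

open Filter Manifold

variable {m d : ℕ} {X : Type*} [TopologicalSpace X] [ChartedSpace (EuclideanSpace ℂ (Fin d)) X]
  [IsManifold (complexModel d) ω X]
  {M : Type*} [TopologicalSpace M] [ChartedSpace (EuclideanSpace ℝ (Fin m)) M]
  [IsManifold (𝓡 m) ∞ M] {ι : M → X}

/-- The differential of `ι`, in the charts at `x` and at `ι x`. -/
def tmap (ι : M → X) (x : M) : EuclideanSpace ℝ (Fin m) →L[ℝ] EuclideanSpace ℂ (Fin d) :=
  mfderiv (𝓡 m) (realModel d) ι x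

instance smoothManifold : IsManifold (realModel d) ∞ X := .of_le (n := ω) le_top

/-- In the normal form of an immersion ι is x ↦ (x,0) up to a linear isomorphism; the retraction is
the first projection read in the two charts. -/
theorem exists_local_retraction (hι : IsImmersion (𝓡 m) (realModel d) ∞ ι) (x : M) :
    ∃ r : X → M, ∃ U ∈ 𝓝 (ι x), ContMDiffOn (realModel d) (𝓡 m) ∞ r U ∧
      ∀ᶠ x' in 𝓝 x, r (ι x') = x' := by
  obtain ⟨F, hF1, hF2, h⟩ := hι.isImmersionAt x
  obtain ⟨φ, χ, e, hφ, hφx, hχ, hχx, hw⟩ : ∃ (φ : OpenPartialHomeomorph M (EuclideanSpace ℝ (Fin m)))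
      (χ : OpenPartialHomeomorph X (EuclideanSpace ℂ (Fin d)))
      (e : (EuclideanSpace ℝ (Fin m) × F) ≃L[ℝ] EuclideanSpace ℂ (Fin d)),
      φ ∈ IsManifold.maximalAtlas (𝓡 m) ∞ M ∧ x ∈ φ.source ∧
      χ ∈ IsManifold.maximalAtlas (realModel d) ∞ X ∧ ι x ∈ χ.source ∧
      Set.EqOn ((χ.extend (realModel d)) ∘ ι ∘ (φ.extend (𝓡 m)).symm) (e ∘ (·, 0))
        (φ.extend (𝓡 m)).target :=
    ⟨_, _, _, h.domChart_mem_maximalAtlas, h.mem_domChart_source, h.codChart_mem_maximalAtlas,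
      h.mem_codChart_source, h.writtenInCharts⟩
  clear h
  set s : X → EuclideanSpace ℝ (Fin m) := fun q => (e.symm (χ.extend (realModel d) q)).1
    with hs
  have hleft : ∀ x' ∈ φ.source, s (ι x') = φ.extend (𝓡 m) x' := by
    intro x' hx'
    have hx2 : φ.extend (𝓡 m) x' ∈ (φ.extend (𝓡 m)).target :=
      (φ.extend (𝓡 m)).map_source (by rwa [φ.extend_source])
    have h1 : χ.extend (realModel d) (ι ((φ.extend (𝓡 m)).symm (φ.extend (𝓡 m) x'))) =
      e (φ.extend (𝓡 m) x', 0) := hw hx2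
    rw [φ.extend_left_inv hx'] at h1
    change (e.symm (χ.extend (realModel d) (ι x'))).1 = _
    rw [h1, ContinuousLinearEquiv.symm_apply_apply]
  have hsm : ContMDiffOn (realModel d) 𝓘(ℝ, EuclideanSpace ℝ (Fin m)) ∞ s χ.source := by
    have h2 : ContMDiff 𝓘(ℝ, EuclideanSpace ℂ (Fin d)) 𝓘(ℝ, EuclideanSpace ℝ (Fin m)) ∞
        (fun w => (e.symm w).1) :=
      ((ContinuousLinearMap.fst ℝ (EuclideanSpace ℝ (Fin m)) F).contDiff.comp
        e.symm.contDiff).contMDiff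
    exact h2.comp_contMDiffOn (χ.contMDiffOn_extend hχ)
  have hopen : IsOpen (φ.extend (𝓡 m)).target := φ.isOpen_extend_target
  refine ⟨fun q => (φ.extend (𝓡 m)).symm (s q), χ.source ∩ s ⁻¹' (φ.extend (𝓡 m)).target,
    ?_, ?_, ?_⟩
  · refine inter_mem (χ.open_source.mem_nhds hχx) ?_
    have hcs : ContinuousAt s (ι x) := hsm.continuousOn.continuousAt (χ.open_source.mem_nhds hχx)
    refine hcs.preimage_mem_nhds (hopen.mem_nhds ?_)
    rw [hleft x hφx]
    exact (φ.extend (𝓡 m)).map_source (by rwa [φ.extend_source])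
  · have h3 := contMDiffOn_extend_symm hφ
    rw [← φ.extend_target'] at h3
    exact h3.comp (hsm.mono Set.inter_subset_left) fun q hq => hq.2
  · filter_upwards [φ.open_source.mem_nhds hφx] with x' hx'
    rw [hleft x' hx', φ.extend_left_inv hx']

/-- The local retraction is a left inverse of ι, so its differential is a left inverse of the
differential of ι. -/
theorem tmap_injective (hι : IsImmersion (𝓡 m) (realModel d) ∞ ι) (x : M) :
    Function.Injective (tmap ι x : EuclideanSpace ℝ (Fin m) → EuclideanSpace ℂ (Fin d)) := by
  obtain ⟨r, U, hU, hr, hrι⟩ := exists_local_retraction hι x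
  have h1 : MDifferentiableAt (realModel d) (𝓡 m) r (ι x) :=
    (hr.contMDiffAt hU).mdifferentiableAt (by simp)
  have h2 : MDifferentiableAt (𝓡 m) (realModel d) ι x :=
    (hι.contMDiff x).mdifferentiableAt (by simp)
  have h3 := (HasMFDerivAt.comp x h1.hasMFDerivAt h2.hasMFDerivAt).congr_of_eventuallyEq
    (f₁ := id) (by filter_upwards [hrι] with x' hx'; exact hx'.symm)
  have h4 := hasMFDerivAt_unique h3 (hasMFDerivAt_id x)
  intro a b hab
  have h5 : ∀ c : EuclideanSpace ℝ (Fin m), (mfderiv (realModel d) (𝓡 m) r (ι x)) (tmap ι x c) = c :=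
    fun c => DFunLike.congr_fun h4 c
  rw [← h5 a, hab, h5 b]

/-- Smooth functions extend from closed submanifolds. -/
theorem exists_smooth_extension [T2Space X] [SecondCountableTopology X]
    (hι : IsSmoothEmbedding (𝓡 m) (realModel d) ∞ ι) (hcl : IsClosed (Set.range ι)) {h : M → ℝ}
    (hh : ContMDiff (𝓡 m) 𝓘(ℝ, ℝ) ∞ h) :
    ∃ H : X → ℝ, ContMDiff (realModel d) 𝓘(ℝ, ℝ) ∞ H ∧ ∀ x, H (ι x) = h x := by
  have : LocallyCompactSpace X :=
    ChartedSpace.locallyCompactSpace (EuclideanSpace ℂ (Fin d)) X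
  -- The prescribed values form a convex condition, vacuous off the range, so local extensions by
  -- retraction and by zero are glued with a partition of unity. Being an embedding ensures that
  -- points of the range near ι x come from points near x.
  obtain ⟨H, hH⟩ := exists_contMDiffMap_forall_mem_convex_of_local (n := (⊤ : ℕ∞)) (realModel d)
    (t := fun q : X => {g : ℝ | ∀ x, ι x = q → g = h x}) (fun q => by
      intro a ha b hb s t _ _ hst x hx
      rw [ha x hx, hb x hx, ← add_smul, hst, one_smul]) (fun q => by
      by_cases hq : q ∈ Set.range ι
      · obtain ⟨x, rfl⟩ := hq
        obtain ⟨r, U, hU, hr, hrι⟩ := exists_local_retraction hι.isImmersion x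
        rw [hι.isEmbedding.nhds_eq_comap] at hrι
        obtain ⟨V, hV, hVr⟩ := hrι
        refine ⟨U ∩ V, inter_mem hU hV, h ∘ r,
          hh.comp_contMDiffOn (hr.mono Set.inter_subset_left), ?_⟩
        rintro q ⟨_, hqV⟩ x' rfl
        simp only [Function.comp_apply]
        rw [show r (ι x') = x' from hVr hqV]
      · exact ⟨_, hcl.isOpen_compl.mem_nhds hq, fun _ => 0, contMDiffOn_const,
          fun q' hq' x hx => absurd ⟨x, hx⟩ hq'⟩)
  exact ⟨H, H.contMDiff, fun x => hH (ι x) x rfl⟩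

theorem compactSpace_of_embedding (hι : IsSmoothEmbedding (𝓡 m) (realModel d) ∞ ι)
    (hc : IsCompact (Set.range ι)) : CompactSpace M := by
  refine ⟨?_⟩
  rwa [hι.isEmbedding.isCompact_iff, Set.image_univ]

end Embedding

/-! ### Forms, vector fields and maps in the charts of a real manifold -/

section RealCharts

open Filter Manifold

variable {m : ℕ} {M : Type*} [TopologicalSpace M] [ChartedSpace (EuclideanSpace ℝ (Fin m)) M]

theorem eventually_chart_symm {x : M} {P : M → Prop} (h : ∀ᶠ x' in 𝓝 x, P x') :
    ∀ᶠ z in 𝓝 (extChartAt (𝓡 m) x x), P ((extChartAt (𝓡 m) x).symm z) := by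
  have h1 := (continuousAt_extChartAt_symm (I := 𝓡 m) x).tendsto
  rw [(extChartAt (𝓡 m) x).left_inv (mem_extChartAt_source x)] at h1
  exact h1.eventually h

theorem eventually_mem_chart_target (x : M) :
    ∀ᶠ z in 𝓝 (extChartAt (𝓡 m) x x), z ∈ (extChartAt (𝓡 m) x).target :=
  (isOpen_extChartAt_target x).mem_nhds (mem_extChartAt_target x)

/-- The differential of the chart at `x`, in the chart at `x'`. -/
def realChartDeriv (x x' : M) : EuclideanSpace ℝ (Fin m) →L[ℝ] EuclideanSpace ℝ (Fin m) :=
  mfderiv (𝓡 m) 𝓘(ℝ, EuclideanSpace ℝ (Fin m)) (extChartAt (𝓡 m) x) x'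

/-- The differential of the inverse of the chart at `x`. -/
def realChartSymmDeriv (x : M) (z : EuclideanSpace ℝ (Fin m)) :
    EuclideanSpace ℝ (Fin m) →L[ℝ] EuclideanSpace ℝ (Fin m) :=
  mfderiv 𝓘(ℝ, EuclideanSpace ℝ (Fin m)) (𝓡 m) (extChartAt (𝓡 m) x).symm z

theorem OneForm.inChart_apply (η : OneForm m M) (x : M) (z a : EuclideanSpace ℝ (Fin m)) :
    η.inChart x z a = η ((extChartAt (𝓡 m) x).symm z) (realChartSymmDeriv x z a) := rfl

variable [IsManifold (𝓡 m) ∞ M]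

instance smoothManifold_one : IsManifold (𝓡 m) 1 M := .of_le (n := ∞) (by simp)

theorem realChartDeriv_self (x : M) : realChartDeriv x x =
    ContinuousLinearMap.id ℝ (EuclideanSpace ℝ (Fin m)) :=
  mfderiv_extChartAt_self

theorem realChartDeriv_symm (x : M) {z : EuclideanSpace ℝ (Fin m)}
    (hz : z ∈ (extChartAt (𝓡 m) x).target) (a : EuclideanSpace ℝ (Fin m)) :
    realChartDeriv x ((extChartAt (𝓡 m) x).symm z) (realChartSymmDeriv x z a) = a := by
  have h := mfderiv_extChartAt_comp_mfderivWithin_extChartAt_symm (I := 𝓡 m) hz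
  simp only [modelWithCornersSelf_coe, Set.range_id, mfderivWithin_univ] at h
  exact DFunLike.congr_fun h a

theorem realChartSymmDeriv_deriv (x : M) {z : EuclideanSpace ℝ (Fin m)}
    (hz : z ∈ (extChartAt (𝓡 m) x).target) (a : EuclideanSpace ℝ (Fin m)) :
    realChartSymmDeriv x z (realChartDeriv x ((extChartAt (𝓡 m) x).symm z) a) = a := by
  have h := mfderivWithin_extChartAt_symm_comp_mfderiv_extChartAt (I := 𝓡 m) hz
  simp only [modelWithCornersSelf_coe, Set.range_id, mfderivWithin_univ] at h
  exact DFunLike.congr_fun h a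

theorem realChartSymmDeriv_self (x : M) (a : EuclideanSpace ℝ (Fin m)) :
    realChartSymmDeriv x (extChartAt (𝓡 m) x x) a = a := by
  have h := realChartDeriv_symm x (mem_extChartAt_target x) a
  rwa [(extChartAt (𝓡 m) x).left_inv (mem_extChartAt_source x), realChartDeriv_self] at h

theorem OneForm.d_eq (η : OneForm m M) (x : M) (v w : EuclideanSpace ℝ (Fin m)) :
    η.d x v w = fderiv ℝ (η.inChart x) (extChartAt (𝓡 m) x x) v w -
      fderiv ℝ (η.inChart x) (extChartAt (𝓡 m) x x) w v := by
  have h := realChartDeriv_self (m := m) x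
  change (fderiv ℝ (η.inChart x) (extChartAt (𝓡 m) x x) (realChartDeriv x x v)
    (realChartDeriv x x w) - fderiv ℝ (η.inChart x) (extChartAt (𝓡 m) x x) (realChartDeriv x x w)
    (realChartDeriv x x v)) = _
  rw [h]
  rfl

theorem contDiffAt_congr {E F : Type*} [NormedAddCommGroup E] [NormedSpace ℝ E]
    [NormedAddCommGroup F] [NormedSpace ℝ F] {f g : E → F} {y : E} {n : WithTop ℕ∞}
    (h : f =ᶠ[𝓝 y] g) : ContDiffAt ℝ n f y ↔ ContDiffAt ℝ n g y :=
  ⟨fun hf => hf.congr_of_eventuallyEq h.symm, fun hg => hg.congr_of_eventuallyEq h⟩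

theorem contMDiffAt_iff_chart {F : Type*} [NormedAddCommGroup F] [NormedSpace ℝ F] {f : M → F}
    {x : M} : ContMDiffAt (𝓡 m) 𝓘(ℝ, F) ∞ f x ↔
      ContDiffAt ℝ ∞ (f ∘ (extChartAt (𝓡 m) x).symm) (extChartAt (𝓡 m) x x) := by
  rw [contMDiffAt_iff_source]
  simp only [modelWithCornersSelf_coe, Set.range_id, contMDiffWithinAt_univ]
  exact contMDiffAt_iff_contDiffAt

theorem OneForm.contMDiffAt_iff (η : OneForm m M) (x : M) :
    ContMDiffAt (𝓡 m) ((𝓡 m).prod 𝓘(ℝ, EuclideanSpace ℝ (Fin m) →L[ℝ] ℂ)) ∞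
      (fun p : M => Bundle.TotalSpace.mk' (EuclideanSpace ℝ (Fin m) →L[ℝ] ℂ)
        (E := fun p : M => TangentSpace (𝓡 m) p →L[ℝ] Bundle.Trivial M ℂ p) p (η p)) x ↔
      ContDiffAt ℝ ∞ (η.inChart x) (extChartAt (𝓡 m) x x) := by
  rw [contMDiffAt_hom_bundle]
  refine (and_iff_right contMDiffAt_id).trans ?_
  rw [contMDiffAt_iff_chart]
  refine contDiffAt_congr ?_
  filter_upwards [eventually_mem_chart_target x] with z hz
  have hz1 := (extChartAt (𝓡 m) x).map_target hz
  rw [extChartAt_source] at hz1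
  have h2 := TangentBundle.symmL_trivializationAt (I := 𝓡 m) hz1
  rw [(extChartAt (𝓡 m) x).right_inv hz] at h2
  simp only [modelWithCornersSelf_coe, Set.range_id, mfderivWithin_univ] at h2
  simp only [Function.comp_apply, ContinuousLinearMap.inCoordinates, h2]
  ext a
  simp
  rfl

theorem OneForm.isSmooth_iff (η : OneForm m M) : η.IsSmooth ↔
    ∀ x, ContDiffAt ℝ ∞ (η.inChart x) (extChartAt (𝓡 m) x x) :=
  forall_congr' fun x => OneForm.contMDiffAt_iff η x

theorem vectorField_contMDiffAt_iff (V : ∀ p : M, RTangent m p) (x : M) :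
    ContMDiffAt (𝓡 m) (𝓡 m).tangent ∞ (fun p : M => (⟨p, V p⟩ : TangentBundle (𝓡 m) M)) x ↔
      ContDiffAt ℝ ∞ (fun z => realChartDeriv x ((extChartAt (𝓡 m) x).symm z)
        (V ((extChartAt (𝓡 m) x).symm z))) (extChartAt (𝓡 m) x x) := by
  have h0 := Bundle.contMDiffAt_section (IB := 𝓡 m) (n := ∞) (F := EuclideanSpace ℝ (Fin m))
    (E := fun p : M => TangentSpace (𝓡 m) p) (s := V) x
  refine h0.trans ?_
  rw [contMDiffAt_iff_chart]
  refine contDiffAt_congr ?_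
  filter_upwards [eventually_mem_chart_target x] with z hz
  have hz1 := (extChartAt (𝓡 m) x).map_target hz
  rw [extChartAt_source] at hz1
  have h2 := TangentBundle.continuousLinearMapAt_trivializationAt (I := 𝓡 m) hz1
  simp only [Function.comp_apply]
  have h3 := DFunLike.congr_fun h2 (V ((extChartAt (𝓡 m) x).symm z))
  exact (Bundle.Trivialization.continuousLinearMapAt_apply_of_mem (R := ℝ)
    (trivializationAt (EuclideanSpace ℝ (Fin m)) (TangentSpace (𝓡 m)) x) (by simpa using hz1)
    (V ((extChartAt (𝓡 m) x).symm z))).symm.trans h3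

end RealCharts

/-! ### Forms on an embedded hypersurface -/

section Hypersurface

open Filter Manifold

variable {m d : ℕ} {X : Type*} [TopologicalSpace X] [ChartedSpace (EuclideanSpace ℂ (Fin d)) X]
  [IsManifold (complexModel d) ω X]
  {M : Type*} [TopologicalSpace M] [ChartedSpace (EuclideanSpace ℝ (Fin m)) M]
  [IsManifold (𝓡 m) ∞ M] {ι : M → X} {Ω : Set X} {ρ : X → ℝ}

/-- The map `ι` in the charts at `x` and at `ι x`. -/
def embChart (ι : M → X) (x : M) (z : EuclideanSpace ℝ (Fin m)) : EuclideanSpace ℂ (Fin d) :=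
  coord d (ι x) (ι ((extChartAt (𝓡 m) x).symm z))

theorem embChart_self (ι : M → X) (x : M) :
    embChart ι x (extChartAt (𝓡 m) x x) = coord d (ι x) (ι x) := by
  rw [embChart, (extChartAt (𝓡 m) x).left_inv (mem_extChartAt_source x)]

theorem chartDeriv_self (p : X) (v : EuclideanSpace ℂ (Fin d)) : chartDeriv d p p v = v := by
  have h := mfderiv_extChartAt_eq p p (mem_extChartAt_source (I := realModel d) p)
  have h1 : IsManifold (realModel d) 1 X := .of_le (n := ω) le_top
  have h2 := mfderiv_extChartAt_self (I := realModel d) (x := p)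
  exact DFunLike.congr_fun (h.symm.trans h2) v

theorem eventually_mem_source (hι : ContMDiff (𝓡 m) (realModel d) ∞ ι) (x : M) :
    ∀ᶠ x' in 𝓝 x, ι x' ∈ (extChartAt (realModel d) (ι x)).source :=
  hι.continuous.continuousAt.eventually
    ((isOpen_extChartAt_source (ι x)).mem_nhds (mem_extChartAt_source (I := realModel d) (ι x)))

theorem contDiffAt_embChart (hι : ContMDiff (𝓡 m) (realModel d) ∞ ι) (x : M) :
    ContDiffAt ℝ ∞ (embChart (d := d) ι x) (extChartAt (𝓡 m) x x) := by
  have h1 : ContMDiffAt (realModel d) 𝓘(ℝ, EuclideanSpace ℂ (Fin d)) ∞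
    (extChartAt (realModel d) (ι x)) (ι x) := contMDiffAt_extChartAt
  exact contMDiffAt_iff_chart.1 (h1.comp x (hι x))

theorem eventually_fderiv_embChart (hι : ContMDiff (𝓡 m) (realModel d) ∞ ι) (x : M) :
    ∀ᶠ z in 𝓝 (extChartAt (𝓡 m) x x), ∀ a, fderiv ℝ (embChart (d := d) ι x) z a =
      chartDeriv d (ι ((extChartAt (𝓡 m) x).symm z)) (ι x)
        (tmap ι ((extChartAt (𝓡 m) x).symm z) (realChartSymmDeriv x z a)) := by
  filter_upwards [eventually_mem_chart_target x,
    eventually_chart_symm (eventually_mem_source hι x)] with z hz hzs a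
  have h1 : MDifferentiableAt 𝓘(ℝ, EuclideanSpace ℝ (Fin m)) (𝓡 m) (extChartAt (𝓡 m) x).symm z := by
    have := mdifferentiableWithinAt_extChartAt_symm (I := 𝓡 m) hz
    simpa only [modelWithCornersSelf_coe, Set.range_id, mdifferentiableWithinAt_univ] using this
  have h2 : MDifferentiableAt (𝓡 m) (realModel d) ι ((extChartAt (𝓡 m) x).symm z) :=
    (hι _).mdifferentiableAt (by simp)
  have i1 : IsManifold (realModel d) 1 X := .of_le (n := ω) le_top
  have h3 : MDifferentiableAt (realModel d) 𝓘(ℝ, EuclideanSpace ℂ (Fin d))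
      (extChartAt (realModel d) (ι x)) (ι ((extChartAt (𝓡 m) x).symm z)) := by
    refine mdifferentiableAt_extChartAt ?_
    rwa [extChartAt_source] at hzs
  have h4 := HasMFDerivAt.comp z h3.hasMFDerivAt (HasMFDerivAt.comp z h2.hasMFDerivAt h1.hasMFDerivAt)
  rw [mfderiv_extChartAt_eq _ _ hzs] at h4
  have h5 : HasFDerivAt (embChart ι x) ((chartDeriv d (ι ((extChartAt (𝓡 m) x).symm z)) (ι x)).comp
      ((tmap ι ((extChartAt (𝓡 m) x).symm z)).comp (realChartSymmDeriv x z))) z :=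
    hasMFDerivAt_iff_hasFDerivAt.1 h4
  rw [h5.fderiv]
  rfl

theorem fderiv_embChart_self (hι : ContMDiff (𝓡 m) (realModel d) ∞ ι) (x : M)
    (a : EuclideanSpace ℝ (Fin m)) :
    fderiv ℝ (embChart (d := d) ι x) (extChartAt (𝓡 m) x x) a = tmap ι x a := by
  have h := (eventually_fderiv_embChart hι x).self_of_nhds a
  rwa [(extChartAt (𝓡 m) x).left_inv (mem_extChartAt_source x), chartDeriv_self,
    realChartSymmDeriv_self] at h

theorem jet₁_chart {u : X → ℝ} {p q : X} (hq : q ∈ (extChartAt (realModel d) p).source)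
    (hu : ContDiffAt ℝ 3 (chartRep u p) (coord d p q)) (v : EuclideanSpace ℂ (Fin d)) :
    jet₁ d u q v = fderiv ℝ (chartRep u p) (coord d p q) (chartDeriv d q p v) := by
  have h := congrArg Complex.re (holPart_chart hq hu v)
  rw [holPart_re, holPart_re] at h
  change fderiv ℝ (chartRep u q) (coord d q q) v = _
  linarith

theorem contactCLM_chart {u : X → ℝ} {p q : X} (hq : q ∈ (extChartAt (realModel d) p).source)
    (hu : ContDiffAt ℝ 3 (chartRep u p) (coord d p q)) (ε : ℝ) (v : EuclideanSpace ℂ (Fin d)) :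
    contactCLM ε (jet₁ d u q) v =
      contactCLM ε (fderiv ℝ (chartRep u p) (coord d p q)) (chartDeriv d q p v) := by
  rw [contactCLM_apply, contactCLM_apply, jet₁_chart hq hu, chartDeriv_I q p hq]

theorem dAngeloCLM_chart {u : X → ℝ} {p q : X} (hq : q ∈ (extChartAt (realModel d) p).source)
    (hu : ContDiffAt ℝ 3 (chartRep u p) (coord d p q)) (N v : EuclideanSpace ℂ (Fin d)) :
    dAngeloCLM (jet₁ d u q) (jet₂ d u q) N v = dAngeloCLM (fderiv ℝ (chartRep u p) (coord d p q))
      (fderiv ℝ (fderiv ℝ (chartRep u p)) (coord d p q)) (chartDeriv d q p N)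
      (chartDeriv d q p v) := by
  rw [dAngeloCLM_apply, dAngeloCLM_apply, holPart_chart hq hu, hermForm_chart hq hu,
    hermQuad_chart hq hu]

theorem inChart_contact (hι : ContMDiff (𝓡 m) (realModel d) ∞ ι) (hρ : IsDefiningFunction d Ω ρ)
    {η : OneForm m M} {ε : ℝ} {x : M}
    (hη : ∀ᶠ x' in 𝓝 x, ∀ a : EuclideanSpace ℝ (Fin m),
      η x' a = contactCLM ε (jet₁ d ρ (ι x')) (tmap ι x' a)) :
    ∀ᶠ z in 𝓝 (extChartAt (𝓡 m) x x), ∀ a, η.inChart x z a =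
      contactCLM ε (fderiv ℝ (chartRep ρ (ι x)) (embChart ι x z))
        (fderiv ℝ (embChart (d := d) ι x) z a) := by
  filter_upwards [eventually_chart_symm hη, eventually_chart_symm (eventually_mem_source hι x),
    eventually_fderiv_embChart hι x] with z h1 h2 h3 a
  rw [OneForm.inChart_apply, h1, contactCLM_chart h2 (hρ.contDiffAt h2), h3]
  rfl

/-- The normal field `N` along `ι`, in the charts at `x` and at `ι x`. -/
def normalChart (ι : M → X) (N : M → EuclideanSpace ℂ (Fin d)) (x : M)
    (z : EuclideanSpace ℝ (Fin m)) : EuclideanSpace ℂ (Fin d) :=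
  chartDeriv d (ι ((extChartAt (𝓡 m) x).symm z)) (ι x) (N ((extChartAt (𝓡 m) x).symm z))

theorem inChart_dAngelo (hι : ContMDiff (𝓡 m) (realModel d) ∞ ι) (hρ : IsDefiningFunction d Ω ρ)
    {om : OneForm m M} {N : M → EuclideanSpace ℂ (Fin d)} {x : M}
    (hom : ∀ᶠ x' in 𝓝 x, ∀ a : EuclideanSpace ℝ (Fin m),
      om x' a = dAngeloCLM (jet₁ d ρ (ι x')) (jet₂ d ρ (ι x')) (N x') (tmap ι x' a)) :
    ∀ᶠ z in 𝓝 (extChartAt (𝓡 m) x x), ∀ a, om.inChart x z a =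
      dAngeloCLM (fderiv ℝ (chartRep ρ (ι x)) (embChart ι x z))
        (fderiv ℝ (fderiv ℝ (chartRep ρ (ι x))) (embChart ι x z)) (normalChart ι N x z)
        (fderiv ℝ (embChart (d := d) ι x) z a) := by
  filter_upwards [eventually_chart_symm hom, eventually_chart_symm (eventually_mem_source hι x),
    eventually_fderiv_embChart hι x] with z h1 h2 h3 a
  rw [OneForm.inChart_apply, h1, dAngeloCLM_chart h2 (hρ.contDiffAt h2), h3]
  rfl

theorem contDiffAt_normalChart (hι : ContMDiff (𝓡 m) (realModel d) ∞ ι) {V : ∀ p : M, RTangent m p}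
    {ε : ℝ} {x : M} (hV : ContMDiffAt (𝓡 m) (𝓡 m).tangent ∞
      (fun p : M => (⟨p, V p⟩ : TangentBundle (𝓡 m) M)) x) :
    ContDiffAt ℝ ∞ (normalChart ι (fun x => ε • Complex.I • tmap (d := d) ι x (V x)) x)
      (extChartAt (𝓡 m) x x) := by
  have h1 := (vectorField_contMDiffAt_iff V x).1 hV
  have h2 : ContDiffAt ℝ ∞ (fderiv ℝ (embChart (d := d) ι x)) (extChartAt (𝓡 m) x x) :=
    (contDiffAt_embChart hι x).fderiv_right (by simp)
  have h3 := ((mulI (EuclideanSpace ℂ (Fin d))).contDiff.contDiffAt.comp _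
    (h2.clm_apply h1)).const_smul ε
  refine (contDiffAt_congr ?_).1 h3
  filter_upwards [eventually_mem_chart_target x, eventually_chart_symm (eventually_mem_source hι x),
    eventually_fderiv_embChart hι x] with z hz h4 h5
  simp only [Function.comp_apply, mulI_apply, normalChart]
  rw [h5, map_smul, chartDeriv_I _ _ h4]
  exact congrArg _ (congrArg _ (congrArg _ (congrArg _ (realChartSymmDeriv_deriv x hz _))))

end Hypersurface

/-! ### The Levi form and the D'Angelo form of an embedded hypersurface -/

section Pointwise

open Filter Manifold

/-- The real computation behind `dAngelo_eq`: contracting the exterior derivative of the contact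
form with a transversal field T = iS produces N = εJ dι(S) in the second slot of H. -/
theorem hermForm_contact {E : Type*} [NormedAddCommGroup E] [NormedSpace ℂ E] [NormedSpace ℝ E]
    [IsScalarTower ℝ ℂ E] {B : E →L[ℝ] E →L[ℝ] ℝ} (hB : ∀ v w, B v w = B w v)
    {ε : ℝ} (hε : ε ^ 2 = 1) (α s : E) :
    -(Complex.I * ε / 2) * (B s α - B (-(Complex.I • α)) (Complex.I • s) : ℝ) -
      Complex.I * (-(Complex.I * ε / 2) * (B s (Complex.I • α) - B α (Complex.I • s) : ℝ)) =
      2 * hermForm B α (ε • Complex.I • s) := by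
  have h1 := hB s α
  have h2 := hB s (Complex.I • α)
  have h3 : Complex.I • ε • Complex.I • s = -(ε • s) := by
    rw [I_smul_real_smul, I_smul_I_smul, smul_neg]
  simp only [hermForm, h3, map_smul, map_neg, neg_apply, smul_eq_mul, h1, h2]
  apply Complex.ext <;> simp <;> ring

variable {m d : ℕ} {X : Type*} [TopologicalSpace X] [ChartedSpace (EuclideanSpace ℂ (Fin d)) X]
  [IsManifold (complexModel d) ω X]
  {M : Type*} [TopologicalSpace M] [ChartedSpace (EuclideanSpace ℝ (Fin m)) M]
  [IsManifold (𝓡 m) ∞ M] {ι : M → X} {Ω : Set X} {ρ : X → ℝ}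

theorem two_le_infty : (2 : WithTop ℕ∞) ≤ ∞ :=
  WithTop.coe_le_coe.2 (le_top : (2 : ℕ∞) ≤ ⊤)

theorem OneForm.d_swap (η : OneForm m M) (x : M) (a b : EuclideanSpace ℝ (Fin m)) :
    η.d x b a = -η.d x a b := by
  rw [OneForm.d_eq, OneForm.d_eq]
  ring

theorem OneForm.d_self (η : OneForm m M) (x : M) (a : EuclideanSpace ℝ (Fin m)) :
    η.d x a a = 0 := by
  rw [OneForm.d_eq]
  exact sub_self _

theorem OneForm.d_neg_right (η : OneForm m M) (x : M) (a b : EuclideanSpace ℝ (Fin m)) :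
    η.d x a (-b) = -η.d x a b := by
  rw [OneForm.d_eq, OneForm.d_eq, map_neg, map_neg, neg_apply]
  ring

/-- For an alternating form, evaluation on (a + ib, a - ib) equals -2i times its value on (a, b). -/
theorem dbarQuad_eq (om : OneForm m M) (x : M) (L : CTangent m x) :
    dbarQuad om x L = 2 * (om.d x L.1 L.2).im := by
  have s1 : om.d x L.1 L.1 = 0 := om.d_self x _
  have s2 : om.d x L.2 (-L.2) = 0 :=
    (om.d_neg_right x _ _).trans ((congrArg Neg.neg (om.d_self x _)).trans neg_zero)
  have s3 : om.d x L.1 (-L.2) = -om.d x L.1 L.2 := om.d_neg_right x _ _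
  have s4 : om.d x L.2 L.1 = -om.d x L.1 L.2 := om.d_swap x _ _
  rw [dbarQuad, extC₂, conjC]
  simp only [s1, s2, s3, s4]
  simp
  ring

theorem mem_inducedCR_iff {x : M} {L : CTangent m x} : L ∈ inducedCR m d ι x ↔
    tmap (d := d) ι x L.2 = -(Complex.I • tmap (d := d) ι x L.1) := by
  have h : L ∈ inducedCR m d ι x ↔
    tmap (d := d) ι x L.1 = Complex.I • tmap (d := d) ι x L.2 := Iff.rfl
  rw [h]
  constructor
  · intro h1
    rw [h1, I_smul_I_smul, neg_neg]
  · intro h1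
    rw [h1, smul_neg, I_smul_I_smul, neg_neg]

theorem jet₁_tmap (hι : ContMDiff (𝓡 m) (realModel d) ∞ ι) (hM : Set.range ι = frontier Ω)
    (hρ : IsDefiningFunction d Ω ρ) (x : M) (a : EuclideanSpace ℝ (Fin m)) :
    jet₁ d ρ (ι x) (tmap ι x a) = 0 := by
  have h1 : (fun z => chartRep ρ (ι x) (embChart (d := d) ι x z)) =ᶠ[𝓝 (extChartAt (𝓡 m) x x)]
      fun _ => 0 := by
    filter_upwards [eventually_chart_symm (eventually_mem_source hι x)] with z hz
    rw [embChart, chartRep_coord ρ hz]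
    exact hρ.eq_zero (hM ▸ Set.mem_range_self _)
  have h2 : HasFDerivAt (chartRep ρ (ι x)) (jet₁ d ρ (ι x))
      (embChart ι x (extChartAt (𝓡 m) x x)) := by
    rw [embChart_self]
    exact (ContDiffAt.jets (hρ.contDiffAt_self (ι x))).1.hasFDerivAt
  have h3 := ((contDiffAt_embChart hι x).differentiableAt (by simp)).hasFDerivAt
  have h4 := (h2.comp _ h3).unique ((hasFDerivAt_const (0 : ℝ) _).congr_of_eventuallyEq h1)
  have h5 := DFunLike.congr_fun h4 a
  rwa [ContinuousLinearMap.comp_apply, fderiv_embChart_self hι] at h5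

theorem holPart_tmap (hι : ContMDiff (𝓡 m) (realModel d) ∞ ι) (hM : Set.range ι = frontier Ω)
    (hρ : IsDefiningFunction d Ω ρ) {x : M} {L : CTangent m x} (hL : L ∈ inducedCR m d ι x) :
    holPart (jet₁ d ρ (ι x)) (tmap ι x L.1) = 0 := by
  rw [holPart_eq_zero_iff]
  refine ⟨jet₁_tmap hι hM hρ x L.1, ?_⟩
  have h := jet₁_tmap hι hM hρ x L.2
  rw [mem_inducedCR_iff] at hL
  rw [hL, map_neg, neg_eq_zero] at h
  exact h

theorem oneForm_d_contact (hι : ContMDiff (𝓡 m) (realModel d) ∞ ι) (hρ : IsDefiningFunction d Ω ρ)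
    {η : OneForm m M} {ε : ℝ} {x : M}
    (hη : ∀ᶠ x' in 𝓝 x, ∀ a : EuclideanSpace ℝ (Fin m),
      η x' a = contactCLM ε (jet₁ d ρ (ι x')) (tmap ι x' a)) (a b : EuclideanSpace ℝ (Fin m)) :
    η.d x a b = -(Complex.I * ε / 2) *
      (jet₂ d ρ (ι x) (tmap ι x a) (Complex.I • tmap ι x b) -
        jet₂ d ρ (ι x) (tmap ι x b) (Complex.I • tmap ι x a) : ℝ) := by
  have h := exteriorDeriv_contact (f := chartRep ρ (ι x)) (j := embChart (d := d) ι x)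
    (θ := η.inChart x) (y := extChartAt (𝓡 m) x x) (ε := ε)
    (by rw [embChart_self]; exact hρ.contDiffAt_self _)
    ((contDiffAt_embChart hι x).of_le two_le_infty) (inChart_contact hι hρ hη) a b
  rw [fderiv_embChart_self hι, fderiv_embChart_self hι, embChart_self] at h
  rw [OneForm.d_eq, h]
  push_cast
  rfl

theorem jet₂_symm (hρ : IsDefiningFunction d Ω ρ) (p : X) (v w : EuclideanSpace ℂ (Fin d)) :
    jet₂ d ρ p v w = jet₂ d ρ p w v :=
  ContDiffAt.fderiv_fderiv_symm (hρ.contDiffAt_self p) v w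

/-- A (1,0) vector a + ib of M corresponds to the vector v = 2dι(a) of the ambient space, since L =
(v - iJv)/2. The factor 4 is 2 for each slot. -/
theorem leviForm_eq (hι : ContMDiff (𝓡 m) (realModel d) ∞ ι) (hρ : IsDefiningFunction d Ω ρ)
    {η : OneForm m M} {ε : ℝ} {x : M}
    (hη : ∀ᶠ x' in 𝓝 x, ∀ a : EuclideanSpace ℝ (Fin m),
      η x' a = contactCLM ε (jet₁ d ρ (ι x')) (tmap ι x' a)) {L L' : CTangent m x}
    (hL : L ∈ inducedCR m d ι x) (hL' : L' ∈ inducedCR m d ι x) :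
    leviForm η x L L' = 4 * ε * hermForm (jet₂ d ρ (ι x)) (tmap ι x L.1) (tmap ι x L'.1) := by
  rw [mem_inducedCR_iff] at hL hL'
  have hn : tmap (d := d) ι x (-L'.2) = Complex.I • tmap (d := d) ι x L'.1 :=
    (map_neg (tmap (d := d) ι x) _).trans ((congrArg Neg.neg hL').trans (neg_neg _))
  have hs := jet₂_symm hρ (ι x)
  have e : ∀ a b : RTangent m x, η.d x a b = _ := oneForm_d_contact hι hρ hη
  have r1 := hs (tmap ι x L'.1) (tmap ι x L.1)
  have r2 := hs (Complex.I • tmap ι x L'.1) (tmap ι x L.1)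
  have r3 := hs (Complex.I • tmap ι x L'.1) (Complex.I • tmap ι x L.1)
  have r4 := hs (tmap ι x L'.1) (Complex.I • tmap ι x L.1)
  rw [leviForm, extC₂, conjC]
  simp only [e, hn, hL]
  simp only [hermForm, smul_neg, I_smul_I_smul, map_neg, neg_apply, neg_neg, r1, r2, r3, r4]
  apply Complex.ext <;> simp <;> ring

theorem dAngelo_eq (hι : ContMDiff (𝓡 m) (realModel d) ∞ ι) (hρ : IsDefiningFunction d Ω ρ)
    {η : OneForm m M} {ε : ℝ} (hε : ε ^ 2 = 1) {x : M}
    (hη : ∀ᶠ x' in 𝓝 x, ∀ a : EuclideanSpace ℝ (Fin m),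
      η x' a = contactCLM ε (jet₁ d ρ (ι x')) (tmap ι x' a)) {T : ∀ p : M, CTangent m p}
    (hT : (T x).1 = 0) {L : CTangent m x} (hL : L ∈ inducedCR m d ι x) :
    dAngelo η T x L = 2 * hermForm (jet₂ d ρ (ι x)) (tmap ι x L.1)
      (ε • Complex.I • tmap ι x (T x).2) := by
  rw [mem_inducedCR_iff] at hL
  have e : ∀ a b : RTangent m x, η.d x a b = _ := oneForm_d_contact hι hρ hη
  have h0 : tmap (d := d) ι x (0 : RTangent m x) = 0 := map_zero (tmap (d := d) ι x)
  rw [← hermForm_contact (jet₂_symm hρ (ι x)) hε, dAngelo, extC₂, hT]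
  simp only [e, h0, hL]
  simp only [map_zero, smul_neg, smul_zero, I_smul_I_smul, neg_neg, zero_apply, sub_self,
    Complex.ofReal_zero, mul_zero]
  ring

/-- The flat computation `exteriorDeriv_dAngelo` read in the charts at x and ι x. These charts have
identity derivative at their centres, so no chart derivatives survive in the result. -/
theorem oneForm_d_dAngelo (hι : ContMDiff (𝓡 m) (realModel d) ∞ ι)
    (hM : Set.range ι = frontier Ω) (hρ : IsDefiningFunction d Ω ρ) (hLevi : LeviNonneg d Ω ρ)
    {om : OneForm m M} {ε : ℝ} {x : M} {V : ∀ p : M, RTangent m p}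
    (hV : ContMDiffAt (𝓡 m) (𝓡 m).tangent ∞
      (fun p : M => (⟨p, V p⟩ : TangentBundle (𝓡 m) M)) x)
    (hN : ∀ᶠ x' in 𝓝 x, holPart (jet₁ d ρ (ι x')) (ε • Complex.I • tmap ι x' (V x')) = 1)
    (hom : ∀ᶠ x' in 𝓝 x, ∀ a : EuclideanSpace ℝ (Fin m),
      om x' a = dAngeloCLM (jet₁ d ρ (ι x')) (jet₂ d ρ (ι x')) (ε • Complex.I • tmap ι x' (V x'))
        (tmap ι x' a)) {a b : EuclideanSpace ℝ (Fin m)}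
    (hab : tmap (d := d) ι x b = -(Complex.I • tmap (d := d) ι x a))
    (hv : holPart (jet₁ d ρ (ι x)) (tmap ι x a) = 0)
    (h0 : hermQuad (jet₂ d ρ (ι x)) (tmap ι x a) = 0) :
    2 * (om.d x a b).im = leviQuad (jet₂ d ρ (ι x)) (jet₃ d ρ (ι x))
      (ε • Complex.I • tmap ι x (V x)) ((2 : ℝ) • tmap ι x a) := by
  have hx : ι x ∈ frontier Ω := hM ▸ Set.mem_range_self x
  have hN1 : ∀ᶠ z in 𝓝 (extChartAt (𝓡 m) x x),
      holPart (fderiv ℝ (chartRep ρ (ι x)) (embChart (d := d) ι x z))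
        (normalChart ι (fun x => ε • Complex.I • tmap (d := d) ι x (V x)) x z) = 1 := by
    filter_upwards [eventually_chart_symm hN, eventually_chart_symm (eventually_mem_source hι x)]
      with z h1 h2
    rw [jet₁, holPart_chart h2 (hρ.contDiffAt h2)] at h1
    exact h1
  have hnorm : normalChart ι (fun x => ε • Complex.I • tmap (d := d) ι x (V x)) x
      (extChartAt (𝓡 m) x x) = ε • Complex.I • tmap (d := d) ι x (V x) := by
    rw [normalChart, (extChartAt (𝓡 m) x).left_inv (mem_extChartAt_source x), chartDeriv_self]
  have h := exteriorDeriv_dAngelo (f := chartRep ρ (ι x)) (j := embChart (d := d) ι x)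
    (θ := om.inChart x) (y := extChartAt (𝓡 m) x x) (a := a) (b := b)
    (by rw [embChart_self]; exact hρ.contDiffAt_self _)
    ((contDiffAt_embChart hι x).of_le two_le_infty)
    ((contDiffAt_normalChart (d := d) (ε := ε) hι hV).of_le (by simp)) hN1
    (inChart_dAngelo hι hρ hom)
    (by rw [embChart_self]; exact hLevi _ hx)
    (by rw [fderiv_embChart_self hι, fderiv_embChart_self hι]; exact hab)
    (by rw [fderiv_embChart_self hι, embChart_self]; exact hv)
    (by rw [fderiv_embChart_self hι, embChart_self]; exact h0)
  rw [fderiv_embChart_self hι, embChart_self, hnorm] at h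
  rw [← h, ← OneForm.d_eq]

theorem wedgeQuad_eq {om : OneForm m M} {x : M} {N : EuclideanSpace ℂ (Fin d)} {l B}
    (hom : ∀ a : EuclideanSpace ℝ (Fin m), om x a = dAngeloCLM l B N (tmap ι x a))
    {L : CTangent m x} (hL : L ∈ inducedCR m d ι x) (hv : holPart l (tmap ι x L.1) = 0) :
    wedgeQuad om x L = ‖hermForm B ((2 : ℝ) • tmap ι x L.1) N‖ ^ 2 := by
  have e : ∀ a : RTangent m x, om x a = _ := hom
  rw [mem_inducedCR_iff] at hL
  have h1 : extC (om x) L = hermForm B ((2 : ℝ) • tmap ι x L.1) N := by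
    rw [← ofReal_smul_eq, hermForm_smul_left, extC, e, e, hL, dAngeloCLM_apply, dAngeloCLM_apply,
      ← neg_smul, holPart_smul, hv, hermForm_smul_left]
    push_cast
    linear_combination (-hermForm B (tmap ι x L.1) N) * Complex.I_sq
  rw [wedgeQuad, h1]

end Pointwise

/-! ### Transversal fields and D'Angelo forms on the boundary -/

section Transversal

open Filter Manifold

variable {n : ℕ} {X : Type*} [TopologicalSpace X]
  [ChartedSpace (EuclideanSpace ℂ (Fin (n + 1))) X] [IsManifold (complexModel (n + 1)) ω X]
  {M : Type*} [TopologicalSpace M] [ChartedSpace (EuclideanSpace ℝ (Fin (2 * n + 1))) M]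
  [IsManifold (𝓡 (2 * n + 1)) ∞ M] {ι : M → X} {Ω : Set X} {ρ : X → ℝ}

/-- The image of the differential of ι lies in the kernel of dρ; both have real dimension 2n + 1, so
they coincide. -/
theorem exists_tmap_eq (hι : IsImmersion (𝓡 (2 * n + 1)) (realModel (n + 1)) ∞ ι)
    (hM : Set.range ι = frontier Ω) (hρ : IsDefiningFunction (n + 1) Ω ρ) {x : M}
    {v : EuclideanSpace ℂ (Fin (n + 1))} (hv : jet₁ (n + 1) ρ (ι x) v = 0) :
    ∃ a : EuclideanSpace ℝ (Fin (2 * n + 1)), tmap ι x a = v := by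
  have hx : ι x ∈ frontier Ω := hM ▸ Set.mem_range_self x
  set l : EuclideanSpace ℂ (Fin (n + 1)) →ₗ[ℝ] ℝ := (jet₁ (n + 1) ρ (ι x)).toLinearMap with hl
  have hl0 : l ≠ 0 := fun h => hρ.jet_ne_zero hx (ContinuousLinearMap.coe_injective h)
  have h1 := Module.Dual.finrank_ker_add_one_of_ne_zero hl0
  have h2 : Module.finrank ℝ (EuclideanSpace ℂ (Fin (n + 1))) = 2 * (n + 1) := by
    rw [← Module.finrank_mul_finrank ℝ ℂ (EuclideanSpace ℂ (Fin (n + 1))),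
      Complex.finrank_real_complex, finrank_euclideanSpace_fin]
  set t : EuclideanSpace ℝ (Fin (2 * n + 1)) →ₗ[ℝ] EuclideanSpace ℂ (Fin (n + 1)) :=
    (tmap ι x).toLinearMap with ht
  have h3 : Module.finrank ℝ (LinearMap.range t) = 2 * n + 1 := by
    rw [LinearMap.finrank_range_of_inj (tmap_injective hι x), finrank_euclideanSpace_fin]
  have h4 : LinearMap.range t ≤ LinearMap.ker l := by
    rintro _ ⟨a, rfl⟩
    exact jet₁_tmap hι.contMDiff hM hρ x a
  have h5 := Submodule.eq_of_le_of_finrank_eq h4 (by omega)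
  have h6 : v ∈ LinearMap.range t := h5 ▸ hv
  exact h6

theorem exists_mem_inducedCR (hι : IsImmersion (𝓡 (2 * n + 1)) (realModel (n + 1)) ∞ ι)
    (hM : Set.range ι = frontier Ω) (hρ : IsDefiningFunction (n + 1) Ω ρ) {x : M}
    {a : EuclideanSpace ℝ (Fin (2 * n + 1))}
    (ha : jet₁ (n + 1) ρ (ι x) (Complex.I • tmap ι x a) = 0) :
    ∃ b : EuclideanSpace ℝ (Fin (2 * n + 1)),
      ((a, b) : CTangent (2 * n + 1) x) ∈ inducedCR (2 * n + 1) (n + 1) ι x := by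
  obtain ⟨b, hb⟩ := exists_tmap_eq hι hM hρ (x := x) (v := -(Complex.I • tmap ι x a))
    (by rw [map_neg, ha, neg_zero])
  exact ⟨b, mem_inducedCR_iff.2 hb⟩

/-- Splitting off the transversal direction. -/
theorem exists_split (hι : IsImmersion (𝓡 (2 * n + 1)) (realModel (n + 1)) ∞ ι)
    (hM : Set.range ι = frontier Ω) (hρ : IsDefiningFunction (n + 1) Ω ρ) {x : M}
    {s : EuclideanSpace ℝ (Fin (2 * n + 1))}
    (hs : jet₁ (n + 1) ρ (ι x) (Complex.I • tmap ι x s) ≠ 0)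
    (a : EuclideanSpace ℝ (Fin (2 * n + 1))) :
    ∃ a' b : EuclideanSpace ℝ (Fin (2 * n + 1)),
      ((a', b) : CTangent (2 * n + 1) x) ∈ inducedCR (2 * n + 1) (n + 1) ι x ∧
      a = a' + (jet₁ (n + 1) ρ (ι x) (Complex.I • tmap ι x a) /
        jet₁ (n + 1) ρ (ι x) (Complex.I • tmap ι x s)) • s := by
  set c := jet₁ (n + 1) ρ (ι x) (Complex.I • tmap ι x a) /
        jet₁ (n + 1) ρ (ι x) (Complex.I • tmap ι x s) with hc
  obtain ⟨b, hb⟩ := exists_mem_inducedCR hι hM hρ (x := x) (a := a - c • s) (by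
    rw [map_sub, map_smul (tmap ι x), smul_sub Complex.I, I_smul_real_smul, map_sub,
      map_smul (jet₁ (n + 1) ρ (ι x)), smul_eq_mul, hc, div_mul_cancel₀ _ hs, sub_self])
  exact ⟨a - c • s, b, hb, (sub_add_cancel _ _).symm⟩

theorem contMDiffAt_contact (hι : ContMDiff (𝓡 (2 * n + 1)) (realModel (n + 1)) ∞ ι)
    (hρ : IsDefiningFunction (n + 1) Ω ρ) {V : ∀ p : M, RTangent (2 * n + 1) p} {x : M}
    (hV : ContMDiffAt (𝓡 (2 * n + 1)) (𝓡 (2 * n + 1)).tangent ∞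
      (fun p : M => (⟨p, V p⟩ : TangentBundle (𝓡 (2 * n + 1)) M)) x) :
    ContMDiffAt (𝓡 (2 * n + 1)) 𝓘(ℝ, ℝ) ∞
      (fun x' => jet₁ (n + 1) ρ (ι x') (Complex.I • tmap ι x' (V x'))) x := by
  rw [contMDiffAt_iff_chart]
  have h1 := contDiffAt_normalChart (d := n + 1) (ε := 1) hι hV
  have h2 : ContDiffAt ℝ ∞ (fun z => fderiv ℝ (chartRep ρ (ι x)) (embChart (d := n + 1) ι x z))
      (extChartAt (𝓡 (2 * n + 1)) x x) := by
    refine ContDiffAt.comp (g := fderiv ℝ (chartRep ρ (ι x))) _ ?_ (contDiffAt_embChart hι x)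
    rw [embChart_self]
    exact (contDiffAt_chartRep (hρ.smooth _) (mem_extChartAt_source (I := realModel (n + 1)) _)).fderiv_right
      (by simp)
  refine (contDiffAt_congr ?_).1 (h2.clm_apply h1)
  filter_upwards [eventually_chart_symm (eventually_mem_source hι x)] with z hz
  simp only [Function.comp_apply, normalChart, one_smul]
  rw [jet₁_chart hz (hρ.contDiffAt hz)]
  rfl

/-- The normalization η(T) = 1 with T = iS is the statement that N = εJ dι(S) satisfies ∂ρ(N) = 1:
the real part is the normalization, the imaginary part is tangency of S. -/
theorem holPart_normal {l : EuclideanSpace ℂ (Fin (n + 1)) →L[ℝ] ℝ} {ε : ℝ}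
    {s : EuclideanSpace ℂ (Fin (n + 1))} (hs : l s = 0)
    (h : Complex.I * contactCLM ε l s = 1) : holPart l (ε • Complex.I • s) = 1 := by
  rw [contactCLM_apply] at h
  have h1 := congrArg Complex.re h
  simp at h1
  apply Complex.ext
  · rw [holPart_re, map_smul, smul_eq_mul, Complex.one_re]
    linarith
  · rw [holPart_im, I_smul_real_smul, I_smul_I_smul, map_smul, map_neg, hs]
    simp

/-- The D'Angelo form of an embedded hypersurface. -/
theorem IsDAngelo10.eq_dAngeloCLM (hι : IsImmersion (𝓡 (2 * n + 1)) (realModel (n + 1)) ∞ ι)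
    (hM : Set.range ι = frontier Ω) (hρ : IsDefiningFunction (n + 1) Ω ρ)
    {η om : OneForm (2 * n + 1) M} {ε : ℝ} (hε : ε ^ 2 = 1) {x : M}
    (hη : ∀ᶠ x' in 𝓝 x, ∀ a : EuclideanSpace ℝ (Fin (2 * n + 1)),
      η x' a = contactCLM ε (jet₁ (n + 1) ρ (ι x')) (tmap ι x' a))
    {T : ∀ p : M, CTangent (2 * n + 1) p} (hT : (T x).1 = 0) (hT1 : extC (η x) (T x) = 1)
    (hom : IsDAngelo10 (inducedCR (2 * n + 1) (n + 1) ι) η T om)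
    (a : EuclideanSpace ℝ (Fin (2 * n + 1))) :
    om x a = dAngeloCLM (jet₁ (n + 1) ρ (ι x)) (jet₂ (n + 1) ρ (ι x))
      (ε • Complex.I • tmap ι x (T x).2) (tmap ι x a) := by
  have hιs := hι.contMDiff
  set s : EuclideanSpace ℝ (Fin (2 * n + 1)) := (T x).2 with hs
  have e1 : extC (η x) (T x) = Complex.I * contactCLM ε (jet₁ (n + 1) ρ (ι x)) (tmap ι x s) := by
    rw [extC, hT, map_zero, zero_add]
    exact congrArg _ (hη.self_of_nhds s)
  have hN := holPart_normal (jet₁_tmap hιs hM hρ x s) (e1.symm.trans hT1)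
  have hne : jet₁ (n + 1) ρ (ι x) (Complex.I • tmap ι x s) ≠ 0 := by
    intro h0
    rw [e1, contactCLM_apply, h0] at hT1
    simp at hT1
  obtain ⟨a', b, hL, ha⟩ := exists_split hι hM hρ hne a
  set N : EuclideanSpace ℂ (Fin (n + 1)) := ε • Complex.I • tmap ι x s with hNdef
  have hv := holPart_tmap hιs hM hρ hL
  have o1 : om x a' + Complex.I * om x b = _ :=
    (hom.on_T10 x _ hL).trans (dAngelo_eq hιs hρ hε hη hT hL)
  have o2 := hom.on_T01 x _ hL
  have o3 : om x (-b) = -om x b := map_neg (om x) b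
  have o2' : om x a' + Complex.I * om x (-b) = 0 := o2
  rw [o3] at o2'
  -- Adding the conditions on T^{1,0} and on its conjugate isolates the value on the real part of L.
  have o4 : om x a' = hermForm (jet₂ (n + 1) ρ (ι x)) (tmap ι x a') N := by
    linear_combination (1 / 2) * o1 + (1 / 2) * o2'
  have o5 : om x s = 0 := by
    have h := hom.on_T x
    rw [extC, hT, map_zero, zero_add] at h
    exact (mul_eq_zero.1 h).resolve_left Complex.I_ne_zero
  -- The transversal direction is a complex multiple of `N`, and ε² = 1 is used to invert N = εJ
  -- dι(S).
  have hS : tmap ι x s = (-(Complex.I * ε)) • N := by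
    rw [hNdef, ← ofReal_smul_eq, smul_smul, smul_smul]
    have : -(Complex.I * ε) * ε * Complex.I = 1 := by
      have : (ε : ℂ) ^ 2 = 1 := by exact_mod_cast hε
      linear_combination (-(ε : ℂ) ^ 2) * Complex.I_sq + this
    rw [this, one_smul]
  have o6 : dAngeloCLM (jet₁ (n + 1) ρ (ι x)) (jet₂ (n + 1) ρ (ι x)) N (tmap ι x s) = 0 := by
    rw [hS, dAngeloCLM_apply, hermForm_smul_left, holPart_smul, hN,
      hermForm_self (jet₂_symm hρ (ι x))]
    ring
  have o7 : dAngeloCLM (jet₁ (n + 1) ρ (ι x)) (jet₂ (n + 1) ρ (ι x)) N (tmap ι x a') =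
      om x a' := by
    rw [dAngeloCLM_apply, o4, hv, mul_zero, sub_zero]
  generalize jet₁ (n + 1) ρ (ι x) (Complex.I • tmap ι x a) /
        jet₁ (n + 1) ρ (ι x) (Complex.I • tmap ι x s) = c at ha
  have o8 : om x a = om x a' + c • om x s := by
    rw [ha]
    exact (map_add (om x) a' (c • s)).trans (congrArg _ (map_smul (om x) c s))
  rw [o8, o5, smul_zero, add_zero, ha, map_add, map_smul, map_add, map_smul, o6, smul_zero,
    add_zero, o7]

end Transversal

/-! ### From trivializations to defining functions -/

section ToDefining

open Filter Manifold

variable {n : ℕ} {X : Type*} [TopologicalSpace X]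
  [ChartedSpace (EuclideanSpace ℂ (Fin (n + 1))) X] [IsManifold (complexModel (n + 1)) ω X]
  {M : Type*} [TopologicalSpace M] [ChartedSpace (EuclideanSpace ℝ (Fin (2 * n + 1))) M]
  [IsManifold (𝓡 (2 * n + 1)) ∞ M] {ι : M → X} {Ω : Set X} {ρ : X → ℝ}

/-- `η` is locally, up to sign, the contact form of the defining function `ρ`. -/
def IsContactForm (ι : M → X) (ρ : X → ℝ) (η : OneForm (2 * n + 1) M) : Prop :=
  ∀ x, ∃ ε : ℝ, ε ^ 2 = 1 ∧ ∀ᶠ x' in 𝓝 x, ∀ a : EuclideanSpace ℝ (Fin (2 * n + 1)),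
    η x' a = contactCLM ε (jet₁ (n + 1) ρ (ι x')) (tmap ι x' a)

/-- A trivialization is a multiple of the contact form of a defining function. -/
theorem IsTrivialization.eq_contactCLM
    (hι : IsImmersion (𝓡 (2 * n + 1)) (realModel (n + 1)) ∞ ι)
    (hM : Set.range ι = frontier Ω) (hρ : IsDefiningFunction (n + 1) Ω ρ)
    {η : OneForm (2 * n + 1) M} (hη : IsTrivialization (inducedCR (2 * n + 1) (n + 1) ι) η)
    {x : M} {s : EuclideanSpace ℝ (Fin (2 * n + 1))} (hs : η x s = -Complex.I) :
    jet₁ (n + 1) ρ (ι x) (Complex.I • tmap ι x s) ≠ 0 ∧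
    ∀ a : EuclideanSpace ℝ (Fin (2 * n + 1)), η x a =
      contactCLM (2 / jet₁ (n + 1) ρ (ι x) (Complex.I • tmap ι x s)) (jet₁ (n + 1) ρ (ι x))
        (tmap ι x a) := by
  have hann : ∀ a b : EuclideanSpace ℝ (Fin (2 * n + 1)),
      ((a, b) : CTangent (2 * n + 1) x) ∈ inducedCR (2 * n + 1) (n + 1) ι x → η x a = 0 := by
    intro a b hab
    obtain ⟨h1, h2⟩ := hη.annihilates x _ hab
    have o3 : η x (-b) = -η x b := map_neg (η x) b
    have h1' : η x a + Complex.I * η x b = 0 := h1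
    have h2' : η x a + Complex.I * η x (-b) = 0 := h2
    rw [o3] at h2'
    linear_combination (1 / 2) * h1' + (1 / 2) * h2'
  -- Otherwise s would be the real part of a (1,0) vector, and the form would annihilate it.
  have hne : jet₁ (n + 1) ρ (ι x) (Complex.I • tmap ι x s) ≠ 0 := by
    intro h0
    obtain ⟨b, hb⟩ := exists_mem_inducedCR hι hM hρ h0
    rw [hann s b hb] at hs
    simp at hs
  refine ⟨hne, fun a => ?_⟩
  obtain ⟨a', b, hL, ha⟩ := exists_split hι hM hρ hne a
  have o8 : η x a = η x a' + (jet₁ (n + 1) ρ (ι x) (Complex.I • tmap ι x a) /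
      jet₁ (n + 1) ρ (ι x) (Complex.I • tmap ι x s)) • η x s := by
    conv_lhs => rw [ha]
    exact (map_add (η x) a' _).trans (congrArg _ (map_smul (η x) _ s))
  rw [o8, hann a' b hL, hs, contactCLM_apply, Complex.real_smul]
  push_cast
  have : (jet₁ (n + 1) ρ (ι x) (Complex.I • tmap ι x s) : ℂ) ≠ 0 := by exact_mod_cast hne
  field_simp
  ring

theorem IsTransversal.apply_snd {η : OneForm (2 * n + 1) M} {T : ∀ p : M, CTangent (2 * n + 1) p}
    (hT : IsTransversal η T) (x : M) : η x (T x).2 = -Complex.I := by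
  have h := hT.normalized x
  rw [extC, hT.imaginary x, map_zero, zero_add] at h
  linear_combination (-Complex.I) * h + η x (T x).2 * Complex.I_sq

theorem jet₁_exp_mul (hρ : IsDefiningFunction (n + 1) Ω ρ) {F : X → ℝ}
    (hF : ContMDiff (realModel (n + 1)) 𝓘(ℝ, ℝ) ∞ F) {p : X} (hp : p ∈ frontier Ω) :
    jet₁ (n + 1) (fun x => Real.exp (F x) * ρ x) p = Real.exp (F p) • jet₁ (n + 1) ρ p := by
  have h1 := (exp_mul_jets (hρ.contDiffAt_self p) (contDiffAt_chartRep_self hF p)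
    ((chartRep_coord_self ρ p).trans (hρ.eq_zero hp))).1
  rwa [chartRep_coord_self] at h1

/-- A trivialization is the contact form of ρ times the nowhere vanishing function 2/g. Its absolute
value is absorbed in ρ by extending log|2/g| from M to `X`; its sign is locally constant and becomes
ε. -/
theorem exists_isContactForm [T2Space X] [SecondCountableTopology X]
    (hι : IsSmoothEmbedding (𝓡 (2 * n + 1)) (realModel (n + 1)) ∞ ι)
    (hM : Set.range ι = frontier Ω) (hρ : IsDefiningFunction (n + 1) Ω ρ)
    {η : OneForm (2 * n + 1) M} (hη : IsTrivialization (inducedCR (2 * n + 1) (n + 1) ι) η)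
    {T : ∀ p : M, CTangent (2 * n + 1) p} (hT : IsTransversal η T) :
    ∃ H : X → ℝ, ContMDiff (realModel (n + 1)) 𝓘(ℝ, ℝ) ∞ H ∧
      IsContactForm ι (fun q => Real.exp (H q) * ρ q) η := by
  set g : M → ℝ := fun x => jet₁ (n + 1) ρ (ι x) (Complex.I • tmap ι x (T x).2) with hg
  have key := fun x => hη.eq_contactCLM hι.isImmersion hM hρ (hT.apply_snd x)
  have hg0 : ∀ x, g x ≠ 0 := fun x => (key x).1
  have hgs : ContMDiff (𝓡 (2 * n + 1)) 𝓘(ℝ, ℝ) ∞ g := fun x =>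
    contMDiffAt_contact hι.contMDiff hρ (V := fun p => (T p).2) (hT.smooth x)
  -- `Real.log` of a negative number is the logarithm of its absolute value, so no case distinction
  -- on the sign of g is needed.
  have hh : ContMDiff (𝓡 (2 * n + 1)) 𝓘(ℝ, ℝ) ∞ fun x => Real.log (2 / g x) := by
    intro x
    have h1 : ContDiffAt ℝ ∞ (fun t : ℝ => Real.log (2 / t)) (g x) :=
      (contDiffAt_const.div contDiffAt_id (hg0 x)).log (div_ne_zero two_ne_zero (hg0 x))
    exact h1.contMDiffAt.comp x (hgs x)
  obtain ⟨H, hH, hHι⟩ := exists_smooth_extension hι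
    (by rw [hM]; exact isClosed_frontier) hh
  refine ⟨H, hH, fun x => ?_⟩
  have hexp : ∀ x, Real.exp (H (ι x)) = |2 / g x| := fun x => by
    rw [hHι, Real.exp_log_eq_abs (div_ne_zero two_ne_zero (hg0 x))]
  -- The sign is only chosen near x, since M need not be connected.
  have hsign : ∃ ε : ℝ, ε ^ 2 = 1 ∧ ∀ᶠ x' in 𝓝 x, 2 / g x' = ε * |2 / g x'| := by
    rcases lt_or_gt_of_ne (hg0 x) with h | h
    · refine ⟨-1, by norm_num, ?_⟩
      filter_upwards [hgs.continuous.continuousAt.eventually_lt_const h] with x' hx'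
      rw [abs_of_neg (div_neg_of_pos_of_neg two_pos hx')]
      ring
    · refine ⟨1, by norm_num, ?_⟩
      filter_upwards [hgs.continuous.continuousAt.eventually_const_lt h] with x' hx'
      rw [abs_of_pos (div_pos two_pos hx'), one_mul]
  obtain ⟨ε, hε, hev⟩ := hsign
  refine ⟨ε, hε, ?_⟩
  filter_upwards [hev] with x' hx' a
  rw [jet₁_exp_mul hρ hH (hM ▸ Set.mem_range_self x'), hexp, (key x').2 a]
  rw [contactCLM_apply, contactCLM_apply, smul_apply, smul_eq_mul]
  change -(Complex.I * ((2 / g x' : ℝ) : ℂ) / 2) * _ = _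
  conv_lhs => rw [hx']
  push_cast
  ring

/-! ### Null vectors and D'Angelo quadratic forms in terms of ρ. -/

section Forms

variable {η om : OneForm (2 * n + 1) M} {T : ∀ p : M, CTangent (2 * n + 1) p}

theorem IsTransversal.holPart_eq (hι : ContMDiff (𝓡 (2 * n + 1)) (realModel (n + 1)) ∞ ι)
    (hM : Set.range ι = frontier Ω) (hρ : IsDefiningFunction (n + 1) Ω ρ) {ε : ℝ} {x : M}
    (hη : ∀ a : EuclideanSpace ℝ (Fin (2 * n + 1)),
      η x a = contactCLM ε (jet₁ (n + 1) ρ (ι x)) (tmap ι x a))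
    (hT : IsTransversal η T) :
    holPart (jet₁ (n + 1) ρ (ι x)) (ε • Complex.I • tmap ι x (T x).2) = 1 := by
  refine holPart_normal (jet₁_tmap hι hM hρ x _) ?_
  have h1 : η x (T x).2 = _ := hη (T x).2
  rw [← h1, hT.apply_snd x]
  linear_combination -Complex.I_sq

/-- The Levi form is semidefinite, so a vector with vanishing diagonal value is orthogonal to
everything; its sign ε plays no role. -/
theorem nullSpace_iff (hι : IsImmersion (𝓡 (2 * n + 1)) (realModel (n + 1)) ∞ ι)
    (hM : Set.range ι = frontier Ω) (hρ : IsDefiningFunction (n + 1) Ω ρ)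
    (hL : LeviNonneg (n + 1) Ω ρ) {ε : ℝ} (hε : ε ^ 2 = 1) {x : M}
    (hη : ∀ᶠ x' in 𝓝 x, ∀ a : EuclideanSpace ℝ (Fin (2 * n + 1)),
      η x' a = contactCLM ε (jet₁ (n + 1) ρ (ι x')) (tmap ι x' a)) {L : CTangent (2 * n + 1) x}
    (hLx : L ∈ inducedCR (2 * n + 1) (n + 1) ι x) :
    L ∈ nullSpace (inducedCR (2 * n + 1) (n + 1) ι) η x ↔
      hermQuad (jet₂ (n + 1) ρ (ι x)) (tmap ι x L.1) = 0 := by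
  have hιs := hι.contMDiff
  constructor
  · rintro ⟨-, h⟩
    have h1 := h L hLx
    rw [leviForm_eq hιs hρ hη hLx hLx, hermForm_self (jet₂_symm hρ (ι x))] at h1
    have hε0 : ε ≠ 0 := by rintro rfl; norm_num at hε
    have : ((4 * ε * hermQuad (jet₂ (n + 1) ρ (ι x)) (tmap ι x L.1) : ℝ) : ℂ) = 0 := by
      push_cast; exact h1
    have h2 := Complex.ofReal_eq_zero.1 this
    exact (mul_eq_zero.1 h2).resolve_left (mul_ne_zero four_ne_zero hε0)
  · intro h0
    refine ⟨hLx, fun L' hL' => ?_⟩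
    rw [leviForm_eq hιs hρ hη hLx hL', hermForm_eq_zero_of_null (jet₂_symm hρ (ι x))
      (hL (ι x) (hM ▸ Set.mem_range_self x)) (holPart_tmap hιs hM hρ hLx)
      (holPart_tmap hιs hM hρ hL') h0, mul_zero]

/-- The quadratic forms of the D'Angelo form in terms of the defining function. -/
theorem IsDAngelo10.quad_eq (hι : IsImmersion (𝓡 (2 * n + 1)) (realModel (n + 1)) ∞ ι)
    (hM : Set.range ι = frontier Ω) (hρ : IsDefiningFunction (n + 1) Ω ρ)
    (hL : LeviNonneg (n + 1) Ω ρ) {ε : ℝ} (hε : ε ^ 2 = 1) {x : M}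
    (hη : ∀ᶠ x' in 𝓝 x, ∀ a : EuclideanSpace ℝ (Fin (2 * n + 1)),
      η x' a = contactCLM ε (jet₁ (n + 1) ρ (ι x')) (tmap ι x' a))
    (hT : IsTransversal η T) (hom : IsDAngelo10 (inducedCR (2 * n + 1) (n + 1) ι) η T om)
    {L : CTangent (2 * n + 1) x} (hLx : L ∈ inducedCR (2 * n + 1) (n + 1) ι x)
    (h0 : hermQuad (jet₂ (n + 1) ρ (ι x)) (tmap ι x L.1) = 0) (σ κ : ℝ) :
    σ * dbarQuad om x L - (1 / κ - σ) * wedgeQuad om x L =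
      boundaryForm (jet₂ (n + 1) ρ (ι x)) (jet₃ (n + 1) ρ (ι x)) σ κ
        (ε • Complex.I • tmap ι x (T x).2) ((2 : ℝ) • tmap ι x L.1) := by
  have hιs := hι.contMDiff
  have hv := holPart_tmap hιs hM hρ hLx
  have hom' : ∀ᶠ x' in 𝓝 x, ∀ a : EuclideanSpace ℝ (Fin (2 * n + 1)),
      om x' a = dAngeloCLM (jet₁ (n + 1) ρ (ι x')) (jet₂ (n + 1) ρ (ι x'))
        (ε • Complex.I • tmap ι x' (T x').2) (tmap ι x' a) := by
    filter_upwards [hη.eventually_nhds] with x' hx' a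
    exact hom.eq_dAngeloCLM hι hM hρ hε hx' (hT.imaginary x') (hT.normalized x') a
  have hN : ∀ᶠ x' in 𝓝 x, holPart (jet₁ (n + 1) ρ (ι x'))
      (ε • Complex.I • tmap ι x' (T x').2) = 1 := by
    filter_upwards [hη] with x' hx'
    exact hT.holPart_eq hιs hM hρ hx'
  rw [dbarQuad_eq, wedgeQuad_eq hom'.self_of_nhds hLx hv, boundaryForm_eq_leviQuad]
  rw [oneForm_d_dAngelo hιs hM hρ hL (V := fun p => (T p).2) (hT.smooth x) hN hom'
    (mem_inducedCR_iff.1 hLx) hv h0]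

/-- The factor 2 matches the identification of a + ib with the ambient vector 2dι(a). -/
theorem exists_null_lift (hι : IsImmersion (𝓡 (2 * n + 1)) (realModel (n + 1)) ∞ ι)
    (hM : Set.range ι = frontier Ω) (hρ : IsDefiningFunction (n + 1) Ω ρ) {x : M}
    {v : EuclideanSpace ℂ (Fin (n + 1))} (hv : holPart (jet₁ (n + 1) ρ (ι x)) v = 0) :
    ∃ L ∈ inducedCR (2 * n + 1) (n + 1) ι x, (2 : ℝ) • tmap (d := n + 1) ι x L.1 = v := by
  obtain ⟨h1, h2⟩ := (holPart_eq_zero_iff _ _).1 hv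
  obtain ⟨a, ha⟩ := exists_tmap_eq hι hM hρ (x := x) (v := (2⁻¹ : ℝ) • v)
    (by rw [map_smul, h1, smul_zero])
  obtain ⟨b, hb⟩ := exists_mem_inducedCR hι hM hρ (x := x) (a := a)
    (by rw [ha, I_smul_real_smul, map_smul, h2, smul_zero])
  exact ⟨(a, b), hb, by rw [ha, smul_smul]; norm_num⟩

theorem IsContactForm.boundaryPos (hι : IsImmersion (𝓡 (2 * n + 1)) (realModel (n + 1)) ∞ ι)
    (hM : Set.range ι = frontier Ω) (hρ : IsDefiningFunction (n + 1) Ω ρ)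
    (hL : LeviNonneg (n + 1) Ω ρ) (hη : IsContactForm ι ρ η) (hT : IsTransversal η T)
    (hom : IsDAngelo10 (inducedCR (2 * n + 1) (n + 1) ι) η T om) {σ κ : ℝ}
    (hpos : ∀ p : M, ∀ L ∈ nullSpace (inducedCR (2 * n + 1) (n + 1) ι) η p, L ≠ 0 →
      0 < σ * dbarQuad om p L - (1 / κ - σ) * wedgeQuad om p L) :
    BoundaryPos (n + 1) Ω ρ σ κ := by
  intro p hp
  obtain ⟨x, rfl⟩ : p ∈ Set.range ι := hM ▸ hp
  obtain ⟨ε, hε, hηx⟩ := hη x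
  refine ⟨_, hT.holPart_eq hι.contMDiff hM hρ hηx.self_of_nhds, fun v hv0 hv hq => ?_⟩
  obtain ⟨L, hLx, rfl⟩ := exists_null_lift hι hM hρ hv
  rw [hermQuad_real_smul] at hq
  have h0 := (mul_eq_zero.1 hq).resolve_left (by norm_num)
  rw [← hom.quad_eq hι hM hρ hL hε hηx hT hLx h0]
  refine hpos x L ((nullSpace_iff hι hM hρ hL hε hηx hLx).2 h0) ?_
  rintro rfl
  refine hv0 ?_
  have : tmap (d := n + 1) ι x (0 : RTangent (2 * n + 1) x) = 0 := map_zero (tmap ι x)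
  exact (congrArg _ this).trans (smul_zero _)

theorem IsContactForm.boundaryNonneg (hι : IsImmersion (𝓡 (2 * n + 1)) (realModel (n + 1)) ∞ ι)
    (hM : Set.range ι = frontier Ω) (hρ : IsDefiningFunction (n + 1) Ω ρ)
    (hL : LeviNonneg (n + 1) Ω ρ) (hη : IsContactForm ι ρ η) (hT : IsTransversal η T)
    (hom : IsDAngelo10 (inducedCR (2 * n + 1) (n + 1) ι) η T om) {σ κ : ℝ}
    (hpos : ∀ p : M, ∀ L ∈ nullSpace (inducedCR (2 * n + 1) (n + 1) ι) η p,
      0 ≤ σ * dbarQuad om p L - (1 / κ - σ) * wedgeQuad om p L) :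
    BoundaryNonneg (n + 1) Ω ρ σ κ := by
  intro p hp
  obtain ⟨x, rfl⟩ : p ∈ Set.range ι := hM ▸ hp
  obtain ⟨ε, hε, hηx⟩ := hη x
  refine ⟨_, hT.holPart_eq hι.contMDiff hM hρ hηx.self_of_nhds, fun v hv hq => ?_⟩
  obtain ⟨L, hLx, rfl⟩ := exists_null_lift hι hM hρ hv
  rw [hermQuad_real_smul] at hq
  have h0 := (mul_eq_zero.1 hq).resolve_left (by norm_num)
  rw [← hom.quad_eq hι hM hρ hL hε hηx hT hLx h0]
  exact hpos x L ((nullSpace_iff hι hM hρ hL hε hηx hLx).2 h0)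

end Forms

end ToDefining

/-! ### From defining functions to trivializations -/

section ToTrivialization

open Filter Manifold

theorem contDiffAt_contactCLM {E G : Type*} [NormedAddCommGroup E] [NormedSpace ℂ E]
    [NormedSpace ℝ E] [IsScalarTower ℝ ℂ E] [NormedAddCommGroup G] [NormedSpace ℝ G]
    {k : WithTop ℕ∞} {l : G → E →L[ℝ] ℝ} {y : G} (hl : ContDiffAt ℝ k l y) (ε : ℝ) :
    ContDiffAt ℝ k (fun z => contactCLM ε (l z)) y :=
  (contDiffAt_const.clm_comp (hl.clm_comp contDiffAt_const)).const_smul (-(Complex.I * ε / 2))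

theorem dAngeloCLM_smul {E : Type*} [NormedAddCommGroup E] [NormedSpace ℂ E]
    [NormedSpace ℝ E] [IsScalarTower ℝ ℂ E] (l : E →L[ℝ] ℝ) (B : E →L[ℝ] E →L[ℝ] ℝ) (N : E)
    (c : ℂ) (v : E) : dAngeloCLM l B N (c • v) = c * dAngeloCLM l B N v := by
  rw [dAngeloCLM_apply, dAngeloCLM_apply, hermForm_smul_left, holPart_smul]
  ring

variable {n : ℕ} {X : Type*} [TopologicalSpace X]
  [ChartedSpace (EuclideanSpace ℂ (Fin (n + 1))) X] [IsManifold (complexModel (n + 1)) ω X]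
  {M : Type*} [TopologicalSpace M] [ChartedSpace (EuclideanSpace ℝ (Fin (2 * n + 1))) M]
  [IsManifold (𝓡 (2 * n + 1)) ∞ M] {ι : M → X} {Ω : Set X} {ρ : X → ℝ}

/-- The contact form `-(i / 2) dρ ∘ J` of a defining function. -/
def contactForm (n : ℕ) {X : Type*} [TopologicalSpace X]
    [ChartedSpace (EuclideanSpace ℂ (Fin (n + 1))) X] {M : Type*} [TopologicalSpace M]
    [ChartedSpace (EuclideanSpace ℝ (Fin (2 * n + 1))) M] (ι : M → X) (ρ : X → ℝ) :
    OneForm (2 * n + 1) M := fun x =>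
  (contactCLM 1 (jet₁ (n + 1) ρ (ι x))).comp (tmap (d := n + 1) ι x)

theorem contactForm_apply (x : M) (a : EuclideanSpace ℝ (Fin (2 * n + 1))) :
    contactForm n ι ρ x a = contactCLM 1 (jet₁ (n + 1) ρ (ι x)) (tmap ι x a) := rfl

theorem contDiffAt_jets_embChart (hι : ContMDiff (𝓡 (2 * n + 1)) (realModel (n + 1)) ∞ ι)
    (hρ : IsDefiningFunction (n + 1) Ω ρ) (x : M) :
    ContDiffAt ℝ ∞ (fun z => fderiv ℝ (chartRep ρ (ι x)) (embChart (d := n + 1) ι x z))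
      (extChartAt (𝓡 (2 * n + 1)) x x) ∧
    ContDiffAt ℝ ∞ (fun z => fderiv ℝ (fderiv ℝ (chartRep ρ (ι x)))
      (embChart (d := n + 1) ι x z)) (extChartAt (𝓡 (2 * n + 1)) x x) := by
  have h1 : ContDiffAt ℝ ∞ (fderiv ℝ (chartRep ρ (ι x)))
      (embChart (d := n + 1) ι x (extChartAt (𝓡 (2 * n + 1)) x x)) := by
    rw [embChart_self]
    exact (contDiffAt_chartRep (hρ.smooth _)
      (mem_extChartAt_source (I := realModel (n + 1)) _)).fderiv_right (by simp)
  have hj := contDiffAt_embChart (d := n + 1) hι x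
  exact ⟨ContDiffAt.comp (g := fderiv ℝ (chartRep ρ (ι x))) _ h1 hj,
    ContDiffAt.comp (g := fderiv ℝ (fderiv ℝ (chartRep ρ (ι x)))) _ (h1.fderiv_right (by simp)) hj⟩

theorem contactForm_isSmooth (hι : ContMDiff (𝓡 (2 * n + 1)) (realModel (n + 1)) ∞ ι)
    (hρ : IsDefiningFunction (n + 1) Ω ρ) : (contactForm n ι ρ).IsSmooth := by
  rw [OneForm.isSmooth_iff]
  intro x
  have h2 := contDiffAt_contactCLM (contDiffAt_jets_embChart hι hρ x).1 1
  have h3 : ContDiffAt ℝ ∞ (fderiv ℝ (embChart (d := n + 1) ι x))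
      (extChartAt (𝓡 (2 * n + 1)) x x) := (contDiffAt_embChart hι x).fderiv_right (by simp)
  refine (contDiffAt_congr ?_).1 (h2.clm_comp h3)
  filter_upwards [inChart_contact hι hρ (η := contactForm n ι ρ) (ε := 1)
    (Eventually.of_forall fun _ _ => rfl)] with z hz
  exact ContinuousLinearMap.ext fun a => (hz a).symm

theorem exists_transversal_vector (hι : IsImmersion (𝓡 (2 * n + 1)) (realModel (n + 1)) ∞ ι)
    (hM : Set.range ι = frontier Ω) (hρ : IsDefiningFunction (n + 1) Ω ρ) (x : M) :
    ∃ a : EuclideanSpace ℝ (Fin (2 * n + 1)),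
      0 < jet₁ (n + 1) ρ (ι x) (Complex.I • tmap ι x a) := by
  obtain ⟨w, hw⟩ := exists_normal hρ (hM ▸ Set.mem_range_self x)
  have h1 := holPart_re (jet₁ (n + 1) ρ (ι x)) w
  have h2 := holPart_im (jet₁ (n + 1) ρ (ι x)) w
  rw [hw] at h1 h2
  simp only [Complex.one_re, Complex.one_im] at h1 h2
  obtain ⟨a, ha⟩ := exists_tmap_eq hι hM hρ (x := x) (v := -(Complex.I • w)) (by
    rw [map_neg]
    linarith)
  refine ⟨a, ?_⟩
  rw [ha, smul_neg, I_smul_I_smul, neg_neg]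
  linarith

theorem contactForm_isPositiveTrivialization
    (hι : IsImmersion (𝓡 (2 * n + 1)) (realModel (n + 1)) ∞ ι)
    (hM : Set.range ι = frontier Ω) (hρ : IsDefiningFunction (n + 1) Ω ρ)
    (hL : LeviNonneg (n + 1) Ω ρ) :
    IsPositiveTrivialization (inducedCR (2 * n + 1) (n + 1) ι) (contactForm n ι ρ) where
  smooth := contactForm_isSmooth hι.contMDiff hρ
  imaginary p v := by
    have h : contactForm n ι ρ p v = _ := contactForm_apply p v
    rw [h, contactCLM_apply]
    simp
  ne_zero p h := by
    obtain ⟨a, ha⟩ := exists_transversal_vector hι hM hρ p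
    have h1 := contactForm_apply (ι := ι) (ρ := ρ) p a
    have h2 : contactForm n ι ρ p a = 0 := DFunLike.congr_fun h a
    rw [h2, contactCLM_apply] at h1
    simp [ha.ne'] at h1
  annihilates p L hLp := by
    have hz : ∀ a : EuclideanSpace ℝ (Fin (2 * n + 1)),
        jet₁ (n + 1) ρ (ι p) (Complex.I • tmap ι p a) = 0 → contactForm n ι ρ p a = 0 := by
      intro a ha
      rw [contactForm_apply, contactCLM_apply, ha]
      simp
    have h1 : contactForm n ι ρ p L.1 = 0 :=
      hz _ ((holPart_eq_zero_iff _ _).1 (holPart_tmap hι.contMDiff hM hρ hLp)).2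
    have h2 : contactForm n ι ρ p L.2 = 0 := by
      refine hz _ ?_
      rw [mem_inducedCR_iff] at hLp
      have h3 : Complex.I • tmap (d := n + 1) ι p L.2 = tmap (d := n + 1) ι p L.1 := by
        rw [hLp, smul_neg, I_smul_I_smul, neg_neg]
      exact (congrArg _ h3).trans (jet₁_tmap hι.contMDiff hM hρ p _)
    have h3 : contactForm n ι ρ p (-L.2) = 0 :=
      (map_neg (contactForm n ι ρ p) L.2).trans ((congrArg Neg.neg h2).trans neg_zero)
    constructor
    · rw [extC, h1, h2]; simp
    · rw [extC, conjC]; simp only [h1, h3]; simp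
  levi_nonneg p L hLp := by
    have h := leviForm_eq hι.contMDiff hρ (η := contactForm n ι ρ) (ε := 1) (x := p)
      (Eventually.of_forall fun _ _ => rfl) hLp hLp
    rw [h, hermForm_self (jet₂_symm hρ (ι p))]
    have := hL (ι p) (hM ▸ Set.mem_range_self p) _ (holPart_tmap hι.contMDiff hM hρ hLp)
    have e : ((4 : ℂ) * ((1 : ℝ) : ℂ) * (hermQuad (jet₂ (n + 1) ρ (ι p)) (tmap ι p L.1) : ℂ)).re =
      4 * hermQuad (jet₂ (n + 1) ρ (ι p)) (tmap ι p L.1) := by simp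
    rw [e]
    positivity

/-- Vectors a with dρ(J dι(a)) > 0 form a nonempty convex set at every point, and the condition is
open along local sections, so a partition of unity gives a global smooth field, which is then
normalized. -/
theorem exists_isTransversal [T2Space M] [CompactSpace M]
    (hι : IsImmersion (𝓡 (2 * n + 1)) (realModel (n + 1)) ∞ ι)
    (hM : Set.range ι = frontier Ω) (hρ : IsDefiningFunction (n + 1) Ω ρ) :
    ∃ T : ∀ p : M, CTangent (2 * n + 1) p, IsTransversal (contactForm n ι ρ) T := by
  obtain ⟨s, hs⟩ := exists_contMDiffSection_forall_mem_convex_of_local (n := (⊤ : ℕ∞))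
    (𝓡 (2 * n + 1)) (F_fiber := EuclideanSpace ℝ (Fin (2 * n + 1)))
    (fun p : M => TangentSpace (𝓡 (2 * n + 1)) p)
    (fun x => {a | 0 < jet₁ (n + 1) ρ (ι x) (Complex.I • tmap ι x a)})
    (fun x a ha b hb s t hs ht hst => by
      have h1 : jet₁ (n + 1) ρ (ι x) (Complex.I • tmap (d := n + 1) ι x (s • a + t • b)) =
          s * jet₁ (n + 1) ρ (ι x) (Complex.I • tmap ι x a) +
            t * jet₁ (n + 1) ρ (ι x) (Complex.I • tmap ι x b) := by
        have h2 : tmap (d := n + 1) ι x (s • a + t • b) =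
            s • tmap (d := n + 1) ι x a + t • tmap (d := n + 1) ι x b :=
          (map_add (tmap ι x) _ _).trans
            (congrArg₂ _ (map_smul (tmap ι x) s a) (map_smul (tmap ι x) t b))
        rw [h2, smul_add, I_smul_real_smul, I_smul_real_smul, map_add,
          map_smul (jet₁ (n + 1) ρ (ι x)), map_smul (jet₁ (n + 1) ρ (ι x)), smul_eq_mul,
          smul_eq_mul]
      refine lt_of_lt_of_eq ?_ h1.symm
      have ha' : 0 < jet₁ (n + 1) ρ (ι x) (Complex.I • tmap ι x a) := ha
      have hb' : 0 < jet₁ (n + 1) ρ (ι x) (Complex.I • tmap ι x b) := hb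
      rcases hs.eq_or_lt with rfl | hs
      · rw [zero_add] at hst
        subst hst
        linarith
      · have := mul_pos hs ha'
        have := mul_nonneg ht hb'.le
        linarith)
    (fun x => by
      obtain ⟨a, ha⟩ := exists_transversal_vector hι hM hρ x
      let σ₀ : TangentSpace (𝓡 (2 * n + 1)) x := a
      obtain ⟨U, hU, hs⟩ := FiberBundle.exists_contMDiffOn_extend (k := ∞) (𝓡 (2 * n + 1))
        (EuclideanSpace ℝ (Fin (2 * n + 1))) (V := fun p : M => TangentSpace (𝓡 (2 * n + 1)) p) σ₀
      have hg := contMDiffAt_contact hι.contMDiff hρ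
        (V := FiberBundle.extend (EuclideanSpace ℝ (Fin (2 * n + 1))) σ₀) (hs.contMDiffAt hU)
      have hpos : 0 < jet₁ (n + 1) ρ (ι x) (Complex.I • tmap ι x
          (FiberBundle.extend (EuclideanSpace ℝ (Fin (2 * n + 1))) σ₀ x)) := by
        rw [FiberBundle.extend_apply_self]
        exact ha
      exact ⟨U ∩ _, inter_mem hU (hg.continuousAt.eventually_const_lt hpos), _,
        hs.mono Set.inter_subset_left, fun y hy => hy.2⟩)
  set g : M → ℝ := fun x => jet₁ (n + 1) ρ (ι x) (Complex.I • tmap ι x (s x)) with hg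
  have hg0 : ∀ x, 0 < g x := hs
  have hgs : ∀ x, ContMDiffAt (𝓡 (2 * n + 1)) 𝓘(ℝ, ℝ) ∞ g x := fun x =>
    contMDiffAt_contact hι.contMDiff hρ (V := fun p => s p) (s.contMDiff x)
  -- On the section s the contact form takes the value -(i/2)g; the factor 2/g brings it to -i,
  -- which is η(T) = 1 for T = iS.
  refine ⟨fun x => (0, (2 / g x) • s x), ?_, fun _ => rfl, fun x => ?_⟩
  · intro x
    have h1 := (vectorField_contMDiffAt_iff (fun p => s p) x).1 (s.contMDiff x)
    have h2 := contMDiffAt_iff_chart.1 (hgs x)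
    refine (vectorField_contMDiffAt_iff _ x).2 ?_
    have h3 := (contDiffAt_const (c := (2 : ℝ))).div h2 (hg0 _).ne'
    refine (contDiffAt_congr (Eventually.of_forall fun z => ?_)).1 (h3.smul h1)
    exact (map_smul (realChartDeriv x ((extChartAt (𝓡 (2 * n + 1)) x).symm z)) _ _).symm
  · have h1 : contactForm n ι ρ x ((2 / g x) • s x) = (2 / g x) • contactForm n ι ρ x (s x) :=
      map_smul (contactForm n ι ρ x) _ _
    have h2 : contactForm n ι ρ x (s x) = _ := contactForm_apply x (s x)
    have h3 : contactForm n ι ρ x 0 = 0 := map_zero (contactForm n ι ρ x)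
    rw [extC]
    simp only [h1, h3, h2]
    rw [contactCLM_apply]
    change 0 + Complex.I * ((2 / g x) • (-(Complex.I * ((1 : ℝ) : ℂ) / 2) * (g x : ℂ))) = 1
    have h4 : (g x : ℂ) ≠ 0 := by exact_mod_cast (hg0 x).ne'
    rw [Complex.real_smul]
    push_cast
    field_simp
    linear_combination -Complex.I_sq

/-- The pullback of `dAngeloCLM` works: complex linearity makes it annihilate T^{0,1}, and its
correction term makes it vanish on `N`, hence on T. -/
theorem exists_isDAngelo10 (hι : IsImmersion (𝓡 (2 * n + 1)) (realModel (n + 1)) ∞ ι)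
    (hM : Set.range ι = frontier Ω) (hρ : IsDefiningFunction (n + 1) Ω ρ)
    {T : ∀ p : M, CTangent (2 * n + 1) p} (hT : IsTransversal (contactForm n ι ρ) T) :
    ∃ om, IsDAngelo10 (inducedCR (2 * n + 1) (n + 1) ι) (contactForm n ι ρ) T om := by
  have hιs := hι.contMDiff
  set N : M → EuclideanSpace ℂ (Fin (n + 1)) := fun x => (1 : ℝ) • Complex.I • tmap ι x (T x).2
    with hN
  set om : OneForm (2 * n + 1) M := fun x =>
    (dAngeloCLM (jet₁ (n + 1) ρ (ι x)) (jet₂ (n + 1) ρ (ι x)) (N x)).comp (tmap ι x) with hom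
  have hom1 : ∀ x (a : RTangent (2 * n + 1) x), om x a =
    dAngeloCLM (jet₁ (n + 1) ρ (ι x)) (jet₂ (n + 1) ρ (ι x)) (N x) (tmap ι x a) := fun _ _ => rfl
  have hN1 : ∀ x, holPart (jet₁ (n + 1) ρ (ι x)) (N x) = 1 := fun x =>
    hT.holPart_eq hιs hM hρ (fun _ => rfl)
  refine ⟨om, ?_, fun p L hL => ?_, fun p L hL => ?_, fun p => ?_⟩
  · rw [OneForm.isSmooth_iff]
    intro x
    obtain ⟨h1, h2⟩ := contDiffAt_jets_embChart hιs hρ x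
    have h3 := contDiffAt_normalChart (d := n + 1) (ε := 1) hιs (V := fun p => (T p).2) (hT.smooth x)
    have h4 : ContDiffAt ℝ ∞ (fderiv ℝ (embChart (d := n + 1) ι x))
        (extChartAt (𝓡 (2 * n + 1)) x x) := (contDiffAt_embChart hιs x).fderiv_right (by simp)
    refine (contDiffAt_congr ?_).1 ((contDiffAt_dAngeloCLM h1 h2 h3).clm_comp h4)
    filter_upwards [inChart_dAngelo hιs hρ (om := om) (N := N) (x := x)
      (Eventually.of_forall fun _ _ => rfl)] with z hz
    exact ContinuousLinearMap.ext fun a => (hz a).symm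
  · have hv := holPart_tmap hιs hM hρ hL
    have hL' := mem_inducedCR_iff.1 hL
    rw [dAngelo_eq hιs hρ (η := contactForm n ι ρ) (ε := 1) (one_pow 2)
      (Eventually.of_forall fun _ _ => rfl) (hT.imaginary p) hL, extC, hom1, hom1, hL', ← neg_smul,
      dAngeloCLM_smul, dAngeloCLM_apply, hv]
    change _ = 2 * hermForm _ _ (N p)
    linear_combination (-hermForm (jet₂ (n + 1) ρ (ι p)) (tmap ι p L.1) (N p)) * Complex.I_sq
  · have hL' := mem_inducedCR_iff.1 hL
    have h2 : tmap (d := n + 1) ι p (-L.2) = Complex.I • tmap (d := n + 1) ι p L.1 :=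
      (map_neg (tmap (d := n + 1) ι p) L.2).trans ((congrArg Neg.neg hL').trans (neg_neg _))
    rw [extC, conjC]
    simp only [hom1, h2, dAngeloCLM_smul]
    linear_combination (dAngeloCLM (jet₁ (n + 1) ρ (ι p)) (jet₂ (n + 1) ρ (ι p)) (N p)
      (tmap ι p L.1)) * Complex.I_sq
  · have hS : tmap (d := n + 1) ι p (T p).2 = (-Complex.I) • N p := by
      simp only [hN, one_smul, smul_smul]
      simp
    have h0 : om p 0 = 0 := map_zero (om p)
    rw [extC, hT.imaginary p, h0, hom1, hS, dAngeloCLM_smul, dAngeloCLM_apply, hN1,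
      hermForm_self (jet₂_symm hρ (ι p))]
    ring

/-! ### From the boundary form back to the CR conditions. -/

section Conclusion

variable [T2Space M] [CompactSpace M]

/-- The transversal field dictates its own normal vector, usually not the one supplied by
`BoundaryPos`; independence of the normal vector bridges the two. -/
theorem BoundaryPos.posOnNull (hι : IsImmersion (𝓡 (2 * n + 1)) (realModel (n + 1)) ∞ ι)
    (hM : Set.range ι = frontier Ω) (hρ : IsDefiningFunction (n + 1) Ω ρ)
    (hL : LeviNonneg (n + 1) Ω ρ) {σ κ : ℝ} (hb : BoundaryPos (n + 1) Ω ρ σ κ) :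
    PosOnNull (inducedCR (2 * n + 1) (n + 1) ι) (contactForm n ι ρ) σ (1 / κ - σ) := by
  obtain ⟨T, hT⟩ := exists_isTransversal hι hM hρ
  obtain ⟨om, hom⟩ := exists_isDAngelo10 hι hM hρ hT
  refine ⟨T, om, hT, hom, fun p L hLp hL0 => ?_⟩
  have hη : ∀ᶠ x' in 𝓝 p, ∀ a : EuclideanSpace ℝ (Fin (2 * n + 1)), contactForm n ι ρ x' a =
      contactCLM 1 (jet₁ (n + 1) ρ (ι x')) (tmap ι x' a) := Eventually.of_forall fun _ _ => rfl
  have h0 := (nullSpace_iff hι hM hρ hL (one_pow 2) hη hLp.1).1 hLp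
  rw [hom.quad_eq hι hM hρ hL (one_pow 2) hη hT hLp.1 h0]
  have hv := holPart_tmap hι.contMDiff hM hρ hLp.1
  refine hb.forall_normal hL hρ (hM ▸ Set.mem_range_self p)
    (hT.holPart_eq hι.contMDiff hM hρ hη.self_of_nhds) ?_ ?_ ?_
  · intro h1
    have h2 := (smul_eq_zero.1 h1).resolve_left two_ne_zero
    have h3 : L.1 = 0 := tmap_injective hι p (h2.trans (map_zero (tmap ι p)).symm)
    have h4 := mem_inducedCR_iff.1 hLp.1
    rw [h2, smul_zero, neg_zero] at h4
    exact hL0 (Prod.ext h3 (tmap_injective hι p (h4.trans (map_zero (tmap ι p)).symm)))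
  · rw [← ofReal_smul_eq, holPart_smul, hv, mul_zero]
  · rw [hermQuad_real_smul, h0, mul_zero]

theorem BoundaryNonneg.nonnegOnNull
    (hι : IsImmersion (𝓡 (2 * n + 1)) (realModel (n + 1)) ∞ ι)
    (hM : Set.range ι = frontier Ω) (hρ : IsDefiningFunction (n + 1) Ω ρ)
    (hL : LeviNonneg (n + 1) Ω ρ) {σ κ : ℝ} (hb : BoundaryNonneg (n + 1) Ω ρ σ κ) :
    NonnegOnNull (inducedCR (2 * n + 1) (n + 1) ι) (contactForm n ι ρ) σ (1 / κ - σ) := by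
  obtain ⟨T, hT⟩ := exists_isTransversal hι hM hρ
  obtain ⟨om, hom⟩ := exists_isDAngelo10 hι hM hρ hT
  refine ⟨T, om, hT, hom, fun p L hLp => ?_⟩
  have hη : ∀ᶠ x' in 𝓝 p, ∀ a : EuclideanSpace ℝ (Fin (2 * n + 1)), contactForm n ι ρ x' a =
      contactCLM 1 (jet₁ (n + 1) ρ (ι x')) (tmap ι x' a) := Eventually.of_forall fun _ _ => rfl
  have h0 := (nullSpace_iff hι hM hρ hL (one_pow 2) hη hLp.1).1 hLp
  rw [hom.quad_eq hι hM hρ hL (one_pow 2) hη hT hLp.1 h0]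
  have hv := holPart_tmap hι.contMDiff hM hρ hLp.1
  refine hb.forall_normal hL hρ (hM ▸ Set.mem_range_self p)
    (hT.holPart_eq hι.contMDiff hM hρ hη.self_of_nhds) ?_ ?_
  · rw [← ofReal_smul_eq, holPart_smul, hv, mul_zero]
  · rw [hermQuad_real_smul, h0, mul_zero]

end Conclusion

end ToTrivialization

/-! ### Comparison of the indices -/

section Indices

open Filter Manifold

/-- The inclusions give one direction; the last set falls back into the first after any decrease of
γ, so the suprema cannot differ. Nonemptiness of the first set is what makes the common value
positive. -/
theorem sSup_chain {A B C D : Set ℝ} (hAB : A ⊆ B) (hBC : B ⊆ C) (hCD : C ⊆ D)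
    (hD : ∀ γ ∈ D, 0 < γ ∧ γ < 1) (hne : A.Nonempty)
    (hDA : ∀ γ ∈ D, ∀ γ', 0 < γ' → γ' < γ → γ' ∈ A) :
    0 < sSup A ∧ sSup A = sSup B ∧ sSup B = sSup C ∧ sSup C = sSup D := by
  have hbD : BddAbove D := ⟨1, fun γ hγ => (hD γ hγ).2.le⟩
  have hbC := hbD.mono hCD
  have hbB := hbC.mono hBC
  have hbA := hbB.mono hAB
  have hneB := hne.mono hAB
  have hneC := hneB.mono hBC
  have hneD := hneC.mono hCD
  have hpos : 0 < sSup A := by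
    obtain ⟨γ, hγ⟩ := hne
    exact (hD γ (hCD (hBC (hAB hγ)))).1.trans_le (le_csSup hbA hγ)
  have h1 := csSup_le_csSup hbB hne hAB
  have h2 := csSup_le_csSup hbC hneB hBC
  have h3 := csSup_le_csSup hbD hneC hCD
  have h4 : sSup D ≤ sSup A := csSup_le hneD fun γ hγ => by
    refine le_of_forall_lt_imp_le_of_dense fun a ha => ?_
    rcases le_or_gt a 0 with h0 | h0
    · exact h0.trans hpos.le
    · exact le_csSup hbA (hDA γ hγ a h0 ha)
  exact ⟨hpos, by linarith, by linarith, by linarith⟩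

/-- No nonemptiness is required: the infima are taken in `EReal`, and if one of the four sets is
empty then all are and the common value is ∞. -/
theorem sInf_chain {A B C D : Set ℝ} (hAB : A ⊆ B) (hBC : B ⊆ C) (hCD : C ⊆ D)
    (hDA : ∀ γ ∈ D, ∀ γ', γ < γ' → γ' ∈ A) :
    sInf ((fun γ : ℝ => (γ : EReal)) '' D) = sInf ((fun γ : ℝ => (γ : EReal)) '' C) ∧
    sInf ((fun γ : ℝ => (γ : EReal)) '' C) = sInf ((fun γ : ℝ => (γ : EReal)) '' B) ∧
    sInf ((fun γ : ℝ => (γ : EReal)) '' B) = sInf ((fun γ : ℝ => (γ : EReal)) '' A) := by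
  have h1 := sInf_le_sInf (Set.image_mono (f := fun γ : ℝ => (γ : EReal)) hAB)
  have h2 := sInf_le_sInf (Set.image_mono (f := fun γ : ℝ => (γ : EReal)) hBC)
  have h3 := sInf_le_sInf (Set.image_mono (f := fun γ : ℝ => (γ : EReal)) hCD)
  have h4 : sInf ((fun γ : ℝ => (γ : EReal)) '' A) ≤ sInf ((fun γ : ℝ => (γ : EReal)) '' D) := by
    refine le_sInf ?_
    rintro _ ⟨γ, hγ, rfl⟩
    refine EReal.le_of_forall_lt_iff_le.1 fun z hz => sInf_le ⟨z, hDA γ hγ z ?_, rfl⟩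
    exact EReal.coe_lt_coe_iff.1 hz
  exact ⟨le_antisymm h3 (h2.trans (h1.trans h4)), le_antisymm h2 (h1.trans (h4.trans h3)),
    le_antisymm h1 (h4.trans (h3.trans h2))⟩

theorem IsStrictlyPSHOn.isPSHOn {d : ℕ} {X : Type*} [TopologicalSpace X]
    [ChartedSpace (EuclideanSpace ℂ (Fin d)) X] {u : X → ℝ} {U : Set X}
    (h : IsStrictlyPSHOn d u U) : IsPSHOn d u U := by
  intro p hp v
  by_cases hv : v = 0
  · subst hv
    have h0 : complexHessian d u p 0 = 0 := by
      change hermQuad (fderiv ℝ (fderiv ℝ (chartRep u p)) (coord d p p))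
        (0 : EuclideanSpace ℂ (Fin d)) = 0
      simp [hermQuad]
    exact h0.ge
  · exact (h p hp v hv).le

variable {n : ℕ} {X : Type*} [TopologicalSpace X] [T2Space X] [SecondCountableTopology X]
  [ChartedSpace (EuclideanSpace ℂ (Fin (n + 1))) X] [IsManifold (complexModel (n + 1)) ω X]
  {M : Type*} [TopologicalSpace M] [ChartedSpace (EuclideanSpace ℝ (Fin (2 * n + 1))) M]
  [IsManifold (𝓡 (2 * n + 1)) ∞ M] {ι : M → X} {Ω : Set X} {ρ : X → ℝ}

theorem IsPseudoconvexDomain.exists_leviNonneg (hΩ : IsPseudoconvexDomain (n + 1) Ω) :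
    ∃ ρ, IsDefiningFunction (n + 1) Ω ρ ∧ LeviNonneg (n + 1) Ω ρ := by
  obtain ⟨ρ, hρ, h⟩ := hΩ.pseudoconvex
  refine ⟨ρ, hρ, fun p hp v hv => ?_⟩
  obtain ⟨h1, h2⟩ := (holPart_eq_zero_iff _ _).1 hv
  exact h p hp v ((diff_eq (hρ.mdifferentiableAt p) v).trans h1)
    ((diff_eq (hρ.mdifferentiableAt p) _).trans h2)

theorem IsPseudoconvexDomain.isCompact_frontier (hΩ : IsPseudoconvexDomain (n + 1) Ω) :
    IsCompact (frontier Ω) :=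
  hΩ.relCompact.of_isClosed_subset isClosed_frontier frontier_subset_closure

/-- Passage from M to Ω at a fixed exponent. The factor exp(H) is kept explicit because two such
defining functions are later compared through the difference of their exponents. -/
theorem exists_boundaryPos_of_posOnNull
    (hι : IsSmoothEmbedding (𝓡 (2 * n + 1)) (realModel (n + 1)) ∞ ι)
    (hM : Set.range ι = frontier Ω) (hρ : IsDefiningFunction (n + 1) Ω ρ)
    (hL : LeviNonneg (n + 1) Ω ρ) {η : OneForm (2 * n + 1) M}
    (hη : IsPositiveTrivialization (inducedCR (2 * n + 1) (n + 1) ι) η) {σ κ : ℝ}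
    (h : PosOnNull (inducedCR (2 * n + 1) (n + 1) ι) η σ (1 / κ - σ)) :
    ∃ H : X → ℝ, ContMDiff (realModel (n + 1)) 𝓘(ℝ, ℝ) ∞ H ∧
      BoundaryPos (n + 1) Ω (fun x => Real.exp (H x) * ρ x) σ κ := by
  obtain ⟨T, om, hT, hom, hpos⟩ := h
  obtain ⟨H, hH, hc⟩ := exists_isContactForm hι hM hρ hη.toIsTrivialization hT
  exact ⟨H, hH, hc.boundaryPos hι.isImmersion hM (hρ.exp_mul hH) (hL.exp_mul hρ hH) hT hom hpos⟩

theorem exists_boundaryNonneg_of_nonnegOnNull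
    (hι : IsSmoothEmbedding (𝓡 (2 * n + 1)) (realModel (n + 1)) ∞ ι)
    (hM : Set.range ι = frontier Ω) (hρ : IsDefiningFunction (n + 1) Ω ρ)
    (hL : LeviNonneg (n + 1) Ω ρ) {η : OneForm (2 * n + 1) M}
    (hη : IsPositiveTrivialization (inducedCR (2 * n + 1) (n + 1) ι) η) {σ κ : ℝ}
    (h : NonnegOnNull (inducedCR (2 * n + 1) (n + 1) ι) η σ (1 / κ - σ)) :
    ∃ H : X → ℝ, ContMDiff (realModel (n + 1)) 𝓘(ℝ, ℝ) ∞ H ∧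
      BoundaryNonneg (n + 1) Ω (fun x => Real.exp (H x) * ρ x) σ κ := by
  obtain ⟨T, om, hT, hom, hpos⟩ := h
  obtain ⟨H, hH, hc⟩ := exists_isContactForm hι hM hρ hη.toIsTrivialization hT
  exact ⟨H, hH, hc.boundaryNonneg hι.isImmersion hM (hρ.exp_mul hH) (hL.exp_mul hρ hH) hT hom hpos⟩

/-- Interpolation between a weak and a strong trivialization. -/
theorem exists_posOnNull_of_nonneg_of_pos
    (hι : IsSmoothEmbedding (𝓡 (2 * n + 1)) (realModel (n + 1)) ∞ ι)
    (hM : Set.range ι = frontier Ω) (hΩ : IsPseudoconvexDomain (n + 1) Ω)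
    {η₀ η₁ : OneForm (2 * n + 1) M}
    (hη₀ : IsPositiveTrivialization (inducedCR (2 * n + 1) (n + 1) ι) η₀)
    (hη₁ : IsPositiveTrivialization (inducedCR (2 * n + 1) (n + 1) ι) η₁) {σ κ₁ κ₀ κ : ℝ}
    (hσ : σ ^ 2 = 1) (hκ₀ : 0 < κ₀) (hκ₀1 : κ₀ < 1) (hκ : 0 < 1 / κ - σ) (hκ₁ : 1 / κ < 1 / κ₁)
    (h₀ : PosOnNull (inducedCR (2 * n + 1) (n + 1) ι) η₀ 1 (1 / κ₀ - 1))
    (h₁ : NonnegOnNull (inducedCR (2 * n + 1) (n + 1) ι) η₁ σ (1 / κ₁ - σ)) :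
    ∃ η, IsPositiveTrivialization (inducedCR (2 * n + 1) (n + 1) ι) η ∧
      PosOnNull (inducedCR (2 * n + 1) (n + 1) ι) η σ (1 / κ - σ) := by
  have : CompactSpace M := compactSpace_of_embedding hι (hM ▸ hΩ.isCompact_frontier)
  have : T2Space M := hι.isEmbedding.t2Space
  obtain ⟨ρ, hρ, hL⟩ := hΩ.exists_leviNonneg
  obtain ⟨H₀, hH₀, hb₀⟩ := exists_boundaryPos_of_posOnNull hι hM hρ hL hη₀ h₀
  obtain ⟨H₁, hH₁, hb₁⟩ := exists_boundaryNonneg_of_nonnegOnNull hι hM hρ hL hη₁ h₁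
  have hρ₁ := hρ.exp_mul hH₁
  have hL₁ := hL.exp_mul hρ hH₁
  -- Relative to the weak defining function exp(H₁)ρ, the strong one is obtained with the weight H₀
  -- - H₁, which is the direction of interpolation.
  have hF := hH₀.sub hH₁
  have e : (fun x => Real.exp (H₀ x - H₁ x) * (Real.exp (H₁ x) * ρ x)) =
      fun x => Real.exp (H₀ x) * ρ x := by
    ext x
    rw [← mul_assoc, ← Real.exp_add, sub_add_cancel]
  obtain ⟨t, ht⟩ := exists_boundaryPos_of_nonneg_of_pos (F := fun x => H₀ x - H₁ x) hρ₁ hL₁ hF hσ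
    hκ₀ hκ₀1 hκ hκ₁ hb₁ (by rw [e]; exact hb₀)
  have htF : ContMDiff (realModel (n + 1)) 𝓘(ℝ, ℝ) ∞ (fun x => t * (H₀ x - H₁ x)) :=
    contMDiff_const.mul hF
  have hρ₂ := hρ₁.exp_mul htF
  have hL₂ := hL₁.exp_mul hρ₁ htF
  exact ⟨_, contactForm_isPositiveTrivialization hι.isImmersion hM hρ₂ hL₂,
    ht.posOnNull hι.isImmersion hM hρ₂ hL₂⟩

/-- Both hypotheses give ∂̄_b ω > 0 on null vectors for some ρ, the borderline κ = 1; compactness of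
the boundary improves this to a positive exponent. -/
theorem exists_posOnNull
    (hι : IsSmoothEmbedding (𝓡 (2 * n + 1)) (realModel (n + 1)) ∞ ι)
    (hM : Set.range ι = frontier Ω) (hΩ : IsPseudoconvexDomain (n + 1) Ω)
    (h : IsStein (n + 1) X ∨ IsTakeuchiOneConvex (n + 1) Ω) :
    ∃ γ : ℝ, 0 < γ ∧ γ < 1 ∧ ∃ η,
      IsPositiveTrivialization (inducedCR (2 * n + 1) (n + 1) ι) η ∧
      PosOnNull (inducedCR (2 * n + 1) (n + 1) ι) η 1 (1 / (1 - γ) - 1) := by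
  have : CompactSpace M := compactSpace_of_embedding hι (hM ▸ hΩ.isCompact_frontier)
  have : T2Space M := hι.isEmbedding.t2Space
  have hc := hΩ.isCompact_frontier
  have key : ∃ ρ, IsDefiningFunction (n + 1) Ω ρ ∧ LeviNonneg (n + 1) Ω ρ ∧
      BoundaryPos (n + 1) Ω ρ 1 1 := by
    rcases h with h | h
    · obtain ⟨ρ, hρ, hL⟩ := hΩ.exists_leviNonneg
      obtain ⟨φ, hφ, hφpos⟩ := h.exists_weight hc
      obtain ⟨K, hK⟩ := exists_weight_boundaryPos hρ hL hc hφ hφpos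
      have hKφ : ContMDiff (realModel (n + 1)) 𝓘(ℝ, ℝ) ∞ (fun x => -K * φ x) :=
        contMDiff_const.mul hφ
      exact ⟨_, hρ.exp_mul hKφ, hL.exp_mul hρ hKφ, hK⟩
    · exact h.exists_boundaryPos
  obtain ⟨ρ, hρ, hL, hb⟩ := key
  obtain ⟨γ, h0, h1, hγ⟩ := hb.exists_improvement hρ hL hc
  exact ⟨γ, h0, h1, _, contactForm_isPositiveTrivialization hι.isImmersion hM hρ hL,
    hγ.posOnNull hι.isImmersion hM hρ hL⟩

theorem exists_strictlyPSH_inside_of_posOnNull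
    (hι : IsSmoothEmbedding (𝓡 (2 * n + 1)) (realModel (n + 1)) ∞ ι)
    (hM : Set.range ι = frontier Ω) (hΩ : IsPseudoconvexDomain (n + 1) Ω)
    {η : OneForm (2 * n + 1) M}
    (hη : IsPositiveTrivialization (inducedCR (2 * n + 1) (n + 1) ι) η) {γ : ℝ} (hγ : 0 < γ)
    (hγ1 : γ < 1) (h : PosOnNull (inducedCR (2 * n + 1) (n + 1) ι) η 1 (1 / (1 - γ) - 1)) :
    ∃ ρ : X → ℝ, IsDefiningFunction (n + 1) Ω ρ ∧ ∃ W : Set X, IsOpen W ∧ frontier Ω ⊆ W ∧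
      IsStrictlyPSHOn (n + 1) (fun x => -(-ρ x) ^ γ) (Ω ∩ W) := by
  obtain ⟨ρ, hρ, hL⟩ := hΩ.exists_leviNonneg
  obtain ⟨H, hH, hb⟩ := exists_boundaryPos_of_posOnNull hι hM hρ hL hη h
  exact ⟨_, hρ.exp_mul hH, (hρ.exp_mul hH).exists_strictlyPSH_inside (hL.exp_mul hρ hH) hγ hγ1 hb⟩

theorem exists_strictlyPSH_outside_of_posOnNull
    (hι : IsSmoothEmbedding (𝓡 (2 * n + 1)) (realModel (n + 1)) ∞ ι)
    (hM : Set.range ι = frontier Ω) (hΩ : IsPseudoconvexDomain (n + 1) Ω)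
    {η : OneForm (2 * n + 1) M}
    (hη : IsPositiveTrivialization (inducedCR (2 * n + 1) (n + 1) ι) η) {γ : ℝ} (hγ1 : 1 < γ)
    (h : PosOnNull (inducedCR (2 * n + 1) (n + 1) ι) η (-1) (1 / (γ - 1) - -1)) :
    ∃ ρ : X → ℝ, IsDefiningFunction (n + 1) Ω ρ ∧ ∃ W : Set X, IsOpen W ∧ frontier Ω ⊆ W ∧
      IsStrictlyPSHOn (n + 1) (fun x => ρ x ^ γ) ((closure Ω)ᶜ ∩ W) := by
  obtain ⟨ρ, hρ, hL⟩ := hΩ.exists_leviNonneg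
  obtain ⟨H, hH, hb⟩ := exists_boundaryPos_of_posOnNull hι hM hρ hL hη h
  exact ⟨_, hρ.exp_mul hH, (hρ.exp_mul hH).exists_strictlyPSH_outside (hL.exp_mul hρ hH) hγ1 hb⟩

theorem exists_nonnegOnNull (hι : IsSmoothEmbedding (𝓡 (2 * n + 1)) (realModel (n + 1)) ∞ ι)
    (hM : Set.range ι = frontier Ω) (hΩ : IsPseudoconvexDomain (n + 1) Ω)
    (hρ : IsDefiningFunction (n + 1) Ω ρ) {σ κ : ℝ}
    (h : LeviNonneg (n + 1) Ω ρ ∧ BoundaryNonneg (n + 1) Ω ρ σ κ) :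
    ∃ η, IsPositiveTrivialization (inducedCR (2 * n + 1) (n + 1) ι) η ∧
      NonnegOnNull (inducedCR (2 * n + 1) (n + 1) ι) η σ (1 / κ - σ) := by
  have : CompactSpace M := compactSpace_of_embedding hι (hM ▸ hΩ.isCompact_frontier)
  have : T2Space M := hι.isEmbedding.t2Space
  exact ⟨_, contactForm_isPositiveTrivialization hι.isImmersion hM hρ h.1,
    h.2.nonnegOnNull hι.isImmersion hM hρ h.1⟩

theorem one_div_sub_one_eq {γ : ℝ} (h : γ < 1) : 1 / (1 - γ) - 1 = γ / (1 - γ) := by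
  have : 1 - γ ≠ 0 := (sub_pos.2 h).ne'
  field_simp
  ring

theorem one_div_sub_neg_one_eq {γ : ℝ} (h : 1 < γ) : 1 / (γ - 1) - -1 = γ / (γ - 1) := by
  have : γ - 1 ≠ 0 := (sub_pos.2 h).ne'
  field_simp
  ring

/-- All Diederich-Fornæss indices agree, and all Steinness indices agree, as soon as the strong
index of the boundary is positive. -/
theorem indices_eq (hι : IsSmoothEmbedding (𝓡 (2 * n + 1)) (realModel (n + 1)) ∞ ι)
    (hM : Set.range ι = frontier Ω) (hΩ : IsPseudoconvexDomain (n + 1) Ω)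
    (hex : ∃ γ : ℝ, 0 < γ ∧ γ < 1 ∧ ∃ η,
      IsPositiveTrivialization (inducedCR (2 * n + 1) (n + 1) ι) η ∧
      PosOnNull (inducedCR (2 * n + 1) (n + 1) ι) η 1 (γ / (1 - γ))) :
    (0 < dfStrongCR (inducedCR (2 * n + 1) (n + 1) ι) ∧
      dfStrongCR (inducedCR (2 * n + 1) (n + 1) ι) = dfStrong (n + 1) Ω ∧
      dfStrong (n + 1) Ω = dfWeak (n + 1) Ω ∧
      dfWeak (n + 1) Ω = dfWeakCR (inducedCR (2 * n + 1) (n + 1) ι)) ∧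
    steinnessWeakCR (inducedCR (2 * n + 1) (n + 1) ι) = steinnessWeak (n + 1) Ω ∧
      steinnessWeak (n + 1) Ω = steinnessStrong (n + 1) Ω ∧
      steinnessStrong (n + 1) Ω = steinnessStrongCR (inducedCR (2 * n + 1) (n + 1) ι) := by
  obtain ⟨γ₀, h00, h01, η₀, hη₀, hpos₀⟩ := hex
  rw [← one_div_sub_one_eq h01] at hpos₀
  refine ⟨sSup_chain ?_ ?_ ?_ (fun γ hγ => ⟨hγ.1, hγ.2.1⟩)
    ⟨γ₀, h00, h01, η₀, hη₀, one_div_sub_one_eq h01 ▸ hpos₀⟩ ?_, sInf_chain ?_ ?_ ?_ ?_⟩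
  · rintro γ ⟨h0, h1, η, hη, h⟩
    rw [← one_div_sub_one_eq h1] at h
    exact ⟨h0, h1, exists_strictlyPSH_inside_of_posOnNull hι hM hΩ hη h0 h1 h⟩
  · rintro γ ⟨h0, h1, ρ, hρ, W, hW, hsub, h⟩
    exact ⟨h0, h1, ρ, hρ, W, hW, hsub, h.isPSHOn⟩
  · rintro γ ⟨h0, h1, ρ, hρ, W, hW, hsub, h⟩
    refine ⟨h0, h1, ?_⟩
    rw [← one_div_sub_one_eq h1]
    exact exists_nonnegOnNull hι hM hΩ hρ (hρ.weak_inside h0 h1 hW hsub h)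
  -- A smaller exponent strictly lowers γ/(1-γ), which is the slack needed to mix in the strong
  -- trivialization η₀.
  · rintro γ ⟨h0, h1, η, hη, h⟩ γ' h0' hlt
    have h1' := hlt.trans h1
    refine ⟨h0', h1', ?_⟩
    rw [← one_div_sub_one_eq h1] at h
    rw [← one_div_sub_one_eq h1']
    refine exists_posOnNull_of_nonneg_of_pos hι hM hΩ hη₀ hη (one_pow 2) (sub_pos.2 h01)
      (by linarith) ?_ ?_ hpos₀ h
    · rw [one_div_sub_one_eq h1']
      exact div_pos h0' (sub_pos.2 h1')
    · exact one_div_lt_one_div_of_lt (sub_pos.2 h1) (by linarith)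
  · rintro γ ⟨h1, η, hη, h⟩
    rw [← one_div_sub_neg_one_eq h1] at h
    exact ⟨h1, exists_strictlyPSH_outside_of_posOnNull hι hM hΩ hη h1 h⟩
  · rintro γ ⟨h1, ρ, hρ, W, hW, hsub, h⟩
    exact ⟨h1, ρ, hρ, W, hW, hsub, h.isPSHOn⟩
  · rintro γ ⟨h1, ρ, hρ, W, hW, hsub, h⟩
    refine ⟨h1, ?_⟩
    rw [← one_div_sub_neg_one_eq h1]
    exact exists_nonnegOnNull hι hM hΩ hρ (hρ.weak_outside h1 hW hsub h)
  -- Here γ/(γ-1) decreases as γ grows, so the slack appears for larger exponents; η₀ is still the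
  -- Diederich-Fornæss one, mixed in with negative weight.
  · rintro γ ⟨h1, η, hη, h⟩ γ' hlt
    have h1' := h1.trans hlt
    refine ⟨h1', ?_⟩
    rw [← one_div_sub_neg_one_eq h1] at h
    rw [← one_div_sub_neg_one_eq h1']
    refine exists_posOnNull_of_nonneg_of_pos hι hM hΩ hη₀ hη (by norm_num) (sub_pos.2 h01)
      (by linarith) ?_ ?_ hpos₀ h
    · rw [one_div_sub_neg_one_eq h1']
      exact div_pos (by linarith) (sub_pos.2 h1')
    · exact one_div_lt_one_div_of_lt (sub_pos.2 h1) (by linarith)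

end Indices

end CRIndex

end

/-! ### Assembly: each hypothesis yields one strong trivialization. -/

theorem mainTheorem3 {n : ℕ}
    {X : Type*} [TopologicalSpace X] [T2Space X] [SecondCountableTopology X]
    [ChartedSpace (EuclideanSpace ℂ (Fin (n + 1))) X]
    [IsManifold (CRIndex.complexModel (n + 1)) ω X]
    {M : Type*} [TopologicalSpace M] [ChartedSpace (EuclideanSpace ℝ (Fin (2 * n + 1))) M]
    [IsManifold (𝓡 (2 * n + 1)) ∞ M]
    (Ω : Set X) (hΩ : CRIndex.IsPseudoconvexDomain (n + 1) Ω)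
    (ι : M → X)
    (hι : Manifold.IsSmoothEmbedding (𝓡 (2 * n + 1)) (CRIndex.realModel (n + 1)) ∞ ι)
    (hM : Set.range ι = frontier Ω)
    (h : CRIndex.IsStein (n + 1) X ∨ CRIndex.IsTakeuchiOneConvex (n + 1) Ω ∨
      0 < CRIndex.dfStrongCR (CRIndex.inducedCR (2 * n + 1) (n + 1) ι)) :
    0 < CRIndex.dfStrongCR (CRIndex.inducedCR (2 * n + 1) (n + 1) ι) ∧
    CRIndex.dfStrongCR (CRIndex.inducedCR (2 * n + 1) (n + 1) ι) = CRIndex.dfStrong (n + 1) Ω ∧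
    CRIndex.dfStrong (n + 1) Ω = CRIndex.dfWeak (n + 1) Ω ∧
    CRIndex.dfWeak (n + 1) Ω = CRIndex.dfWeakCR (CRIndex.inducedCR (2 * n + 1) (n + 1) ι) ∧
    CRIndex.steinnessWeakCR (CRIndex.inducedCR (2 * n + 1) (n + 1) ι) = CRIndex.steinnessWeak (n + 1) Ω ∧
    CRIndex.steinnessWeak (n + 1) Ω = CRIndex.steinnessStrong (n + 1) Ω ∧
    CRIndex.steinnessStrong (n + 1) Ω = CRIndex.steinnessStrongCR (CRIndex.inducedCR (2 * n + 1) (n + 1) ι) := by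
  have key := CRIndex.indices_eq hι hM hΩ (by
    have hfirst : CRIndex.IsStein (n + 1) X ∨ CRIndex.IsTakeuchiOneConvex (n + 1) Ω →
        ∃ γ : ℝ, 0 < γ ∧ γ < 1 ∧ ∃ η,
          CRIndex.IsPositiveTrivialization (CRIndex.inducedCR (2 * n + 1) (n + 1) ι) η ∧
          CRIndex.PosOnNull (CRIndex.inducedCR (2 * n + 1) (n + 1) ι) η 1 (γ / (1 - γ)) := by
      intro h'
      obtain ⟨γ, h0, h1, η, hη, hpos⟩ := CRIndex.exists_posOnNull hι hM hΩ h'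
      exact ⟨γ, h0, h1, η, hη, CRIndex.one_div_sub_one_eq h1 ▸ hpos⟩
    rcases h with h | h | h
    · exact hfirst (Or.inl h)
    · exact hfirst (Or.inr h)
    -- The supremum of the empty set of reals is 0, so a positive index already provides an
    -- admissible exponent.
    · by_contra hne
      exact h.ne' ((congrArg sSup (Set.not_nonempty_iff_eq_empty.1 hne)).trans Real.sSup_empty))
  exact ⟨key.1.1, key.1.2.1, key.1.2.2.1, key.1.2.2.2, key.2⟩
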